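/- **Explicit amalgams $\mathbb D_{2n}*_{\mathbb Z_n}\mathbb D_{2n}$, $\mathbb D_4*_{\mathbb Z_2}\mathbb D_6$, $\mathbb D_6*_{\mathbb Z_3}\mathbb A_4$ and their Schottky subgroups.** Conventions. $\mathbb D_{2n}$ is the dihedral group of order $2n$. A Kleinian group is a discrete group of Möbius transformations of $\hat{\mathbb C}$; an extended Kleinian group consists of conformal and anti-conformal maps, contains an anti-conformal one, and has a Kleinian orientation-preserving subgroup. For maps $r_1,\dots,r_4$, $\hat{\mathcal K}$ is the group they generate, $\mathcal K$ its orientation-preserving subgroup, and $\langle r_i,r_j,r_k\rangle^+$ the orientation-preserving subgroup of $\langle r_i,r_j,r_k\rangle$; products are compositions. Elements $L_1,\dots,L_g$ are Schottky generators if there are $2g$ circles $C_i,C_i'$ bounding pairwise disjoint closed discs such that $L_i$ is a Möbius map taking the interior of $C_i$ onto the exterior of $C_i'$; a group freely generated by Schottky generators $L_1,\dots,L_g$ is a Schottky group of rank $g$ (its quotient handlebody has genus $g$). "$\mathcal K$ is the Maskit combination of $\mathcal K_1,\mathcal K_2$ along $\mathcal J$" means: $\mathcal K_1,\mathcal K_2$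 are finite Kleinian groups, $\mathcal J$ is a cyclic proper subgroup of both, some circle $\gamma$ bounds two $\mathcal J$-invariant open discs $B_1,B_2$ with $k(B_1)\subseteq B_2$ for $k\in\mathcal K_1\setminus\mathcal J$ and $k(B_2)\subseteq B_1$ for $k\in\mathcal K_2\setminus\mathcal J$, some fundamental regions $D_i$ of $\mathcal K_i$ satisfy $\gamma\cap D_1=\gamma\cap D_2$, and $\mathcal K=\mathcal K_1*_{\mathcal J}\mathcal K_2$. The characteristic is $\chi(\mathcal K)=\frac1{|\mathcal K_1|}+\frac1{|\mathcal K_2|}-\frac1{|\mathcal J|}$. **(A)** Let $n\ge2$, $p>1$, and $$r_1(z)=\bar z,\quad r_2(z)=\frac1{\bar z},\quad r_3(z)=e^{2\pi i/n}\bar z,\quad r_4(z)=\frac{1}{p^2\bar z}.$$ Then $\hat{\mathcal K}$ is an extended Kleinian group with the presentation $$r_i^2=(r_2r_1)^2=(r_3r_1)^n=(r_4r_1)^2=(r_2r_3)^2=(r_3r_4)^2=1,$$ $r_2r_4$ has infinite order, and $\mathcal K$ is the Maskit combination of $\langle r_1,r_2,r_3\rangle^+\cong\mathbb D_{2n}$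 and $\langle r_1,r_4,r_3\rangle^+\cong\mathbb D_{2n}$ along $\langle r_3r_1\rangle\cong\mathbb Z_n$, with $\chi(\mathcal K)=0$. For every $m\ge1$ the normal closure $\mathcal S$ of $(r_2r_4)^m$ in $\hat{\mathcal K}$ is contained in $\mathcal K$ with index $2nm$ and is a Schottky group of rank $1$ with generator $(r_2r_4)^m$; for $m\ge2$, $\hat{\mathcal K}/\mathcal S$ is the finite Coxeter group with the above presentation and the additional relation $(r_2r_4)^m=1$. **(B)** Let $1<p\le2$ and $$r_1(z)=\bar z,\quad r_2(z)=\frac1{\bar z},\quad r_3(z)=e^{2\pi i/3}\bar z,\quad r_4(z)=\frac{p\bar z-1}{\bar z-p}.$$ Then $\hat{\mathcal K}$ is an extended Kleinian group with the presentation $$r_i^2=(r_2r_1)^2=(r_3r_1)^3=(r_4r_1)^2=(r_2r_3)^2=(r_2r_4)^2=1,$$ $r_3r_4$ has infinite order, and $\mathcal K=\mathcal K_1*_{\mathcal J}\mathcal K_2$ with $\mathcal K_1=\langle r_1,r_2,r_4\rangle^+\cong\mathbb D_4$, $\mathcal K_2=\langle r_1,r_2,r_3\rangle^+\cong\mathbb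 D_6$, $\mathcal J=\langle r_2r_1\rangle\cong\mathbb Z_2$ and $\chi(\mathcal K)=-\frac1{12}$; for $p<2$ this is a Maskit combination. All free generators named below are Schottky generators if $p<2$. * For $m=2,3,4,5$ let $\mathcal S_m$ be the normal closure of $(r_3r_4)^m$ in $\hat{\mathcal K}$. Then $\hat{\mathcal K}/\mathcal S_m$ is the Coxeter group with the above presentation and the additional relation $(r_3r_4)^m=1$. It is finite, $\mathcal S_m\subset\mathcal K$, $|\mathcal K/\mathcal S_m|=12,24,48,120$ respectively, and $\mathcal S_m$ is free of rank $2,3,5,11$ respectively, with a free basis that consists of Schottky generators if $p<2$ (so that the quotient handlebody has this genus). For $m\ge6$ that Coxeter group is infinite. * $\mathcal S_2$ is freely generated by $L_1=(r_3r_4)^2$, $L_2=r_1L_1r_1$. * $\mathcal S_3$ is freely generated by $L_1=(r_3r_4)^3$, $L_2=r_1L_1r_1$, $L_3=(r_1r_3r_1)L_1(r_1r_3r_1)^{-1}$. * The elements $$L_1=((r_4r_3)^2r_1)^2,\quad L_2=(r_1(r_4r_3)^2)^2,\quad L_3=(r_1r_4r_3)^3\,r_1r_3r_4r_3r_1,\quad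 L_4=(r_4r_3r_1)^3\,r_3r_4r_3$$ freely generate a normal subgroup $\mathcal S$ of $\hat{\mathcal K}$, contained in $\mathcal K$, with $\mathcal K/\mathcal S\cong\mathbb S_3\times\mathbb S_3$, of order $36$. **(C)** Let $\alpha=\frac{1-\sqrt3}{1+\sqrt3}$, $0<p\le-\alpha$, and $$r_1(z)=\bar z,\quad r_2(z)=\frac{p^2}{\bar z},\quad r_3(z)=e^{2\pi i/3}\bar z,\quad r_4(z)=\frac{(1+\alpha)\bar z-2\alpha}{2\bar z-(1+\alpha)}.$$ Then $\hat{\mathcal K}$ is an extended Kleinian group with the presentation $$r_i^2=(r_2r_1)^2=(r_3r_1)^3=(r_4r_1)^2=(r_2r_3)^2=(r_3r_4)^3=1,$$ and $\mathcal K=\mathcal K_1*_{\mathcal J}\mathcal K_2$ with $\mathcal K_1=\langle r_1,r_2,r_3\rangle^+\cong\mathbb D_6$, $\mathcal K_2=\langle r_1,r_3,r_4\rangle^+\cong\mathbb A_4$, $\mathcal J=\langle r_3r_1\rangle\cong\mathbb Z_3$ and $\chi(\mathcal K)=-\frac1{12}$; for $p<-\alpha$ this is a Maskit combination. The elements $L_1=(r_2r_4)^2$,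 $L_2=(r_1r_3)L_1(r_1r_3)^{-1}$, $L_3=(r_1r_3)^2L_1(r_1r_3)^{-2}$ freely generate a normal subgroup $\mathcal S$ of $\hat{\mathcal K}$, contained in $\mathcal K$, with $\mathcal K/\mathcal S\cong\mathbb S_4$, of order $24$; they are Schottky generators if $p<-\alpha$. -/

import Mathlib

open Matrix
open scoped Real MatrixGroups

noncomputable section

namespace Kleinian

/-! ### Conformal and anti-conformal maps of the Riemann sphere -/

/-- The Riemann sphere `ℂ ∪ {∞}`. -/
abbrev Sphere : Type := OnePoint ℂ

/-- The group of all bijections of the Riemann sphere; the product is composition. -/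
abbrev SpherePerm : Type := Equiv.Perm Sphere

/-- Complex conjugation on the Riemann sphere, fixing `∞`. -/
def conjPerm : SpherePerm :=
  Function.Involutive.toPerm (OnePoint.map (starRingEnd ℂ)) (fun z => by
    induction z using OnePoint.rec <;> simp)

/-- The Möbius transformation `z ↦ (a z + b) / (c z + d)` of an invertible matrix. -/
def mobius : GL (Fin 2) ℂ →* SpherePerm := MulAction.toPermHom (GL (Fin 2) ℂ) Sphere

/-- The group of all Möbius transformations (the conformal automorphisms of the sphere). -/
def mobiusGroup : Subgroup SpherePerm := mobius.range

/-- The anti-conformal map `z ↦ (a z̄ + b) / (c z̄ + d)`. -/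
def antiMobius (A : Matrix (Fin 2) (Fin 2) ℂ) (hA : A.det ≠ 0) : SpherePerm :=
  mobius (GeneralLinearGroup.mkOfDetNeZero A hA) * conjPerm

/-- A map is anti-conformal if it is complex conjugation followed by a Möbius map. -/
def IsAntiConformal (f : SpherePerm) : Prop := ∃ A : GL (Fin 2) ℂ, f = mobius A * conjPerm

/-- A Kleinian group: a group of Möbius transformations that is discrete, i.e. whose full
preimage in `SL(2, ℂ)` is a discrete subset. -/
def IsKleinian (K : Subgroup SpherePerm) : Prop :=
  K ≤ mobiusGroup ∧ DiscreteTopology (K.comap (mobius.comp SpecialLinearGroup.toGL))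

/-- The orientation-preserving subgroup. -/
def orientationPreserving (H : Subgroup SpherePerm) : Subgroup SpherePerm := H ⊓ mobiusGroup

/-- An extended Kleinian group: it consists of conformal and anti-conformal maps, contains
an anti-conformal one, and its orientation-preserving subgroup is Kleinian. -/
def IsExtendedKleinian (H : Subgroup SpherePerm) : Prop :=
  (∀ f ∈ H, f ∈ mobiusGroup ∨ IsAntiConformal f) ∧ (∃ f ∈ H, IsAntiConformal f) ∧
    IsKleinian (orientationPreserving H)

/-! ### Round discs, Schottky groups -/

/-- The open round disc that is the image of the open unit disc under a Möbius map. -/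
def openDisc (A : GL (Fin 2) ℂ) : Set Sphere :=
  mobius A '' ((fun z : ℂ => (z : Sphere)) '' Metric.ball 0 1)

/-- The closed round disc that is the image of the closed unit disc under a Möbius map. -/
def closedDisc (A : GL (Fin 2) ℂ) : Set Sphere :=
  mobius A '' ((fun z : ℂ => (z : Sphere)) '' Metric.closedBall 0 1)

/-- `L 0, …, L (g-1)` are classical Schottky generators: there are `2g` circles `C i, C' i`
bounding pairwise disjoint closed discs such that `L i` is a Möbius map taking the interior of
`C i` onto the exterior of `C' i`. -/
def IsSchottkySystem {g : ℕ} (L : Fin g → SpherePerm) : Prop :=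
  ∃ c c' : Fin g → GL (Fin 2) ℂ,
    Pairwise (Function.onFun Disjoint
      (Sum.elim (fun i => closedDisc (c i)) (fun i => closedDisc (c' i)))) ∧
    ∀ i, L i ∈ mobiusGroup ∧ L i '' openDisc (c i) = (closedDisc (c' i))ᶜ

/-- The family `L` generates the subgroup `S` freely. -/
def IsFreeBasis {G : Type*} [Group G] {g : ℕ} (L : Fin g → G) (S : Subgroup G) : Prop :=
  Function.Injective (FreeGroup.lift L) ∧ (FreeGroup.lift L).range = S

/-! ### Presentations, quotients, normal closures -/

section Groups

variable {G : Type*} [Group G]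

/-- The reflections `r i` generate a Coxeter group with Coxeter matrix `M`: the subgroup they
generate has the presentation with generators `r i` and relations `(r i * r j) ^ M i j = 1`
(an entry `0` means that there is no relation). -/
def HasCoxeterPresentation {ι : Type*} (M : CoxeterMatrix ι) (r : ι → G) : Prop :=
  ∃ cs : CoxeterSystem M (Subgroup.closure (Set.range r)), ∀ i, (cs.simple i : G) = r i

/-- `S` is a normal subgroup of `H`. -/
def IsNormalIn (S H : Subgroup G) : Prop := S ≤ H ∧ (S.subgroupOf H).Normal

/-- `S` is a normal subgroup of `H` with `H / S` isomorphic to `Q`. -/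
def HasQuotient (H S : Subgroup G) (Q : Type*) [Group Q] : Prop :=
  S ≤ H ∧ ∃ φ : H →* Q, Function.Surjective φ ∧ φ.ker = S.subgroupOf H

/-- The quotient of the group generated by the `r i` by its normal subgroup `S` is the Coxeter
group of `M`, with the class of `r i` corresponding to the `i`-th simple reflection. -/
def HasCoxeterQuotient {ι : Type*} (M : CoxeterMatrix ι) (r : ι → G) (S : Subgroup G) : Prop :=
  S ≤ Subgroup.closure (Set.range r) ∧
    ∃ φ : Subgroup.closure (Set.range r) →* M.Group,
      (∀ i, φ ⟨r i, Subgroup.subset_closure (Set.mem_range_self i)⟩ = M.simple i) ∧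
      φ.ker = S.subgroupOf (Subgroup.closure (Set.range r))

/-- The subgroup generated by all conjugates of `x` by elements of `H`; for `x ∈ H` this is
the normal closure of `x` in `H`. -/
def normalClosureIn (H : Subgroup G) (x : G) : Subgroup G :=
  Subgroup.closure {y | ∃ h ∈ H, y = h * x * h⁻¹}

/-- `K` is the (internal) amalgamated free product `A 0 *_J A 1`: the canonical map from the
pushout of the inclusions `J → A i` to the ambient group is injective with image `K`. -/
structure IsAmalgam (A : Fin 2 → Subgroup G) (J K : Subgroup G) : Prop where
  le : ∀ i, J ≤ A i
  injective : Function.Injective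
    (Monoid.PushoutI.lift (φ := fun i => Subgroup.inclusion (le i))
      (fun i => (A i).subtype) J.subtype (fun _ => rfl))
  range_eq : (Monoid.PushoutI.lift (φ := fun i => Subgroup.inclusion (le i))
      (fun i => (A i).subtype) J.subtype (fun _ => rfl)).range = K

/-- The characteristic `1/|K₁| + 1/|K₂| - 1/|J|` of the amalgam `K₁ *_J K₂` of two finite
groups. -/
def amalgamCharacteristic (K₁ K₂ J : Subgroup G) : ℚ :=
  1 / (Nat.card K₁ : ℚ) + 1 / (Nat.card K₂ : ℚ) - 1 / (Nat.card J : ℚ)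

end Groups

/-! ### Maskit combination of spherical groups -/

/-- `D` is a fundamental region for the finite group `K` acting on the sphere. -/
def IsFundamentalRegion (K : Subgroup SpherePerm) (D : Set Sphere) : Prop :=
  IsOpen D ∧ (∀ k ∈ K, k ≠ 1 → Disjoint (k '' D) D) ∧ (⋃ k ∈ K, k '' closure D) = Set.univ

/-- The hypotheses of Maskit's combination theorem for two spherical (finite Kleinian) groups
`K₁, K₂` and a proper cyclic common subgroup `J`, with a round circle as separating curve:
the circle bounds two open discs `B₁, B₂`, both invariant under `J`; elements of
`K₁ \ J` map `B₁` into `B₂`, elements of `K₂ \ J` map `B₂` into `B₁`; and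
there are fundamental regions `D₁, D₂` of `K₁, K₂` that meet the circle in the same set. -/
def IsMaskitCombination (K₁ K₂ J : Subgroup SpherePerm) : Prop :=
  IsKleinian K₁ ∧ Finite K₁ ∧ IsKleinian K₂ ∧ Finite K₂ ∧ IsCyclic J ∧ J < K₁ ∧ J < K₂ ∧
  ∃ A : GL (Fin 2) ℂ, ∃ γ B₁ B₂ D₁ D₂ : Set Sphere,
    γ = closedDisc A \ openDisc A ∧
    (B₁ = openDisc A ∧ B₂ = (closedDisc A)ᶜ ∨ B₂ = openDisc A ∧ B₁ = (closedDisc A)ᶜ) ∧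
    (∀ j ∈ J, j '' B₁ = B₁ ∧ j '' B₂ = B₂) ∧
    IsFundamentalRegion K₁ D₁ ∧ IsFundamentalRegion K₂ D₂ ∧ γ ∩ D₁ = γ ∩ D₂ ∧
    (∀ k ∈ K₁, k ∉ J → k '' B₁ ⊆ B₂) ∧ (∀ k ∈ K₂, k ∉ J → k '' B₂ ⊆ B₁)

/-! ### Generalities on four reflections `r 0, r 1, r 2, r 3` (written `r₁, …, r₄` below) -/

/-- The extended group generated by the four reflections. -/
def extendedGroup (r : Fin 4 → SpherePerm) : Subgroup SpherePerm :=
  Subgroup.closure (Set.range r)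

/-- The orientation-preserving subgroup of the group generated by the four reflections. -/
def conformalGroup (r : Fin 4 → SpherePerm) : Subgroup SpherePerm :=
  orientationPreserving (extendedGroup r)

/-- The orientation-preserving subgroup of the group generated by `r i, r j, r k`. -/
def sphericalGroup (r : Fin 4 → SpherePerm) (i j k : Fin 4) : Subgroup SpherePerm :=
  orientationPreserving (Subgroup.closure {r i, r j, r k})

/-! ### The amalgam `D_{2n} *_{ℤ_n} D_{2n}` -/

/-- The four reflections
`r₁(z) = z̄`, `r₂(z) = 1 / z̄`, `r₃(z) = e^{2πi/n} z̄`, `r₄(z) = p⁻² / z̄`. -/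
def reflDD (n : ℕ) (p : ℝ) (hp : 1 < p) : Fin 4 → SpherePerm :=
  ![conjPerm,
    antiMobius !![0, 1; 1, 0] (by simp [det_fin_two]),
    antiMobius !![Complex.exp (2 * π * Complex.I / n), 0; 0, 1]
      (by simp [det_fin_two, Complex.exp_ne_zero]),
    antiMobius !![0, 1; (p : ℂ) ^ 2, 0] (by
      have h : (p : ℂ) ≠ 0 := by exact_mod_cast (by linarith : p ≠ 0)
      simp [det_fin_two, h])]

/-- `m₁₂ = 2, m₁₃ = n, m₁₄ = 2, m₂₃ = 2, m₂₄ = m, m₃₄ = 2`. -/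
def coxDD (n m : ℕ) (hn : n ≠ 1) (hm : m ≠ 1) : CoxeterMatrix (Fin 4) where
  M := !![1, 2, n, 2; 2, 1, 2, m; n, 2, 1, 2; 2, m, 2, 1]
  isSymm := by ext i j; fin_cases i <;> fin_cases j <;> rfl
  diagonal i := by fin_cases i <;> rfl
  off_diagonal i j := by fin_cases i <;> fin_cases j <;> simp [hn, hm]

/-! ### The amalgam `D₄ *_{ℤ₂} D₆` -/

/-- The four reflections
`r₁(z) = z̄`, `r₂(z) = 1 / z̄`, `r₃(z) = e^{2πi/3} z̄`, `r₄(z) = (p z̄ - 1) / (z̄ - p)`. -/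
def reflD4D6 (p : ℝ) (hp : 1 < p) : Fin 4 → SpherePerm :=
  ![conjPerm,
    antiMobius !![0, 1; 1, 0] (by simp [det_fin_two]),
    antiMobius !![Complex.exp (2 * π * Complex.I / 3), 0; 0, 1]
      (by simp [det_fin_two, Complex.exp_ne_zero]),
    antiMobius !![(p : ℂ), -1; 1, -(p : ℂ)] (by
      rw [det_fin_two_of]
      have h : p * -p - -1 * 1 ≠ 0 := by nlinarith
      exact_mod_cast h)]

/-- `m₁₂ = 2, m₁₃ = 3, m₁₄ = 2, m₂₃ = 2, m₂₄ = 2, m₃₄ = m`. -/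
def coxD4D6 (m : ℕ) (hm : m ≠ 1) : CoxeterMatrix (Fin 4) where
  M := !![1, 2, 3, 2; 2, 1, 2, 2; 3, 2, 1, m; 2, 2, m, 1]
  isSymm := by ext i j; fin_cases i <;> fin_cases j <;> rfl
  diagonal i := by fin_cases i <;> rfl
  off_diagonal i j := by fin_cases i <;> fin_cases j <;> simp [hm]

/-! ### The amalgam `D₆ *_{ℤ₃} A₄` -/

/-- `α = (1 - √3) / (1 + √3)`, a negative number. -/
def alpha : ℝ := (1 - √3) / (1 + √3)

theorem alpha_ne_one : alpha ≠ 1 := by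
  have h : (0 : ℝ) < √3 := by positivity
  unfold alpha
  rw [Ne, div_eq_one_iff_eq (by positivity)]
  intro h'
  linarith

/-- The four reflections `r₁(z) = z̄`, `r₂(z) = p² / z̄`, `r₃(z) = e^{2πi/3} z̄`,
`r₄(z) = ((1 + α) z̄ - 2α) / (2 z̄ - (1 + α))`. -/
def reflD6A4 (p : ℝ) (hp : 0 < p) : Fin 4 → SpherePerm :=
  ![conjPerm,
    antiMobius !![0, (p : ℂ) ^ 2; 1, 0] (by
      have h : (p : ℂ) ≠ 0 := by exact_mod_cast hp.ne'
      simp [det_fin_two, h]),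
    antiMobius !![Complex.exp (2 * π * Complex.I / 3), 0; 0, 1]
      (by simp [det_fin_two, Complex.exp_ne_zero]),
    antiMobius !![1 + (alpha : ℂ), -2 * (alpha : ℂ); 2, -(1 + (alpha : ℂ))] (by
      rw [det_fin_two_of]
      have h : (1 + alpha) * -(1 + alpha) - -2 * alpha * 2 ≠ 0 := by
        have h1 : (1 - alpha) ^ 2 ≠ 0 := pow_ne_zero 2 (sub_ne_zero.mpr alpha_ne_one.symm)
        intro h2
        apply h1
        linarith
      exact_mod_cast h)]

/-- `m₁₂ = 2, m₁₃ = 3, m₁₄ = 2, m₂₃ = 2, m₂₄ = m, m₃₄ = 3`. -/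
def coxD6A4 (m : ℕ) (hm : m ≠ 1) : CoxeterMatrix (Fin 4) where
  M := !![1, 2, 3, 2; 2, 1, 2, m; 3, 2, 1, 3; 2, m, 3, 1]
  isSymm := by ext i j; fin_cases i <;> fin_cases j <;> rfl
  diagonal i := by fin_cases i <;> rfl
  off_diagonal i j := by fin_cases i <;> fin_cases j <;> simp [hm]

end Kleinian

end

open Kleinian

/-!
# Amalgams of finite Kleinian groups generated by reflections, and their Schottky subgroups

In each of the three families the reflections `r₁, …, r₄` generate an amalgam of two finite reflection
groups along a dihedral group: the latter is generated by `r₁` and a second reflection `r_y`, and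
each factor arises from it by adding one of the two remaining reflections. All statements about the
full groups come from one ping-pong argument (`ReflectionAmalgam`). The sphere contains sets `Y`,
`X₁`, `X₂` invariant under `⟨r₁, r_y⟩` such that one remaining reflection takes `Y ∪ X₁` into `X₂`
and the other takes `Y ∪ X₂` into `X₁`. Since each finite factor is the union of two double cosets of
`⟨r₁, r_y⟩`, every element outside that subgroup takes `Y` into `X₁ ∪ X₂` (`pingPong`), and so a
suitable point `z₀ ∈ Y` has a neighbourhood to which no nontrivial element returns it
(`ReflectionAmalgam.eq_one_or_notMem`). Only the Coxeter relations enter the combinatorial part, so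
the argument applies to the abstract Coxeter group acting through the reflections. This gives three
things at once: the action is faithful, which is the presentation (`hasCoxeterPresentation`); the
group is discrete, since a sequence converging to the identity would return `z₀` to its neighbourhood
(`isKleinian_of_moves`); and the orientation-preserving subgroup is the amalgam
(`isAmalgam_of_pingPong`). The geometric input is `reflDD_amalgam`, `reflD4D6_amalgam` and
`reflD6A4_amalgam`. A Maskit combination needs, besides, a circle strictly between the ping-pong
sets and fundamental regions of the two finite groups that agree along it; for the extremal
parameter the sets touch and there is no such circle.

For two dihedral groups the reflections `r₂`, `r₄` commute with `r₁`, `r₃`, so the normal closure of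
`(r₂ r₄) ^ m` is cyclic (`coxDD_normalClosureIn_eq`) with quotient a product of two dihedral groups
(`coxDD_relIndex`), and `(r₂ r₄) ^ m` is the dilation by `p ^ (2 * m)`.

For the dihedral groups of orders four and six the group acts on a trivalent Bass–Serre tree,
handled through normal forms (`NormalForm`). A normal subgroup acting freely on the tree is described
by a finite subtree, the free generators pairing the edges that leave it, together with permutations
on which the generators act trivially (`TreeQuotient`). The quotient graphs are those of the maps
`{2, 3}`, `{3, 3}`, `{4, 3}`, `{5, 3}` for the normal closures of `(r₃ r₄) ^ m`, `m = 2, …, 5`, and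
`K₃,₃` for the subgroup of rank four. Since products of a vertex and a vertex stabilizer represent all
cosets and have distinct permutations, the generators generate the kernel of the permutation action
(`TreeQuotient.IsValid.ker_eq`); writing them as products of conjugates of `(r₃ r₄) ^ m` identifies the
kernel with the normal closure (`TreeQuotient.IsValid.normalClosureIn_eq`). The disc of `r₄` gives
the Schottky discs: translated along an edge that leaves the subtree it contains the images of all
discs further out, so different edges have disjoint discs and the edge pairing pairs these
(`TreeQuotient.IsValid.isSchottkySystem`). For `p = 2` these discs touch, but freeness depends only on
the presentation and is inherited from smaller `p` (`injective_lift_of_isLiftable`). For `m ≥ 6` the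
Coxeter group is infinite, because its reflection representation sends a Coxeter element to a matrix
of infinite order (`coxeterElement_pow`).

For the amalgam with `A₄`, the reflections `r₁`, `r₃`, `r₄` are those of a regular tetrahedron.
Modulo the subgroup generated by the three conjugates of `(r₂ r₄) ^ 2`, the reflection `r₂` commutes
with `r₄`, hence with everything, and so each element is a product of an element of the subgroup, a
power of `r₂` and an element of the tetrahedral group (`exists_decomposition`). The homomorphism
`permFourSign` to `S₄ × {±1}` shows that this product is unique and that the subgroup is its kernel.
The Schottky circles are images of the circle of `r₂` (`reflD6A4_isSchottkySystem`).
-/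

namespace Kleinian

/-! ### Double cosets and ping-pong for amalgams -/

section Algebra

variable {G : Type*} [Group G]

/-- A group generated by a subgroup `C` and an involution `s` with `s C s ⊆ C ∪ C s C` is the union
of the double cosets `C` and `C s C`. -/
theorem mem_or_doubleCoset {C A : Subgroup G} {s : G} (hs : s * s = 1)
    (h : ∀ c ∈ C, s * c * s ∈ C ∨ ∃ c₁ ∈ C, ∃ c₂ ∈ C, s * c * s = c₁ * s * c₂)
    (hA : A ≤ C ⊔ Subgroup.closure {s}) {g : G} (hg : g ∈ A) :
    g ∈ C ∨ ∃ c₁ ∈ C, ∃ c₂ ∈ C, g = c₁ * s * c₂ := by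
  have hs' : s⁻¹ = s := inv_eq_of_mul_eq_one_left hs
  have hle : C ⊔ Subgroup.closure {s} = Subgroup.closure ((C : Set G) ∪ {s}) := by
    rw [Subgroup.closure_union, Subgroup.closure_eq]
  have hg' := hA hg
  clear hg
  rw [hle] at hg'
  have key : ∀ x, x ∈ (C : Set G) ∪ {s} → ∀ y, (y ∈ C ∨ ∃ c₁ ∈ C, ∃ c₂ ∈ C, y = c₁ * s * c₂) →
      (x * y ∈ C ∨ ∃ c₁ ∈ C, ∃ c₂ ∈ C, x * y = c₁ * s * c₂) := by
    rintro x (hx | hx) y hy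
    · rcases hy with hy | ⟨c₁, h1, c₂, h2, rfl⟩
      · exact Or.inl (C.mul_mem hx hy)
      · exact Or.inr ⟨x * c₁, C.mul_mem hx h1, c₂, h2, by group⟩
    · obtain rfl : x = s := hx
      rcases hy with hy | ⟨c₁, h1, c₂, h2, rfl⟩
      · exact Or.inr ⟨1, C.one_mem, y, hy, by group⟩
      · rcases h c₁ h1 with h3 | ⟨c₃, h3, c₄, h4, e⟩
        · refine Or.inl ?_
          rw [show x * (c₁ * x * c₂) = x * c₁ * x * c₂ by group]
          exact C.mul_mem h3 h2
        · refine Or.inr ⟨c₃, h3, c₄ * c₂, C.mul_mem h4 h2, ?_⟩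
          rw [show x * (c₁ * x * c₂) = x * c₁ * x * c₂ by group, e]
          group
  induction hg' using Subgroup.closure_induction_left with
  | one => exact Or.inl C.one_mem
  | mul_left x hx y _ ih => exact key x hx y ih
  | inv_mul_cancel x hx y _ ih =>
    refine key x⁻¹ ?_ y ih
    rcases hx with hx | hx
    · exact Or.inl (C.inv_mem hx)
    · obtain rfl : x = s := hx
      exact Or.inr hs'

/-- Reduced products of elements of `A \ C` and `B \ C` that start with a factor from `A \ C`. -/
inductive StartsIn (C : Subgroup G) : Subgroup G → Subgroup G → G → Prop
  | single {A B : Subgroup G} {a c : G} (ha : a ∈ A) (ha' : a ∉ C) (hc : c ∈ C) :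
      StartsIn C A B (a * c)
  | cons {A B : Subgroup G} {a w : G} (ha : a ∈ A) (ha' : a ∉ C) (hw : StartsIn C B A w) :
      StartsIn C A B (a * w)

theorem StartsIn.mul_left_mem {C A B : Subgroup G} (hCA : C ≤ A) {c w : G} (hc : c ∈ C)
    (hw : StartsIn C A B w) : StartsIn C A B (c * w) := by
  cases hw with
  | single ha ha' h =>
    rw [← mul_assoc]
    exact .single (A.mul_mem (hCA hc) ha) (fun h' => ha' ((C.mul_mem_cancel_left hc).1 h')) h
  | cons ha ha' h =>
    rw [← mul_assoc]
    exact .cons (A.mul_mem (hCA hc) ha) (fun h' => ha' ((C.mul_mem_cancel_left hc).1 h')) h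

/-- `C` together with the reduced products is closed under left multiplication by `A`. -/
theorem StartsIn.mul_left {C A B : Subgroup G} (hCA : C ≤ A) (hCB : C ≤ B) {a w : G} (ha : a ∈ A)
    (hw : w ∈ C ∨ StartsIn C A B w ∨ StartsIn C B A w) :
    a * w ∈ C ∨ StartsIn C A B (a * w) ∨ StartsIn C B A (a * w) := by
  by_cases haC : a ∈ C
  · rcases hw with hw | hw | hw
    · exact Or.inl (C.mul_mem haC hw)
    · exact Or.inr (Or.inl (hw.mul_left_mem hCA haC))
    · exact Or.inr (Or.inr (hw.mul_left_mem hCB haC))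
  rcases hw with hw | hw | hw
  · exact Or.inr (Or.inl (.single ha haC hw))
  · cases hw with
    | @single _ _ b c hb hb' hc =>
      rw [← mul_assoc]
      by_cases h : a * b ∈ C
      · exact Or.inl (C.mul_mem h hc)
      · exact Or.inr (Or.inl (.single (A.mul_mem ha hb) h hc))
    | @cons _ _ b w' hb hb' hw' =>
      rw [← mul_assoc]
      by_cases h : a * b ∈ C
      · exact Or.inr (Or.inr (hw'.mul_left_mem hCB h))
      · exact Or.inr (Or.inl (.cons (A.mul_mem ha hb) h hw'))
  · exact Or.inr (Or.inl (.cons ha haC hw))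

/-- Every element of `⟨A, B⟩` outside `C` is a reduced product. -/
theorem mem_or_startsIn {C A B : Subgroup G} (hCA : C ≤ A) (hCB : C ≤ B) {w : G} (hw : w ∈ A ⊔ B) :
    w ∈ C ∨ StartsIn C A B w ∨ StartsIn C B A w := by
  rw [show A ⊔ B = Subgroup.closure ((A : Set G) ∪ B) by
    rw [Subgroup.closure_union, Subgroup.closure_eq, Subgroup.closure_eq]] at hw
  have key : ∀ x ∈ (A : Set G) ∪ B, ∀ y, (y ∈ C ∨ StartsIn C A B y ∨ StartsIn C B A y) →
      (x * y ∈ C ∨ StartsIn C A B (x * y) ∨ StartsIn C B A (x * y)) := by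
    rintro x (hx | hx) y hy
    · exact StartsIn.mul_left hCA hCB hx hy
    · have := StartsIn.mul_left hCB hCA hx (hy.imp_right Or.symm)
      exact this.imp_right Or.symm
  induction hw using Subgroup.closure_induction_left with
  | one => exact Or.inl C.one_mem
  | mul_left x hx y _ ih => exact key x hx y ih
  | inv_mul_cancel x hx y _ ih =>
    exact key x⁻¹ (hx.imp A.inv_mem B.inv_mem) y ih

variable {X : Type*}

/-- The last factor carries `Y` into one of the sets `X₁`, `X₂`; every further factor passes to the
other one. -/
theorem StartsIn.mapsTo {C A B : Subgroup G} {ρ : G →* Equiv.Perm X} {Y X₁ X₂ : Set X} {w : G}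
    (hw : StartsIn C A B w) (hC : ∀ c ∈ C, ∀ p ∈ Y, ρ c p ∈ Y)
    (hA : ∀ a ∈ A, a ∉ C → ∀ p, p ∈ Y ∪ X₁ → ρ a p ∈ X₂)
    (hB : ∀ b ∈ B, b ∉ C → ∀ p, p ∈ Y ∪ X₂ → ρ b p ∈ X₁) : ∀ p ∈ Y, ρ w p ∈ X₂ := by
  induction hw generalizing X₁ X₂ with
  | single ha ha' hc =>
    intro p hp
    rw [map_mul, Equiv.Perm.mul_apply]
    exact hA _ ha ha' _ (Or.inl (hC _ hc p hp))
  | cons ha ha' _ ih =>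
    intro p hp
    rw [map_mul, Equiv.Perm.mul_apply]
    exact hA _ ha ha' _ (Or.inr (ih hB hA p hp))

/-- Ping-pong for amalgams: if `A \ C` maps `Y ∪ X₁` into `X₂` and `B \ C` maps `Y ∪ X₂` into `X₁`,
then every element of `⟨A, B⟩` outside `C` maps `Y` into `X₁ ∪ X₂`. -/
theorem pingPong {C A B : Subgroup G} (hCA : C ≤ A) (hCB : C ≤ B) {ρ : G →* Equiv.Perm X}
    {Y X₁ X₂ : Set X} (hC : ∀ c ∈ C, ∀ p ∈ Y, ρ c p ∈ Y)
    (hA : ∀ a ∈ A, a ∉ C → ∀ p, p ∈ Y ∪ X₁ → ρ a p ∈ X₂)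
    (hB : ∀ b ∈ B, b ∉ C → ∀ p, p ∈ Y ∪ X₂ → ρ b p ∈ X₁) {w : G} (hw : w ∈ A ⊔ B) :
    w ∈ C ∨ ∀ p ∈ Y, ρ w p ∈ X₁ ∪ X₂ := by
  rcases mem_or_startsIn hCA hCB hw with h | h | h
  · exact Or.inl h
  · exact Or.inr fun p hp => Or.inr (h.mapsTo hC hA hB p hp)
  · exact Or.inr fun p hp => Or.inl (h.mapsTo hC hB hA p hp)

/-- The internal amalgam of two groups of bijections for which ping-pong is possible. -/
theorem isAmalgam_of_pingPong {K₁ K₂ J : Subgroup (Equiv.Perm X)} (h₁ : J ≤ K₁) (h₂ : J ≤ K₂)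
    {Y X₁ X₂ : Set X} (hJ : ∀ c ∈ J, ∀ p ∈ Y, c p ∈ Y)
    (hA : ∀ a ∈ K₁, a ∉ J → ∀ p, p ∈ Y ∪ X₁ → a p ∈ X₂)
    (hB : ∀ b ∈ K₂, b ∉ J → ∀ p, p ∈ Y ∪ X₂ → b p ∈ X₁)
    {p₀ : X} (hp₀ : p₀ ∈ Y) (hp₀' : p₀ ∉ X₁ ∪ X₂) : IsAmalgam ![K₁, K₂] J (K₁ ⊔ K₂) := by
  have hle : ∀ i, J ≤ (![K₁, K₂] : Fin 2 → _) i := by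
    intro i; fin_cases i
    · exact h₁
    · exact h₂
  let φ := fun i => Subgroup.inclusion (hle i)
  let ρ : Monoid.PushoutI φ →* Equiv.Perm X := Monoid.PushoutI.lift (φ := φ)
      (fun i => ((![K₁, K₂] : Fin 2 → _) i).subtype) J.subtype (fun _ => rfl)
  -- the images of `J`, `K₁` and `K₂` in the abstract amalgam
  let C : Subgroup (Monoid.PushoutI φ) := (Monoid.PushoutI.base φ).range
  let A : Subgroup (Monoid.PushoutI φ) := (Monoid.PushoutI.of (φ := φ) 0).range
  let B : Subgroup (Monoid.PushoutI φ) := (Monoid.PushoutI.of (φ := φ) 1).range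
  have hCA : C ≤ A := by
    rintro _ ⟨j, rfl⟩
    exact ⟨φ 0 j, Monoid.PushoutI.of_apply_eq_base φ 0 j⟩
  have hCB : C ≤ B := by
    rintro _ ⟨j, rfl⟩
    exact ⟨φ 1 j, Monoid.PushoutI.of_apply_eq_base φ 1 j⟩
  have hof : ∀ i (k : (![K₁, K₂] : Fin 2 → Subgroup (Equiv.Perm X)) i),
      ρ (Monoid.PushoutI.of (φ := φ) i k) = k := fun i k => by
    simp only [ρ]; rfl
  have hbase : ∀ j : J, ρ (Monoid.PushoutI.base φ j) = j := fun j => by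
    simp only [ρ]; rfl
  have htop : A ⊔ B = ⊤ := by
    rw [eq_top_iff]
    rintro w -
    induction w using Monoid.PushoutI.induction_on with
    | of i g =>
      fin_cases i
      · exact (le_sup_left : A ≤ A ⊔ B) ⟨g, rfl⟩
      · exact (le_sup_right : B ≤ A ⊔ B) ⟨g, rfl⟩
    | base h => exact (le_sup_left : A ≤ A ⊔ B) (hCA ⟨h, rfl⟩)
    | mul x y hx hy => exact Subgroup.mul_mem _ hx hy
  refine ⟨hle, ?_, ?_⟩
  · change Function.Injective ρ
    rw [injective_iff_map_eq_one]
    intro w hw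
    have := pingPong (ρ := ρ) (Y := Y) (X₁ := X₁) (X₂ := X₂) hCA hCB ?_ ?_ ?_
      (htop ▸ Subgroup.mem_top w : w ∈ A ⊔ B)
    · rcases this with ⟨j, rfl⟩ | h
      · rw [hbase] at hw
        rw [show j = 1 from Subtype.ext hw, map_one]
      · have := h p₀ hp₀
        rw [hw] at this
        exact absurd this hp₀'
    · rintro _ ⟨j, rfl⟩ p hp
      rw [hbase]
      exact hJ _ j.2 p hp
    · rintro _ ⟨k, rfl⟩ hk p hp
      rw [hof]
      exact hA _ k.2 (fun h => hk ⟨⟨k, h⟩, by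
        rw [← Monoid.PushoutI.of_apply_eq_base φ 0]; rfl⟩) p hp
    · rintro _ ⟨k, rfl⟩ hk p hp
      rw [hof]
      exact hB _ k.2 (fun h => hk ⟨⟨k, h⟩, by
        rw [← Monoid.PushoutI.of_apply_eq_base φ 1]; rfl⟩) p hp
  · change ρ.range = _
    rw [MonoidHom.range_eq_map, ← htop, Subgroup.map_sup]
    congr 1
    · ext x; constructor
      · rintro ⟨_, ⟨k, rfl⟩, rfl⟩
        change ρ _ ∈ _
        rw [hof]; exact k.2
      · intro hx
        exact ⟨_, ⟨⟨x, hx⟩, rfl⟩, hof 0 ⟨x, hx⟩⟩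
    · ext x; constructor
      · rintro ⟨_, ⟨k, rfl⟩, rfl⟩
        change ρ _ ∈ _
        rw [hof]; exact k.2
      · intro hx
        exact ⟨_, ⟨⟨x, hx⟩, rfl⟩, hof 1 ⟨x, hx⟩⟩

/-! ### Coxeter presentations and their quotients -/

/-- A faithful action of the abstract Coxeter group through the `r i` is a Coxeter presentation of
the group that they generate. -/
theorem hasCoxeterPresentation_of_injective {ι : Type*} {M : CoxeterMatrix ι} {r : ι → G}
    (hr : M.IsLiftable r) (hinj : Function.Injective (M.toCoxeterSystem.lift ⟨r, hr⟩)) :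
    HasCoxeterPresentation M r := by
  set ρ := M.toCoxeterSystem.lift ⟨r, hr⟩ with hρ
  have hs : ∀ i, ρ (M.simple i) = r i := fun i => M.toCoxeterSystem.lift_apply_simple hr i
  have hrange : ρ.range = Subgroup.closure (Set.range r) := by
    rw [MonoidHom.range_eq_map, ← M.toCoxeterSystem.subgroup_closure_range_simple,
      MonoidHom.map_closure, ← Set.range_comp]
    congr 2
    ext i; exact hs i
  let e : M.Group ≃* Subgroup.closure (Set.range r) :=
    (MonoidHom.ofInjective hinj).trans (MulEquiv.subgroupCongr hrange)
  exact ⟨M.toCoxeterSystem.map e, fun i => hs i⟩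

theorem HasCoxeterPresentation.isLiftable {ι : Type*} {M : CoxeterMatrix ι} {r : ι → G}
    (h : HasCoxeterPresentation M r) : M.IsLiftable r := by
  obtain ⟨cs, hcs⟩ := h
  intro i j
  rw [← hcs, ← hcs, ← Subgroup.coe_mul, ← Subgroup.coe_pow, cs.simple_mul_simple_pow,
    Subgroup.coe_one]

/-- The homomorphism out of a group with a Coxeter presentation. -/
theorem HasCoxeterPresentation.exists_hom {ι : Type*} {M : CoxeterMatrix ι} {r : ι → G}
    (h : HasCoxeterPresentation M r) {Q : Type*} [Group Q] {f : ι → Q} (hf : M.IsLiftable f) :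
    ∃ q : Subgroup.closure (Set.range r) →* Q,
      ∀ i, q ⟨r i, Subgroup.subset_closure (Set.mem_range_self i)⟩ = f i := by
  obtain ⟨cs, hcs⟩ := h
  refine ⟨cs.lift ⟨f, hf⟩, fun i => ?_⟩
  rw [← cs.lift_apply_simple hf i]
  congr 1
  exact Subtype.ext (hcs i).symm

theorem normalClosureIn_eq_map {H : Subgroup G} {x : G} (hx : x ∈ H) :
    (normalClosureIn H x).subgroupOf H = Subgroup.normalClosure {(⟨x, hx⟩ : H)} ∧
      normalClosureIn H x ≤ H := by
  have hle : normalClosureIn H x ≤ H := by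
    refine (Subgroup.closure_le _).2 ?_
    rintro _ ⟨h, hh, rfl⟩
    exact H.mul_mem (H.mul_mem hh hx) (H.inv_mem hh)
  refine ⟨?_, hle⟩
  have : normalClosureIn H x = (Subgroup.normalClosure {(⟨x, hx⟩ : H)}).map H.subtype := by
    rw [Subgroup.normalClosure, MonoidHom.map_closure, normalClosureIn]
    congr 1
    ext y
    simp only [Set.mem_ofPred_eq, Set.mem_image, Group.mem_conjugatesOfSet_iff,
      Set.mem_singleton_iff, exists_eq_left, isConj_iff]
    constructor
    · rintro ⟨h, hh, rfl⟩
      exact ⟨_, ⟨⟨h, hh⟩, rfl⟩, by simp⟩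
    · rintro ⟨_, ⟨c, rfl⟩, rfl⟩
      exact ⟨c, c.2, by simp⟩
  rw [this, Subgroup.subgroupOf, Subgroup.comap_map_eq_self_of_injective H.subtype_injective]

theorem isNormalIn_normalClosureIn {H : Subgroup G} {x : G} (hx : x ∈ H) :
    IsNormalIn (normalClosureIn H x) H := by
  obtain ⟨h1, h2⟩ := normalClosureIn_eq_map hx
  exact ⟨h2, h1 ▸ Subgroup.normalClosure_normal⟩

/-- Adding the relation `(r a * r b) ^ m = 1` to a Coxeter presentation amounts to dividing by the
normal closure of `(r a * r b) ^ m`. -/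
theorem hasCoxeterQuotient_normalClosureIn {ι : Type*} {M M' : CoxeterMatrix ι} {r : ι → G}
    (h : HasCoxeterPresentation M r) {a b : ι} {m : ℕ}
    (h0 : M a b = 0) (hm : M' a b = m)
    (hMM : ∀ i j, M' i j = M i j ∨ (i = a ∧ j = b) ∨ (i = b ∧ j = a)) :
    HasCoxeterQuotient M' r
      (normalClosureIn (Subgroup.closure (Set.range r)) ((r a * r b) ^ m)) := by
  set H := Subgroup.closure (Set.range r) with hH
  have hrH : ∀ i, r i ∈ H := fun i => Subgroup.subset_closure (Set.mem_range_self i)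
  have hx : (r a * r b) ^ m ∈ H := H.pow_mem (H.mul_mem (hrH a) (hrH b)) m
  obtain ⟨hN, hle⟩ := normalClosureIn_eq_map hx
  have hlift : M.IsLiftable M'.simple := by
    intro i j
    have h1 := M'.toCoxeterSystem.simple_mul_simple_pow i j
    rcases hMM i j with e | ⟨rfl, rfl⟩ | ⟨rfl, rfl⟩
    · rw [← e]; exact h1
    · rw [h0, pow_zero]
    · rw [M.symmetric, h0, pow_zero]
  obtain ⟨φ, hφ⟩ := h.exists_hom hlift
  refine ⟨hle, φ, hφ, ?_⟩
  rw [hN]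
  have hrinv : ∀ i, r i * r i = 1 := fun i => by
    have := HasCoxeterPresentation.isLiftable h i i
    rwa [M.diagonal, pow_one] at this
  apply le_antisymm
  · -- the quotient map factors through the Coxeter group of `M'`
    have hlift' : M'.IsLiftable (fun i => (QuotientGroup.mk' (Subgroup.normalClosure
        {(⟨(r a * r b) ^ m, hx⟩ : H)})) ⟨r i, hrH i⟩) := by
      intro i j
      have hab : ∀ i j : ι, (⟨r i, hrH i⟩ * ⟨r j, hrH j⟩ : H) ^ m ∈ Subgroup.normalClosure
          {(⟨(r a * r b) ^ m, hx⟩ : H)} → (((QuotientGroup.mk' (Subgroup.normalClosure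
        {(⟨(r a * r b) ^ m, hx⟩ : H)})) ⟨r i, hrH i⟩) * ((QuotientGroup.mk' (Subgroup.normalClosure
        {(⟨(r a * r b) ^ m, hx⟩ : H)})) ⟨r j, hrH j⟩)) ^ m = 1 := by
        intro i j hij
        rw [← map_mul, ← map_pow]
        exact (QuotientGroup.eq_one_iff _).2 hij
      have h1 : (⟨r a, hrH a⟩ * ⟨r b, hrH b⟩ : H) ^ m ∈ Subgroup.normalClosure
          {(⟨(r a * r b) ^ m, hx⟩ : H)} := Subgroup.subset_normalClosure (Subtype.ext rfl)
      rcases hMM i j with e | ⟨rfl, rfl⟩ | ⟨rfl, rfl⟩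
      · rw [e, ← map_mul, ← map_pow]
        have : (⟨r i, hrH i⟩ * ⟨r j, hrH j⟩ : H) ^ M i j = 1 :=
          Subtype.ext (HasCoxeterPresentation.isLiftable h i j)
        rw [this, map_one]
      · rw [hm]; exact hab _ _ h1
      · rw [M'.symmetric, hm]
        refine hab _ _ ?_
        have e : (⟨r i, hrH i⟩ * ⟨r j, hrH j⟩ : H) ^ m
            = ((⟨r j, hrH j⟩ * ⟨r i, hrH i⟩ : H) ^ m)⁻¹ := by
          rw [← inv_pow, _root_.mul_inv_rev]
          congr 2
          · exact eq_inv_of_mul_eq_one_left (Subtype.ext (hrinv i))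
          · exact eq_inv_of_mul_eq_one_left (Subtype.ext (hrinv j))
        rw [e]
        exact Subgroup.inv_mem _ h1
    have hcomp : (M'.toCoxeterSystem.lift ⟨_, hlift'⟩).comp φ = QuotientGroup.mk' _ := by
      obtain ⟨cs, hcs⟩ := h
      refine cs.ext_simple fun i => ?_
      have e : cs.simple i = ⟨r i, hrH i⟩ := Subtype.ext (hcs i)
      rw [MonoidHom.comp_apply, e, hφ]
      exact M'.toCoxeterSystem.lift_apply_simple hlift' i
    intro x hxk
    rw [MonoidHom.mem_ker] at hxk
    have := DFunLike.congr_fun hcomp x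
    rw [MonoidHom.comp_apply, hxk, map_one] at this
    exact (QuotientGroup.eq_one_iff x).1 this.symm
  · have : φ.ker.Normal := inferInstance
    refine Subgroup.normalClosure_le_normal ?_
    rw [Set.singleton_subset_iff]
    change φ _ = 1
    have e : (⟨(r a * r b) ^ m, hx⟩ : H) = (⟨r a, hrH a⟩ * ⟨r b, hrH b⟩) ^ m := Subtype.ext rfl
    rw [e, map_pow, map_mul, hφ, hφ, ← hm]
    exact M'.toCoxeterSystem.simple_mul_simple_pow a b

theorem HasCoxeterQuotient.finite {ι : Type*} {M : CoxeterMatrix ι} {r : ι → G} {S : Subgroup G}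
    (h : HasCoxeterQuotient M r S) (hS : S.relIndex (Subgroup.closure (Set.range r)) ≠ 0) :
    Finite M.Group := by
  obtain ⟨-, φ, hφ, hker⟩ := h
  have hsurj : Function.Surjective φ := by
    rw [← MonoidHom.range_eq_top, eq_top_iff, ← M.toCoxeterSystem.subgroup_closure_range_simple,
      Subgroup.closure_le]
    rintro _ ⟨i, rfl⟩
    exact ⟨_, hφ i⟩
  apply Nat.finite_of_card_ne_zero
  rw [Subgroup.relIndex, ← hker, Subgroup.index_ker, MonoidHom.range_eq_top.2 hsurj,
    Subgroup.card_top] at hS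
  exact hS

/-! ### Even subgroups -/

/-- If the `r i` are involutions outside `E` whose pairwise products lie in `E`, then the elements
of `⟨r i⟩` in `E` are the products of an even number of generators. -/
theorem closure_inf_eq_closure_mul {ι : Type*} {r : ι → G} {E : Subgroup G} (i₀ : ι)
    (hinv : ∀ i, r i * r i = 1) (hmul : ∀ i j, r i * r j ∈ E) (hnot : r i₀ ∉ E) :
    Subgroup.closure (Set.range r) ⊓ E = Subgroup.closure (Set.range fun i => r i * r i₀) := by
  have hri : ∀ i, (r i)⁻¹ = r i := fun i => inv_eq_of_mul_eq_one_left (hinv i)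
  set E' := Subgroup.closure (Set.range fun i => r i * r i₀) with hE'
  have hmem : ∀ i, r i * r i₀ ∈ E' := fun i => Subgroup.subset_closure ⟨i, rfl⟩
  have hmem' : ∀ i, r i₀ * r i ∈ E' := fun i => by
    have := E'.inv_mem (hmem i)
    rwa [_root_.mul_inv_rev, hri, hri] at this
  apply le_antisymm
  · rintro x ⟨hx, hxE⟩
    have hconj : ∀ y ∈ E', r i₀ * y * r i₀ ∈ E' := by
      intro y hy
      induction hy using Subgroup.closure_induction with
      | mem y hy =>
        obtain ⟨i, rfl⟩ := hy
        have : r i₀ * (r i * r i₀) * r i₀ = r i₀ * r i := by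
          rw [mul_assoc, mul_assoc, hinv, mul_one]
        rw [this]; exact hmem' i
      | one => rw [mul_one, hinv]; exact E'.one_mem
      | mul y z _ _ hy hz =>
        have : r i₀ * (y * z) * r i₀ = (r i₀ * y * r i₀) * (r i₀ * z * r i₀) := by
          rw [show (r i₀ * y * r i₀) * (r i₀ * z * r i₀) = r i₀ * y * (r i₀ * r i₀) * z * r i₀ by
            group, hinv]
          group
        rw [this]; exact E'.mul_mem hy hz
      | inv y _ hy =>
        have : r i₀ * y⁻¹ * r i₀ = (r i₀ * y * r i₀)⁻¹ := by
          rw [_root_.mul_inv_rev, _root_.mul_inv_rev, hri, mul_assoc]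
        rw [this]; exact E'.inv_mem hy
    -- `E'` is normalised by `r i₀`, so `E'` and `E' * r i₀` make up the whole group
    have key : ∀ i, ∀ y, (y ∈ E' ∨ y * r i₀ ∈ E') → (r i * y ∈ E' ∨ r i * y * r i₀ ∈ E') := by
      rintro i y (hy | hy)
      · right
        have : r i * y * r i₀ = (r i * r i₀) * (r i₀ * y * r i₀) := by
          rw [show (r i * r i₀) * (r i₀ * y * r i₀) = r i * (r i₀ * r i₀) * y * r i₀ by group, hinv]
          group
        rw [this]; exact E'.mul_mem (hmem i) (hconj y hy)
      · left
        have : r i * y = (r i * r i₀) * (r i₀ * (y * r i₀) * r i₀) := by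
          rw [show (r i * r i₀) * (r i₀ * (y * r i₀) * r i₀)
            = r i * (r i₀ * r i₀) * y * (r i₀ * r i₀) by group, hinv]
          group
        rw [this]; exact E'.mul_mem (hmem i) (hconj _ hy)
    have : x ∈ E' ∨ x * r i₀ ∈ E' := by
      clear hxE
      induction hx using Subgroup.closure_induction_left with
      | one => exact Or.inl E'.one_mem
      | mul_left x hx y _ ih => obtain ⟨i, rfl⟩ := hx; exact key i y ih
      | inv_mul_cancel x hx y _ ih => obtain ⟨i, rfl⟩ := hx; rw [hri]; exact key i y ih
    rcases this with h | h
    · exact h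
    · have hle : E' ≤ E := (Subgroup.closure_le _).2 (by rintro _ ⟨i, rfl⟩; exact hmul i i₀)
      exact absurd ((E.mul_mem_cancel_left hxE).1 (hle h)) hnot
  · refine le_inf ?_ ?_
    · refine (Subgroup.closure_le _).2 ?_
      rintro _ ⟨i, rfl⟩
      exact Subgroup.mul_mem _ (Subgroup.subset_closure ⟨i, rfl⟩)
        (Subgroup.subset_closure ⟨i₀, rfl⟩)
    · exact (Subgroup.closure_le _).2 (by rintro _ ⟨i, rfl⟩; exact hmul i i₀)

/-! ### Dihedral groups -/

theorem conj_zpow_of_involution {a b : G} (hb : b * b = 1) (hab : b * a * b = a⁻¹) (k : ℤ) :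
    b * a ^ k = a ^ (-k) * b := by
  have hb' : b⁻¹ = b := inv_eq_of_mul_eq_one_left hb
  have h : b * a ^ k * b⁻¹ = a ^ (-k) := by
    rw [← conj_zpow, hb', hab, _root_.inv_zpow, _root_.zpow_neg]
  rw [← h]; group

/-- The elements of a dihedral group. -/
theorem mem_closure_pair_iff {a b : G} (hb : b * b = 1) (hab : b * a * b = a⁻¹) {g : G} :
    g ∈ Subgroup.closure {a, b} ↔ ∃ k : ℤ, g = a ^ k ∨ g = a ^ k * b := by
  have hb' : b⁻¹ = b := inv_eq_of_mul_eq_one_left hb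
  have ha : a ∈ Subgroup.closure {a, b} := Subgroup.subset_closure (by simp)
  have hb1 : b ∈ Subgroup.closure {a, b} := Subgroup.subset_closure (by simp)
  constructor
  · intro hg
    have key : ∀ y, (∃ k : ℤ, y = a ^ k ∨ y = a ^ k * b) →
        ∃ k : ℤ, b * y = a ^ k ∨ b * y = a ^ k * b := by
      rintro y ⟨k, rfl | rfl⟩
      · exact ⟨-k, Or.inr (conj_zpow_of_involution hb hab k)⟩
      · refine ⟨-k, Or.inl ?_⟩
        rw [← mul_assoc, conj_zpow_of_involution hb hab k, mul_assoc, hb, mul_one]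
    have key2 : ∀ (e : ℤ) (y), (∃ k : ℤ, y = a ^ k ∨ y = a ^ k * b) →
        ∃ k : ℤ, a ^ e * y = a ^ k ∨ a ^ e * y = a ^ k * b := by
      rintro e y ⟨k, rfl | rfl⟩
      · exact ⟨e + k, Or.inl (by rw [_root_.zpow_add])⟩
      · exact ⟨e + k, Or.inr (by rw [_root_.zpow_add, mul_assoc])⟩
    induction hg using Subgroup.closure_induction_left with
    | one => exact ⟨0, by simp⟩
    | mul_left x hx y _ ih =>
      rcases hx with rfl | rfl
      · simpa using key2 1 y ih
      · exact key y ih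
    | inv_mul_cancel x hx y _ ih =>
      rcases hx with rfl | rfl
      · simpa using key2 (-1) y ih
      · rw [hb']; exact key y ih
  · rintro ⟨k, rfl | rfl⟩
    · exact Subgroup.zpow_mem _ ha k
    · exact Subgroup.mul_mem _ (Subgroup.zpow_mem _ ha k) hb1

/-- A rotation `a` of order `n` and a half-turn `b` outside `⟨a⟩` that inverts it generate a dihedral
group. -/
theorem dihedral_mulEquiv {n : ℕ} [NeZero n] {a b : G} (hb : b * b = 1) (hab : b * a * b = a⁻¹)
    (ha : orderOf a = n) (hnot : b ∉ Subgroup.zpowers a) :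
    Nonempty (Subgroup.closure {a, b} ≃* DihedralGroup n) := by
  have hpow : ∀ i j : ZMod n, a ^ i.val * a ^ j.val = a ^ (i + j).val := by
    intro i j
    rw [← pow_add, ← pow_mod_orderOf a (i.val + j.val), ha, ← ZMod.val_add]
  have hneg : ∀ i j : ZMod n, (a ^ i.val)⁻¹ * a ^ j.val = a ^ (j - i).val := by
    intro i j
    rw [inv_mul_eq_iff_eq_mul, hpow, add_sub_cancel]
  have hcomm : ∀ k : ℕ, b * a ^ k = (a ^ k)⁻¹ * b := by
    intro k
    have := conj_zpow_of_involution hb hab k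
    rwa [_root_.zpow_neg, zpow_natCast] at this
  let f : DihedralGroup n →* G :=
    { toFun := fun x => match x with
        | .r i => a ^ i.val
        | .sr i => b * a ^ i.val
      map_one' := by
        change a ^ (0 : ZMod n).val = 1
        simp
      map_mul' := by
        rintro (i | i) (j | j)
        · change a ^ (i + j).val = a ^ i.val * a ^ j.val
          exact (hpow i j).symm
        · change b * a ^ (j - i).val = a ^ i.val * (b * a ^ j.val)
          have : a ^ i.val * b = b * (a ^ i.val)⁻¹ := by
            have h1 := conj_zpow_of_involution hb hab (-(i.val : ℤ))
            rw [neg_neg, _root_.zpow_neg, zpow_natCast] at h1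
            exact h1.symm
          rw [← mul_assoc, this, mul_assoc, hneg]
        · change b * a ^ (i + j).val = b * a ^ i.val * a ^ j.val
          rw [mul_assoc, hpow]
        · change a ^ (j - i).val = b * a ^ i.val * (b * a ^ j.val)
          rw [hcomm, show (a ^ i.val)⁻¹ * b * (b * a ^ j.val)
            = (a ^ i.val)⁻¹ * (b * b) * a ^ j.val by group, hb, mul_one, hneg] }
  have hinj : Function.Injective f := by
    rw [injective_iff_map_eq_one]
    rintro (i | i) h
    · change a ^ i.val = 1 at h
      have h1 := orderOf_dvd_of_pow_eq_one h
      rw [ha] at h1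
      have h2 := Nat.eq_zero_of_dvd_of_lt h1 i.val_lt
      rw [ZMod.val_eq_zero] at h2
      rw [h2]; rfl
    · change b * a ^ i.val = 1 at h
      exact absurd ⟨-(i.val : ℤ), by
        simp only [_root_.zpow_neg, zpow_natCast]; exact (eq_inv_of_mul_eq_one_left h).symm⟩ hnot
  have hrange : f.range = Subgroup.closure {a, b} := by
    apply le_antisymm
    · rintro _ ⟨(i | i), rfl⟩
      · exact Subgroup.pow_mem _ (Subgroup.subset_closure (by simp)) _
      · exact Subgroup.mul_mem _ (Subgroup.subset_closure (by simp))
          (Subgroup.pow_mem _ (Subgroup.subset_closure (by simp)) _)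
    · rw [Subgroup.closure_le]
      rintro g (rfl | rfl)
      · refine ⟨.r 1, ?_⟩
        change g ^ (1 : ZMod n).val = g
        rw [ZMod.val_one_eq_one_mod, ← ha, pow_mod_orderOf, pow_one]
      · refine ⟨.sr 0, ?_⟩
        change g * a ^ (0 : ZMod n).val = g
        simp
  exact ⟨((MonoidHom.ofInjective hinj).trans (MulEquiv.subgroupCongr hrange)).symm⟩

/-! ### Kernels from transversals -/

/-- If `H = ⟨r k⟩` is covered by the cosets `S τ` with `S` in the kernel of `q : H → Q` and `q`
separates the `τ`, then `S` is the kernel of `q` and the `τ` are a transversal. -/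
theorem ker_eq_of_transversal {κ ι : Type*} [Fintype ι] {r : κ → G} (hr : ∀ k, r k * r k = 1)
    {Q : Type*} [Group Q] (q : Subgroup.closure (Set.range r) →* Q) {S : Subgroup G}
    (hS : S ≤ Subgroup.closure (Set.range r))
    (hker : S.subgroupOf (Subgroup.closure (Set.range r)) ≤ q.ker)
    (τ : ι → Subgroup.closure (Set.range r)) (i₀ : ι) (h₀ : τ i₀ = 1)
    (hτ : ∀ i k, ∃ s ∈ S, ∃ j, (τ i : G) * r k = s * τ j)
    (hinj : Function.Injective (q ∘ τ)) :
    q.ker = S.subgroupOf (Subgroup.closure (Set.range r)) ∧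
    S.relIndex (Subgroup.closure (Set.range r)) = Fintype.card ι ∧
    ∀ h : Subgroup.closure (Set.range r), ∃ s ∈ S, ∃ i, (h : G) = s * τ i := by
  have hcov : ∀ h : Subgroup.closure (Set.range r), ∃ s ∈ S, ∃ i, (h : G) = s * τ i := by
    rintro ⟨h, hh⟩
    have key : ∀ k y, (∃ s ∈ S, ∃ i, y = s * (τ i : G)) →
        (∃ s ∈ S, ∃ i, y * r k = s * (τ i : G)) := by
      rintro k y ⟨s, hs, i, rfl⟩
      obtain ⟨s', hs', j, e⟩ := hτ i k
      exact ⟨s * s', S.mul_mem hs hs', j, by rw [mul_assoc, e, mul_assoc]⟩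
    change ∃ s ∈ S, ∃ i, h = s * (τ i : G)
    induction hh using Subgroup.closure_induction_right with
    | one => exact ⟨1, S.one_mem, i₀, by simp [h₀]⟩
    | mul_right y _ x hx ih => obtain ⟨k, rfl⟩ := hx; exact key k y ih
    | mul_inv_cancel y _ x hx ih =>
      obtain ⟨k, rfl⟩ := hx
      rw [inv_eq_of_mul_eq_one_left (hr k)]; exact key k y ih
  have hq : ∀ h : Subgroup.closure (Set.range r), ∀ s ∈ S, ∀ i, (h : G) = s * τ i →
      q h = q (τ i) := by
    intro h s hs i e
    have : h = ⟨s, hS hs⟩ * τ i := Subtype.ext e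
    have h1 : (⟨s, hS hs⟩ : Subgroup.closure (Set.range r)) ∈ q.ker := hker hs
    rw [this, map_mul, MonoidHom.mem_ker.1 h1, one_mul]
  have hk : q.ker = S.subgroupOf (Subgroup.closure (Set.range r)) := by
    refine le_antisymm ?_ hker
    intro h hh
    obtain ⟨s, hs, i, e⟩ := hcov h
    have h1 := hq h s hs i e
    rw [MonoidHom.mem_ker.1 hh] at h1
    have h2 : i = i₀ := hinj (by rw [Function.comp_apply, ← h1, Function.comp_apply, h₀, map_one])
    rw [h2, h₀, Subgroup.coe_one, mul_one] at e
    change (h : G) ∈ S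
    rw [e]; exact hs
  refine ⟨hk, ?_, hcov⟩
  rw [Subgroup.relIndex, ← hk, Subgroup.index_ker, ← Nat.card_eq_fintype_card]
  symm
  refine Nat.card_congr (Equiv.ofBijective (fun i => ⟨q (τ i), _, rfl⟩) ⟨?_, ?_⟩)
  · intro i j hij
    exact hinj (Subtype.ext_iff.1 hij)
  · rintro ⟨_, h, rfl⟩
    obtain ⟨s, hs, i, e⟩ := hcov h
    exact ⟨i, Subtype.ext (hq h s hs i e).symm⟩

end Algebra

/-! ### Möbius and anti-conformal maps -/

theorem mobius_apply (A : GL (Fin 2) ℂ) (x : Sphere) : mobius A x = A • x := rfl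

@[simp] theorem conjPerm_coe (z : ℂ) : conjPerm (z : Sphere) = ((starRingEnd ℂ z : ℂ) : Sphere) :=
  rfl

@[simp] theorem conjPerm_infty : conjPerm (OnePoint.infty : Sphere) = OnePoint.infty := rfl

theorem conjPerm_mul_self : conjPerm * conjPerm = 1 := by
  ext x
  exact (Function.Involutive.toPerm_involutive (h := _)) x

theorem mobius_coe (A : GL (Fin 2) ℂ) {z : ℂ} (h : A 1 0 * z + A 1 1 ≠ 0) :
    mobius A (z : Sphere) = (((A 0 0 * z + A 0 1) / (A 1 0 * z + A 1 1) : ℂ) : Sphere) := by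
  rw [mobius_apply, OnePoint.smul_some_eq_ite, if_neg h]

theorem antiMobius_coe {A : Matrix (Fin 2) (Fin 2) ℂ} (hA : A.det ≠ 0) {z : ℂ}
    (h : A 1 0 * starRingEnd ℂ z + A 1 1 ≠ 0) :
    antiMobius A hA (z : Sphere) = (((A 0 0 * starRingEnd ℂ z + A 0 1) /
      (A 1 0 * starRingEnd ℂ z + A 1 1) : ℂ) : Sphere) := by
  rw [antiMobius, Equiv.Perm.mul_apply, conjPerm_coe, mobius_coe _ h]; rfl

theorem antiMobius_coe_eq_infty {A : Matrix (Fin 2) (Fin 2) ℂ} (hA : A.det ≠ 0) {z : ℂ}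
    (h : A 1 0 * starRingEnd ℂ z + A 1 1 = 0) :
    antiMobius A hA (z : Sphere) = OnePoint.infty := by
  rw [antiMobius, Equiv.Perm.mul_apply, conjPerm_coe, mobius_apply, OnePoint.smul_some_eq_ite]
  exact if_pos h

theorem antiMobius_infty {A : Matrix (Fin 2) (Fin 2) ℂ} (hA : A.det ≠ 0) (h : A 1 0 ≠ 0) :
    antiMobius A hA OnePoint.infty = ((A 0 0 / A 1 0 : ℂ) : Sphere) := by
  rw [antiMobius, Equiv.Perm.mul_apply, conjPerm_infty, mobius_apply, OnePoint.smul_infty_eq_ite]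
  exact if_neg h

theorem antiMobius_infty_eq_infty {A : Matrix (Fin 2) (Fin 2) ℂ} (hA : A.det ≠ 0) (h : A 1 0 = 0) :
    antiMobius A hA OnePoint.infty = OnePoint.infty := by
  rw [antiMobius, Equiv.Perm.mul_apply, conjPerm_infty, mobius_apply, OnePoint.smul_infty_eq_ite]
  exact if_pos h

theorem conjPerm_mul_mobius (A : GL (Fin 2) ℂ) :
    conjPerm * mobius A = mobius (A.map (starRingEnd ℂ)) * conjPerm := by
  ext x
  exact OnePoint.map_smul (starRingEnd ℂ) A x

theorem mobius_eq_one {A : GL (Fin 2) ℂ} {c : ℂ} (h : (A : Matrix (Fin 2) (Fin 2) ℂ) = c • 1) :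
    mobius A = 1 := by
  have h00 : A 0 0 = c := by rw [h]; simp
  have h01 : A 0 1 = 0 := by rw [h]; simp
  have h10 : A 1 0 = 0 := by rw [h]; simp
  have h11 : A 1 1 = c := by rw [h]; simp
  have hc : c ≠ 0 := by
    rintro rfl
    have := A.det_ne_zero
    rw [h] at this
    simp at this
  apply Equiv.ext
  intro x
  rw [mobius_apply, Equiv.Perm.one_apply]
  induction x using OnePoint.rec with
  | infty => rw [OnePoint.smul_infty_eq_ite, if_pos h10]
  | coe z =>
    rw [OnePoint.smul_some_eq_ite, if_neg (by rw [h10, h11]; simpa using hc), h00, h01, h10, h11]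
    congr 1
    rw [add_zero, zero_mul, zero_add, mul_div_cancel_left₀ _ hc]

theorem antiMobius_mul_antiMobius {A B : Matrix (Fin 2) (Fin 2) ℂ} (hA : A.det ≠ 0)
    (hB : B.det ≠ 0) : antiMobius A hA * antiMobius B hB =
      mobius (GeneralLinearGroup.mkOfDetNeZero A hA *
        (GeneralLinearGroup.mkOfDetNeZero B hB).map (starRingEnd ℂ)) := by
  rw [antiMobius, antiMobius, map_mul, mul_assoc, ← mul_assoc conjPerm, conjPerm_mul_mobius,
    mul_assoc (mobius _) conjPerm, conjPerm_mul_self, mul_one]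

theorem antiMobius_mul_antiMobius_pow_eq_one {A B : Matrix (Fin 2) (Fin 2) ℂ} (hA : A.det ≠ 0)
    (hB : B.det ≠ 0) {k : ℕ} {c : ℂ} (h : (A * B.map (starRingEnd ℂ)) ^ k = c • 1) :
    (antiMobius A hA * antiMobius B hB) ^ k = 1 := by
  rw [antiMobius_mul_antiMobius, ← map_pow]
  exact mobius_eq_one (c := c) h

theorem isAntiConformal_antiMobius {A : Matrix (Fin 2) (Fin 2) ℂ} (hA : A.det ≠ 0) :
    IsAntiConformal (antiMobius A hA) := ⟨_, rfl⟩

theorem conjPerm_eq_antiMobius : conjPerm = antiMobius 1 (by simp) := by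
  rw [antiMobius, mobius_eq_one (c := 1) (by rw [one_smul]; rfl), one_mul]

theorem isAntiConformal_conjPerm : IsAntiConformal conjPerm :=
  conjPerm_eq_antiMobius ▸ isAntiConformal_antiMobius _

/-- Conjugation is not a Möbius map: a Möbius map that fixes `0`, `1` and `∞` is the identity. -/
theorem conjPerm_notMem_mobiusGroup : conjPerm ∉ mobiusGroup := by
  rintro ⟨A, hA⟩
  have h0 : A 1 0 = 0 := by
    rw [← OnePoint.smul_infty_eq_self_iff, ← mobius_apply, hA]; rfl
  have h11 : A 1 1 ≠ 0 := by
    intro h11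
    apply A.det_ne_zero
    rw [det_fin_two, h0, h11]; simp
  have hz : ∀ z : ℂ, (A 0 0 * z + A 0 1) / A 1 1 = starRingEnd ℂ z := by
    intro z
    have h1 : mobius A (z : Sphere) = conjPerm z := by rw [hA]
    rw [mobius_coe A (by rw [h0]; simpa using h11), h0, conjPerm_coe, OnePoint.coe_eq_coe] at h1
    simpa using h1
  have e0 := hz 0
  have e1 := hz 1
  have e2 := hz Complex.I
  simp only [mul_zero, zero_add, map_zero, mul_one, map_one, Complex.conj_I] at e0 e1 e2
  rw [div_eq_zero_iff, or_iff_left h11] at e0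
  rw [e0, add_zero, div_eq_one_iff_eq h11] at e1
  rw [e0, e1, add_zero, mul_div_cancel_left₀ _ h11] at e2
  have := congrArg Complex.im e2
  norm_num at this

theorem IsAntiConformal.notMem_mobiusGroup {f : SpherePerm} (hf : IsAntiConformal f) :
    f ∉ mobiusGroup := by
  obtain ⟨A, rfl⟩ := hf
  intro h
  exact conjPerm_notMem_mobiusGroup ((mobiusGroup.mul_mem_cancel_left ⟨A, rfl⟩).1 h)

theorem IsAntiConformal.mul {f g : SpherePerm} (hf : IsAntiConformal f) (hg : IsAntiConformal g) :
    f * g ∈ mobiusGroup := by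
  obtain ⟨A, rfl⟩ := hf
  obtain ⟨B, rfl⟩ := hg
  refine ⟨A * B.map (starRingEnd ℂ), ?_⟩
  rw [map_mul, mul_assoc, ← mul_assoc conjPerm, conjPerm_mul_mobius,
    mul_assoc (mobius _) conjPerm, conjPerm_mul_self, mul_one]

theorem IsAntiConformal.mul_mobius {f g : SpherePerm} (hf : IsAntiConformal f)
    (hg : g ∈ mobiusGroup) : IsAntiConformal (f * g) := by
  obtain ⟨A, rfl⟩ := hf
  obtain ⟨B, rfl⟩ := hg
  exact ⟨A * B.map (starRingEnd ℂ), by rw [mul_assoc, conjPerm_mul_mobius, map_mul, mul_assoc]⟩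

theorem conformal_or_antiConformal {ι : Type*} {r : ι → SpherePerm}
    (hr : ∀ i, IsAntiConformal (r i)) (hinv : ∀ i, r i * r i = 1) {f : SpherePerm}
    (hf : f ∈ Subgroup.closure (Set.range r)) : f ∈ mobiusGroup ∨ IsAntiConformal f := by
  have key : ∀ i g, (g ∈ mobiusGroup ∨ IsAntiConformal g) →
      (r i * g ∈ mobiusGroup ∨ IsAntiConformal (r i * g)) := by
    rintro i g (hg | hg)
    · exact Or.inr ((hr i).mul_mobius hg)
    · exact Or.inl ((hr i).mul hg)
  induction hf using Subgroup.closure_induction_left with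
  | one => exact Or.inl mobiusGroup.one_mem
  | mul_left x hx y _ ih => obtain ⟨i, rfl⟩ := hx; exact key i y ih
  | inv_mul_cancel x hx y _ ih =>
    obtain ⟨i, rfl⟩ := hx
    rw [inv_eq_of_mul_eq_one_left (hinv i)]
    exact key i y ih

/-! ### Discreteness -/

theorem IsKleinian.mono {K K' : Subgroup SpherePerm} (h : IsKleinian K') (hle : K ≤ K') :
    IsKleinian K := by
  refine ⟨hle.trans h.1, ?_⟩
  have := h.2
  exact DiscreteTopology.of_subset (s := (K'.comap (mobius.comp SpecialLinearGroup.toGL) : Set _))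
    this (Subgroup.comap_mono hle)

theorem eq_of_mobius_toGL_eq_one {A : SL(2, ℂ)} (h : mobius (SpecialLinearGroup.toGL A) = 1) :
    A = 1 ∨ A = -1 := by
  have hz : ∀ x : Sphere, (SpecialLinearGroup.toGL A) • x = x := fun x => by
    rw [← mobius_apply, h]; rfl
  have h0 : A 1 0 = 0 := OnePoint.smul_infty_eq_self_iff.1 (hz OnePoint.infty)
  have hdet := A.det_coe
  rw [det_fin_two, h0, mul_zero, sub_zero] at hdet
  have h11 : A 1 1 ≠ 0 := right_ne_zero_of_mul_eq_one hdet
  have e : ∀ z : ℂ, (A 0 0 * z + A 0 1) / A 1 1 = z := by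
    intro z
    have h1 := hz z
    rw [OnePoint.smul_some_eq_ite, if_neg, OnePoint.coe_eq_coe] at h1
    · change (A 0 0 * z + A 0 1) / (A 1 0 * z + A 1 1) = z at h1
      rwa [h0, zero_mul, zero_add] at h1
    · change ¬ A 1 0 * z + A 1 1 = 0
      rwa [h0, zero_mul, zero_add]
  have e0 := e 0
  have e1 := e 1
  simp only [mul_zero, zero_add, mul_one] at e0 e1
  rw [div_eq_zero_iff, or_iff_left h11] at e0
  rw [e0, add_zero, div_eq_one_iff_eq h11] at e1
  rw [e1] at hdet
  rcases mul_self_eq_one_iff.1 hdet with h1 | h1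
  · left
    ext i j; fin_cases i <;> fin_cases j <;> simp [h0, e0, e1, h1]
  · right
    ext i j; fin_cases i <;> fin_cases j <;> simp [h0, e0, e1, h1]

/-- A group of Möbius maps is discrete if the nontrivial elements move some point `z₀` out of a
neighbourhood of `z₀`. -/
theorem isKleinian_of_moves {K : Subgroup SpherePerm} (hK : K ≤ mobiusGroup) {U : Set ℂ}
    (hU : IsOpen U) {z₀ : ℂ} (hz : z₀ ∈ U)
    (h : ∀ k ∈ K, k ≠ 1 → k (z₀ : Sphere) ∉ ((↑) : ℂ → Sphere) '' U) : IsKleinian K := by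
  refine ⟨hK, ?_⟩
  set Γ := K.comap (mobius.comp SpecialLinearGroup.toGL) with hΓ
  have c : ∀ i j : Fin 2, Continuous fun A : SL(2, ℂ) => A i j := fun i j =>
    (continuous_subtype_val.matrix_elem i j)
  -- near the identity, the image of `z₀` stays in `U`, and `-1` is excluded
  have hev : ∀ᶠ A : SL(2, ℂ) in nhds 1, A ∈ Γ → A = 1 := by
    have h1 : ∀ᶠ A : SL(2, ℂ) in nhds 1, A 1 0 * z₀ + A 1 1 ≠ 0 := by
      have : Continuous fun A : SL(2, ℂ) => A 1 0 * z₀ + A 1 1 :=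
        ((c 1 0).mul continuous_const).add (c 1 1)
      exact this.continuousAt.eventually_ne (by simp)
    have h2 : ∀ᶠ A : SL(2, ℂ) in nhds 1,
        (A 0 0 * z₀ + A 0 1) / (A 1 0 * z₀ + A 1 1) ∈ U := by
      have : ContinuousAt (fun A : SL(2, ℂ) =>
          (A 0 0 * z₀ + A 0 1) / (A 1 0 * z₀ + A 1 1)) 1 :=
        ContinuousAt.div ((((c 0 0).mul continuous_const).add (c 0 1)).continuousAt)
          ((((c 1 0).mul continuous_const).add (c 1 1)).continuousAt) (by simp)
      exact this.eventually_mem (hU.mem_nhds (by simpa using hz))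
    have h3 : ∀ᶠ A : SL(2, ℂ) in nhds 1, A 0 0 ≠ -1 :=
      (c 0 0).continuousAt.eventually_ne (by simp; norm_num)
    filter_upwards [h1, h2, h3] with A a1 a2 a3 hA
    have hA1 : mobius (SpecialLinearGroup.toGL A) = 1 := by
      by_contra hne
      refine h _ hA hne ⟨_, a2, ?_⟩
      exact (mobius_coe (SpecialLinearGroup.toGL A) a1).symm
    rcases eq_of_mobius_toGL_eq_one hA1 with e | e
    · exact e
    · exact absurd (by rw [e]; simp) a3
  rw [discreteTopology_iff_isOpen_singleton_one, isOpen_iff_mem_nhds]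
  rintro B rfl
  have : ∀ᶠ B : Γ in nhds 1, (B : SL(2, ℂ)) ∈ Γ → (B : SL(2, ℂ)) = 1 :=
    (continuous_subtype_val.tendsto (1 : Γ)).eventually hev
  filter_upwards [this] with B hB
  exact Subtype.ext (hB B.2)

/-! ### Round discs -/

/-- A Euclidean disc is the image of the unit disc under an affine map. -/
theorem exists_disc_eq_ball (c : ℂ) {R : ℝ} (hR : 0 < R) : ∃ A : GL (Fin 2) ℂ,
    openDisc A = ((↑) : ℂ → Sphere) '' Metric.ball c R ∧
    closedDisc A = ((↑) : ℂ → Sphere) '' Metric.closedBall c R := by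
  have hR' : (R : ℂ) ≠ 0 := by exact_mod_cast hR.ne'
  have hdet : (!![(R : ℂ), c; 0, 1] : Matrix (Fin 2) (Fin 2) ℂ).det ≠ 0 := by
    simpa [det_fin_two] using hR.ne'
  have hact : ∀ z : ℂ, mobius (GeneralLinearGroup.mkOfDetNeZero _ hdet) (z : Sphere)
      = ((R * z + c : ℂ) : Sphere) := by
    intro z
    have h1 : (0 : ℂ) * z + 1 ≠ 0 := by simp
    refine (mobius_coe (GeneralLinearGroup.mkOfDetNeZero _ hdet) h1).trans ?_
    change (((R * z + c) / (0 * z + 1) : ℂ) : Sphere) = _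
    rw [zero_mul, zero_add, div_one]
  refine ⟨GeneralLinearGroup.mkOfDetNeZero _ hdet, ?_, ?_⟩
  · rw [openDisc, Set.image_image]
    simp only [hact]
    rw [← Set.image_image (fun z : ℂ => (z : Sphere)) (fun z : ℂ => R * z + c)]
    congr 1
    ext w
    constructor
    · rintro ⟨z, hz, rfl⟩
      rw [mem_ball_zero_iff] at hz
      rw [mem_ball_iff_norm, add_sub_cancel_right, norm_mul, Complex.norm_real,
        Real.norm_of_nonneg hR.le]
      exact mul_lt_of_lt_one_right hR hz
    · intro hw
      rw [mem_ball_iff_norm] at hw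
      refine ⟨(w - c) / R, ?_, ?_⟩
      · rw [mem_ball_zero_iff, norm_div, Complex.norm_real, Real.norm_of_nonneg hR.le,
          div_lt_one hR]
        exact hw
      · change R * ((w - c) / R) + c = w
        rw [mul_div_cancel₀ _ hR', sub_add_cancel]
  · rw [closedDisc, Set.image_image]
    simp only [hact]
    rw [← Set.image_image (fun z : ℂ => (z : Sphere)) (fun z : ℂ => R * z + c)]
    congr 1
    ext w
    constructor
    · rintro ⟨z, hz, rfl⟩
      rw [mem_closedBall_zero_iff] at hz
      rw [mem_closedBall_iff_norm, add_sub_cancel_right, norm_mul, Complex.norm_real,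
        Real.norm_of_nonneg hR.le]
      exact mul_le_of_le_one_right hR.le hz
    · intro hw
      rw [mem_closedBall_iff_norm] at hw
      refine ⟨(w - c) / R, ?_, ?_⟩
      · rw [mem_closedBall_zero_iff, norm_div, Complex.norm_real, Real.norm_of_nonneg hR.le,
          div_le_one hR]
        exact hw
      · change R * ((w - c) / R) + c = w
        rw [mul_div_cancel₀ _ hR', sub_add_cancel]

theorem image_mul (f g : SpherePerm) (D : Set Sphere) : (f * g) '' D = f '' (g '' D) := by
  rw [Set.image_image]; rfl

/-- Conformal and anti-conformal maps take round discs to round discs. -/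
theorem exists_disc_eq_image {f : SpherePerm} (hf : f ∈ mobiusGroup ∨ IsAntiConformal f)
    (A : GL (Fin 2) ℂ) : ∃ A' : GL (Fin 2) ℂ,
      openDisc A' = f '' openDisc A ∧ closedDisc A' = f '' closedDisc A := by
  rcases hf with ⟨B, rfl⟩ | ⟨B, rfl⟩
  · refine ⟨B * A, ?_, ?_⟩
    · rw [openDisc, map_mul, image_mul]; rfl
    · rw [closedDisc, map_mul, image_mul]; rfl
  · have hconj : ∀ s : Set ℂ, (∀ z, z ∈ s ↔ starRingEnd ℂ z ∈ s) →
        conjPerm '' ((fun z : ℂ => (z : Sphere)) '' s) = (fun z : ℂ => (z : Sphere)) '' s := by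
      intro s hs
      rw [Set.image_image]
      ext w
      constructor
      · rintro ⟨z, hz, rfl⟩
        exact ⟨_, (hs z).1 hz, rfl⟩
      · rintro ⟨z, hz, rfl⟩
        exact ⟨_, (hs z).1 hz, by simp⟩
    refine ⟨B * A.map (starRingEnd ℂ), ?_, ?_⟩
    · rw [openDisc, openDisc, ← image_mul, mul_assoc, conjPerm_mul_mobius, ← mul_assoc, image_mul,
        hconj _ (by simp), ← map_mul]
    · rw [closedDisc, closedDisc, ← image_mul, mul_assoc, conjPerm_mul_mobius, ← mul_assoc,
        image_mul, hconj _ (by simp), ← map_mul]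

theorem openDisc_subset_closedDisc (A : GL (Fin 2) ℂ) : openDisc A ⊆ closedDisc A :=
  Set.image_mono (Set.image_mono Metric.ball_subset_closedBall)

theorem openDisc_nonempty (A : GL (Fin 2) ℂ) : (openDisc A).Nonempty :=
  ((Metric.nonempty_ball.2 one_pos).image _).image _

/-- Schottky generators generate freely, by ping-pong on their discs. With a single generator the
ping-pong lemma does not apply; there freeness is just infinite order. -/
theorem IsSchottkySystem.injective {g : ℕ} (hg : 2 ≤ g) {L : Fin g → SpherePerm}
    (h : IsSchottkySystem L) : Function.Injective (FreeGroup.lift L) := by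
  obtain ⟨c, c', hdisj, hL⟩ := h
  have : Nontrivial (Fin g) := Fin.nontrivial_iff_two_le.2 hg
  have hsub := fun i => openDisc_subset_closedDisc (c i)
  refine FreeGroup.injective_lift_of_ping_pong L (fun i => closedDisc (c' i))
    (fun i => openDisc (c i)) ?_ ?_ ?_ ?_ ?_ ?_
  · exact fun i => (openDisc_nonempty _).mono (openDisc_subset_closedDisc _)
  · intro i j hij
    exact hdisj (show (Sum.inr i : Fin g ⊕ Fin g) ≠ Sum.inr j by simpa using hij)
  · intro i j hij
    exact (hdisj (show (Sum.inl i : Fin g ⊕ Fin g) ≠ Sum.inl j by simpa using hij)).mono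
      (hsub i) (hsub j)
  · intro i j
    exact (hdisj (show (Sum.inr i : Fin g ⊕ Fin g) ≠ Sum.inl j by simp)).mono_right (hsub j)
  · intro i
    change L i '' _ ⊆ _
    rw [Set.image_compl_eq (L i).bijective, (hL i).2, compl_compl]
  · intro i
    change ((L i)⁻¹ : SpherePerm) '' _ ⊆ _
    rw [← (hL i).2, ← image_mul, inv_mul_cancel]
    simp

/-! ### Amalgams generated by four reflections -/

/-- Geometric data that make the group of four reflections `r 0`, `r y`, `r s`, `r t` the amalgam of
`⟨r 0, r y, r s⟩` and `⟨r 0, r y, r t⟩` along the dihedral group `⟨r 0, r y⟩` of order `2 n`: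
ping-pong sets `Y`, `X₁`, `X₂` in the sphere, and a point `z₀ ∈ Y` with a neighbourhood `U` that
meets neither `X₁ ∪ X₂` (`disj`) nor the rest of the orbit of `z₀` under `⟨r 0, r y⟩` (`rot`, `refl`).

The conditions `coset_s` and `coset_t` say that the finite groups are unions of two double cosets of
the dihedral group. They are consequences of the Coxeter relations and are required in every group
that satisfies them, because the ping-pong is played both by the reflections and by the abstract
Coxeter group. -/
structure ReflectionAmalgam (M : CoxeterMatrix (Fin 4)) (r : Fin 4 → SpherePerm) (y s t : Fin 4)
    (n : ℕ) (z₀ : ℂ) (U : Set ℂ) (Y X₁ X₂ : Set Sphere) : Prop where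
  univ : ∀ i, i = 0 ∨ i = y ∨ i = s ∨ i = t
  anti : ∀ i, IsAntiConformal (r i)
  lift : M.IsLiftable r
  order : M y 0 = n
  pos : 0 < n
  coset_s : ∀ (G : Type) [Group G] (f : Fin 4 → G), M.IsLiftable f →
    ∀ C : Subgroup G, C = Subgroup.closure {f 0, f y} → ∀ c ∈ C,
      f s * c * f s ∈ C ∨ ∃ c₁ ∈ C, ∃ c₂ ∈ C, f s * c * f s = c₁ * f s * c₂
  coset_t : ∀ (G : Type) [Group G] (f : Fin 4 → G), M.IsLiftable f →
    ∀ C : Subgroup G, C = Subgroup.closure {f 0, f y} → ∀ c ∈ C,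
      f t * c * f t ∈ C ∨ ∃ c₁ ∈ C, ∃ c₂ ∈ C, f t * c * f t = c₁ * f t * c₂
  mapsY : ∀ i, i = 0 ∨ i = y → ∀ p ∈ Y, r i p ∈ Y
  maps₁ : ∀ i, i = 0 ∨ i = y → ∀ p ∈ X₁, r i p ∈ X₁
  maps₂ : ∀ i, i = 0 ∨ i = y → ∀ p ∈ X₂, r i p ∈ X₂
  maps_s : ∀ p ∈ Y ∪ X₁, r s p ∈ X₂
  maps_t : ∀ p ∈ Y ∪ X₂, r t p ∈ X₁
  isOpen : IsOpen U
  mem : z₀ ∈ U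
  memY : (z₀ : Sphere) ∈ Y
  disjY : ∀ p ∈ Y, p ∉ X₁ ∪ X₂
  disj : ∀ z ∈ U, (z : Sphere) ∉ X₁ ∪ X₂
  rot : ∀ k : ℤ, ((r y * r 0) ^ k : SpherePerm) z₀ ∈ ((↑) : ℂ → Sphere) '' U → (n : ℤ) ∣ k
  refl : ∀ k : ℤ, ((r y * r 0) ^ k * r 0 : SpherePerm) z₀ ∉ ((↑) : ℂ → Sphere) '' U

theorem mul_self_of_isLiftable {ι G : Type*} [Group G] {M : CoxeterMatrix ι} {f : ι → G}
    (h : M.IsLiftable f) (i : ι) : f i * f i = 1 := by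
  have := h i i
  rwa [M.diagonal, pow_one] at this

theorem closure_mapsTo {X : Type*} {ι : Type*} {f : ι → Equiv.Perm X} (hf : ∀ i, f i * f i = 1)
    {S : Set ι} {Y : Set X} (hY : ∀ i ∈ S, ∀ p ∈ Y, f i p ∈ Y) {c : Equiv.Perm X}
    (hc : c ∈ Subgroup.closure (f '' S)) : ∀ p ∈ Y, c p ∈ Y := by
  induction hc using Subgroup.closure_induction_left with
  | one => exact fun p hp => hp
  | mul_left x hx y _ ih =>
    obtain ⟨i, hi, rfl⟩ := hx
    exact fun p hp => hY i hi _ (ih p hp)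
  | inv_mul_cancel x hx y _ ih =>
    obtain ⟨i, hi, rfl⟩ := hx
    rw [inv_eq_of_mul_eq_one_left (hf i)]
    exact fun p hp => hY i hi _ (ih p hp)

/-- The elements of the dihedral group generated by two involutions. -/
theorem mem_closure_involutions {G : Type*} [Group G] {a b g : G} (ha : a * a = 1) (hb : b * b = 1)
    (hg : g ∈ Subgroup.closure {a, b}) : ∃ k : ℤ, g = (b * a) ^ k ∨ g = (b * a) ^ k * a := by
  have ha' : a⁻¹ = a := inv_eq_of_mul_eq_one_left ha
  have hb' : b⁻¹ = b := inv_eq_of_mul_eq_one_left hb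
  rw [← mem_closure_pair_iff ha (by rw [_root_.mul_inv_rev, ha', hb', mul_assoc, mul_assoc, ha,
    mul_one])]
  refine (Subgroup.closure_le _).2 ?_ hg
  rintro x (rfl | rfl)
  · exact Subgroup.subset_closure (by simp)
  · have := Subgroup.mul_mem (Subgroup.closure {x * a, a})
      (Subgroup.subset_closure (by simp : x * a ∈ _)) (Subgroup.subset_closure (by simp : a ∈ _))
    rwa [mul_assoc, ha, mul_one] at this

theorem sphericalGroup_comm (r : Fin 4 → SpherePerm) (i j k : Fin 4) :
    sphericalGroup r i j k = sphericalGroup r i k j := by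
  rw [sphericalGroup, sphericalGroup, Set.pair_comm]

theorem commute_of_sq {G : Type*} [Group G] {a b : G} (ha : a * a = 1) (hb : b * b = 1)
    (h : (a * b) ^ 2 = 1) : Commute a b := by
  rw [pow_two] at h
  have := eq_inv_of_mul_eq_one_left h
  rw [_root_.mul_inv_rev, inv_eq_of_mul_eq_one_left ha, inv_eq_of_mul_eq_one_left hb] at this
  exact this

theorem commute_of_isLiftable {ι G : Type*} [Group G] {M : CoxeterMatrix ι} {f : ι → G}
    (h : M.IsLiftable f) {i j : ι} (hM : M i j = 2) : Commute (f i) (f j) :=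
  commute_of_sq (mul_self_of_isLiftable h i) (mul_self_of_isLiftable h j) (hM ▸ h i j)

/-- The double coset condition for a reflection that commutes with the dihedral group. -/
theorem coset_of_commute {G : Type*} [Group G] {a b s : G} (hs : s * s = 1) (ha : Commute s a)
    (hb : Commute s b) {C : Subgroup G} (hC : C = Subgroup.closure {a, b}) {c : G} (hc : c ∈ C) :
    s * c * s ∈ C ∨ ∃ c₁ ∈ C, ∃ c₂ ∈ C, s * c * s = c₁ * s * c₂ := by
  left
  have hcomm : Commute s c := by
    have : C ≤ Subgroup.centralizer {s} := by
      rw [hC, Subgroup.closure_le]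
      rintro _ (rfl | rfl)
      · exact Subgroup.mem_centralizer_singleton_iff.2 ha.eq.symm
      · exact Subgroup.mem_centralizer_singleton_iff.2 hb.eq.symm
    exact (Subgroup.mem_centralizer_singleton_iff.1 (this hc)).symm
  rw [hcomm.eq, mul_assoc, hs, mul_one]
  exact hc

namespace ReflectionAmalgam

variable {M : CoxeterMatrix (Fin 4)} {r : Fin 4 → SpherePerm} {y s t : Fin 4} {n : ℕ}
  {z₀ : ℂ} {U : Set ℂ} {Y X₁ X₂ : Set Sphere}

theorem inv (h : ReflectionAmalgam M r y s t n z₀ U Y X₁ X₂) (i : Fin 4) : r i * r i = 1 :=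
  mul_self_of_isLiftable h.lift i

section Lift

variable {G : Type} [Group G] {f : Fin 4 → G} {ρ : G →* SpherePerm}

/-- Ping-pong for any group with generators `f i` that satisfy the Coxeter relations and act
as the reflections `r i`. -/
theorem eq_one_or_notMem (h : ReflectionAmalgam M r y s t n z₀ U Y X₁ X₂) (hf : M.IsLiftable f)
    (hρ : ∀ i, ρ (f i) = r i) {w : G} (hw : w ∈ Subgroup.closure (Set.range f)) :
    w = 1 ∨ ρ w z₀ ∉ ((↑) : ℂ → Sphere) '' U := by
  have hinv : ∀ i, f i * f i = 1 := mul_self_of_isLiftable hf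
  set C := Subgroup.closure {f 0, f y} with hC
  have hρC : ∀ c ∈ C, ρ c ∈ Subgroup.closure (r '' {0, y}) := by
    intro c hc
    have : ρ c ∈ C.map ρ := ⟨c, hc, rfl⟩
    rw [hC, MonoidHom.map_closure, Set.image_pair, hρ, hρ] at this
    rwa [Set.image_pair]
  have mY : ∀ c ∈ C, ∀ p ∈ Y, ρ c p ∈ Y := fun c hc =>
    closure_mapsTo h.inv (fun i hi => h.mapsY i (by simpa using hi)) (hρC c hc)
  have m1 : ∀ c ∈ C, ∀ p ∈ X₁, ρ c p ∈ X₁ := fun c hc =>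
    closure_mapsTo h.inv (fun i hi => h.maps₁ i (by simpa using hi)) (hρC c hc)
  have m2 : ∀ c ∈ C, ∀ p ∈ X₂, ρ c p ∈ X₂ := fun c hc =>
    closure_mapsTo h.inv (fun i hi => h.maps₂ i (by simpa using hi)) (hρC c hc)
  have hw' : w ∈ (C ⊔ Subgroup.closure {f s}) ⊔ (C ⊔ Subgroup.closure {f t}) := by
    refine (Subgroup.closure_le _).2 ?_ hw
    rintro _ ⟨i, rfl⟩
    rcases h.univ i with rfl | rfl | rfl | rfl
    · exact le_sup_left (a := C ⊔ _) (le_sup_left (a := C) (Subgroup.subset_closure (by simp)))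
    · exact le_sup_left (a := C ⊔ _) (le_sup_left (a := C) (Subgroup.subset_closure (by simp)))
    · exact le_sup_left (a := C ⊔ _) (le_sup_right (a := C) (Subgroup.subset_closure (by simp)))
    · exact le_sup_right (b := C ⊔ _) (le_sup_right (a := C) (Subgroup.subset_closure (by simp)))
  have pp := pingPong (ρ := ρ) (C := C) (A := C ⊔ Subgroup.closure {f s})
    (B := C ⊔ Subgroup.closure {f t}) le_sup_left le_sup_left (Y := Y) (X₁ := X₁) (X₂ := X₂) mY
    ?_ ?_ hw'
  -- an element of the dihedral group moves `z₀` off `U` or is trivial; any other element moves all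
  -- of `Y` into `X₁ ∪ X₂`
  · rcases pp with hwC | hw1
    · obtain ⟨k, rfl | rfl⟩ := mem_closure_involutions (hinv 0) (hinv y) hwC
      · by_cases hk : (n : ℤ) ∣ k
        · left
          obtain ⟨l, rfl⟩ := hk
          rw [_root_.zpow_mul, zpow_natCast, ← h.order, hf y 0, _root_.one_zpow]
        · right
          intro h1
          rw [map_zpow, map_mul, hρ, hρ] at h1
          exact hk (h.rot k h1)
      · right
        rw [map_mul, map_zpow, map_mul, hρ, hρ]
        exact h.refl k
    · right
      rintro ⟨z, hz, e⟩
      exact h.disj z hz (e ▸ hw1 _ h.memY)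
  · intro a ha haC p hp
    obtain h1 | ⟨c₁, hc1, c₂, hc2, rfl⟩ := mem_or_doubleCoset (hinv s) (h.coset_s G f hf C hC) le_rfl ha
    · exact absurd h1 haC
    · rw [map_mul, map_mul, hρ]
      exact m2 _ hc1 _ (h.maps_s _ (hp.imp (mY _ hc2 p) (m1 _ hc2 p)))
  · intro a ha haC p hp
    obtain h1 | ⟨c₁, hc1, c₂, hc2, rfl⟩ := mem_or_doubleCoset (hinv t) (h.coset_t G f hf C hC) le_rfl ha
    · exact absurd h1 haC
    · rw [map_mul, map_mul, hρ]
      exact m1 _ hc1 _ (h.maps_t _ (hp.imp (mY _ hc2 p) (m2 _ hc2 p)))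

end Lift

theorem moves (h : ReflectionAmalgam M r y s t n z₀ U Y X₁ X₂) {w : SpherePerm}
    (hw : w ∈ extendedGroup r) (h1 : w ≠ 1) : w z₀ ∉ ((↑) : ℂ → Sphere) '' U :=
  (h.eq_one_or_notMem (ρ := MonoidHom.id _) h.lift (fun _ => rfl) hw).resolve_left h1

/-- Ping-pong in the abstract Coxeter group: a nontrivial element moves `z₀`, so the Coxeter group
acts faithfully. -/
theorem hasCoxeterPresentation (h : ReflectionAmalgam M r y s t n z₀ U Y X₁ X₂) :
    HasCoxeterPresentation M r := by
  refine hasCoxeterPresentation_of_injective h.lift ?_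
  rw [injective_iff_map_eq_one]
  intro w hw
  refine (h.eq_one_or_notMem (G := M.Group) (f := M.simple) (ρ := M.toCoxeterSystem.lift ⟨r, h.lift⟩)
    (fun i j => M.toCoxeterSystem.simple_mul_simple_pow i j)
    (fun i => M.toCoxeterSystem.lift_apply_simple h.lift i) (w := w) ?_).resolve_right ?_
  · have := M.toCoxeterSystem.subgroup_closure_range_simple
    rw [M.toCoxeterSystem_simple] at this
    rw [this]; trivial
  · rw [hw]
    simpa using h.mem

theorem conformalGroup_eq (h : ReflectionAmalgam M r y s t n z₀ U Y X₁ X₂) :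
    conformalGroup r = Subgroup.closure (Set.range fun i => r i * r 0) :=
  closure_inf_eq_closure_mul 0 h.inv (fun i j => (h.anti i).mul (h.anti j))
    (h.anti 0).notMem_mobiusGroup

theorem isExtendedKleinian (h : ReflectionAmalgam M r y s t n z₀ U Y X₁ X₂) :
    IsExtendedKleinian (extendedGroup r) :=
  ⟨fun _ hf => conformal_or_antiConformal h.anti h.inv hf,
    ⟨r 0, Subgroup.subset_closure ⟨0, rfl⟩, h.anti 0⟩,
    isKleinian_of_moves inf_le_right h.isOpen h.mem fun _ hk h1 => h.moves hk.1 h1⟩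

theorem isKleinian (h : ReflectionAmalgam M r y s t n z₀ U Y X₁ X₂) {K : Subgroup SpherePerm}
    (hK : K ≤ conformalGroup r) : IsKleinian K :=
  h.isExtendedKleinian.2.2.mono hK

theorem orientationPreserving_closure (h : ReflectionAmalgam M r y s t n z₀ U Y X₁ X₂)
    (S : Set (Fin 4)) (h0 : (0 : Fin 4) ∈ S) :
    orientationPreserving (Subgroup.closure (r '' S)) =
      Subgroup.closure ((fun i => r i * r 0) '' S) := by
  have := closure_inf_eq_closure_mul (r := fun i : S => r i) (E := mobiusGroup) ⟨0, h0⟩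
    (fun i => h.inv i) (fun i j => (h.anti i).mul (h.anti j)) (h.anti 0).notMem_mobiusGroup
  rw [orientationPreserving, Set.image_eq_range, Set.image_eq_range]
  exact this

theorem sphericalGroup_eq (h : ReflectionAmalgam M r y s t n z₀ U Y X₁ X₂) (i j : Fin 4) :
    sphericalGroup r 0 i j = Subgroup.closure {r i * r 0, r j * r 0} := by
  have := h.orientationPreserving_closure {0, i, j} (by simp)
  rw [Set.image_insert_eq, Set.image_insert_eq, Set.image_singleton, Set.image_insert_eq,
    Set.image_insert_eq, Set.image_singleton, h.inv, Subgroup.closure_insert_one] at this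
  exact this

theorem sphericalGroup_le (r : Fin 4 → SpherePerm) (i j k : Fin 4) :
    sphericalGroup r i j k ≤ conformalGroup r := by
  refine inf_le_inf_right _ (Subgroup.closure_mono ?_)
  rintro _ (rfl | rfl | rfl) <;> exact ⟨_, rfl⟩

theorem zpowers_eq (h : ReflectionAmalgam M r y s t n z₀ U Y X₁ X₂) :
    orientationPreserving (Subgroup.closure {r 0, r y}) = Subgroup.zpowers (r y * r 0) := by
  have := h.orientationPreserving_closure {0, y} (by simp)
  rw [Set.image_pair, Set.image_pair, h.inv, Subgroup.closure_insert_one,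
    ← Subgroup.zpowers_eq_closure] at this
  exact this

theorem orderOf_eq (h : ReflectionAmalgam M r y s t n z₀ U Y X₁ X₂) : orderOf (r y * r 0) = n := by
  refine Nat.dvd_antisymm ?_ ?_
  · rw [← h.order]; exact orderOf_dvd_of_pow_eq_one (h.lift y 0)
  · have := h.rot (orderOf (r y * r 0)) (by
      rw [zpow_natCast, pow_orderOf_eq_one]; exact ⟨z₀, h.mem, rfl⟩)
    exact_mod_cast this

theorem card_zpowers (h : ReflectionAmalgam M r y s t n z₀ U Y X₁ X₂) :
    Nat.card (Subgroup.zpowers (r y * r 0)) = n := by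
  rw [Nat.card_zpowers, h.orderOf_eq]

/-- Elements of `K₁` outside `J` lie in the double coset of `r s`. -/
theorem mem_s (h : ReflectionAmalgam M r y s t n z₀ U Y X₁ X₂) {k : SpherePerm}
    (hk : k ∈ sphericalGroup r 0 y s) (hkJ : k ∉ Subgroup.zpowers (r y * r 0)) :
    ∃ c₁ ∈ Subgroup.closure {r 0, r y}, ∃ c₂ ∈ Subgroup.closure {r 0, r y},
      k = c₁ * r s * c₂ := by
  refine (mem_or_doubleCoset (h.inv s) (h.coset_s _ r h.lift _ rfl)
    (A := Subgroup.closure {r 0, r y, r s}) ?_ hk.1).resolve_left ?_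
  · rw [← Subgroup.closure_union]
    exact Subgroup.closure_mono (by rintro _ (rfl | rfl | rfl) <;> simp)
  · intro hC
    exact hkJ (h.zpowers_eq ▸ ⟨hC, hk.2⟩)

theorem mem_t (h : ReflectionAmalgam M r y s t n z₀ U Y X₁ X₂) {k : SpherePerm}
    (hk : k ∈ sphericalGroup r 0 y t) (hkJ : k ∉ Subgroup.zpowers (r y * r 0)) :
    ∃ c₁ ∈ Subgroup.closure {r 0, r y}, ∃ c₂ ∈ Subgroup.closure {r 0, r y},
      k = c₁ * r t * c₂ := by
  refine (mem_or_doubleCoset (h.inv t) (h.coset_t _ r h.lift _ rfl)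
    (A := Subgroup.closure {r 0, r y, r t}) ?_ hk.1).resolve_left ?_
  · rw [← Subgroup.closure_union]
    exact Subgroup.closure_mono (by rintro _ (rfl | rfl | rfl) <;> simp)
  · intro hC
    exact hkJ (h.zpowers_eq ▸ ⟨hC, hk.2⟩)

/-- An element of `K₁ \ J` maps a set into another set if `r s` does and both sets are invariant
under `r 0` and `r y`. -/
theorem maps_of_mem_s (h : ReflectionAmalgam M r y s t n z₀ U Y X₁ X₂) {P Q : Set Sphere}
    (hP : ∀ i, i = 0 ∨ i = y → ∀ p ∈ P, r i p ∈ P) (hQ : ∀ i, i = 0 ∨ i = y → ∀ p ∈ Q, r i p ∈ Q)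
    (hs : ∀ p ∈ P, r s p ∈ Q) {k : SpherePerm}
    (hk : k ∈ sphericalGroup r 0 y s) (hkJ : k ∉ Subgroup.zpowers (r y * r 0)) :
    ∀ p ∈ P, k p ∈ Q := by
  obtain ⟨c₁, hc1, c₂, hc2, rfl⟩ := h.mem_s hk hkJ
  rw [← Set.image_pair] at hc1 hc2
  exact fun p hp => closure_mapsTo h.inv (fun i hi => hQ i (by simpa using hi)) hc1 _
    (hs _ (closure_mapsTo h.inv (fun i hi => hP i (by simpa using hi)) hc2 _ hp))

theorem maps_of_mem_t (h : ReflectionAmalgam M r y s t n z₀ U Y X₁ X₂) {P Q : Set Sphere}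
    (hP : ∀ i, i = 0 ∨ i = y → ∀ p ∈ P, r i p ∈ P) (hQ : ∀ i, i = 0 ∨ i = y → ∀ p ∈ Q, r i p ∈ Q)
    (hs : ∀ p ∈ P, r t p ∈ Q) {k : SpherePerm}
    (hk : k ∈ sphericalGroup r 0 y t) (hkJ : k ∉ Subgroup.zpowers (r y * r 0)) :
    ∀ p ∈ P, k p ∈ Q := by
  obtain ⟨c₁, hc1, c₂, hc2, rfl⟩ := h.mem_t hk hkJ
  rw [← Set.image_pair] at hc1 hc2
  exact fun p hp => closure_mapsTo h.inv (fun i hi => hQ i (by simpa using hi)) hc1 _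
    (hs _ (closure_mapsTo h.inv (fun i hi => hP i (by simpa using hi)) hc2 _ hp))

theorem maps_of_mem_zpowers (h : ReflectionAmalgam M r y s t n z₀ U Y X₁ X₂) {P : Set Sphere}
    (hP : ∀ i, i = 0 ∨ i = y → ∀ p ∈ P, r i p ∈ P) {j : SpherePerm}
    (hj : j ∈ Subgroup.zpowers (r y * r 0)) : ∀ p ∈ P, j p ∈ P := by
  have hj' : j ∈ Subgroup.closure (r '' {0, y}) := by
    rw [← h.zpowers_eq] at hj
    rw [Set.image_pair]; exact hj.1
  exact closure_mapsTo h.inv (fun i hi => hP i (by simpa using hi)) hj'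

theorem zpowers_image_eq (h : ReflectionAmalgam M r y s t n z₀ U Y X₁ X₂) {P : Set Sphere}
    (hP : ∀ i, i = 0 ∨ i = y → ∀ p ∈ P, r i p ∈ P) {j : SpherePerm}
    (hj : j ∈ Subgroup.zpowers (r y * r 0)) : j '' P = P := by
  apply Set.Subset.antisymm
  · rintro _ ⟨p, hp, rfl⟩
    exact h.maps_of_mem_zpowers hP hj p hp
  · intro p hp
    refine ⟨j⁻¹ p, h.maps_of_mem_zpowers hP (inv_mem hj) p hp, ?_⟩
    rw [← Equiv.Perm.mul_apply, mul_inv_cancel, Equiv.Perm.one_apply]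

theorem zpowers_le (h : ReflectionAmalgam M r y s t n z₀ U Y X₁ X₂) (i : Fin 4) :
    Subgroup.zpowers (r y * r 0) ≤ sphericalGroup r 0 y i := by
  rw [h.sphericalGroup_eq, Subgroup.zpowers_le]
  exact Subgroup.subset_closure (by simp)

/-- The orientation-preserving subgroup is the amalgam: the ping-pong sets of the extended group
serve it as well. -/
theorem isAmalgam (h : ReflectionAmalgam M r y s t n z₀ U Y X₁ X₂) :
    IsAmalgam ![sphericalGroup r 0 y s, sphericalGroup r 0 y t] (Subgroup.zpowers (r y * r 0))
      (conformalGroup r) := by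
  have e : conformalGroup r = sphericalGroup r 0 y s ⊔ sphericalGroup r 0 y t := by
    apply le_antisymm
    · rw [h.conformalGroup_eq, Subgroup.closure_le, h.sphericalGroup_eq, h.sphericalGroup_eq]
      rintro _ ⟨i, rfl⟩
      rcases h.univ i with rfl | rfl | rfl | rfl
      · simp only [h.inv]; exact Subgroup.one_mem _
      · exact le_sup_left (a := Subgroup.closure _) (Subgroup.subset_closure (by simp))
      · exact le_sup_left (a := Subgroup.closure _) (Subgroup.subset_closure (by simp))
      · exact le_sup_right (b := Subgroup.closure _) (Subgroup.subset_closure (by simp))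
    · exact sup_le (sphericalGroup_le r 0 y s) (sphericalGroup_le r 0 y t)
  rw [e]
  have hYX : ∀ {X : Set Sphere}, (∀ i, i = 0 ∨ i = y → ∀ p ∈ X, r i p ∈ X) →
      ∀ i, i = 0 ∨ i = y → ∀ p ∈ Y ∪ X, r i p ∈ Y ∪ X := fun hX i hi p hp =>
    hp.imp (h.mapsY i hi p) (hX i hi p)
  exact isAmalgam_of_pingPong (h.zpowers_le s) (h.zpowers_le t)
    (fun j hj => h.maps_of_mem_zpowers h.mapsY hj)
    (fun k hk hkJ => h.maps_of_mem_s (hYX h.maps₁) h.maps₂ h.maps_s hk hkJ)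
    (fun k hk hkJ => h.maps_of_mem_t (hYX h.maps₂) h.maps₁ h.maps_t hk hkJ)
    h.memY (h.disj z₀ h.mem)

theorem s_notMem_zpowers (h : ReflectionAmalgam M r y s t n z₀ U Y X₁ X₂) :
    r s * r 0 ∉ Subgroup.zpowers (r y * r 0) := fun hJ =>
  h.disjY _ (h.maps_of_mem_zpowers h.mapsY hJ _ h.memY)
    (Or.inr (h.maps_s _ (Or.inl (h.mapsY 0 (Or.inl rfl) _ h.memY))))

theorem t_notMem_zpowers (h : ReflectionAmalgam M r y s t n z₀ U Y X₁ X₂) :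
    r t * r 0 ∉ Subgroup.zpowers (r y * r 0) := fun hJ =>
  h.disjY _ (h.maps_of_mem_zpowers h.mapsY hJ _ h.memY)
    (Or.inl (h.maps_t _ (Or.inl (h.mapsY 0 (Or.inl rfl) _ h.memY))))

theorem zpowers_lt_s (h : ReflectionAmalgam M r y s t n z₀ U Y X₁ X₂) :
    Subgroup.zpowers (r y * r 0) < sphericalGroup r 0 y s :=
  SetLike.lt_iff_le_and_exists.2 ⟨h.zpowers_le s, _, by
    rw [h.sphericalGroup_eq]; exact Subgroup.subset_closure (by simp), h.s_notMem_zpowers⟩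

theorem zpowers_lt_t (h : ReflectionAmalgam M r y s t n z₀ U Y X₁ X₂) :
    Subgroup.zpowers (r y * r 0) < sphericalGroup r 0 y t :=
  SetLike.lt_iff_le_and_exists.2 ⟨h.zpowers_le t, _, by
    rw [h.sphericalGroup_eq]; exact Subgroup.subset_closure (by simp), h.t_notMem_zpowers⟩

/-- A reflection that commutes with `r 0` and `r y` generates with them a group whose orientation
preserving part is dihedral. -/
theorem dihedral_of_commute (h : ReflectionAmalgam M r y s t n z₀ U Y X₁ X₂) {i : Fin 4}
    (hi : r i * r 0 ∉ Subgroup.zpowers (r y * r 0)) (h0 : Commute (r i) (r 0))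
    (hy : Commute (r i) (r y)) : Nonempty (sphericalGroup r 0 y i ≃* DihedralGroup n) := by
  have := NeZero.of_pos h.pos
  rw [h.sphericalGroup_eq]
  have hb : r i * r 0 * (r i * r 0) = 1 := by
    rw [← mul_assoc, h0.eq, mul_assoc (r 0), h.inv, mul_one, h.inv]
  refine dihedral_mulEquiv hb ?_ h.orderOf_eq hi
  have hc : Commute (r i) (r y * r 0) := hy.mul_right h0
  calc r i * r 0 * (r y * r 0) * (r i * r 0)
      = r i * (r 0 * r y * (r 0 * r i) * r 0) := by group
    _ = r i * (r 0 * r y * r i * (r 0 * r 0)) := by rw [← h0.eq]; group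
    _ = r i * (r 0 * (r i * r y)) := by rw [h.inv, mul_one, mul_assoc, ← hy.eq]
    _ = (r i * r i) * r 0 * r y := by rw [← mul_assoc (r 0), ← h0.eq]; group
    _ = r 0 * r y := by rw [h.inv, one_mul]
    _ = (r y * r 0)⁻¹ := by
      rw [_root_.mul_inv_rev, inv_eq_of_mul_eq_one_left (h.inv 0),
        inv_eq_of_mul_eq_one_left (h.inv y)]

theorem relIndex_conformalGroup (h : ReflectionAmalgam M r y s t n z₀ U Y X₁ X₂) :
    (conformalGroup r).relIndex (extendedGroup r) = 2 := by
  rw [Subgroup.relIndex, Subgroup.index_eq_two_iff]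
  refine ⟨⟨r 0, Subgroup.subset_closure ⟨0, rfl⟩⟩, fun b => ?_⟩
  simp only [Subgroup.mem_subgroupOf, conformalGroup, orientationPreserving, Subgroup.mem_inf,
    Subgroup.coe_mul, SetLike.coe_mem, true_and]
  have hmem : (b : SpherePerm) * r 0 ∈ extendedGroup r :=
    mul_mem b.2 (Subgroup.subset_closure ⟨0, rfl⟩)
  rcases conformal_or_antiConformal h.anti h.inv b.2 with hb | hb
  · refine Or.inr ⟨hb, fun h1 => ?_⟩
    exact (h.anti 0).notMem_mobiusGroup ((mobiusGroup.mul_mem_cancel_left hb).1 h1.2)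
  · exact Or.inl ⟨by
      have := hb.mul (h.anti 0)
      exact ⟨hmem, this⟩, hb.notMem_mobiusGroup⟩

/-- Half of the index of `S` in the extended group is its index in the orientation-preserving
subgroup. -/
theorem relIndex_eq (h : ReflectionAmalgam M r y s t n z₀ U Y X₁ X₂) {S : Subgroup SpherePerm}
    (hS : S ≤ conformalGroup r) {N : ℕ} (hN : S.relIndex (extendedGroup r) = 2 * N) :
    S.relIndex (conformalGroup r) = N := by
  have := Subgroup.relIndex_mul_relIndex S (conformalGroup r) (extendedGroup r) hS inf_le_left
  rw [h.relIndex_conformalGroup, hN] at this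
  omega

end ReflectionAmalgam

/-! ### Rotations, sectors and dihedral fundamental regions -/

/-- The root of unity `e^{2πi/n}`. -/
noncomputable def zeta (n : ℕ) : ℂ := Complex.exp (2 * π * Complex.I / n)

theorem zeta_zpow (n : ℕ) (k : ℤ) :
    zeta n ^ k = Complex.exp (((2 * π * k / n : ℝ) : ℂ) * Complex.I) := by
  rw [zeta, ← Complex.exp_int_mul]
  congr 1
  push_cast
  ring

theorem zeta_ne_zero (n : ℕ) : zeta n ≠ 0 := Complex.exp_ne_zero _

theorem norm_zeta (n : ℕ) : ‖zeta n‖ = 1 := by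
  have := zeta_zpow n 1
  rw [zpow_one] at this
  rw [this, Complex.norm_exp_ofReal_mul_I]

theorem norm_zeta_zpow (n : ℕ) (k : ℤ) : ‖zeta n ^ k‖ = 1 := by
  rw [norm_zpow, norm_zeta, _root_.one_zpow]

theorem conj_zeta (n : ℕ) : starRingEnd ℂ (zeta n) = (zeta n)⁻¹ := by
  have h : zeta n * starRingEnd ℂ (zeta n) = 1 := by
    rw [Complex.mul_conj, Complex.normSq_eq_norm_sq, norm_zeta]; norm_num
  exact eq_inv_of_mul_eq_one_right h

theorem zeta_pow_self {n : ℕ} (hn : n ≠ 0) : zeta n ^ n = 1 := by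
  have := zeta_zpow n n
  rw [zpow_natCast] at this
  rw [this]
  have hn' : (n : ℝ) ≠ 0 := by exact_mod_cast hn
  rw [show ((2 * π * (n : ℤ) / n : ℝ)) = 2 * π by push_cast; field_simp]
  push_cast
  exact Complex.exp_two_pi_mul_I

/-- The open sector `0 < arg z < π / n`. -/
def sector (n : ℕ) : Set ℂ := {z | 0 < z.arg ∧ z.arg < π / n}

theorem isOpen_sector {n : ℕ} (hn : 1 ≤ n) : IsOpen (sector n) := by
  have hn' : (1 : ℝ) ≤ n := by exact_mod_cast hn
  have h : sector n = Complex.slitPlane ∩ Complex.arg ⁻¹' Set.Ioo 0 (π / n) := by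
    ext z
    refine ⟨fun hz => ⟨?_, hz⟩, fun hz => hz.2⟩
    rw [Complex.mem_slitPlane_iff_arg]
    refine ⟨fun h => ?_, fun h => ?_⟩
    · have := hz.2
      rw [h, lt_div_iff₀ (by linarith)] at this
      nlinarith [Real.pi_pos]
    · have := hz.1
      rw [h, Complex.arg_zero] at this
      exact lt_irrefl _ this
  rw [h]
  exact ContinuousOn.isOpen_inter_preimage (fun z hz => (Complex.continuousAt_arg hz).continuousWithinAt)
    Complex.isOpen_slitPlane isOpen_Ioo

theorem ne_zero_of_mem_sector {n : ℕ} {z : ℂ} (hz : z ∈ sector n) : z ≠ 0 := by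
  rintro rfl
  have := hz.1
  rw [Complex.arg_zero] at this
  exact lt_irrefl _ this

theorem exp_mem_sector {n : ℕ} (hn : 1 ≤ n) {t φ : ℝ} (ht : 0 < t) (h0 : 0 < φ) (h1 : φ < π / n) :
    (t : ℂ) * Complex.exp (φ * Complex.I) ∈ sector n := by
  have hn' : (1 : ℝ) ≤ n := by exact_mod_cast hn
  have h2 : φ ≤ π := h1.le.trans (div_le_self Real.pi_pos.le hn')
  have : ((t : ℂ) * Complex.exp (φ * Complex.I)).arg = φ := by
    rw [Complex.exp_mul_I, Complex.arg_mul_cos_add_sin_mul_I ht ⟨by linarith [Real.pi_pos], h2⟩]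
  refine ⟨?_, ?_⟩ <;> rw [this] <;> assumption

theorem arg_zeta_zpow (n : ℕ) (k : ℤ) :
    ((zeta n ^ k).arg : Real.Angle) = ((2 * π * k / n : ℝ) : Real.Angle) := by
  rw [zeta_zpow, Complex.exp_mul_I, ← Complex.ofReal_cos, ← Complex.ofReal_sin]
  exact Complex.arg_cos_add_sin_mul_I_coe_angle ((2 * π * k / n : ℝ) : Real.Angle)

/-- A rotation by a multiple of `2π/n` that does not fix the sector maps it off itself. -/
theorem dvd_of_rotate_mem_sector {n : ℕ} (hn : 1 ≤ n) {z : ℂ} (hz : z ∈ sector n) {k : ℤ}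
    (hk : zeta n ^ k * z ∈ sector n) : (n : ℤ) ∣ k := by
  have hn' : (1 : ℝ) ≤ n := by exact_mod_cast hn
  have h := Complex.arg_mul_coe_angle (zpow_ne_zero k (zeta_ne_zero n)) (ne_zero_of_mem_sector hz)
  rw [arg_zeta_zpow, ← Real.Angle.coe_add, Real.Angle.angle_eq_iff_two_pi_dvd_sub] at h
  obtain ⟨l, hl⟩ := h
  have h1 := hz.1; have h2 := hz.2; have h3 := hk.1; have h4 := hk.2
  rw [lt_div_iff₀ (by linarith)] at h2 h4
  have e : (zeta n ^ k * z).arg * n = 2 * π * (k + n * l) + z.arg * n := by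
    have : (zeta n ^ k * z).arg = 2 * π * k / n + z.arg + 2 * π * l := by linarith
    rw [this]; field_simp; ring
  have h5 : (0 : ℝ) < z.arg * n := by positivity
  have h6 : (0 : ℝ) < (zeta n ^ k * z).arg * n := by positivity
  have h7 : (k + n * l : ℝ) < 1 := by
    by_contra h; push Not at h; nlinarith [Real.pi_pos]
  have h8 : (-1 : ℝ) < (k + n * l : ℝ) := by
    by_contra h; push Not at h; nlinarith [Real.pi_pos]
  have h9 : k + n * l = 0 := by
    have a1 : k + n * l < 1 := by exact_mod_cast h7
    have a2 : -1 < k + n * l := by exact_mod_cast h8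
    omega
  exact ⟨-l, by linarith⟩

/-- Reflections whose mirrors are at angles that are multiples of `π/n` map the sector off
itself. -/
theorem reflect_notMem_sector {n : ℕ} (hn : 1 ≤ n) {z w : ℂ} (hz : z ∈ sector n) (hw : w ≠ 0)
    (harg : (w.arg : Real.Angle) = -(z.arg : Real.Angle)) (k : ℤ) :
    zeta n ^ k * w ∉ sector n := by
  intro hk
  have hn' : (1 : ℝ) ≤ n := by exact_mod_cast hn
  have h := Complex.arg_mul_coe_angle (zpow_ne_zero k (zeta_ne_zero n)) hw
  rw [arg_zeta_zpow, harg, ← Real.Angle.coe_neg, ← Real.Angle.coe_add,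
    Real.Angle.angle_eq_iff_two_pi_dvd_sub] at h
  obtain ⟨l, hl⟩ := h
  have h1 := hz.1; have h2 := hz.2; have h3 := hk.1; have h4 := hk.2
  rw [lt_div_iff₀ (by linarith)] at h2 h4
  have e : (zeta n ^ k * w).arg * n = 2 * π * (k + n * l) - z.arg * n := by
    have : (zeta n ^ k * w).arg = 2 * π * k / n + -z.arg + 2 * π * l := by linarith
    rw [this]; field_simp; ring
  have h5 : (0 : ℝ) < z.arg * n := by positivity
  have h6 : (0 : ℝ) < (zeta n ^ k * w).arg * n := by positivity
  have h7 : (k + n * l : ℝ) < 1 := by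
    by_contra h; push Not at h; nlinarith [Real.pi_pos]
  have h8 : (0 : ℝ) < (k + n * l : ℝ) := by
    by_contra h; push Not at h; nlinarith [Real.pi_pos]
  have a1 : k + n * l < 1 := by exact_mod_cast h7
  have a2 : 0 < k + n * l := by exact_mod_cast h8
  omega

theorem closedSector_subset_closure {n : ℕ} (hn : 1 ≤ n) {t φ : ℝ} (ht : 0 ≤ t) (h0 : 0 ≤ φ)
    (h1 : φ ≤ π / n) :
    (((t : ℂ) * Complex.exp (φ * Complex.I) : ℂ) : Sphere) ∈
      closure (((↑) : ℂ → Sphere) '' sector n) := by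
  have hn' : (1 : ℝ) ≤ n := by exact_mod_cast hn
  have hpos : (0 : ℝ) < π / n := div_pos Real.pi_pos (by linarith)
  refine image_closure_subset_closure_image OnePoint.continuous_coe ⟨_, ?_, rfl⟩
  have hc : Continuous fun x : ℝ × ℝ => (x.1 : ℂ) * Complex.exp (x.2 * Complex.I) := by fun_prop
  have hmem : ((t, φ) : ℝ × ℝ) ∈ closure (Set.Ioi (0 : ℝ) ×ˢ Set.Ioo 0 (π / n)) := by
    rw [closure_prod_eq, closure_Ioi, closure_Ioo hpos.ne]
    exact ⟨ht, h0, h1⟩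
  exact map_mem_closure (f := fun x : ℝ × ℝ => (x.1 : ℂ) * Complex.exp (x.2 * Complex.I)) hc hmem
    fun x hx => exp_mem_sector hn hx.1 hx.2.1 hx.2.2

theorem rotation_zpow_coe {n : ℕ} {a : SpherePerm}
    (ha : ∀ z : ℂ, a (z : Sphere) = ((zeta n * z : ℂ) : Sphere)) (k : ℤ) (z : ℂ) :
    (a ^ k : SpherePerm) (z : Sphere) = ((zeta n ^ k * z : ℂ) : Sphere) := by
  have hz := zeta_ne_zero n
  induction k using Int.induction_on generalizing z with
  | zero => simp
  | succ k ih =>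
    rw [_root_.zpow_add, Equiv.Perm.mul_apply, zpow_one, ha, ih, zpow_add₀ hz, zpow_one, mul_assoc]
  | pred k ih =>
    have hinv : (a⁻¹ : SpherePerm) (z : Sphere) = (((zeta n)⁻¹ * z : ℂ) : Sphere) := by
      rw [Equiv.Perm.inv_eq_iff_eq, ha, mul_inv_cancel_left₀ hz]
    rw [sub_eq_add_neg, _root_.zpow_add, Equiv.Perm.mul_apply, _root_.zpow_neg_one, hinv, ih,
      zpow_add₀ hz, _root_.zpow_neg_one, mul_assoc]

/-- The sector `0 < arg z < π / n` is a fundamental region for the dihedral group generated by the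
rotation `z ↦ e^{2πi/n} z` and the half-turn `z ↦ s / z`, for any `s > 0`. -/
theorem isFundamentalRegion_sector {n : ℕ} (hn : 1 ≤ n) {s : ℝ} (hs : 0 < s) {a b : SpherePerm}
    (ha : ∀ z : ℂ, a (z : Sphere) = ((zeta n * z : ℂ) : Sphere))
    (hb : ∀ z : ℂ, z ≠ 0 → b (z : Sphere) = ((s / z : ℂ) : Sphere))
    (hb0 : b ((0 : ℂ) : Sphere) = OnePoint.infty) (han : a ^ n = 1)
    (hbb : b * b = 1) (hab : b * a * b = a⁻¹) :
    IsFundamentalRegion (Subgroup.closure {a, b}) (((↑) : ℂ → Sphere) '' sector n) := by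
  have hn' : (1 : ℝ) ≤ n := by exact_mod_cast hn
  have hn0 : (n : ℝ) ≠ 0 := by linarith
  have hrot := rotation_zpow_coe ha
  have hbinf : b OnePoint.infty = ((0 : ℂ) : Sphere) := by
    rw [← hb0, ← Equiv.Perm.mul_apply, hbb, Equiv.Perm.one_apply]
  have hsC : (s : ℂ) ≠ 0 := by exact_mod_cast hs.ne'
  refine ⟨OnePoint.isOpenEmbedding_coe.isOpenMap _ (isOpen_sector hn), ?_, ?_⟩
  · intro g hg hg1
    rw [Set.disjoint_left]
    rintro _ ⟨_, ⟨z, hz, rfl⟩, rfl⟩ ⟨w, hw, e⟩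
    obtain ⟨k, rfl | rfl⟩ := (mem_closure_pair_iff hbb hab).1 hg
    · rw [hrot, OnePoint.coe_eq_coe] at e
      obtain ⟨l, rfl⟩ := dvd_of_rotate_mem_sector hn hz (k := k) (e ▸ hw)
      exact hg1 (by rw [_root_.zpow_mul, zpow_natCast, han, _root_.one_zpow])
    · have hz0 := ne_zero_of_mem_sector hz
      rw [Equiv.Perm.mul_apply, hb z hz0, hrot, OnePoint.coe_eq_coe] at e
      refine reflect_notMem_sector hn hz (w := s / z) (div_ne_zero hsC hz0) ?_ k (e ▸ hw)
      rw [div_eq_mul_inv, Complex.arg_real_mul _ hs, Complex.arg_inv_coe_angle]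
  · rw [Set.eq_univ_iff_forall]
    intro x
    have hamem : ∀ k : ℤ, a ^ k ∈ Subgroup.closure {a, b} := fun k =>
      Subgroup.zpow_mem _ (Subgroup.subset_closure (by simp)) k
    have hbmem : b ∈ Subgroup.closure {a, b} := Subgroup.subset_closure (by simp)
    have hzero : ((0 : ℂ) : Sphere) ∈ closure (((↑) : ℂ → Sphere) '' sector n) := by
      have := closedSector_subset_closure hn (t := 0) (φ := 0) le_rfl le_rfl (by positivity)
      simpa using this
    simp only [Set.mem_iUnion]
    induction x using OnePoint.rec with
    | infty => exact ⟨b, hbmem, _, hzero, hb0⟩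
    | coe z =>
      by_cases hz : z = 0
      · exact ⟨1, Subgroup.one_mem _, _, hzero, by rw [hz]; rfl⟩
      -- rotate `z` into the sector `0 ≤ arg < 2π/n`
      set k : ℤ := ⌊z.arg * n / (2 * π)⌋ with hk
      have hpi := Real.pi_pos
      have hk1 : (k : ℝ) ≤ z.arg * n / (2 * π) := Int.floor_le _
      have hk2 : z.arg * n / (2 * π) < k + 1 := Int.lt_floor_add_one _
      rw [le_div_iff₀ (by positivity)] at hk1
      rw [div_lt_iff₀ (by positivity)] at hk2
      set φ : ℝ := z.arg - 2 * π * k / n with hφ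
      have hφ0 : 0 ≤ φ * n := by rw [hφ, sub_mul, div_mul_cancel₀ _ hn0]; linarith
      have hφ1 : φ * n < 2 * π := by rw [hφ, sub_mul, div_mul_cancel₀ _ hn0]; linarith
      have hφ0' : 0 ≤ φ := nonneg_of_mul_nonneg_left hφ0 (by linarith)
      have hzpol : z = zeta n ^ k * ((‖z‖ : ℂ) * Complex.exp (φ * Complex.I)) := by
        rw [zeta_zpow, mul_left_comm, ← Complex.exp_add, ← add_mul, ← Complex.ofReal_add, hφ,
          add_sub_cancel]
        exact (Complex.norm_mul_exp_arg_mul_I z).symm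
      by_cases hle : φ ≤ π / n
      · exact ⟨a ^ k, hamem k, _, closedSector_subset_closure hn (norm_nonneg z) hφ0' hle, by
          rw [hrot, ← hzpol]⟩
      · push Not at hle
        have hψ : 2 * π / n - φ ≤ π / n := by
          have : 2 * π / n = π / n + π / n := by ring
          linarith
        have hψ0 : 0 ≤ 2 * π / n - φ := by
          rw [sub_nonneg, le_div_iff₀ (by linarith)]; exact hφ1.le
        have hzn : 0 < ‖z‖ := norm_pos_iff.2 hz
        refine ⟨a ^ (k + 1) * b, Subgroup.mul_mem _ (hamem _) hbmem, _,
          closedSector_subset_closure hn (t := s / ‖z‖) (by positivity) hψ0 hψ, ?_⟩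
        have hzn' : (‖z‖ : ℂ) ≠ 0 := by exact_mod_cast hzn.ne'
        rw [Equiv.Perm.mul_apply, hb, hrot]
        · conv_rhs => rw [hzpol]
          rw [OnePoint.coe_eq_coe, zpow_add₀ (zeta_ne_zero n), mul_assoc]
          congr 1
          have h1 := zeta_zpow n 1
          rw [h1]
          have h2 : Complex.exp ((2 * π * (1 : ℤ) / n : ℝ) * Complex.I) =
              Complex.exp (φ * Complex.I) * Complex.exp ((2 * π / n - φ : ℝ) * Complex.I) := by
            rw [← Complex.exp_add]
            congr 1
            push_cast
            ring
          rw [h2]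
          have h3 := Complex.exp_ne_zero ((2 * π / n - φ : ℝ) * Complex.I)
          rw [Complex.ofReal_div]
          field_simp
        · exact mul_ne_zero (by exact_mod_cast (div_pos hs hzn).ne') (Complex.exp_ne_zero _)

/-! ### Inversions and mirrors -/

theorem isLiftable_fin_four {G : Type*} [Group G] {M : CoxeterMatrix (Fin 4)} {f : Fin 4 → G}
    (hinv : ∀ i, f i * f i = 1) (h : ∀ i j, i < j → (f i * f j) ^ M i j = 1) :
    M.IsLiftable f := by
  intro i j
  rcases lt_trichotomy i j with hij | rfl | hij
  · exact h i j hij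
  · rw [M.diagonal, pow_one, hinv]
  · have h1 := h j i hij
    have h2 : f i * f j = (f j * f i)⁻¹ := by
      rw [_root_.mul_inv_rev, inv_eq_of_mul_eq_one_left (hinv i),
        inv_eq_of_mul_eq_one_left (hinv j)]
    rw [h2, M.symmetric, inv_pow, h1, inv_one]

theorem rotation_pow_eq_one {n : ℕ} (hn : n ≠ 0) {a : SpherePerm}
    (ha : ∀ z : ℂ, a (z : Sphere) = ((zeta n * z : ℂ) : Sphere))
    (ha' : a OnePoint.infty = OnePoint.infty) : a ^ n = 1 := by
  apply Equiv.ext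
  intro x
  induction x using OnePoint.rec with
  | infty =>
    have : ∀ k : ℕ, (a ^ k) OnePoint.infty = OnePoint.infty := by
      intro k
      induction k with
      | zero => rfl
      | succ k ih => rw [pow_succ, Equiv.Perm.mul_apply, ha', ih]
    exact this n
  | coe z =>
    have := rotation_zpow_coe ha n z
    rw [zpow_natCast, zpow_natCast, zeta_pow_self hn, one_mul] at this
    exact this

/-- `f` is the inversion `z ↦ s / z̄` in the circle of radius `√s` about the origin. -/
structure IsInversion (f : SpherePerm) (s : ℝ) : Prop where
  pos : 0 < s
  coe : ∀ z : ℂ, z ≠ 0 → f (z : Sphere) = ((s / starRingEnd ℂ z : ℂ) : Sphere)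
  zero : f ((0 : ℂ) : Sphere) = OnePoint.infty
  infty : f OnePoint.infty = ((0 : ℂ) : Sphere)

/-- `f` is the reflection `z ↦ ζ z̄` in a line through the origin. -/
structure IsMirror (f : SpherePerm) (ζ : ℂ) : Prop where
  norm : ζ * starRingEnd ℂ ζ = 1
  coe : ∀ z : ℂ, f (z : Sphere) = ((ζ * starRingEnd ℂ z : ℂ) : Sphere)
  infty : f OnePoint.infty = OnePoint.infty

theorem isInversion_antiMobius {a b : ℂ}
    (h : (!![0, a; b, 0] : Matrix (Fin 2) (Fin 2) ℂ).det ≠ 0) {s : ℝ} (hs : 0 < s)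
    (hab : a = b * s) : IsInversion (antiMobius !![0, a; b, 0] h) s := by
  have hb : b ≠ 0 := by rintro rfl; simp [det_fin_two] at h
  refine ⟨hs, fun z hz => ?_, antiMobius_coe_eq_infty h (by simp), ?_⟩
  · have hz' : starRingEnd ℂ z ≠ 0 := (map_ne_zero _).2 hz
    rw [antiMobius_coe h (by simpa using ⟨hb, hz⟩), OnePoint.coe_eq_coe]
    simp only [of_apply, cons_val', cons_val_zero, cons_val_fin_one, cons_val_one, zero_mul,
      zero_add, add_zero, hab]
    rw [mul_div_mul_left _ _ hb]
  · rw [antiMobius_infty h (by simpa using hb)]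
    simp

theorem isMirror_conjPerm : IsMirror conjPerm 1 :=
  ⟨by simp, fun z => by rw [conjPerm_coe, one_mul], conjPerm_infty⟩

theorem isMirror_antiMobius {a : ℂ} (h : (!![a, 0; 0, 1] : Matrix (Fin 2) (Fin 2) ℂ).det ≠ 0)
    (ha : a * starRingEnd ℂ a = 1) : IsMirror (antiMobius !![a, 0; 0, 1] h) a := by
  refine ⟨ha, fun z => ?_, antiMobius_infty_eq_infty h (by simp)⟩
  rw [antiMobius_coe h (by simp)]
  simp

theorem zeta_mul_conj (n : ℕ) : zeta n * starRingEnd ℂ (zeta n) = 1 := by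
  rw [conj_zeta, mul_inv_cancel₀ (zeta_ne_zero n)]

theorem IsInversion.mul_self {f : SpherePerm} {s : ℝ} (h : IsInversion f s) : f * f = 1 := by
  have hs : (s : ℂ) ≠ 0 := by exact_mod_cast h.pos.ne'
  apply Equiv.ext
  intro x
  rw [Equiv.Perm.mul_apply, Equiv.Perm.one_apply]
  induction x using OnePoint.rec with
  | infty => rw [h.infty, h.zero]
  | coe z =>
    by_cases h0 : z = 0
    · rw [h0, h.zero, h.infty]
    · have h0' : starRingEnd ℂ z ≠ 0 := (map_ne_zero _).2 h0
      rw [h.coe z h0, h.coe _ (div_ne_zero hs h0'), OnePoint.coe_eq_coe, map_div₀,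
        Complex.conj_conj, Complex.conj_ofReal]
      field_simp

theorem IsMirror.ne_zero {f : SpherePerm} {ζ : ℂ} (h : IsMirror f ζ) : ζ ≠ 0 :=
  left_ne_zero_of_mul_eq_one h.norm

theorem IsMirror.mul_self {f : SpherePerm} {ζ : ℂ} (h : IsMirror f ζ) : f * f = 1 := by
  apply Equiv.ext
  intro x
  rw [Equiv.Perm.mul_apply, Equiv.Perm.one_apply]
  induction x using OnePoint.rec with
  | infty => rw [h.infty, h.infty]
  | coe z =>
    rw [h.coe, h.coe, OnePoint.coe_eq_coe, map_mul, Complex.conj_conj, ← mul_assoc, h.norm, one_mul]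

theorem IsMirror.mul_inversion_sq {f g : SpherePerm} {s : ℝ} {ζ : ℂ} (hf : IsMirror f ζ)
    (hg : IsInversion g s) : (f * g) ^ 2 = 1 := by
  have hcomm : f * g = g * f := by
    apply Equiv.ext
    intro x
    rw [Equiv.Perm.mul_apply, Equiv.Perm.mul_apply]
    induction x using OnePoint.rec with
    | infty => rw [hg.infty, hf.coe, hf.infty, hg.infty]; simp
    | coe z =>
      by_cases h0 : z = 0
      · rw [h0, hg.zero, hf.infty, hf.coe, map_zero, mul_zero, hg.zero]
      · have h0' : starRingEnd ℂ z ≠ 0 := (map_ne_zero _).2 h0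
        have hζ := hf.ne_zero
        rw [hg.coe z h0, hf.coe, hf.coe, hg.coe _ (mul_ne_zero hζ h0'), OnePoint.coe_eq_coe,
          map_mul, map_div₀, Complex.conj_conj, Complex.conj_ofReal,
          eq_inv_of_mul_eq_one_right hf.norm]
        field_simp
  rw [pow_two]
  nth_rewrite 2 [hcomm]
  rw [mul_assoc, ← mul_assoc g g, hg.mul_self, one_mul, hf.mul_self]

theorem IsMirror.rot {f g : SpherePerm} {ζ : ℂ} (hf : IsMirror f ζ) (hg : IsMirror g 1) (z : ℂ) :
    (f * g) (z : Sphere) = ((ζ * z : ℂ) : Sphere) := by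
  rw [Equiv.Perm.mul_apply, hg.coe, hf.coe, one_mul, Complex.conj_conj]

theorem IsMirror.rot_infty {f g : SpherePerm} {ζ ξ : ℂ} (hf : IsMirror f ζ) (hg : IsMirror g ξ) :
    (f * g) OnePoint.infty = OnePoint.infty := by
  rw [Equiv.Perm.mul_apply, hg.infty, hf.infty]

theorem mul_pow_eq_one_comm {G : Type*} [Group G] {a b : G} (ha : a * a = 1) (hb : b * b = 1)
    {m : ℕ} (h : (a * b) ^ m = 1) : (b * a) ^ m = 1 := by
  have : b * a = (a * b)⁻¹ := by
    rw [_root_.mul_inv_rev, inv_eq_of_mul_eq_one_left ha, inv_eq_of_mul_eq_one_left hb]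
  rw [this, inv_pow, h, inv_one]

theorem IsMirror.rot_pow {f g : SpherePerm} {n : ℕ} (hn : n ≠ 0) (hf : IsMirror f (zeta n))
    (hg : IsMirror g 1) : (f * g) ^ n = 1 :=
  rotation_pow_eq_one hn (hf.rot hg) (hf.rot_infty hg)

theorem IsInversion.mul_conj_coe {f g : SpherePerm} {s : ℝ} (hf : IsInversion f s)
    (hg : IsMirror g 1) {z : ℂ} (hz : z ≠ 0) : (f * g) (z : Sphere) = ((s / z : ℂ) : Sphere) := by
  rw [Equiv.Perm.mul_apply, hg.coe, one_mul, hf.coe _ ((map_ne_zero _).2 hz), Complex.conj_conj]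

/-! ### The amalgam of two dihedral groups -/

section DD

variable {n : ℕ} {p : ℝ} {hp : 1 < p}

theorem reflDD_zero : IsMirror (reflDD n p hp 0) 1 := isMirror_conjPerm

theorem reflDD_one : IsInversion (reflDD n p hp 1) 1 :=
  isInversion_antiMobius _ one_pos (by simp)

theorem reflDD_two : IsMirror (reflDD n p hp 2) (zeta n) :=
  isMirror_antiMobius _ (zeta_mul_conj n)

theorem reflDD_three : IsInversion (reflDD n p hp 3) ((p ^ 2)⁻¹) :=
  isInversion_antiMobius _ (by positivity) (by
    have : (p : ℂ) ≠ 0 := by exact_mod_cast (by linarith : p ≠ 0)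
    push_cast
    rw [mul_inv_cancel₀ (pow_ne_zero 2 this)])

theorem reflDD_anti (i : Fin 4) : IsAntiConformal (reflDD n p hp i) := by
  fin_cases i
  · exact isAntiConformal_conjPerm
  all_goals exact isAntiConformal_antiMobius _

theorem reflDD_isLiftable (hn : 2 ≤ n) : (coxDD n 0 (Nat.ne_of_gt hn) (by decide)).IsLiftable
    (reflDD n p hp) := by
  have inv : ∀ i, reflDD n p hp i * reflDD n p hp i = 1 := by
    intro i
    fin_cases i
    exacts [reflDD_zero.mul_self, reflDD_one.mul_self, reflDD_two.mul_self, reflDD_three.mul_self]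
  refine isLiftable_fin_four inv ?_
  intro i j hij
  fin_cases i <;> fin_cases j <;> first | exact absurd hij (by decide) | skip
  · exact reflDD_zero.mul_inversion_sq reflDD_one
  · exact mul_pow_eq_one_comm (inv 2) (inv 0) (reflDD_two.rot_pow (n := n) (by omega) reflDD_zero)
  · exact reflDD_zero.mul_inversion_sq reflDD_three
  · exact mul_pow_eq_one_comm (inv 2) (inv 1) (reflDD_two.mul_inversion_sq reflDD_one)
  · exact pow_zero _
  · exact reflDD_two.mul_inversion_sq reflDD_three

/-- The sets of the ping-pong: two round discs about `0` and `∞` and the annulus between them. -/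
theorem reflDD_amalgam (hn : 2 ≤ n) : ∃ z₀ : ℂ, ∃ U : Set ℂ,
    ReflectionAmalgam (coxDD n 0 (Nat.ne_of_gt hn) (by decide)) (reflDD n p hp) 2 1 3 n z₀ U
      (((↑) : ℂ → Sphere) '' {z | 1 / p < ‖z‖ ∧ ‖z‖ < 1})
      (((↑) : ℂ → Sphere) '' {z | ‖z‖ < 1 / p})
      (((↑) : ℂ → Sphere) '' {z | 1 < ‖z‖} ∪ {OnePoint.infty}) := by
  have hp0 : 0 < p := by linarith
  have hp1 : 1 / p < 1 := by rw [div_lt_one hp0]; exact hp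
  have hn' : (1 : ℝ) ≤ n := by exact_mod_cast (by omega : 1 ≤ n)
  have hpi := Real.pi_pos
  have hlift := reflDD_isLiftable (p := p) (hp := hp) hn
  set r := reflDD n p hp with hr
  have mirror : ∀ i : Fin 4, i = 0 ∨ i = 2 → ∀ z : ℂ, ∃ w : ℂ, ‖w‖ = ‖z‖ ∧ r i (z : Sphere) = w := by
    rintro i (rfl | rfl) z
    · exact ⟨_, by simp, reflDD_zero.coe z⟩
    · exact ⟨_, by rw [norm_mul, norm_zeta, one_mul, Complex.norm_conj], reflDD_two.coe z⟩
  have mirror' : ∀ i : Fin 4, i = 0 ∨ i = 2 → r i OnePoint.infty = OnePoint.infty := by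
    rintro i (rfl | rfl)
    · exact reflDD_zero.infty
    · exact reflDD_two.infty
  have hnorm : ∀ (s : ℝ) (z : ℂ), 0 < s → ‖(s / starRingEnd ℂ z : ℂ)‖ = s / ‖z‖ := by
    intro s z hs
    rw [norm_div, Complex.norm_conj, Complex.norm_real, Real.norm_of_nonneg hs.le]
  refine ⟨(((1 / p + 1) / 2 : ℝ) : ℂ) * Complex.exp ((π / n / 2 : ℝ) * Complex.I),
    sector n ∩ {z | 1 / p < ‖z‖ ∧ ‖z‖ < 1}, ?_⟩
  have hz₀ : (((1 / p + 1) / 2 : ℝ) : ℂ) * Complex.exp ((π / n / 2 : ℝ) * Complex.I) ∈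
      sector n ∩ {z | 1 / p < ‖z‖ ∧ ‖z‖ < 1} := by
    refine ⟨exp_mem_sector (by omega) (by positivity) (by positivity)
      (half_lt_self (by positivity)), ?_⟩
    rw [Set.mem_ofPred_eq, norm_mul, Complex.norm_exp_ofReal_mul_I, mul_one, Complex.norm_real,
      Real.norm_of_nonneg (by positivity)]
    constructor <;> linarith
  refine
  { univ := by decide
    anti := reflDD_anti
    lift := hlift
    order := rfl
    pos := by omega
    coset_s := fun G _ f hf C hC c hc => coset_of_commute (mul_self_of_isLiftable hf 1)
      (commute_of_isLiftable hf rfl) (commute_of_isLiftable hf rfl) hC hc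
    coset_t := fun G _ f hf C hC c hc => coset_of_commute (mul_self_of_isLiftable hf 3)
      (commute_of_isLiftable hf rfl) (commute_of_isLiftable hf rfl) hC hc
    mapsY := ?_
    maps₁ := ?_
    maps₂ := ?_
    maps_s := ?_
    maps_t := ?_
    isOpen := (isOpen_sector (by omega)).inter ((isOpen_lt continuous_const continuous_norm).inter
      (isOpen_lt continuous_norm continuous_const))
    mem := hz₀
    memY := ⟨_, hz₀.2, rfl⟩
    disjY := ?_
    disj := ?_
    rot := ?_
    refl := ?_ }
  · rintro i hi _ ⟨z, hz, rfl⟩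
    obtain ⟨w, hw, e⟩ := mirror i hi z
    exact ⟨w, by rwa [Set.mem_ofPred_eq, hw], e.symm⟩
  · rintro i hi _ ⟨z, hz, rfl⟩
    obtain ⟨w, hw, e⟩ := mirror i hi z
    exact ⟨w, by rwa [Set.mem_ofPred_eq, hw], e.symm⟩
  · rintro i hi _ (⟨z, hz, rfl⟩ | rfl)
    · obtain ⟨w, hw, e⟩ := mirror i hi z
      exact Or.inl ⟨w, by rwa [Set.mem_ofPred_eq, hw], e.symm⟩
    · exact Or.inr (mirror' i hi)
  · intro x hx
    obtain ⟨z, hz, rfl⟩ : ∃ z : ℂ, ‖z‖ < 1 ∧ (z : Sphere) = x := by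
      rcases hx with ⟨z, hz, rfl⟩ | ⟨z, hz, rfl⟩
      · exact ⟨z, hz.2, rfl⟩
      · exact ⟨z, lt_trans hz hp1, rfl⟩
    by_cases h0 : z = 0
    · rw [h0, reflDD_one.zero]; exact Or.inr rfl
    · refine Or.inl ⟨_, ?_, (reflDD_one.coe z h0).symm⟩
      rw [Set.mem_ofPred_eq, hnorm _ _ one_pos, lt_div_iff₀ (norm_pos_iff.2 h0)]
      linarith
  · intro x hx
    have hx' : x = OnePoint.infty ∨ ∃ z : ℂ, 1 / p < ‖z‖ ∧ (z : Sphere) = x := by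
      rcases hx with ⟨z, hz, rfl⟩ | ⟨z, hz, rfl⟩ | rfl
      · exact Or.inr ⟨z, hz.1, rfl⟩
      · exact Or.inr ⟨z, lt_trans hp1 hz, rfl⟩
      · exact Or.inl rfl
    rcases hx' with rfl | ⟨z, hz, rfl⟩
    · exact ⟨0, by simpa using hp0, reflDD_three.infty.symm⟩
    · have hz0 : 0 < ‖z‖ := lt_trans (by positivity) hz
      refine ⟨_, ?_, (reflDD_three.coe z (norm_pos_iff.1 hz0)).symm⟩
      rw [Set.mem_ofPred_eq, hnorm _ _ (by positivity), div_lt_iff₀ hz0]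
      rw [div_lt_iff₀ hp0] at hz
      rw [← one_div, pow_two, one_div_mul_eq_div, div_lt_div_iff₀ (by positivity) hp0]
      nlinarith
  · rintro _ ⟨z, hz, rfl⟩ (⟨w, hw, e⟩ | ⟨w, hw, e⟩ | e)
    · rw [OnePoint.coe_eq_coe] at e
      rw [e] at hw
      exact lt_asymm hz.1 hw
    · rw [OnePoint.coe_eq_coe] at e
      rw [e] at hw
      exact lt_asymm hz.2 hw
    · exact OnePoint.coe_ne_infty _ e
  · rintro z ⟨-, hz⟩ (⟨w, hw, e⟩ | ⟨w, hw, e⟩ | e)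
    · rw [OnePoint.coe_eq_coe] at e
      rw [e] at hw
      exact lt_asymm hz.1 hw
    · rw [OnePoint.coe_eq_coe] at e
      rw [e] at hw
      exact lt_asymm hz.2 hw
    · exact OnePoint.coe_ne_infty _ e
  · rintro k ⟨w, hw, e⟩
    rw [rotation_zpow_coe (reflDD_two.rot reflDD_zero), OnePoint.coe_eq_coe] at e
    exact dvd_of_rotate_mem_sector (by omega) hz₀.1 (e ▸ hw.1)
  · rintro k ⟨w, hw, e⟩
    rw [Equiv.Perm.mul_apply, reflDD_zero.coe, one_mul,
      rotation_zpow_coe (reflDD_two.rot reflDD_zero), OnePoint.coe_eq_coe] at e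
    exact reflect_notMem_sector (by omega) hz₀.1
      ((map_ne_zero _).2 (ne_zero_of_mem_sector hz₀.1)) (Complex.arg_conj_coe_angle _) k (e ▸ hw.1)

end DD

/-! ### Free generators and Maskit combination for two dihedral groups -/

/-- Ping-pong needs two generators; a single one is free as soon as its order is infinite. -/
theorem isFreeBasis_one {G : Type*} [Group G] {x : G} (hx : orderOf x = 0) :
    IsFreeBasis ![x] (Subgroup.zpowers x) := by
  have hof : ∀ w : FreeGroup (Fin 1), ∃ k : ℤ, w = FreeGroup.of 0 ^ k := by
    intro w
    induction w using FreeGroup.induction_on with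
    | C1 => exact ⟨0, by simp⟩
    | of i => exact ⟨1, by rw [Subsingleton.elim i 0, zpow_one]⟩
    | inv_of i ih => exact ⟨-1, by rw [Subsingleton.elim i 0, _root_.zpow_neg_one]⟩
    | mul a b ha hb =>
      obtain ⟨k, rfl⟩ := ha
      obtain ⟨l, rfl⟩ := hb
      exact ⟨k + l, by rw [_root_.zpow_add]⟩
  constructor
  · rw [injective_iff_map_eq_one]
    intro w hw
    obtain ⟨k, rfl⟩ := hof w
    rw [map_zpow, FreeGroup.lift_apply_of] at hw
    change x ^ k = 1 at hw
    rw [← orderOf_dvd_iff_zpow_eq_one, hx] at hw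
    have : k = 0 := by simpa using hw
    rw [this, zpow_zero]
  · rw [FreeGroup.range_lift_eq_closure, Matrix.range_cons, Matrix.range_empty, Set.union_empty,
      Subgroup.zpowers_eq_closure]

section DD

variable {n : ℕ} {p : ℝ} {hp : 1 < p}

theorem reflDD_one_mul_three_zpow (k : ℤ) (z : ℂ) :
    ((reflDD n p hp 1 * reflDD n p hp 3) ^ k : SpherePerm) (z : Sphere)
      = (((p : ℂ) ^ (2 * k) * z : ℂ) : Sphere) := by
  have hp0 : (p : ℂ) ≠ 0 := by exact_mod_cast (by linarith : p ≠ 0)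
  have h1 : ∀ z : ℂ, (reflDD n p hp 1 * reflDD n p hp 3) (z : Sphere)
      = (((p : ℂ) ^ 2 * z : ℂ) : Sphere) := by
    intro z
    rw [Equiv.Perm.mul_apply]
    by_cases h0 : z = 0
    · rw [h0, reflDD_three.zero, reflDD_one.infty, mul_zero]
    · have h0' : starRingEnd ℂ z ≠ 0 := (map_ne_zero _).2 h0
      rw [reflDD_three.coe z h0, reflDD_one.coe _ (by simp [h0, hp0]), OnePoint.coe_eq_coe, map_div₀,
        Complex.conj_conj, Complex.conj_ofReal]
      push_cast
      field_simp
  induction k using Int.induction_on generalizing z with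
  | zero => simp
  | succ k ih =>
    rw [_root_.zpow_add, Equiv.Perm.mul_apply, zpow_one, h1, ih, mul_add, zpow_add₀ hp0, mul_one,
      mul_assoc]
    rfl
  | pred k ih =>
    have hinv : ((reflDD n p hp 1 * reflDD n p hp 3)⁻¹ : SpherePerm) (z : Sphere)
        = (((p : ℂ) ^ (-2 : ℤ) * z : ℂ) : Sphere) := by
      rw [Equiv.Perm.inv_eq_iff_eq, h1, OnePoint.coe_eq_coe, ← mul_assoc]
      rw [_root_.zpow_neg, zpow_ofNat, mul_inv_cancel₀ (pow_ne_zero 2 hp0), one_mul]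
    rw [sub_eq_add_neg, _root_.zpow_add, Equiv.Perm.mul_apply, _root_.zpow_neg_one, hinv, ih, mul_add,
      zpow_add₀ hp0, mul_assoc]
    rfl

theorem reflDD_orderOf : orderOf (reflDD n p hp 1 * reflDD n p hp 3) = 0 := by
  rw [orderOf_eq_zero_iff']
  intro k hk h
  have h1 := reflDD_one_mul_three_zpow (n := n) (hp := hp) k 1
  rw [zpow_natCast, h, Equiv.Perm.one_apply, OnePoint.coe_eq_coe, mul_one] at h1
  have h2 : (p : ℝ) ^ (2 * k) = 1 := by exact_mod_cast h1.symm
  have := one_lt_pow₀ hp (n := 2 * k) (by omega)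
  linarith

/-- The dilation `z ↦ p^{2m} z` takes the unit disc onto the exterior of the disc
`|z| ≥ p^{2m}` about `∞`. -/
theorem reflDD_isSchottkySystem {m : ℕ} (hm : 1 ≤ m) :
    IsSchottkySystem ![(reflDD n p hp 1 * reflDD n p hp 3) ^ m] := by
  have hp0 : 0 < p := by linarith
  have hq1 : 1 < p ^ (2 * m) := one_lt_pow₀ hp (by omega)
  have hact : ∀ z : ℂ, ((reflDD n p hp 1 * reflDD n p hp 3) ^ m : SpherePerm) (z : Sphere)
      = ((((p ^ (2 * m) : ℝ) : ℂ) * z : ℂ) : Sphere) := by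
    intro z
    have := reflDD_one_mul_three_zpow (n := n) (hp := hp) m z
    rw [zpow_natCast] at this
    rw [this]
    push_cast
    norm_cast
  set q : ℝ := p ^ (2 * m) with hq
  have hq0 : 0 < q := by linarith
  -- the inversion `z ↦ q / z̄` takes the unit disc to the exterior disc
  have hdet : (!![0, (q : ℂ); 1, 0] : Matrix (Fin 2) (Fin 2) ℂ).det ≠ 0 := by
    simp [det_fin_two, hq0.ne']
  have hinv : IsInversion (antiMobius _ hdet) q := isInversion_antiMobius _ hq0 (by simp)
  obtain ⟨A, hA1, hA2⟩ := exists_disc_eq_ball 0 one_pos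
  obtain ⟨A', -, hA'2⟩ := exists_disc_eq_image (Or.inr (isAntiConformal_antiMobius hdet)) A
  have hext : closedDisc A' = (((↑) : ℂ → Sphere) '' Metric.ball 0 q)ᶜ := by
    rw [hA'2, hA2]
    ext x
    constructor
    · rintro ⟨_, ⟨z, hz, rfl⟩, rfl⟩ ⟨w, hw, e⟩
      rw [mem_closedBall_zero_iff] at hz
      rw [mem_ball_zero_iff] at hw
      by_cases h0 : z = 0
      · rw [h0, hinv.zero] at e
        exact OnePoint.coe_ne_infty _ e
      · rw [hinv.coe z h0, OnePoint.coe_eq_coe] at e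
        rw [e, norm_div, Complex.norm_conj, Complex.norm_real, Real.norm_of_nonneg hq0.le,
          div_lt_iff₀ (norm_pos_iff.2 h0)] at hw
        nlinarith
    · intro hx
      refine ⟨antiMobius _ hdet x, ?_, by
        rw [← Equiv.Perm.mul_apply, hinv.mul_self, Equiv.Perm.one_apply]⟩
      induction x using OnePoint.rec with
      | infty => exact ⟨0, by simp, hinv.infty.symm⟩
      | coe z =>
        have hz : q ≤ ‖z‖ := by
          by_contra h
          exact hx ⟨z, by simpa using h, rfl⟩
        have hz0 : 0 < ‖z‖ := by linarith
        refine ⟨_, ?_, (hinv.coe z (norm_pos_iff.1 hz0)).symm⟩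
        rw [mem_closedBall_zero_iff, norm_div, Complex.norm_conj, Complex.norm_real,
          Real.norm_of_nonneg hq0.le, div_le_one hz0]
        exact hz
  refine ⟨fun _ => A, fun _ => A', ?_, fun i => ⟨?_, ?_⟩⟩
  · have hAA : Disjoint (closedDisc A) (closedDisc A') := by
      rw [hext, hA2, Set.disjoint_compl_right_iff_subset]
      exact Set.image_mono (Metric.closedBall_subset_ball hq1)
    rintro (i | i) (j | j) hij
    · exact absurd (congrArg _ (Subsingleton.elim i j)) hij
    · exact hAA
    · exact hAA.symm
    · exact absurd (congrArg _ (Subsingleton.elim i j)) hij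
  · rw [Subsingleton.elim i 0]
    exact mobiusGroup.pow_mem ((reflDD_anti 1).mul (reflDD_anti 3)) m
  · rw [Subsingleton.elim i 0]
    change ((reflDD n p hp 1 * reflDD n p hp 3) ^ m : SpherePerm) '' _ = _
    rw [hext, compl_compl, hA1]
    ext x
    constructor
    · rintro ⟨_, ⟨z, hz, rfl⟩, rfl⟩
      rw [hact]
      refine ⟨_, ?_, rfl⟩
      rw [mem_ball_zero_iff] at hz ⊢
      rw [norm_mul, Complex.norm_real, Real.norm_of_nonneg hq0.le]
      nlinarith
    · rintro ⟨z, hz, rfl⟩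
      rw [mem_ball_zero_iff] at hz
      refine ⟨_, ⟨z / q, ?_, rfl⟩, ?_⟩
      · rw [mem_ball_zero_iff, norm_div, Complex.norm_real, Real.norm_of_nonneg hq0.le,
          div_lt_one hq0]
        exact hz
      · rw [hact, mul_div_cancel₀]
        exact_mod_cast hq0.ne'

/-- The separating circle is the circle about the origin midway between the circles of `r₂` and
`r₄`; both groups have the sector of angle `π / n` as a fundamental region. -/
theorem reflDD_isMaskitCombination (hn : 2 ≤ n) :
    IsMaskitCombination (sphericalGroup (reflDD n p hp) 0 1 2) (sphericalGroup (reflDD n p hp) 0 3 2)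
      (Subgroup.zpowers (reflDD n p hp 2 * reflDD n p hp 0)) := by
  obtain ⟨z₀, U, h⟩ := reflDD_amalgam (p := p) (hp := hp) hn
  have hp0 : 0 < p := by linarith
  have hp1 : 1 / p < 1 := by rw [div_lt_one hp0]; exact hp
  have hn0 : NeZero n := ⟨by omega⟩
  have hC1 : Commute (reflDD n p hp 1) (reflDD n p hp 0) := commute_of_isLiftable h.lift rfl
  have hC2 : Commute (reflDD n p hp 1) (reflDD n p hp 2) := commute_of_isLiftable h.lift rfl
  have hC3 : Commute (reflDD n p hp 3) (reflDD n p hp 0) := commute_of_isLiftable h.lift rfl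
  have hC4 : Commute (reflDD n p hp 3) (reflDD n p hp 2) := commute_of_isLiftable h.lift rfl
  obtain ⟨e1⟩ := h.dihedral_of_commute h.s_notMem_zpowers hC1 hC2
  obtain ⟨e2⟩ := h.dihedral_of_commute h.t_notMem_zpowers hC3 hC4
  have fundamental : ∀ (f : SpherePerm) (s : ℝ), IsInversion f s → Commute f (reflDD n p hp 2) →
      IsFundamentalRegion (Subgroup.closure {reflDD n p hp 2 * reflDD n p hp 0,
        f * reflDD n p hp 0}) (((↑) : ℂ → Sphere) '' sector n) := by
    intro f s hf hc
    have h0f : Commute f (reflDD n p hp 0) :=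
      (commute_of_sq (h.inv 0) hf.mul_self (reflDD_zero.mul_inversion_sq hf)).symm
    have hb : f * reflDD n p hp 0 * (f * reflDD n p hp 0) = 1 := by
      rw [← pow_two, h0f.eq]; exact reflDD_zero.mul_inversion_sq hf
    refine isFundamentalRegion_sector (by omega) hf.pos (reflDD_two.rot reflDD_zero)
      (fun z hz => hf.mul_conj_coe reflDD_zero hz) ?_
      (reflDD_two.rot_pow (by omega) reflDD_zero) hb ?_
    · rw [Equiv.Perm.mul_apply, reflDD_zero.coe, map_zero, mul_zero, hf.zero]
    · rw [_root_.mul_inv_rev, inv_eq_of_mul_eq_one_left (h.inv 0),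
        inv_eq_of_mul_eq_one_left (h.inv 2), h0f.eq]
      calc reflDD n p hp 0 * f * (reflDD n p hp 2 * reflDD n p hp 0) * (reflDD n p hp 0 * f)
          = reflDD n p hp 0 * f * reflDD n p hp 2 * (reflDD n p hp 0 * reflDD n p hp 0) * f := by
            group
        _ = reflDD n p hp 0 * (f * reflDD n p hp 2) * f := by rw [h.inv, mul_one]; group
        _ = reflDD n p hp 0 * reflDD n p hp 2 * (f * f) := by rw [hc.eq]; group
        _ = _ := by rw [hf.mul_self, mul_one]
  have f1 := fundamental _ _ reflDD_one hC2
  have f2 := fundamental _ _ reflDD_three hC4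
  rw [← h.sphericalGroup_eq] at f1 f2
  set s : ℝ := (1 / p + 1) / 2 with hs
  have hs0 : 0 < s := by positivity
  have hs1 : 1 / p < s := by rw [hs]; linarith
  have hs2 : s < 1 := by rw [hs]; linarith
  have hsp : 1 < s * p := by rwa [div_lt_iff₀ hp0] at hs1
  obtain ⟨A, hA1, hA2⟩ := exists_disc_eq_ball 0 hs0
  have hnorm : ∀ (s : ℝ) (z : ℂ), 0 < s → ‖(s / starRingEnd ℂ z : ℂ)‖ = s / ‖z‖ := by
    intro s z hs
    rw [norm_div, Complex.norm_conj, Complex.norm_real, Real.norm_of_nonneg hs.le]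
  have mirror : ∀ i : Fin 4, i = 0 ∨ i = 2 → ∀ z : ℂ, ∃ w : ℂ, ‖w‖ = ‖z‖ ∧
      reflDD n p hp i (z : Sphere) = w := by
    rintro i (rfl | rfl) z
    · exact ⟨_, by simp, reflDD_zero.coe z⟩
    · exact ⟨_, by rw [norm_mul, norm_zeta, one_mul, Complex.norm_conj], reflDD_two.coe z⟩
  have hin : ∀ i, i = 0 ∨ i = 2 → ∀ p' ∈ ((↑) : ℂ → Sphere) '' Metric.ball 0 s,
      reflDD n p hp i p' ∈ ((↑) : ℂ → Sphere) '' Metric.ball 0 s := by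
    rintro i hi _ ⟨z, hz, rfl⟩
    obtain ⟨w, hw, e⟩ := mirror i hi z
    exact ⟨w, by simpa [hw] using hz, e.symm⟩
  have hout : ∀ i, i = 0 ∨ i = 2 → ∀ p' ∈ (((↑) : ℂ → Sphere) '' Metric.closedBall 0 s)ᶜ,
      reflDD n p hp i p' ∈ (((↑) : ℂ → Sphere) '' Metric.closedBall 0 s)ᶜ := by
    rintro i hi x hx ⟨z, hz, e⟩
    obtain ⟨w, hw, e'⟩ := mirror i hi z
    apply hx
    refine ⟨w, by simpa [hw] using hz, ?_⟩
    rw [← e', e, ← Equiv.Perm.mul_apply, h.inv, Equiv.Perm.one_apply]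
  refine ⟨h.isKleinian (ReflectionAmalgam.sphericalGroup_le _ _ _ _), ?_,
    h.isKleinian (ReflectionAmalgam.sphericalGroup_le _ _ _ _), ?_, inferInstance, ?_, ?_, A,
    closedDisc A \ openDisc A, openDisc A, (closedDisc A)ᶜ, ((↑) : ℂ → Sphere) '' sector n,
    ((↑) : ℂ → Sphere) '' sector n, rfl, Or.inl ⟨rfl, rfl⟩, ?_, ?_, ?_, rfl, ?_, ?_⟩
  · rw [sphericalGroup_comm]; exact Finite.of_equiv _ e1.symm.toEquiv
  · rw [sphericalGroup_comm]; exact Finite.of_equiv _ e2.symm.toEquiv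
  · rw [sphericalGroup_comm]; exact h.zpowers_lt_s
  · rw [sphericalGroup_comm]; exact h.zpowers_lt_t
  · intro j hj
    rw [hA1, hA2]
    exact ⟨h.zpowers_image_eq hin hj, h.zpowers_image_eq hout hj⟩
  · rw [sphericalGroup_comm]; exact f1
  · rw [sphericalGroup_comm]; exact f2
  · intro k hk hkJ
    rw [hA1, hA2]
    rw [sphericalGroup_comm] at hk
    rintro _ ⟨x, hx, rfl⟩
    refine h.maps_of_mem_s hin hout ?_ hk hkJ x hx
    rintro _ ⟨z, hz, rfl⟩ ⟨w, hw, e⟩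
    rw [mem_ball_zero_iff] at hz
    rw [mem_closedBall_zero_iff] at hw
    by_cases h0 : z = 0
    · rw [h0, reflDD_one.zero] at e
      exact OnePoint.coe_ne_infty _ e
    · rw [reflDD_one.coe z h0, OnePoint.coe_eq_coe] at e
      rw [e, hnorm _ _ one_pos, div_le_iff₀ (norm_pos_iff.2 h0)] at hw
      nlinarith [norm_nonneg z]
  · intro k hk hkJ
    rw [hA1, hA2]
    rw [sphericalGroup_comm] at hk
    rintro _ ⟨x, hx, rfl⟩
    refine h.maps_of_mem_t hout hin ?_ hk hkJ x hx
    intro x hx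
    induction x using OnePoint.rec with
    | infty => exact ⟨0, by simpa using hs0, reflDD_three.infty.symm⟩
    | coe z =>
      have hz : s < ‖z‖ := by
        by_contra h
        exact hx ⟨z, by simpa using h, rfl⟩
      have hz0 : 0 < ‖z‖ := hs0.trans hz
      refine ⟨_, ?_, (reflDD_three.coe z (norm_pos_iff.1 hz0)).symm⟩
      rw [mem_ball_zero_iff, hnorm _ _ (by positivity), div_lt_iff₀ hz0,
        inv_lt_iff_one_lt_mul₀ (by positivity)]
      nlinarith [mul_pos hs0 hp0, mul_pos hp0 hp0, mul_pos hs0 (mul_pos hp0 hp0)]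

end DD

/-! ### Normal closures in the amalgam of two dihedral groups -/

section DD

variable {n : ℕ} {G : Type} [Group G] {r : Fin 4 → G} {hn₁ : n ≠ 1} {h0 : 0 ≠ 1}

/-- The normal closure of `(r₂ r₄) ^ m` is cyclic: conjugation by a generator fixes or inverts
`r₂ r₄`. -/
theorem coxDD_normalClosureIn_eq (hl : (coxDD n 0 hn₁ h0).IsLiftable r) (m : ℕ) :
    normalClosureIn (Subgroup.closure (Set.range r)) ((r 1 * r 3) ^ m) =
      Subgroup.zpowers ((r 1 * r 3) ^ m) := by
  have inv := mul_self_of_isLiftable hl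
  set x := (r 1 * r 3) ^ m with hx
  have hri : ∀ i, (r i)⁻¹ = r i := fun i => inv_eq_of_mul_eq_one_left (inv i)
  have h13 : (r 1 * r 3)⁻¹ = r 3 * r 1 := by rw [_root_.mul_inv_rev, hri, hri]
  have key : ∀ i, r i * x * r i = x ∨ r i * x * r i = x⁻¹ := by
    intro i
    have hpow : ∀ i, r i * x * r i = (r i * (r 1 * r 3) * r i) ^ m := by
      intro i
      have := conj_pow (a := r i) (b := r 1 * r 3) (i := m)
      rw [hri] at this
      rw [this]
    have hcomm : ∀ i, Commute (r i) (r 1) → Commute (r i) (r 3) → r i * x * r i = x := by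
      intro i h1 h3
      rw [((h1.mul_right h3).pow_right m).eq, mul_assoc, inv, mul_one]
    fin_cases i
    · exact Or.inl (hcomm 0 (commute_of_isLiftable hl rfl) (commute_of_isLiftable hl rfl))
    · right
      change r 1 * x * r 1 = _
      rw [hpow, hx, ← inv_pow, h13, ← mul_assoc, inv, one_mul]
    · exact Or.inl (hcomm 2 (commute_of_isLiftable hl rfl) (commute_of_isLiftable hl rfl))
    · right
      change r 3 * x * r 3 = _
      rw [hpow, hx, ← inv_pow, h13, mul_assoc, mul_assoc, inv, mul_one]
  have key2 : ∀ h ∈ Subgroup.closure (Set.range r), h * x * h⁻¹ = x ∨ h * x * h⁻¹ = x⁻¹ := by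
    have step : ∀ i y, (y * x * y⁻¹ = x ∨ y * x * y⁻¹ = x⁻¹) →
        (r i * y * x * (r i * y)⁻¹ = x ∨ r i * y * x * (r i * y)⁻¹ = x⁻¹) := by
      intro i y hy
      have e : r i * y * x * (r i * y)⁻¹ = r i * (y * x * y⁻¹) * r i := by
        rw [_root_.mul_inv_rev, hri]; group
      rw [e]
      rcases hy with hy | hy
      · rw [hy]; exact key i
      · rw [hy]
        have e2 : r i * x⁻¹ * r i = (r i * x * r i)⁻¹ := by
          rw [_root_.mul_inv_rev, _root_.mul_inv_rev, hri, mul_assoc]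
        rw [e2]
        rcases key i with h | h
        · exact Or.inr (by rw [h])
        · exact Or.inl (by rw [h, inv_inv])
    intro h hh
    induction hh using Subgroup.closure_induction_left with
    | one => left; group
    | mul_left a ha y _ ih => obtain ⟨i, rfl⟩ := ha; exact step i y ih
    | inv_mul_cancel a ha y _ ih => obtain ⟨i, rfl⟩ := ha; rw [hri]; exact step i y ih
  apply le_antisymm
  · refine (Subgroup.closure_le _).2 ?_
    rintro _ ⟨h, hh, rfl⟩
    rcases key2 h hh with e | e
    · rw [e]; exact Subgroup.mem_zpowers x
    · rw [e]; exact inv_mem (Subgroup.mem_zpowers x)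
  · rw [Subgroup.zpowers_le]
    exact Subgroup.subset_closure ⟨1, Subgroup.one_mem _, by group⟩

/-- The quotient of the extended group by `⟨(r₂ r₄) ^ m⟩` is a product of two dihedral groups. -/
theorem coxDD_relIndex (h : HasCoxeterPresentation (coxDD n 0 hn₁ h0) r) (hn : 2 ≤ n) {m : ℕ}
    (hm : 1 ≤ m) : (Subgroup.zpowers ((r 1 * r 3) ^ m)).relIndex
      (Subgroup.closure (Set.range r)) = 2 * (2 * n * m) := by
  have hl := HasCoxeterPresentation.isLiftable h
  have inv := mul_self_of_isLiftable hl
  have : NeZero n := ⟨by omega⟩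
  have : NeZero m := ⟨by omega⟩
  have sr_ne : ∀ {l : ℕ} (i : ZMod l), (DihedralGroup.sr i : DihedralGroup l) ≠ 1 := by
    intro l i
    rw [DihedralGroup.one_def]
    exact nofun
  -- `r₁`, `r₃` generate the first factor and `r₂`, `r₄` the second one
  let f : Fin 4 → DihedralGroup n × DihedralGroup m :=
    ![(.sr 1, 1), (1, .sr 0), (.sr 0, 1), (1, .sr 1)]
  have hf : (coxDD n 0 hn₁ h0).IsLiftable f := by
    refine isLiftable_fin_four ?_ ?_
    · intro i; fin_cases i <;> simp [f]
    · intro i j hij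
      fin_cases i <;> fin_cases j <;> first | exact absurd hij (by decide) | skip
      · change ((DihedralGroup.sr 1, 1) * (1, DihedralGroup.sr 0)) ^ 2 = _
        simp [pow_two]
      · change ((DihedralGroup.sr 1, 1) * (DihedralGroup.sr 0, 1)) ^ n = _
        simp [Prod.ext_iff, DihedralGroup.r_pow]
      · change ((DihedralGroup.sr 1, 1) * (1, DihedralGroup.sr 1)) ^ 2 = _
        simp [pow_two]
      · change ((1, DihedralGroup.sr 0) * (DihedralGroup.sr 0, 1)) ^ 2 = _
        simp [pow_two]
      · exact pow_zero _
      · change ((DihedralGroup.sr 0, 1) * (1, DihedralGroup.sr 1)) ^ 2 = _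
        simp [pow_two]
  obtain ⟨q, hq⟩ := h.exists_hom hf
  let R : Fin 4 → Subgroup.closure (Set.range r) := fun i => ⟨r i, Subgroup.subset_closure ⟨i, rfl⟩⟩
  have hqR : ∀ i, q (R i) = f i := hq
  have q20 : q (R 2 * R 0) = (.r 1, 1) := by
    rw [map_mul, hqR, hqR]; simp [f]
  have q13 : q (R 1 * R 3) = (1, .r 1) := by
    rw [map_mul, hqR, hqR]; simp [f]
  have hsurj : Function.Surjective q := by
    have e1 : ∀ c : DihedralGroup n, ∃ y, q y = (c, 1) := by
      have hr1 : ∀ i : ZMod n, ∃ y, q y = (.r i, 1) := fun i => ⟨(R 2 * R 0) ^ i.val, by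
        rw [map_pow, q20, Prod.pow_mk, one_pow, DihedralGroup.r_one_pow, ZMod.natCast_zmod_val]⟩
      rintro (i | i)
      · exact hr1 i
      · obtain ⟨y, hy⟩ := hr1 (1 - i)
        exact ⟨y * R 0, by rw [map_mul, hy, hqR]; simp [f]⟩
    have e2 : ∀ c : DihedralGroup m, ∃ y, q y = (1, c) := by
      have hr1 : ∀ i : ZMod m, ∃ y, q y = (1, .r i) := fun i => ⟨(R 1 * R 3) ^ i.val, by
        rw [map_pow, q13, Prod.pow_mk, one_pow, DihedralGroup.r_one_pow, ZMod.natCast_zmod_val]⟩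
      rintro (i | i)
      · exact hr1 i
      · obtain ⟨y, hy⟩ := hr1 (0 - i)
        exact ⟨y * R 1, by rw [map_mul, hy, hqR]; simp [f]⟩
    rintro ⟨c, d⟩
    obtain ⟨y, hy⟩ := e1 c
    obtain ⟨y', hy'⟩ := e2 d
    exact ⟨y * y', by rw [map_mul, hy, hy']; simp⟩
  have hker : q.ker = (Subgroup.zpowers ((r 1 * r 3) ^ m)).subgroupOf (Subgroup.closure (Set.range r)) := by
    apply le_antisymm
    · -- every element is a product of one of `⟨r₁, r₃⟩` and one of `⟨r₂, r₄⟩`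
      have hdec : ∀ y ∈ Subgroup.closure (Set.range r), ∃ c ∈ Subgroup.closure {r 0, r 2},
          ∃ d ∈ Subgroup.closure {r 3, r 1}, y = c * d := by
        have hle : ∀ i, i = 1 ∨ i = 3 → ∀ c ∈ Subgroup.closure {r 0, r 2}, Commute (r i) c := by
          intro i hi c hc
          have : Subgroup.closure {r 0, r 2} ≤ Subgroup.centralizer {r i} := by
            rw [Subgroup.closure_le]
            rintro _ (rfl | rfl) <;> rcases hi with rfl | rfl <;>
              exact Subgroup.mem_centralizer_singleton_iff.2
                (commute_of_isLiftable hl rfl : Commute _ _).eq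
          exact (Subgroup.mem_centralizer_singleton_iff.1 (this hc)).symm
        have step : ∀ i y, (∃ c ∈ Subgroup.closure {r 0, r 2},
            ∃ d ∈ Subgroup.closure {r 3, r 1}, y = c * d) → (∃ c ∈ Subgroup.closure {r 0, r 2},
            ∃ d ∈ Subgroup.closure {r 3, r 1}, r i * y = c * d) := by
          rintro i _ ⟨y₁, hc, y₂, hd, rfl⟩
          have h02 : i = 0 ∨ i = 2 → _ := fun hi => (⟨r i * y₁, Subgroup.mul_mem _
            (Subgroup.subset_closure (by rcases hi with rfl | rfl <;> simp)) hc, y₂, hd,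
            (mul_assoc _ _ _).symm⟩ : ∃ c ∈ Subgroup.closure {r 0, r 2},
              ∃ d' ∈ Subgroup.closure {r 3, r 1}, r i * (y₁ * y₂) = c * d')
          have h13 : i = 1 ∨ i = 3 → _ := fun hi => (⟨y₁, hc, r i * y₂, Subgroup.mul_mem _
            (Subgroup.subset_closure (by rcases hi with rfl | rfl <;> simp)) hd,
            by rw [← mul_assoc, (hle i hi y₁ hc).eq, mul_assoc]⟩ :
              ∃ c ∈ Subgroup.closure {r 0, r 2},
              ∃ d' ∈ Subgroup.closure {r 3, r 1}, r i * (y₁ * y₂) = c * d')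
          have hi : ∀ i : Fin 4, (i = 0 ∨ i = 2) ∨ (i = 1 ∨ i = 3) := by decide
          exact (hi i).elim h02 h13
        intro y hy
        induction hy using Subgroup.closure_induction_left with
        | one => exact ⟨1, Subgroup.one_mem _, 1, Subgroup.one_mem _, by simp⟩
        | mul_left a ha y _ ih => obtain ⟨i, rfl⟩ := ha; exact step i y ih
        | inv_mul_cancel a ha y _ ih =>
          obtain ⟨i, rfl⟩ := ha
          rw [inv_eq_of_mul_eq_one_left (inv i)]
          exact step i y ih
      rintro ⟨y, hy⟩ hyq
      obtain ⟨c, hc, d, hd, rfl⟩ := hdec y hy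
      obtain ⟨k, hk⟩ := mem_closure_involutions (inv 0) (inv 2) hc
      obtain ⟨j, hj⟩ := mem_closure_involutions (inv 3) (inv 1) hd
      have qa : ∀ c' d' : Subgroup.closure (Set.range r), (c' : G) = c → (d' : G) = d →
          q c' * q d' = 1 := by
        intro c' d' h1 h2
        rw [← map_mul]
        have : c' * d' = ⟨c * d, hy⟩ := Subtype.ext (by rw [Subgroup.coe_mul, h1, h2])
        rw [this]; exact hyq
      have p20 : ∀ k : ℤ, q ((R 2 * R 0) ^ k) = (.r k, 1) := by
        intro k
        rw [map_zpow, q20]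
        ext1
        · change (DihedralGroup.r 1 : DihedralGroup n) ^ k = _
          rw [DihedralGroup.r_one_zpow]
        · change (1 : DihedralGroup m) ^ k = 1
          rw [_root_.one_zpow]
      have p13 : ∀ k : ℤ, q ((R 1 * R 3) ^ k) = (1, .r k) := by
        intro k
        rw [map_zpow, q13]
        ext1
        · change (1 : DihedralGroup n) ^ k = 1
          rw [_root_.one_zpow]
        · change (DihedralGroup.r 1 : DihedralGroup m) ^ k = _
          rw [DihedralGroup.r_one_zpow]
      have fin : (DihedralGroup.r (k : ZMod n), DihedralGroup.r (j : ZMod m)) = 1 →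
          ((r 2 * r 0) ^ k * (r 1 * r 3) ^ j ) ∈ Subgroup.zpowers ((r 1 * r 3) ^ m) := by
        intro e
        have e1 : (DihedralGroup.r (k : ZMod n)) = DihedralGroup.r 0 := congrArg Prod.fst e
        have e2 : (DihedralGroup.r (j : ZMod m)) = DihedralGroup.r 0 := congrArg Prod.snd e
        rw [DihedralGroup.r.injEq, ZMod.intCast_zmod_eq_zero_iff_dvd] at e1 e2
        obtain ⟨k', rfl⟩ := e1
        obtain ⟨j', rfl⟩ := e2
        rw [_root_.zpow_mul, _root_.zpow_mul, zpow_natCast, zpow_natCast,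
          show (r 2 * r 0) ^ n = 1 from hl 2 0, _root_.one_zpow, one_mul]
        exact Subgroup.zpow_mem _ (Subgroup.mem_zpowers _) _
      change c * d ∈ Subgroup.zpowers ((r 1 * r 3) ^ m)
      rcases hk with rfl | rfl <;> rcases hj with rfl | rfl
      · have := qa ((R 2 * R 0) ^ k) ((R 1 * R 3) ^ j) rfl rfl
        rw [p20, p13] at this
        exact fin (by simpa using this)
      · have := qa ((R 2 * R 0) ^ k) ((R 1 * R 3) ^ j * R 3) rfl rfl
        rw [map_mul, p20, p13, hqR] at this
        simp [f, Prod.ext_iff, sr_ne] at this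
      · have := qa ((R 2 * R 0) ^ k * R 0) ((R 1 * R 3) ^ j) rfl rfl
        rw [map_mul, p20, p13, hqR] at this
        simp [f, Prod.ext_iff, sr_ne] at this
      · have := qa ((R 2 * R 0) ^ k * R 0) ((R 1 * R 3) ^ j * R 3) rfl rfl
        rw [map_mul, map_mul, p20, p13, hqR, hqR] at this
        simp [f, Prod.ext_iff, sr_ne] at this
    · rintro ⟨y, hy⟩ ⟨k, hk⟩
      have e : (⟨y, hy⟩ : Subgroup.closure (Set.range r)) = ((R 1 * R 3) ^ m) ^ k := Subtype.ext hk.symm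
      rw [e, MonoidHom.mem_ker, map_zpow, map_pow, q13]
      have : ((1, DihedralGroup.r 1) : DihedralGroup n × DihedralGroup m) ^ m = 1 := by
        ext1
        · change (1 : DihedralGroup n) ^ m = 1
          rw [one_pow]
        · change (DihedralGroup.r 1 : DihedralGroup m) ^ m = 1
          rw [DihedralGroup.r_one_pow_n]
      rw [this, _root_.one_zpow]
  rw [Subgroup.relIndex, ← hker, Subgroup.index_ker, MonoidHom.range_eq_top.2 hsurj,
    Subgroup.card_top, Nat.card_prod, DihedralGroup.nat_card, DihedralGroup.nat_card]
  ring

theorem coxDD_apply_eq_or {n m : ℕ} (hn : n ≠ 1) (hm : m ≠ 1) (h0 : 0 ≠ 1) (i j : Fin 4) :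
    coxDD n m hn hm i j = coxDD n 0 hn h0 i j ∨ (i = 1 ∧ j = 3) ∨ (i = 3 ∧ j = 1) := by
  change !![1, 2, n, 2; 2, 1, 2, m; n, 2, 1, 2; 2, m, 2, 1] i j =
    !![1, 2, n, 2; 2, 1, 2, 0; n, 2, 1, 2; 2, 0, 2, 1] i j ∨ _
  fin_cases i <;> fin_cases j <;> simp

theorem amalgamCharacteristic_dihedral {K₁ K₂ J : Subgroup SpherePerm} (hn : n ≠ 0)
    (h1 : Nat.card K₁ = 2 * n) (h2 : Nat.card K₂ = 2 * n) (h3 : Nat.card J = n) :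
    amalgamCharacteristic K₁ K₂ J = 0 := by
  have : (n : ℚ) ≠ 0 := by exact_mod_cast hn
  rw [amalgamCharacteristic, h1, h2, h3]
  push_cast
  field_simp
  ring

/-- The amalgam `D_{2n} *_{ℤ_n} D_{2n}` and its normal Schottky subgroups of rank one. -/
theorem amalgam_dihedral_dihedral (n : ℕ) (hn : 2 ≤ n) (p : ℝ) (hp : 1 < p)
    (r : Fin 4 → SpherePerm) (hr : r = reflDD n p hp) (K₁ K₂ J : Subgroup SpherePerm)
    (hK₁ : K₁ = sphericalGroup r 0 1 2) (hK₂ : K₂ = sphericalGroup r 0 3 2)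
    (hJ : J = Subgroup.zpowers (r 2 * r 0)) :
      IsExtendedKleinian (extendedGroup r) ∧
      HasCoxeterPresentation (coxDD n 0 (Nat.ne_of_gt hn) (by decide)) r ∧
      orderOf (r 1 * r 3) = 0 ∧
      Nonempty (K₁ ≃* DihedralGroup n) ∧ Nonempty (K₂ ≃* DihedralGroup n) ∧ Nat.card J = n ∧
      IsMaskitCombination K₁ K₂ J ∧ IsAmalgam ![K₁, K₂] J (conformalGroup r) ∧
      amalgamCharacteristic K₁ K₂ J = 0 ∧
      ∀ m : ℕ, 1 ≤ m → ∀ S : Subgroup SpherePerm,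
        S = normalClosureIn (extendedGroup r) ((r 1 * r 3) ^ m) →
        IsNormalIn S (extendedGroup r) ∧ S ≤ conformalGroup r ∧
        IsFreeBasis ![(r 1 * r 3) ^ m] S ∧ IsSchottkySystem ![(r 1 * r 3) ^ m] ∧
        S.relIndex (conformalGroup r) = 2 * n * m ∧
        ∀ hm : m ≠ 1, Finite (coxDD n m (Nat.ne_of_gt hn) hm).Group ∧
          HasCoxeterQuotient (coxDD n m (Nat.ne_of_gt hn) hm) r S := by
  have hanti : ∀ i, IsAntiConformal (r i) := hr ▸ reflDD_anti
  have hord : orderOf (r 1 * r 3) = 0 := hr ▸ reflDD_orderOf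
  have hSch : ∀ m : ℕ, 1 ≤ m → IsSchottkySystem ![(r 1 * r 3) ^ m] :=
    fun m hm => hr ▸ reflDD_isSchottkySystem hm
  have hMask : IsMaskitCombination K₁ K₂ J := by
    rw [hK₁, hK₂, hJ, hr]; exact reflDD_isMaskitCombination hn
  obtain ⟨z₀, U, h⟩ := reflDD_amalgam (p := p) (hp := hp) hn
  rw [← hr] at h
  clear hr
  subst hK₁ hK₂ hJ
  have : NeZero n := ⟨by omega⟩
  have e1 : Nonempty (sphericalGroup r 0 1 2 ≃* DihedralGroup n) := by
    rw [sphericalGroup_comm]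
    exact h.dihedral_of_commute h.s_notMem_zpowers (commute_of_isLiftable h.lift rfl)
      (commute_of_isLiftable h.lift rfl)
  have e2 : Nonempty (sphericalGroup r 0 3 2 ≃* DihedralGroup n) := by
    rw [sphericalGroup_comm]
    exact h.dihedral_of_commute h.t_notMem_zpowers (commute_of_isLiftable h.lift rfl)
      (commute_of_isLiftable h.lift rfl)
  have hmem : ∀ i, r i ∈ extendedGroup r := fun i => Subgroup.subset_closure ⟨i, rfl⟩
  refine ⟨h.isExtendedKleinian, h.hasCoxeterPresentation, hord, e1, e2, h.card_zpowers, hMask,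
    ?_, ?_, ?_⟩
  · rw [sphericalGroup_comm _ 0 1 2, sphericalGroup_comm _ 0 3 2]; exact h.isAmalgam
  · obtain ⟨e1⟩ := e1
    obtain ⟨e2⟩ := e2
    exact amalgamCharacteristic_dihedral (by omega)
      ((Nat.card_congr e1.toEquiv).trans DihedralGroup.nat_card)
      ((Nat.card_congr e2.toEquiv).trans DihedralGroup.nat_card) h.card_zpowers
  · rintro m hm S rfl
    have hx : (r 1 * r 3) ^ m ∈ extendedGroup r := pow_mem (mul_mem (hmem 1) (hmem 3)) m
    have hS : normalClosureIn (extendedGroup r) ((r 1 * r 3) ^ m) = _ :=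
      coxDD_normalClosureIn_eq h.lift m
    have hidx := coxDD_relIndex h.hasCoxeterPresentation hn hm
    have hle : Subgroup.zpowers ((r 1 * r 3) ^ m) ≤ conformalGroup r := by
      rw [Subgroup.zpowers_le]
      exact ⟨hx, mobiusGroup.pow_mem ((hanti 1).mul (hanti 3)) m⟩
    have hquot : ∀ hm : m ≠ 1, HasCoxeterQuotient (coxDD n m (Nat.ne_of_gt hn) hm) r
        (normalClosureIn (extendedGroup r) ((r 1 * r 3) ^ m)) := by
      intro hm
      exact hasCoxeterQuotient_normalClosureIn (a := 1) (b := 3) h.hasCoxeterPresentation rfl rfl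
        (coxDD_apply_eq_or _ hm _)
    refine ⟨isNormalIn_normalClosureIn hx, hS ▸ hle, ?_, hSch m hm, ?_, ?_⟩
    · rw [hS]
      exact isFreeBasis_one (by rw [orderOf_pow' _ (by omega), hord, Nat.zero_div])
    · rw [hS]; exact h.relIndex_eq hle hidx
    · intro hm1
      refine ⟨(hquot hm1).finite ?_, hquot hm1⟩
      rw [hS, hidx]
      positivity

end DD

/-! ### Reflections in circles -/

/-- The braid relation for two involutions whose product has order dividing three. -/
theorem eq_of_sq_eq_one_of_pow_three {G : Type*} [Group G] {a b : G} (ha : a * a = 1)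
    (hb : b * b = 1) (h : (a * b) ^ 3 = 1) : b * a * b = a * b * a := by
  have h1 : a * b * a * (b * a * b) = 1 := by
    rw [← h]; simp only [pow_succ, pow_zero, one_mul, mul_assoc]
  rw [eq_inv_of_mul_eq_one_right h1]
  simp only [_root_.mul_inv_rev, inv_eq_of_mul_eq_one_left ha, inv_eq_of_mul_eq_one_left hb,
    mul_assoc]

/-- The double coset condition for a reflection `s` that commutes with one generator of the
dihedral group and satisfies a braid relation with the other. -/
theorem coset_of_braid {G : Type*} [Group G] {a b s : G} (ha : a * a = 1) (hb : b * b = 1)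
    (hs : s * s = 1) (has : Commute s a) (hbs : s * b * s = b * s * b)
    (hab : b * a * b = a ∨ b * a * b = a * b * a) {C : Subgroup G}
    (hC : C = Subgroup.closure {a, b}) {c : G} (hc : c ∈ C) :
    s * c * s ∈ C ∨ ∃ c₁ ∈ C, ∃ c₂ ∈ C, s * c * s = c₁ * s * c₂ := by
  have haC : a ∈ C := hC ▸ Subgroup.subset_closure (by simp)
  have hbC : b ∈ C := hC ▸ Subgroup.subset_closure (by simp)
  -- with `A = {1, a}` the dihedral group is `A ∪ A b A`
  have hform : ∃ u, (u = 1 ∨ u = a) ∧ (c = u ∨ ∃ v, (v = 1 ∨ v = a) ∧ c = u * b * v) := by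
    have hA : ∀ y, (∃ u, (u = 1 ∨ u = a) ∧ (y = u ∨ ∃ v, (v = 1 ∨ v = a) ∧ y = u * b * v)) →
        ∃ u, (u = 1 ∨ u = a) ∧ (a * y = u ∨ ∃ v, (v = 1 ∨ v = a) ∧ a * y = u * b * v) := by
      rintro y ⟨u, hu, h⟩
      refine ⟨a * u, by rcases hu with rfl | rfl <;> simp [ha], ?_⟩
      rcases h with rfl | ⟨v, hv, rfl⟩
      · exact Or.inl rfl
      · exact Or.inr ⟨v, hv, by simp only [mul_assoc]⟩
    have hB : ∀ y, (∃ u, (u = 1 ∨ u = a) ∧ (y = u ∨ ∃ v, (v = 1 ∨ v = a) ∧ y = u * b * v)) →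
        ∃ u, (u = 1 ∨ u = a) ∧ (b * y = u ∨ ∃ v, (v = 1 ∨ v = a) ∧ b * y = u * b * v) := by
      rintro y ⟨u, hu, h⟩
      rcases h with rfl | ⟨v, hv, rfl⟩
      · exact ⟨1, Or.inl rfl, Or.inr ⟨y, hu, by rw [one_mul]⟩⟩
      · rcases hu with rfl | rfl
        · exact ⟨v, hv, Or.inl (by rw [one_mul, ← mul_assoc, hb, one_mul])⟩
        · rcases hab with hab | hab
          · exact ⟨u * v, by rcases hv with rfl | rfl <;> simp [ha],
              Or.inl (by rw [← mul_assoc, ← mul_assoc, hab])⟩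
          · exact ⟨u, Or.inr rfl, Or.inr ⟨u * v, by rcases hv with rfl | rfl <;> simp [ha],
              by rw [← mul_assoc, ← mul_assoc, hab, mul_assoc (u * b)]⟩⟩
    rw [hC] at hc
    induction hc using Subgroup.closure_induction_left with
    | one => exact ⟨1, Or.inl rfl, Or.inl rfl⟩
    | mul_left x hx y _ ih =>
      rcases hx with rfl | rfl
      · exact hA y ih
      · exact hB y ih
    | inv_mul_cancel x hx y _ ih =>
      rcases hx with rfl | rfl
      · rw [inv_eq_of_mul_eq_one_left ha]; exact hA y ih
      · rw [inv_eq_of_mul_eq_one_left hb]; exact hB y ih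
  have hcomm : ∀ u, u = 1 ∨ u = a → u ∈ C ∧ s * u = u * s := by
    rintro u (rfl | rfl)
    · exact ⟨one_mem C, by simp⟩
    · exact ⟨haC, has.eq⟩
  obtain ⟨u, hu, rfl | ⟨v, hv, rfl⟩⟩ := hform
  · left
    rw [(hcomm c hu).2, mul_assoc, hs, mul_one]
    exact (hcomm c hu).1
  · right
    refine ⟨u * b, mul_mem (hcomm u hu).1 hbC, b * v, mul_mem hbC (hcomm v hv).1, ?_⟩
    calc s * (u * b * v) * s = s * u * b * (v * s) := by group
      _ = u * (s * b * s) * v := by rw [(hcomm u hu).2, ← (hcomm v hv).2]; group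
      _ = u * b * s * (b * v) := by rw [hbs]; group

/-- `f` is the reflection in the circle with centre `c` on the real line and radius `√R`. -/
structure IsCircleReflection (f : SpherePerm) (c R : ℝ) : Prop where
  pos : 0 < R
  coe : ∀ z : ℂ, z ≠ c → f (z : Sphere) = ((c + R / (starRingEnd ℂ z - c) : ℂ) : Sphere)
  center : f ((c : ℂ) : Sphere) = OnePoint.infty
  infty : f OnePoint.infty = ((c : ℂ) : Sphere)

theorem IsInversion.isCircleReflection {f : SpherePerm} {s : ℝ} (h : IsInversion f s) :
    IsCircleReflection f 0 s where
  pos := h.pos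
  coe z hz := by rw [h.coe z (by simpa using hz)]; simp
  center := by simpa using h.zero
  infty := by simpa using h.infty

theorem isCircleReflection_antiMobius {a b d : ℂ} {c R : ℝ} (hR : 0 < R)
    (h : (!![a, b; d, -a] : Matrix (Fin 2) (Fin 2) ℂ).det ≠ 0) (hd : d ≠ 0) (ha : a = d * c)
    (hb : b = d * (R - c ^ 2)) : IsCircleReflection (antiMobius !![a, b; d, -a] h) c R := by
  refine ⟨hR, fun z hz => ?_, antiMobius_coe_eq_infty h ?_, ?_⟩
  · have hz' : starRingEnd ℂ z - c ≠ 0 := by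
      intro h0
      apply hz
      rw [sub_eq_zero] at h0
      rw [← Complex.conj_conj z, h0, Complex.conj_ofReal]
    have e : d * starRingEnd ℂ z + -a = d * (starRingEnd ℂ z - c) := by rw [ha]; ring
    rw [antiMobius_coe h, OnePoint.coe_eq_coe]
    · simp only [of_apply, cons_val', cons_val_zero, cons_val_fin_one, cons_val_one]
      rw [e, ha, hb]
      field_simp
      ring
    · simp only [of_apply, cons_val', cons_val_zero, cons_val_fin_one, cons_val_one]
      rw [e]
      exact mul_ne_zero hd hz'
  · simp [ha]
  · rw [antiMobius_infty h (by simpa using hd)]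
    simp [ha, hd]

namespace IsCircleReflection

variable {f : SpherePerm} {c R : ℝ}

theorem ne_center {z : ℂ} (hz : 0 < (z.re - c) ^ 2 + z.im ^ 2) : z ≠ c := by
  rintro rfl
  simp at hz

theorem pos_of_ne {z : ℂ} (hz : z ≠ c) : 0 < (z.re - c) ^ 2 + z.im ^ 2 := by
  by_contra h
  have h1 : z.re - c = 0 := by nlinarith [sq_nonneg (z.re - c), sq_nonneg z.im]
  have h2 : z.im = 0 := by nlinarith [sq_nonneg (z.re - c), sq_nonneg z.im]
  exact hz (Complex.ext (by simpa [sub_eq_zero] using h1) (by simpa using h2))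

/-- The reflection in coordinates. -/
theorem exists_coe (h : IsCircleReflection f c R) {z : ℂ}
    (hz : 0 < (z.re - c) ^ 2 + z.im ^ 2) : ∃ w : ℂ, f (z : Sphere) = (w : Sphere) ∧
      w.re = c + R * (z.re - c) / ((z.re - c) ^ 2 + z.im ^ 2) ∧
      w.im = R * z.im / ((z.re - c) ^ 2 + z.im ^ 2) := by
  have e : Complex.normSq (starRingEnd ℂ z - c) = (z.re - c) ^ 2 + z.im ^ 2 := by
    rw [Complex.normSq_apply]; simp; ring
  refine ⟨_, h.coe z (ne_center hz), ?_, ?_⟩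
  · rw [Complex.add_re, Complex.ofReal_re, Complex.div_re, e]; simp
  · rw [Complex.add_im, Complex.ofReal_im, Complex.div_im, e]; simp [neg_div]

end IsCircleReflection

theorem IsMirror.exists_coe {f : SpherePerm} {ζ : ℂ} (h : IsMirror f ζ) (z : ℂ) :
    ∃ w : ℂ, f (z : Sphere) = (w : Sphere) ∧ w.re = ζ.re * z.re + ζ.im * z.im ∧
      w.im = ζ.im * z.re - ζ.re * z.im :=
  ⟨_, h.coe z, by simp, by simp; ring⟩

theorem zeta_three : zeta 3 = ⟨-1 / 2, √3 / 2⟩ := by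
  have h := zeta_zpow 3 1
  rw [zpow_one] at h
  have e : (2 * π * (1 : ℤ) / (3 : ℕ) : ℝ) = π - π / 3 := by push_cast; ring
  rw [h, e]
  apply Complex.ext
  · rw [Complex.exp_ofReal_mul_I_re, Real.cos_pi_sub, Real.cos_pi_div_three]; norm_num
  · rw [Complex.exp_ofReal_mul_I_im, Real.sin_pi_sub, Real.sin_pi_div_three]

/-! ### The amalgam of the dihedral groups of orders four and six -/

section D4D6

variable {p : ℝ} {hp : 1 < p}

theorem reflD4D6_zero : IsMirror (reflD4D6 p hp 0) 1 := isMirror_conjPerm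

theorem reflD4D6_one : IsInversion (reflD4D6 p hp 1) 1 :=
  isInversion_antiMobius _ one_pos (by simp)

theorem reflD4D6_two : IsMirror (reflD4D6 p hp 2) (zeta 3) :=
  isMirror_antiMobius _ (by simpa [zeta] using zeta_mul_conj 3)

theorem reflD4D6_three : IsCircleReflection (reflD4D6 p hp 3) p (p ^ 2 - 1) :=
  isCircleReflection_antiMobius (by nlinarith) _ one_ne_zero (by simp) (by push_cast; ring)

theorem reflD4D6_anti (i : Fin 4) : IsAntiConformal (reflD4D6 p hp i) := by
  fin_cases i
  · exact isAntiConformal_conjPerm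
  all_goals exact isAntiConformal_antiMobius _

theorem map_conj_of_real (a b c d : ℝ) :
    (!![(a : ℂ), b; c, d]).map (starRingEnd ℂ) = !![(a : ℂ), b; c, d] := by
  ext i j
  fin_cases i <;> fin_cases j <;> simp

theorem reflD4D6_isLiftable : (coxD4D6 0 (by decide)).IsLiftable (reflD4D6 p hp) := by
  have e3 : reflD4D6 p hp 3 = antiMobius !![(p : ℂ), -1; 1, -(p : ℂ)] (by
      rw [det_fin_two_of]
      have h : p * -p - -1 * 1 ≠ 0 := by nlinarith
      exact_mod_cast h) := rfl
  have hmap : (!![(p : ℂ), -1; 1, -(p : ℂ)]).map (starRingEnd ℂ) = !![(p : ℂ), -1; 1, -(p : ℂ)] := by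
    simpa using map_conj_of_real p (-1) 1 (-p)
  have inv : ∀ i, reflD4D6 p hp i * reflD4D6 p hp i = 1 := by
    intro i
    fin_cases i
    · exact reflD4D6_zero.mul_self
    · exact reflD4D6_one.mul_self
    · exact reflD4D6_two.mul_self
    · change reflD4D6 p hp 3 * reflD4D6 p hp 3 = 1
      rw [← pow_one (reflD4D6 p hp 3 * reflD4D6 p hp 3), e3]
      refine antiMobius_mul_antiMobius_pow_eq_one (c := p ^ 2 - 1) _ _ ?_
      rw [hmap, pow_one, Matrix.mul_fin_two, Matrix.one_fin_two, Matrix.smul_of]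
      simp
      ring_nf
      trivial
  refine isLiftable_fin_four inv ?_
  intro i j hij
  fin_cases i <;> fin_cases j <;> first | exact absurd hij (by decide) | skip
  · exact reflD4D6_zero.mul_inversion_sq reflD4D6_one
  · exact mul_pow_eq_one_comm (inv 2) (inv 0)
      (reflD4D6_two.rot_pow (n := 3) (by norm_num) reflD4D6_zero)
  · change (conjPerm * reflD4D6 p hp 3) ^ 2 = 1
    rw [conjPerm_eq_antiMobius, e3]
    refine antiMobius_mul_antiMobius_pow_eq_one (c := p ^ 2 - 1) _ _ ?_
    rw [hmap, one_mul, pow_two, Matrix.mul_fin_two, Matrix.one_fin_two, Matrix.smul_of]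
    simp
    ring_nf
    trivial
  · exact mul_pow_eq_one_comm (inv 2) (inv 1) (reflD4D6_two.mul_inversion_sq reflD4D6_one)
  · change (antiMobius !![0, 1; 1, 0] _ * reflD4D6 p hp 3) ^ 2 = 1
    rw [e3]
    refine antiMobius_mul_antiMobius_pow_eq_one (c := 1 - p ^ 2) _ _ ?_
    rw [hmap, pow_two, Matrix.mul_fin_two, Matrix.mul_fin_two, Matrix.one_fin_two, Matrix.smul_of]
    simp
    ring_nf
    trivial
  · exact pow_zero _

/-- The reflection `r₃` in the line of argument `π / 3` takes the sector `|arg z| < π / 3` to the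
outside of the closed sector. -/
theorem reflD4D6_two_maps {z : ℂ} (hx : 0 < z.re) (hy : z.im ^ 2 < 3 * z.re ^ 2) :
    ∃ w : ℂ, reflD4D6 p hp 2 (z : Sphere) = (w : Sphere) ∧
      (w.re < 0 ∨ 3 * w.re ^ 2 < w.im ^ 2) := by
  obtain ⟨w, hw, hre, him⟩ := (reflD4D6_two (hp := hp)).exists_coe z
  refine ⟨w, hw, ?_⟩
  rw [zeta_three] at hre him
  simp only at hre him
  have h3 : √3 ^ 2 = 3 := Real.sq_sqrt (by norm_num)
  have h3' : 0 < √3 := by positivity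
  rcases le_or_gt z.im 0 with h0 | h0
  · left; rw [hre]; nlinarith
  · right
    have h4 : z.im < √3 * z.re := by
      by_contra h
      push Not at h
      have : (√3 * z.re) ^ 2 ≤ z.im ^ 2 := pow_le_pow_left₀ (by positivity) h 2
      rw [mul_pow, h3] at this
      linarith
    have e : 3 * w.re ^ 2 - w.im ^ 2 = 2 * z.im * (z.im - √3 * z.re) := by
      rw [hre, him]; linear_combination (3 / 4 * z.im ^ 2 - 1 / 4 * z.re ^ 2) * h3
    nlinarith [mul_pos h0 (sub_pos.2 h4)]

/-- The sets of the ping-pong: the disc bounded by the circle of `r₄`, the complement of the closed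
sector `|arg z| ≤ π / 3`, and the part of the open sector outside the circle of `r₄`. -/
theorem reflD4D6_amalgam (hp2 : p ≤ 2) : ∃ z₀ : ℂ, ∃ U : Set ℂ,
    ReflectionAmalgam (coxD4D6 0 (by decide)) (reflD4D6 p hp) 1 3 2 2 z₀ U
      (((↑) : ℂ → Sphere) '' {z | 0 < z.re ∧ z.im ^ 2 < 3 * z.re ^ 2 ∧
        2 * p * z.re < z.re ^ 2 + z.im ^ 2 + 1})
      (((↑) : ℂ → Sphere) '' {z | z.re < 0 ∨ 3 * z.re ^ 2 < z.im ^ 2})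
      (((↑) : ℂ → Sphere) '' {z | z.re ^ 2 + z.im ^ 2 + 1 < 2 * p * z.re}) := by
  have hlift := reflD4D6_isLiftable (p := p) (hp := hp)
  have h0 := reflD4D6_zero (p := p) (hp := hp)
  have h1 := (reflD4D6_one (p := p) (hp := hp))
  have h1c := h1.isCircleReflection
  have h3 := reflD4D6_three (p := p) (hp := hp)
  have h2 := fun z => reflD4D6_two_maps (p := p) (hp := hp) (z := z)
  set r := reflD4D6 p hp with hr
  -- the two reflections of the dihedral group of order four, in coordinates
  have mirror : ∀ z : ℂ, ∃ w : ℂ, r 0 (z : Sphere) = w ∧ w.re = z.re ∧ w.im = -z.im := by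
    intro z
    obtain ⟨w, hw, e1, e2⟩ := h0.exists_coe z
    exact ⟨w, hw, by simpa using e1, by simpa using e2⟩
  have inversion : ∀ z : ℂ, 0 < z.re ^ 2 + z.im ^ 2 → ∃ w : ℂ, ∃ t : ℝ, r 1 (z : Sphere) = w ∧
      0 < t ∧ t * (z.re ^ 2 + z.im ^ 2) = 1 ∧ w.re = t * z.re ∧ w.im = t * z.im := by
    intro z hz
    obtain ⟨w, hw, e1, e2⟩ := h1c.exists_coe (z := z) (by simpa using hz)
    refine ⟨w, _, hw, inv_pos.2 hz, inv_mul_cancel₀ hz.ne', ?_, ?_⟩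
    · rw [e1]; simp only [sub_zero, zero_add, one_mul]; field_simp
    · rw [e2]; simp only [sub_zero, one_mul]; field_simp
  -- `U` lies in the upper half of the unit disc, which `r₁`, `r₂` and `r₂ r₁` map off itself; as
  -- `|z₀|² = 1 / 20`, the inversion `r₂` multiplies `z₀` by `20`
  set z₀ : ℂ := ⟨1 / 5, 1 / 10⟩ with hz₀
  refine ⟨z₀, {z | 0 < z.im ∧ 0 < z.re ∧ z.im ^ 2 < 3 * z.re ^ 2 ∧ z.re ^ 2 + z.im ^ 2 < 1 ∧
    2 * p * z.re < z.re ^ 2 + z.im ^ 2 + 1}, ?_⟩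
  have rotation : ∀ k : ℤ, (2 : ℤ) ∣ k ∨ (r 1 * r 0) ^ k = r 1 * r 0 := by
    intro k
    rcases Int.even_or_odd k with ⟨l, rfl⟩ | ⟨l, rfl⟩
    · exact Or.inl ⟨l, by ring⟩
    · right
      have h : (r 1 * r 0) ^ (2 : ℤ) = 1 := by exact_mod_cast hlift 1 0
      rw [_root_.zpow_add, _root_.zpow_mul, h, _root_.one_zpow, one_mul, zpow_one]
  have inv := mul_self_of_isLiftable hlift
  have outside : ∀ z : ℂ, z.re ^ 2 + z.im ^ 2 = 1 / 20 → ∃ w : ℂ, r 1 (z : Sphere) = w ∧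
      ¬ (w.re ^ 2 + w.im ^ 2 < 1) := by
    intro z hz
    obtain ⟨w, t, hw, -, ht, e1, e2⟩ := inversion z (by rw [hz]; norm_num)
    rw [hz] at ht
    have ht : t = 20 := by linarith
    rw [ht] at e1 e2
    refine ⟨w, hw, ?_⟩
    rw [e1, e2, mul_pow, mul_pow, ← mul_add, hz]
    norm_num
  refine
  { univ := by decide
    anti := reflD4D6_anti
    lift := hlift
    order := rfl
    pos := by norm_num
    coset_s := fun G _ f hf C hC c hc => coset_of_commute (mul_self_of_isLiftable hf 3)
      (commute_of_isLiftable hf rfl) (commute_of_isLiftable hf rfl) hC hc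
    coset_t := fun G _ f hf C hC c hc => by
      have inv := mul_self_of_isLiftable hf
      refine coset_of_braid (inv 1) (inv 0) (inv 2) (commute_of_isLiftable hf rfl)
        (eq_of_sq_eq_one_of_pow_three (inv 0) (inv 2) (hf 0 2)) (Or.inl ?_)
        (hC.trans (by rw [Set.pair_comm])) hc
      rw [(commute_of_isLiftable hf rfl : Commute (f 0) (f 1)).eq, mul_assoc, inv, mul_one]
    mapsY := ?_
    maps₁ := ?_
    maps₂ := ?_
    maps_s := ?_
    maps_t := ?_
    isOpen := ?_
    mem := ?_
    memY := ?_
    disjY := ?_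
    disj := ?_
    rot := ?_
    refl := ?_ }
  · rintro i (rfl | rfl) _ ⟨z, ⟨hz1, hz2, hz3⟩, rfl⟩
    · obtain ⟨w, hw, e1, e2⟩ := mirror z
      exact ⟨w, by rw [Set.mem_ofPred_eq, e1, e2, neg_sq]; exact ⟨hz1, hz2, hz3⟩, hw.symm⟩
    · obtain ⟨w, t, hw, ht, hN, e1, e2⟩ := inversion z (by positivity)
      refine ⟨w, ⟨?_, ?_, ?_⟩, hw.symm⟩
      · rw [e1]; positivity
      · rw [e1, e2, mul_pow, mul_pow]
        nlinarith [mul_pos ht ht]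
      · have := mul_lt_mul_of_pos_left hz3 ht
        rw [e1, e2]
        nlinarith
  · rintro i (rfl | rfl) _ ⟨z, hz, rfl⟩
    · obtain ⟨w, hw, e1, e2⟩ := mirror z
      exact ⟨w, by rw [Set.mem_ofPred_eq, e1, e2, neg_sq]; exact hz, hw.symm⟩
    · have hN : 0 < z.re ^ 2 + z.im ^ 2 := by
        rcases hz with hz | hz <;> nlinarith [sq_nonneg z.re, sq_nonneg z.im]
      obtain ⟨w, t, hw, ht, hN, e1, e2⟩ := inversion z hN
      refine ⟨w, ?_, hw.symm⟩
      rw [Set.mem_ofPred_eq, e1, e2]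
      rcases hz with hz | hz
      · exact Or.inl (mul_neg_of_pos_of_neg ht hz)
      · right
        rw [mul_pow, mul_pow]
        nlinarith [mul_pos ht ht]
  · rintro i (rfl | rfl) _ ⟨z, hz, rfl⟩
    · obtain ⟨w, hw, e1, e2⟩ := mirror z
      exact ⟨w, by rw [Set.mem_ofPred_eq, e1, e2, neg_sq]; exact hz, hw.symm⟩
    · have hz' : z.re ^ 2 + z.im ^ 2 + 1 < 2 * p * z.re := hz
      have hN : 0 < z.re ^ 2 + z.im ^ 2 := by
        have : 0 < z.re := by
          by_contra h
          nlinarith [sq_nonneg z.re, sq_nonneg z.im]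
        positivity
      obtain ⟨w, t, hw, ht, hN, e1, e2⟩ := inversion z hN
      refine ⟨w, ?_, hw.symm⟩
      have := mul_lt_mul_of_pos_left hz' ht
      rw [Set.mem_ofPred_eq, e1, e2]
      nlinarith
  · intro x hx
    obtain ⟨z, hz, rfl⟩ : ∃ z : ℂ, 2 * p * z.re < z.re ^ 2 + z.im ^ 2 + 1 ∧ (z : Sphere) = x := by
      rcases hx with ⟨z, hz, rfl⟩ | ⟨z, hz, rfl⟩
      · exact ⟨z, hz.2.2, rfl⟩
      · refine ⟨z, ?_, rfl⟩
        rcases hz with hz | hz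
        · nlinarith [sq_nonneg z.re, sq_nonneg z.im]
        · nlinarith [sq_nonneg (2 * z.re - 1), sq_nonneg (2 * z.re + 1), sq_nonneg z.re]
    by_cases hc : z = p
    · rw [hc] at hz
      simp at hz
      nlinarith
    · have hN := IsCircleReflection.pos_of_ne hc
      obtain ⟨w, hw, e1, e2⟩ := h3.exists_coe hN
      refine ⟨w, ?_, hw.symm⟩
      rw [Set.mem_ofPred_eq]
      set N := (z.re - p) ^ 2 + z.im ^ 2 with hNdef
      have e : w.re ^ 2 + w.im ^ 2 + 1 - 2 * p * w.re = (p ^ 2 - 1) * ((p ^ 2 - 1) - N) / N := by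
        have : (w.re - p) ^ 2 + w.im ^ 2 = (p ^ 2 - 1) ^ 2 / N := by
          rw [e1, e2]
          field_simp
          rw [hNdef]
          ring
        have h5 : (p ^ 2 - 1) * ((p ^ 2 - 1) - N) / N = (p ^ 2 - 1) ^ 2 / N - (p ^ 2 - 1) := by
          field_simp
        rw [h5, ← this]
        ring
      have : (p ^ 2 - 1) * ((p ^ 2 - 1) - N) / N < 0 :=
        div_neg_of_neg_of_pos (mul_neg_of_pos_of_neg h3.pos (by rw [hNdef]; linarith)) hN
      linarith
  · intro x hx
    obtain ⟨z, hz1, hz2, rfl⟩ : ∃ z : ℂ, 0 < z.re ∧ z.im ^ 2 < 3 * z.re ^ 2 ∧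
        (z : Sphere) = x := by
      rcases hx with ⟨z, hz, rfl⟩ | ⟨z, hz, rfl⟩
      · exact ⟨z, hz.1, hz.2.1, rfl⟩
      · have hz' : z.re ^ 2 + z.im ^ 2 + 1 < 2 * p * z.re := hz
        have h : 0 < z.re := by
          by_contra h
          nlinarith [sq_nonneg z.re, sq_nonneg z.im]
        refine ⟨z, h, ?_, rfl⟩
        nlinarith [sq_nonneg (2 * z.re - 1)]
    obtain ⟨w, hw, h⟩ := h2 z hz1 hz2
    exact ⟨w, h, hw.symm⟩
  · have hre := Complex.continuous_re
    have him := Complex.continuous_im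
    exact (isOpen_lt continuous_const him).inter ((isOpen_lt continuous_const hre).inter
      ((isOpen_lt (him.pow 2) (continuous_const.mul (hre.pow 2))).inter
      ((isOpen_lt ((hre.pow 2).add (him.pow 2)) continuous_const).inter
      (isOpen_lt (continuous_const.mul hre) (((hre.pow 2).add (him.pow 2)).add continuous_const)))))
  · simp only [hz₀, Set.mem_ofPred_eq]
    norm_num
    linarith
  · refine ⟨z₀, ?_, rfl⟩
    simp only [hz₀, Set.mem_ofPred_eq]
    norm_num
    linarith
  · rintro _ ⟨z, ⟨hz1, hz2, hz3⟩, rfl⟩ (⟨w, hw, e⟩ | ⟨w, hw, e⟩)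
    all_goals
      rw [OnePoint.coe_eq_coe] at e
      rw [e] at hw
    · rcases hw with hw | hw <;> linarith
    · exact lt_asymm hz3 hw
  · rintro z ⟨-, hz1, hz2, -, hz3⟩ (⟨w, hw, e⟩ | ⟨w, hw, e⟩)
    all_goals
      rw [OnePoint.coe_eq_coe] at e
      rw [e] at hw
    · rcases hw with hw | hw <;> linarith
    · exact lt_asymm hz3 hw
  · rintro k ⟨w, hw, e⟩
    rcases rotation k with h | h
    · exact h
    · exfalso
      obtain ⟨u, hu, e1, e2⟩ := mirror z₀
      obtain ⟨v, hv, hn⟩ := outside u (by rw [e1, e2, hz₀]; norm_num)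
      rw [h, Equiv.Perm.mul_apply, hu, hv, OnePoint.coe_eq_coe] at e
      rw [← e] at hn
      exact hn hw.2.2.2.1
  · rintro k ⟨w, hw, e⟩
    have hu0 := mirror z₀
    rcases rotation k with ⟨l, rfl⟩ | h
    · obtain ⟨u, hu, e1, e2⟩ := mirror z₀
      have h : (r 1 * r 0) ^ (2 : ℤ) = 1 := by exact_mod_cast hlift 1 0
      rw [_root_.zpow_mul, h, _root_.one_zpow, one_mul, hu, OnePoint.coe_eq_coe] at e
      have := hw.1
      rw [e, e2, hz₀] at this
      norm_num at this
    · obtain ⟨v, hv, hn⟩ := outside z₀ (by rw [hz₀]; norm_num)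
      rw [h, mul_assoc, inv, mul_one, hv, OnePoint.coe_eq_coe] at e
      rw [← e] at hn
      exact hn hw.2.2.2.1

end D4D6

/-! ### Normal forms in the amalgam of the dihedral groups of orders four and six -/

/-- A normal form `(v, a, f, e)`: with `ρ = r₃ r₁` it stands for the product
`(ρ ^ aₖ r₄) ⋯ (ρ ^ a₁ r₄) ρ ^ a r₁ ^ f r₂ ^ e`, where `v = [a₁, …, aₖ]`. The list `v` describes
a vertex of the Bass–Serre tree, the rest an element of the finite group that stabilizes it. -/
abbrev NormalForm : Type := List (Fin 3) × Fin 3 × Bool × Bool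

section NormalForm

variable {G : Type*} [Group G] (r : Fin 4 → G)

/-- The value of a word in the generators. -/
def wordElt (w : List (Fin 4)) : G := (w.map r).prod

/-- The element of the group that takes the base vertex of the tree to the vertex `v`. -/
def vertexElt (v : List (Fin 3)) : G :=
  (v.reverse.map fun a : Fin 3 => (r 2 * r 0) ^ (a : ℕ) * r 3).prod

/-- The elements `ρ ^ a r₁ ^ f r₂ ^ e` of the stabilizer of the base vertex. -/
def stabElt (c : Fin 3 × Bool × Bool) : G :=
  (r 2 * r 0) ^ (c.1 : ℕ) * (r 0 ^ c.2.1.toNat * r 1 ^ c.2.2.toNat)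

/-- The value of a normal form. -/
def normalFormElt (s : NormalForm) : G := vertexElt r s.1 * stabElt r s.2

/-- Multiplication of a normal form by a generator on the right. -/
def NormalForm.step : NormalForm → Fin 4 → NormalForm
  | (v, a, f, e), 0 => (v, a, !f, e)
  | (v, a, f, e), 1 => (v, a, f, !e)
  | (v, a, f, e), 2 => (v, bif f then a + 2 else a + 1, !f, e)
  | ([], a, f, e), 3 => ([a], 0, f, e)
  | (b :: v, a, f, e), 3 => if a = 0 then (v, b, f, e) else (a :: b :: v, 0, f, e)

/-- The normal form of a word. -/
def normalForm (w : List (Fin 4)) : NormalForm := w.foldl NormalForm.step ([], 0, false, false)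

/-- A word whose value is `vertexElt`. -/
def vertexWord (v : List (Fin 3)) : List (Fin 4) :=
  v.reverse.flatMap fun a : Fin 3 => (List.replicate (a : ℕ) [2, 0]).flatten ++ [3]

variable {r}

theorem vertexElt_cons (a : Fin 3) (v : List (Fin 3)) :
    vertexElt r (a :: v) = vertexElt r v * ((r 2 * r 0) ^ (a : ℕ) * r 3) := by
  simp [vertexElt]

theorem vertexElt_nil : vertexElt r [] = 1 := rfl

theorem wordElt_append (w w' : List (Fin 4)) : wordElt r (w ++ w') = wordElt r w * wordElt r w' := by
  simp [wordElt]

theorem wordElt_vertexWord (v : List (Fin 3)) : wordElt r (vertexWord v) = vertexElt r v := by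
  have h : ∀ n : ℕ, wordElt r (List.replicate n [2, 0]).flatten = (r 2 * r 0) ^ n := by
    intro n
    induction n with
    | zero => simp [wordElt]
    | succ n ih =>
      rw [List.replicate_succ, List.flatten_cons, wordElt_append, ih, pow_succ']
      simp [wordElt]
  rw [vertexWord, vertexElt]
  induction v.reverse with
  | nil => simp [wordElt]
  | cons a t ih =>
    rw [List.flatMap_cons, wordElt_append, wordElt_append, ih, h, List.map_cons, List.prod_cons]
    simp [wordElt]

section Liftable

variable {m : ℕ} {hm : m ≠ 1} (h : (coxD4D6 m hm).IsLiftable r)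

include h

theorem coxD4D6_rotation_pow : (r 2 * r 0) ^ 3 = 1 := h 2 0

theorem coxD4D6_commute_zero_three : Commute (r 0) (r 3) := commute_of_isLiftable h rfl
theorem coxD4D6_commute_one_three : Commute (r 1) (r 3) := commute_of_isLiftable h rfl
theorem coxD4D6_commute_zero_one : Commute (r 0) (r 1) := commute_of_isLiftable h rfl
theorem coxD4D6_commute_one_two : Commute (r 1) (r 2) := commute_of_isLiftable h rfl

theorem commute_stab_three (f e : Bool) : Commute (r 0 ^ f.toNat * r 1 ^ e.toNat) (r 3) :=
  ((coxD4D6_commute_zero_three h).pow_left _).mul_left ((coxD4D6_commute_one_three h).pow_left _)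

/-- `NormalForm.step` computes the product in every group that satisfies the Coxeter relations. -/
theorem normalFormElt_step (s : NormalForm) (i : Fin 4) :
    normalFormElt r (s.step i) = normalFormElt r s * r i := by
  have inv := mul_self_of_isLiftable h
  have h01 := coxD4D6_commute_zero_one h
  have h12 := coxD4D6_commute_one_two h
  have h3 := coxD4D6_rotation_pow h
  obtain ⟨v, a, f, e⟩ := s
  have hflip : ∀ (k : Fin 4) (b : Bool), r k ^ (!b).toNat = r k ^ b.toNat * r k := by
    intro k b; cases b <;> simp [inv]
  have key : i ≠ 3 → ∀ v, normalFormElt r (NormalForm.step (v, a, f, e) i) =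
      normalFormElt r (v, a, f, e) * r i := by
    intro hi v
    have h' : i = 0 ∨ i = 1 ∨ i = 2 := by revert i; decide
    rcases h' with rfl | rfl | rfl
    · simp only [NormalForm.step, normalFormElt, stabElt, hflip, mul_assoc]
      rw [(h01.pow_right _).eq]
    · simp only [NormalForm.step, normalFormElt, stabElt, hflip, mul_assoc]
    · have hadd : ∀ k : Fin 3, (r 2 * r 0) ^ ((a + k : Fin 3) : ℕ) =
          (r 2 * r 0) ^ (a : ℕ) * (r 2 * r 0) ^ (k : ℕ) := by
        intro k
        rw [Fin.val_add, ← pow_add, ← pow_eq_pow_mod _ h3]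
      have h3' : (r 2 * r 0) ^ 2 = r 0 * r 2 := by
        rw [pow_succ, pow_two] at h3
        rw [pow_two, eq_inv_of_mul_eq_one_left h3, _root_.mul_inv_rev,
          inv_eq_of_mul_eq_one_left (inv 0), inv_eq_of_mul_eq_one_left (inv 2)]
      cases f
      · simp only [NormalForm.step, normalFormElt, stabElt, mul_assoc, cond_false, hadd,
          Bool.not_false, Bool.toNat_true, Bool.toNat_false, pow_zero, pow_one, one_mul, Fin.val_one]
        rw [← mul_assoc (r 0) (r 0), inv, one_mul, ((h12.symm).pow_right _).eq]
      · simp only [NormalForm.step, normalFormElt, stabElt, mul_assoc, cond_true, hadd,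
          Bool.not_true, Bool.toNat_true, Bool.toNat_false, pow_zero, pow_one, one_mul, Fin.val_two,
          h3']
        rw [((h12.symm).pow_right _).eq]
  by_cases hi : i = 3
  · subst hi
    have h3s := commute_stab_three h f e
    have push : ∀ v, normalFormElt r (a :: v, 0, f, e) = normalFormElt r (v, a, f, e) * r 3 := by
      intro v
      simp only [normalFormElt, stabElt, vertexElt_cons, Fin.val_zero, pow_zero, one_mul]
      rw [mul_assoc, mul_assoc, ← h3s.eq]
      simp only [mul_assoc]
    cases v with
    | nil => exact push []
    | cons b v =>
      simp only [NormalForm.step]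
      split_ifs with ha
      · subst ha
        simp only [normalFormElt, stabElt, vertexElt_cons, Fin.val_zero, pow_zero, one_mul]
        rw [mul_assoc _ _ (r 3), h3s.eq]
        simp only [mul_assoc]
        rw [← mul_assoc (r 3) (r 3), inv, one_mul]
      · exact push _
  · exact key hi v

theorem normalFormElt_foldl (w : List (Fin 4)) (s : NormalForm) :
    normalFormElt r (w.foldl NormalForm.step s) = normalFormElt r s * wordElt r w := by
  induction w generalizing s with
  | nil => simp [wordElt]
  | cons i w ih =>
    rw [List.foldl_cons, ih, normalFormElt_step h, wordElt, wordElt, List.map_cons,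
      List.prod_cons, mul_assoc]

theorem normalFormElt_normalForm (w : List (Fin 4)) :
    normalFormElt r (normalForm w) = wordElt r w := by
  rw [normalForm, normalFormElt_foldl h]
  simp [normalFormElt, stabElt, vertexElt_nil]

end Liftable

end NormalForm

/-! ### Finite quotients of the amalgam from finite subtrees -/

section Map

variable {G Q : Type*} [Group G] [Group Q] (φ : G →* Q) (r : Fin 4 → G)

theorem map_wordElt (w : List (Fin 4)) : φ (wordElt r w) = wordElt (φ ∘ r) w := by
  rw [wordElt, wordElt, map_list_prod, List.map_map]

theorem map_vertexElt (v : List (Fin 3)) : φ (vertexElt r v) = vertexElt (φ ∘ r) v := by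
  rw [← wordElt_vertexWord, map_wordElt, wordElt_vertexWord]

theorem map_stabElt (c : Fin 3 × Bool × Bool) : φ (stabElt r c) = stabElt (φ ∘ r) c := by
  simp [stabElt]

theorem map_normalFormElt (s : NormalForm) :
    φ (normalFormElt r s) = normalFormElt (φ ∘ r) s := by
  rw [normalFormElt, map_mul, map_vertexElt, map_stabElt, normalFormElt]

end Map

section Words

variable {G : Type*} [Group G] {r : Fin 4 → G}

theorem wordElt_mem (w : List (Fin 4)) : wordElt r w ∈ Subgroup.closure (Set.range r) := by
  refine Subgroup.list_prod_mem _ fun x hx => ?_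
  obtain ⟨i, -, rfl⟩ := List.mem_map.1 hx
  exact Subgroup.subset_closure ⟨i, rfl⟩

theorem wordElt_reverse (inv : ∀ i, r i * r i = 1) (w : List (Fin 4)) :
    wordElt r w.reverse = (wordElt r w)⁻¹ := by
  rw [wordElt, wordElt, List.prod_inv_reverse, List.map_reverse, List.map_map]
  congr 2
  refine List.map_congr_left fun i _ => ?_
  exact (inv_eq_of_mul_eq_one_left (inv i)).symm

theorem wordElt_replicate_flatten (w : List (Fin 4)) (n : ℕ) :
    wordElt r (List.replicate n w).flatten = wordElt r w ^ n := by
  induction n with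
  | zero => simp [wordElt]
  | succ n ih => rw [List.replicate_succ, List.flatten_cons, wordElt_append, ih, pow_succ']

theorem stabElt_mul {m : ℕ} {hm : m ≠ 1} (h : (coxD4D6 m hm).IsLiftable r) (a : Fin 3)
    (f e f' e' : Bool) :
    stabElt r (a, f, e) * stabElt r (0, f', e') = stabElt r (a, xor f f', xor e e') := by
  have inv := mul_self_of_isLiftable h
  have h01 := coxD4D6_commute_zero_one h
  have hx : ∀ (k : Fin 4) (b b' : Bool), r k ^ b.toNat * r k ^ b'.toNat = r k ^ (xor b b').toNat := by
    intro k b b'; cases b <;> cases b' <;> simp [inv]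
  simp only [stabElt, Fin.val_zero, pow_zero, one_mul]
  rw [mul_assoc, mul_assoc (r 0 ^ f.toNat), ← mul_assoc (r 1 ^ e.toNat),
    ← ((h01.pow_left f'.toNat).pow_right e.toNat).eq, mul_assoc, hx, ← mul_assoc (r 0 ^ f.toNat), hx]

end Words

/-- Combinatorial data for a finite-index subgroup that acts freely on the Bass–Serre tree of the
amalgam: the vertices of a fundamental subtree, words for the free generators, and for each
generator the edges at which it enters and leaves the subtree (an edge `(a, i)` leaves the vertex
`i` in the direction `a`), together with a homomorphism to a permutation group whose kernel is the
subgroup. The first `N` of the `k` permuted points stand for the vertices of the subtree, that is,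
of the quotient graph. -/
structure TreeQuotient (N g k : ℕ) where
  /-- The vertices of the subtree, as paths in the notation of `NormalForm`. -/
  vertex : Fin N → List (Fin 3)
  /-- Words for the free generators. -/
  word : Fin g → List (Fin 4)
  /-- The edge out of the subtree that a generator takes to the reverse of its edge `tgt`. -/
  src : Fin g → Fin 3 × Fin N
  /-- The edge out of the subtree across which a generator enters the neighbouring translate. -/
  tgt : Fin g → Fin 3 × Fin N
  /-- The element `r₁ ^ f r₂ ^ e` of the stabilizer of an edge by which a generator differs from
  the standard element that takes the edge `src` to the edge `tgt`. -/
  sym : Fin g → Bool × Bool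
  /-- The permutations by which the four reflections act. -/
  perm : Fin 4 → Equiv.Perm (Fin k)
  /-- The index of the base vertex of the tree. -/
  root : Fin N
  /-- The permuted point that stands for the base vertex. -/
  base : Fin k

namespace TreeQuotient

variable {N g k : ℕ}

/-- The vertex of the tree at the other end of an edge. -/
def leaf (T : TreeQuotient N g k) (x : Fin 3 × Fin N) : List (Fin 3) := x.1 :: T.vertex x.2

/-- The conditions that tie the data together. All of them can be checked by computation: the
vertices form a subtree (`root`, `tail`), every edge at a vertex of the subtree stays in it or is
`src` or `tgt` of a generator (`edge`), the generators take the former edges to the latter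
(`normalForm`), the permutations satisfy the Coxeter relations and `(r₃ r₄) ^ m = 1`, which is void
for `m = 0` (`inv`, `rel`, `rel_two_three`), they are trivial on the generators (`word_perm`), and they
separate the products of a vertex and an element of the vertex stabilizer (`base_vertex`,
`base_stab`, `stab`). -/
structure IsValid (T : TreeQuotient N g k) (m : ℕ) : Prop where
  root : T.vertex T.root = []
  tail : ∀ i, T.vertex i = [] ∨ ∃ j, T.vertex j = (T.vertex i).tail
  edge : ∀ i a, (a = 0 ∧ T.vertex i ≠ []) ∨ (∃ j, T.vertex j = a :: T.vertex i) ∨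
    (∃ j, T.src j = (a, i)) ∨ ∃ j, T.tgt j = (a, i)
  normalForm : ∀ j, normalForm (T.word j ++ vertexWord (T.leaf (T.src j))) =
    (T.vertex (T.tgt j).2, (T.tgt j).1, T.sym j)
  even : ∀ j, (T.word j).length % 2 = 0
  inv : ∀ i, T.perm i * T.perm i = 1
  rel : ∀ i j, i < j → i ≠ 2 → (T.perm i * T.perm j) ^
    (!![1, 2, 3, 2; 2, 1, 2, 2; 3, 2, 1, 0; 2, 2, 0, 1] : Matrix (Fin 4) (Fin 4) ℕ) i j = 1
  rel_two_three : (T.perm 2 * T.perm 3) ^ m = 1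
  word_perm : ∀ j, wordElt T.perm (T.word j) = 1
  base_vertex : ∀ i, (vertexElt T.perm (T.vertex i) T.base : ℕ) = i
  base_stab : ∀ c, stabElt T.perm c T.base = T.base
  stab : ∀ c c', stabElt T.perm c = stabElt T.perm c' → c = c'

namespace IsValid

variable {T : TreeQuotient N g k} {m : ℕ} (V : T.IsValid m) {G : Type*} [Group G] {r : Fin 4 → G}

include V

theorem isLiftable_perm : (coxD4D6 0 (by decide)).IsLiftable T.perm := by
  refine isLiftable_fin_four V.inv fun i j hij => ?_
  by_cases hi : i = 2
  · subst hi
    obtain rfl : j = 3 := by revert j; decide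
    exact pow_zero _
  · exact V.rel i j hij hi

/-- The subgroup generated by the words is the kernel of a homomorphism to a permutation group,
and the products of the vertices of the subtree and the elements of the base stabilizer represent
its cosets. -/
theorem ker_eq (h : HasCoxeterPresentation (coxD4D6 0 (by decide)) r) :
    ∃ q : Subgroup.closure (Set.range r) →* Equiv.Perm (Fin k),
      (∀ i, q ⟨r i, Subgroup.subset_closure ⟨i, rfl⟩⟩ = T.perm i) ∧
      q.ker = (Subgroup.closure (Set.range (wordElt r ∘ T.word))).subgroupOf
        (Subgroup.closure (Set.range r)) ∧
      (Subgroup.closure (Set.range (wordElt r ∘ T.word))).relIndex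
        (Subgroup.closure (Set.range r)) = 12 * N := by
  have hl := HasCoxeterPresentation.isLiftable h
  have inv := mul_self_of_isLiftable hl
  have hom := h.exists_hom V.isLiftable_perm
  set H := Subgroup.closure (Set.range r) with hH
  obtain ⟨q, hq⟩ := hom
  set S := Subgroup.closure (Set.range (wordElt r ∘ T.word)) with hS
  have hLS : ∀ j, wordElt r (T.word j) ∈ S := fun j => Subgroup.subset_closure ⟨j, rfl⟩
  let R : Fin 4 → H := fun i => ⟨r i, Subgroup.subset_closure ⟨i, rfl⟩⟩
  have hqR : q ∘ R = T.perm := funext hq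
  have hRr : H.subtype ∘ R = r := rfl
  have hSH : S ≤ H := by
    rw [hS, Subgroup.closure_le]
    rintro _ ⟨j, rfl⟩
    exact wordElt_mem _
  have hker : S.subgroupOf H ≤ q.ker := by
    have : S ≤ q.ker.map H.subtype := by
      rw [hS, Subgroup.closure_le]
      rintro _ ⟨j, rfl⟩
      refine ⟨wordElt R (T.word j), ?_, ?_⟩
      · change q _ = 1
        rw [map_wordElt, hqR, V.word_perm]
      · rw [map_wordElt, hRr]; rfl
    rintro ⟨x, hx⟩ hxS
    obtain ⟨y, hy, e⟩ := this hxS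
    have : y = ⟨x, hx⟩ := Subtype.ext e
    exact this ▸ hy
  let τ : Fin N × (Fin 3 × Bool × Bool) → H := fun s => normalFormElt R (T.vertex s.1, s.2)
  have hτr : ∀ s, (τ s : G) = normalFormElt r (T.vertex s.1, s.2) := by
    intro s
    exact (map_normalFormElt H.subtype R _).trans (by rw [hRr])
  have h₀ : τ (T.root, 0, false, false) = 1 := by
    change normalFormElt R (T.vertex T.root, _) = 1
    rw [V.root]; simp [normalFormElt, vertexElt, stabElt]
  have hinj : Function.Injective (q ∘ τ) := by
    have hqτ : ∀ s, (q ∘ τ) s = vertexElt T.perm (T.vertex s.1) * stabElt T.perm s.2 := by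
      intro s
      change q (normalFormElt R _) = _
      rw [map_normalFormElt, hqR]; rfl
    rintro ⟨i, c⟩ ⟨i', c'⟩ e
    rw [hqτ, hqτ] at e
    have e1 := congrArg (fun σ => ((σ T.base : Fin k) : ℕ)) e
    simp only [Equiv.Perm.mul_apply, V.base_stab, V.base_vertex] at e1
    obtain rfl := Fin.ext e1
    rw [V.stab c c' (mul_left_cancel e)]
  have hτ : ∀ i k, ∃ s ∈ S, ∃ j, (τ i : G) * r k = s * τ j := by
    have one : ∀ x j, x = (τ j : G) → ∃ s ∈ S, ∃ j, x = s * τ j := fun x j e =>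
      ⟨1, one_mem S, j, by rw [e, one_mul]⟩
    -- the pairing of the edges that leave the subtree
    have pair : ∀ j, wordElt r (T.word j) * vertexElt r (T.leaf (T.src j)) =
        vertexElt r (T.vertex (T.tgt j).2) * stabElt r ((T.tgt j).1, T.sym j) := by
      intro j
      have := normalFormElt_normalForm hl (T.word j ++ vertexWord (T.leaf (T.src j)))
      rw [V.normalForm j, wordElt_append, wordElt_vertexWord] at this
      rw [← this]; rfl
    rintro ⟨i, a, f, e⟩ k
    rw [hτr, ← normalFormElt_step hl]
    have hk : k = 0 ∨ k = 1 ∨ k = 2 ∨ k = 3 := by revert k; decide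
    rcases hk with rfl | rfl | rfl | rfl
    -- `r₁`, `r₂`, `r₃` fix the base vertex; `r₄` crosses the edge `a` at the vertex `i`
    · exact one _ (i, a, !f, e) (by rw [hτr]; simp only [NormalForm.step])
    · exact one _ (i, a, f, !e) (by rw [hτr]; simp only [NormalForm.step])
    · exact one _ (i, bif f then a + 2 else a + 1, !f, e) (by rw [hτr]; simp only [NormalForm.step])
    · by_cases hpop : a = 0 ∧ T.vertex i ≠ []
      -- the edge leads back towards the base vertex
      · obtain ⟨rfl, hne⟩ := hpop
        obtain ⟨j, hj⟩ := (V.tail i).resolve_left hne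
        obtain ⟨b, v, hv⟩ := List.exists_cons_of_ne_nil hne
        refine one _ (j, b, f, e) ?_
        rw [hτr]
        dsimp only
        rw [hj, hv]
        simp [NormalForm.step]
      · have hstep : NormalForm.step (T.vertex i, a, f, e) 3 = (a :: T.vertex i, 0, f, e) := by
          cases hv : T.vertex i with
          | nil => rfl
          | cons b v =>
            have : a ≠ 0 := fun ha => hpop ⟨ha, by simp [hv]⟩
            simp [NormalForm.step, this]
        dsimp only
        rw [hstep]
        rcases (V.edge i a).resolve_left hpop with ⟨j, hj⟩ | ⟨j, hj⟩ | ⟨j, hj⟩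
        -- the edge stays in the subtree, or it is the edge `src` or `tgt` of the generator `j`
        · exact one _ (j, 0, f, e) (by rw [hτr]; dsimp only; rw [hj])
        · refine ⟨_, inv_mem (hLS j), ((T.tgt j).2, (T.tgt j).1, xor (T.sym j).1 f,
            xor (T.sym j).2 e), ?_⟩
          rw [hτr, eq_inv_mul_iff_mul_eq]
          change wordElt r (T.word j) * (vertexElt r (a :: T.vertex i) * stabElt r (0, f, e)) =
            vertexElt r _ * stabElt r _
          have := pair j
          rw [hj] at this
          rw [← mul_assoc, show vertexElt r (a :: T.vertex i) = vertexElt r (T.leaf (a, i)) from rfl,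
            this, mul_assoc, ← stabElt_mul hl]
        · refine ⟨_, hLS j, ((T.src j).2, (T.src j).1, xor (T.sym j).1 f,
            xor (T.sym j).2 e), ?_⟩
          rw [hτr]
          change vertexElt r (a :: T.vertex i) * stabElt r (0, f, e) =
            wordElt r (T.word j) * (vertexElt r _ * stabElt r _)
          have hp := pair j
          rw [hj] at hp
          -- both sides times `r₄`, which commutes with the symmetry at the edge
          have hsplit : ∀ (b : Fin 3) (x : Bool × Bool), stabElt r (b, x) =
              (r 2 * r 0) ^ (b : ℕ) * stabElt r (0, x) := by
            intro b x; simp [stabElt]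
          have hcomm : ∀ x : Bool × Bool, stabElt r (0, x) * r 3 = r 3 * stabElt r (0, x) := by
            intro x
            simpa [stabElt] using (commute_stab_three hl x.1 x.2).eq
          have hself : stabElt r (0, T.sym j) * stabElt r (0, T.sym j) = 1 := by
            have := stabElt_mul hl 0 (T.sym j).1 (T.sym j).2 (T.sym j).1 (T.sym j).2
            rw [Bool.xor_self, Bool.xor_self] at this
            simpa [stabElt] using this
          rw [← stabElt_mul hl, ← mul_assoc, ← mul_assoc]
          congr 1
          rw [vertexElt_cons]
          have hs := hsplit (T.src j).1 ((T.sym j).1, (T.sym j).2)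
          rw [hs]
          change _ = wordElt r (T.word j) * vertexElt r (T.vertex (T.src j).2) *
            ((r 2 * r 0) ^ ((T.src j).1 : ℕ) * stabElt r (0, T.sym j))
          have e1 : (r 2 * r 0) ^ ((T.src j).1 : ℕ) * stabElt r (0, T.sym j) =
              (r 2 * r 0) ^ ((T.src j).1 : ℕ) * r 3 * (stabElt r (0, T.sym j) * r 3) := by
            rw [hcomm, mul_assoc, ← mul_assoc (r 3), inv, one_mul]
          rw [e1, ← mul_assoc (wordElt r (T.word j) * _) ((r 2 * r 0) ^ ((T.src j).1 : ℕ) * r 3),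
            mul_assoc (wordElt r (T.word j)) _ ((r 2 * r 0) ^ ((T.src j).1 : ℕ) * r 3),
            ← vertexElt_cons (T.src j).1]
          change _ = wordElt r (T.word j) * vertexElt r (T.leaf (T.src j)) * _
          rw [hp]
          dsimp only
          rw [hsplit a (T.sym j), mul_assoc, mul_assoc, ← mul_assoc (stabElt r (0, T.sym j)), hself,
            one_mul]
  obtain ⟨h1, h2, -⟩ := ker_eq_of_transversal inv q hSH hker τ _ h₀ hτ hinj
  refine ⟨q, hq, h1, h2.trans ?_⟩
  simp only [Fintype.card_prod, Fintype.card_fin, Fintype.card_bool]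
  ring

theorem isNormalIn (h : HasCoxeterPresentation (coxD4D6 0 (by decide)) r) :
    IsNormalIn (Subgroup.closure (Set.range (wordElt r ∘ T.word)))
      (Subgroup.closure (Set.range r)) := by
  obtain ⟨q, -, h1, -⟩ := V.ker_eq h
  refine ⟨?_, h1 ▸ q.normal_ker⟩
  rw [Subgroup.closure_le]
  rintro _ ⟨j, rfl⟩
  exact wordElt_mem _

/-- If the words are products of conjugates of `(r₃ r₄) ^ m` and its inverse, given by a
certificate, they generate the normal closure of `(r₃ r₄) ^ m`. -/
theorem normalClosureIn_eq (h : HasCoxeterPresentation (coxD4D6 0 (by decide)) r)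
    (cert : Fin g → List (List (Fin 4) × Bool))
    (hcert : ∀ j, Kleinian.normalForm (T.word j) = Kleinian.normalForm ((cert j).flatMap fun x =>
      x.1 ++ ((List.replicate m (bif x.2 then [2, 3] else [3, 2])).flatten ++ x.1.reverse))) :
    normalClosureIn (Subgroup.closure (Set.range r)) ((r 2 * r 3) ^ m) =
      Subgroup.closure (Set.range (wordElt r ∘ T.word)) := by
  have hl := HasCoxeterPresentation.isLiftable h
  have inv := mul_self_of_isLiftable hl
  obtain ⟨q, hq, h1, -⟩ := V.ker_eq h
  have hmem : ∀ i, r i ∈ Subgroup.closure (Set.range r) := fun i => Subgroup.subset_closure ⟨i, rfl⟩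
  apply le_antisymm
  · refine (Subgroup.closure_le _).2 ?_
    rintro _ ⟨y, hy, rfl⟩
    let x : Subgroup.closure (Set.range r) := ⟨y, hy⟩ * (⟨r 2, hmem 2⟩ * ⟨r 3, hmem 3⟩) ^ m * ⟨y, hy⟩⁻¹
    have hx : x ∈ q.ker := by
      rw [MonoidHom.mem_ker, map_mul, map_mul, map_pow, map_mul, hq, hq, V.rel_two_three, mul_one,
        map_inv, mul_inv_cancel]
    rw [h1] at hx
    exact hx
  · rw [Subgroup.closure_le]
    rintro _ ⟨j, rfl⟩
    change wordElt r (T.word j) ∈ _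
    rw [← normalFormElt_normalForm hl, hcert j, normalFormElt_normalForm hl]
    have hinv : r 3 * r 2 = (r 2 * r 3)⁻¹ := by
      rw [_root_.mul_inv_rev, inv_eq_of_mul_eq_one_left (inv 2),
        inv_eq_of_mul_eq_one_left (inv 3)]
    induction cert j with
    | nil => exact one_mem _
    | cons x t ih =>
      rw [List.flatMap_cons, wordElt_append]
      refine mul_mem ?_ ih
      rw [wordElt_append, wordElt_append, wordElt_reverse inv, wordElt_replicate_flatten, ← mul_assoc]
      obtain ⟨u, b⟩ := x
      have hgen : wordElt r u * (r 2 * r 3) ^ m * (wordElt r u)⁻¹ ∈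
          normalClosureIn (Subgroup.closure (Set.range r)) ((r 2 * r 3) ^ m) :=
        Subgroup.subset_closure ⟨_, wordElt_mem u, rfl⟩
      cases b
      · have e : wordElt r [3, 2] = (r 2 * r 3)⁻¹ := by rw [← hinv]; simp [wordElt]
        simp only [cond_false, e, inv_pow]
        rw [← conj_inv]
        exact inv_mem hgen
      · have e : wordElt r [2, 3] = r 2 * r 3 := by simp [wordElt]
        simpa only [cond_true, e] using hgen

end IsValid

end TreeQuotient

/-! ### The finite quotient graphs -/

/-- The subtree with quotient the graph with two vertices and three edges (the hosohedron `{2, 3}`). -/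
def treeTwo : TreeQuotient 2 2 7 where
  vertex := ![[], [0]]
  word := ![[2, 3, 2, 3],
    [0, 2, 3, 2, 3, 0]]
  src := ![(1, 1), (2, 1)]
  tgt := ![(1, 0), (2, 0)]
  sym := ![(false, false), (false, false)]
  perm := ![⟨![0, 1, 3, 2, 4, 5, 6],
      ![0, 1, 3, 2, 4, 5, 6], by decide, by decide⟩,
    ⟨![0, 1, 2, 3, 4, 6, 5],
      ![0, 1, 2, 3, 4, 6, 5], by decide, by decide⟩,
    ⟨![0, 1, 2, 4, 3, 5, 6],
      ![0, 1, 2, 4, 3, 5, 6], by decide, by decide⟩,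
    ⟨![1, 0, 2, 3, 4, 5, 6],
      ![1, 0, 2, 3, 4, 5, 6], by decide, by decide⟩]
  root := 0
  base := 0

theorem treeTwo_isValid : treeTwo.IsValid 2 where
  root := by decide +kernel
  tail := by decide +kernel
  edge := by decide +kernel
  normalForm := by decide +kernel
  even := by decide +kernel
  inv := by decide +kernel
  rel := by decide +kernel
  rel_two_three := by decide +kernel
  word_perm := by decide +kernel
  base_vertex := by decide +kernel
  base_stab := by decide +kernel
  stab := by decide +kernel

/-- The words for the generators as products of conjugates of the relator. -/
def treeTwoCert : Fin 2 → List (List (Fin 4) × Bool) :=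
  ![[([], true)], [([0], true)]]

/-- The subtree with quotient the complete graph on four vertices (the tetrahedron). -/
def treeThree : TreeQuotient 4 3 6 where
  vertex := ![[], [0], [1], [2]]
  word := ![[2, 3, 2, 3, 2, 3],
    [0, 2, 3, 2, 3, 2, 3, 0],
    [0, 2, 0, 2, 3, 2, 3, 2, 3, 0, 2, 0]]
  src := ![(1, 1), (2, 1), (2, 3)]
  tgt := ![(2, 2), (1, 3), (1, 2)]
  sym := ![(true, false), (true, false), (true, false)]
  perm := ![⟨![0, 1, 3, 2, 4, 5],
      ![0, 1, 3, 2, 4, 5], by decide, by decide⟩,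
    ⟨![0, 1, 2, 3, 5, 4],
      ![0, 1, 2, 3, 5, 4], by decide, by decide⟩,
    ⟨![0, 2, 1, 3, 4, 5],
      ![0, 2, 1, 3, 4, 5], by decide, by decide⟩,
    ⟨![1, 0, 2, 3, 4, 5],
      ![1, 0, 2, 3, 4, 5], by decide, by decide⟩]
  root := 0
  base := 0

theorem treeThree_isValid : treeThree.IsValid 3 where
  root := by decide +kernel
  tail := by decide +kernel
  edge := by decide +kernel
  normalForm := by decide +kernel
  even := by decide +kernel
  inv := by decide +kernel
  rel := by decide +kernel
  rel_two_three := by decide +kernel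
  word_perm := by decide +kernel
  base_vertex := by decide +kernel
  base_stab := by decide +kernel
  stab := by decide +kernel

/-- The words for the generators as products of conjugates of the relator. -/
def treeThreeCert : Fin 3 → List (List (Fin 4) × Bool) :=
  ![[([], true)], [([0], true)], [([2, 0], false)]]

/-- The subtree with quotient the edge graph of the cube. -/
def treeFour : TreeQuotient 8 5 10 where
  vertex := ![[], [0], [1], [2], [1, 0], [2, 0], [1, 1], [1, 1, 0]]
  word := ![[3, 2, 0, 3, 2, 0, 2, 0, 3, 0, 2, 0, 2, 3, 0, 2],
    [3, 2, 0, 2, 0, 3, 2, 0, 3, 0, 2, 3, 0, 2, 0, 2],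
    [2, 0, 3, 2, 0, 3, 2, 0, 2, 0, 3, 0, 2, 0, 2, 3, 0, 2, 0, 2],
    [3, 2, 0, 3, 2, 0, 3, 2, 0, 2, 0, 3, 0, 2, 0, 2, 3, 0, 2, 0, 2, 3],
    [3, 2, 0, 3, 2, 0, 3, 2, 0, 3, 0, 2, 3, 0, 2, 3, 0, 2]]
  src := ![(2, 2), (1, 3), (2, 3), (2, 5), (1, 6)]
  tgt := ![(2, 4), (1, 5), (2, 6), (2, 7), (1, 7)]
  sym := ![(false, false), (false, false), (false, false), (false, false), (false, false)]
  perm := ![⟨![0, 1, 3, 2, 5, 4, 6, 7, 8, 9],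
      ![0, 1, 3, 2, 5, 4, 6, 7, 8, 9], by decide, by decide⟩,
    ⟨![0, 1, 2, 3, 4, 5, 6, 7, 9, 8],
      ![0, 1, 2, 3, 4, 5, 6, 7, 9, 8], by decide, by decide⟩,
    ⟨![0, 2, 1, 3, 4, 6, 5, 7, 8, 9],
      ![0, 2, 1, 3, 4, 6, 5, 7, 8, 9], by decide, by decide⟩,
    ⟨![1, 0, 4, 5, 2, 3, 7, 6, 8, 9],
      ![1, 0, 4, 5, 2, 3, 7, 6, 8, 9], by decide, by decide⟩]
  root := 0
  base := 0

theorem treeFour_isValid : treeFour.IsValid 4 where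
  root := by decide +kernel
  tail := by decide +kernel
  edge := by decide +kernel
  normalForm := by decide +kernel
  even := by decide +kernel
  inv := by decide +kernel
  rel := by decide +kernel
  rel_two_three := by decide +kernel
  word_perm := by decide +kernel
  base_vertex := by decide +kernel
  base_stab := by decide +kernel
  stab := by decide +kernel

/-- The words for the generators as products of conjugates of the relator. -/
def treeFourCert : Fin 5 → List (List (Fin 4) × Bool) :=
  ![[([], false)], [([0], false)], [([2, 0], false)], [([3, 2, 0], false)], [([], false), ([2, 0,
  3, 2, 0], true)]]

/-- The subtree with quotient the edge graph of the dodecahedron. -/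
def treeFive : TreeQuotient 20 11 22 where
  vertex := ![[], [0], [1], [2], [1, 0], [2, 0], [1, 1], [2, 1], [1, 2], [2, 2], [1, 1, 0], [2, 2,
  0], [1, 1, 1], [2, 2, 1], [1, 1, 2], [2, 2, 2], [1, 1, 1, 0], [2, 2, 2, 0], [1, 1, 1, 1], [1, 1,
  1, 1, 0]]
  word := ![[2, 0, 3, 2, 0, 2, 0, 3, 2, 3, 0, 2, 0, 2, 3, 0, 2, 3],
    [2, 0, 2, 0, 3, 2, 0, 3, 2, 0, 2, 3, 0, 2, 3, 0, 2, 0, 2, 3],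
    [2, 0, 2, 0, 3, 2, 0, 2, 0, 3, 2, 3, 0, 2, 0, 2, 3, 0, 2, 3, 0, 2],
    [3, 2, 0, 2, 0, 3, 2, 0, 2, 0, 3, 2, 3, 0, 2, 0, 2, 3, 0, 2, 3, 0, 2, 3],
    [2, 0, 3, 2, 0, 2, 0, 3, 2, 0, 2, 0, 3, 2, 3, 0, 2, 0, 2, 3, 0, 2, 3, 0, 2, 3, 0, 2],
    [3, 2, 0, 3, 2, 0, 3, 2, 0, 3, 2, 0, 2, 0, 3, 0, 2, 0, 2, 3, 0, 2, 0, 2, 3, 0, 2, 0, 2, 3, 0,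
    2],
    [3, 2, 0, 2, 0, 3, 2, 0, 2, 0, 3, 2, 0, 2, 0, 3, 2, 0, 3, 0, 2, 3, 0, 2, 3, 0, 2, 3, 0, 2, 0,
    2],
    [2, 0, 2, 0, 3, 2, 0, 2, 0, 3, 2, 0, 2, 0, 3, 2, 3, 0, 2, 0, 2, 3, 0, 2, 3, 0, 2, 3, 0, 2, 0,
    2],
    [2, 0, 3, 2, 0, 3, 2, 0, 3, 2, 0, 3, 2, 0, 2, 0, 3, 0, 2, 0, 2, 3, 0, 2, 0, 2, 3, 0, 2, 0, 2,
    3, 0, 2, 0, 2],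
    [3, 2, 0, 3, 2, 0, 3, 2, 0, 3, 2, 0, 3, 2, 0, 2, 0, 3, 0, 2, 0, 2, 3, 0, 2, 0, 2, 3, 0, 2, 0,
    2, 3, 0, 2, 0, 2, 3],
    [3, 2, 0, 3, 2, 0, 3, 2, 0, 3, 2, 0, 3, 2, 0, 3, 0, 2, 3, 0, 2, 3, 0, 2, 3, 0, 2, 3, 0, 2]]
  src := ![(2, 4), (1, 5), (2, 6), (2, 10), (2, 12), (2, 13), (1, 14), (2, 14), (2, 15), (2, 17),
  (1, 18)]
  tgt := ![(1, 7), (2, 8), (1, 9), (1, 11), (1, 13), (2, 16), (1, 17), (1, 15), (2, 18), (2, 19),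
  (1, 19)]
  sym := ![(true, false), (true, false), (true, false), (true, false), (true, false), (false,
  false), (false, false), (true, false), (false, false), (false, false), (false, false)]
  perm := ![⟨![0, 1, 3, 2, 5, 4, 9, 8, 7, 6, 11, 10, 15, 14, 13, 12, 17, 16, 18, 19, 20, 21],
      ![0, 1, 3, 2, 5, 4, 9, 8, 7, 6, 11, 10, 15, 14, 13, 12, 17, 16, 18, 19, 20, 21], by decide, by decide⟩,
    ⟨![0, 1, 2, 3, 4, 5, 6, 7, 8, 9, 10, 11, 12, 13, 14, 15, 16, 17, 18, 19, 21, 20],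
      ![0, 1, 2, 3, 4, 5, 6, 7, 8, 9, 10, 11, 12, 13, 14, 15, 16, 17, 18, 19, 21, 20], by decide, by decide⟩,
    ⟨![0, 2, 1, 3, 7, 6, 5, 4, 9, 8, 13, 12, 11, 10, 15, 14, 16, 18, 17, 19, 20, 21],
      ![0, 2, 1, 3, 7, 6, 5, 4, 9, 8, 13, 12, 11, 10, 15, 14, 16, 18, 17, 19, 20, 21], by decide, by decide⟩,
    ⟨![1, 0, 4, 5, 2, 3, 10, 7, 8, 11, 6, 9, 16, 13, 14, 17, 12, 15, 19, 18, 20, 21],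
      ![1, 0, 4, 5, 2, 3, 10, 7, 8, 11, 6, 9, 16, 13, 14, 17, 12, 15, 19, 18, 20, 21], by decide, by decide⟩]
  root := 0
  base := 0

theorem treeFive_isValid : treeFive.IsValid 5 where
  root := by decide +kernel
  tail := by decide +kernel
  edge := by decide +kernel
  normalForm := by decide +kernel
  even := by decide +kernel
  inv := by decide +kernel
  rel := by decide +kernel
  rel_two_three := by decide +kernel
  word_perm := by decide +kernel
  base_vertex := by decide +kernel
  base_stab := by decide +kernel
  stab := by decide +kernel

/-- The words for the generators as products of conjugates of the relator. -/
def treeFiveCert : Fin 11 → List (List (Fin 4) × Bool) :=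
  ![[([], true)], [([0], true)], [([2, 0], true)], [([3, 2, 0], true)], [([2, 0, 3, 2, 0], true)],
  [([3, 2, 0, 3, 2, 0], false), ([], false)], [([3, 2, 0, 2, 0, 3, 2, 0], true), ([0], false)],
  [([2, 0, 2, 0, 3, 2, 0], true)], [([2, 0, 3, 2, 0, 3, 2, 0], false), ([2, 0], false)], [([3, 2,
  0, 3, 2, 0, 3, 2, 0], false), ([3, 2, 0], false)], [([3, 2, 0, 3, 2, 0], false), ([], false),
  ([2, 0, 3, 2, 0], true), ([2, 0, 3, 2, 0, 3, 2, 0, 3, 2, 0], true)]]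

/-- The subtree with quotient the complete bipartite graph `K₃,₃`. -/
def treeRankFour : TreeQuotient 6 4 8 where
  vertex := ![[], [0], [1], [2], [1, 0], [2, 0]]
  word := ![[3, 2, 3, 2, 0, 3, 2, 3, 2, 0],
    [0, 3, 2, 3, 2, 0, 3, 2, 3, 2],
    [0, 3, 2, 0, 3, 2, 0, 3, 2, 0, 2, 3, 2, 0],
    [3, 2, 0, 3, 2, 0, 3, 2, 0, 2, 3, 2]]
  src := ![(1, 3), (2, 2), (2, 3), (1, 2)]
  tgt := ![(2, 4), (1, 5), (2, 5), (1, 4)]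
  sym := ![(false, false), (false, false), (false, false), (false, false)]
  perm := ![⟨![0, 1, 3, 2, 5, 4, 6, 7],
      ![0, 1, 3, 2, 5, 4, 6, 7], by decide, by decide⟩,
    ⟨![0, 1, 2, 3, 4, 5, 7, 6],
      ![0, 1, 2, 3, 4, 5, 7, 6], by decide, by decide⟩,
    ⟨![0, 2, 1, 3, 5, 4, 6, 7],
      ![0, 2, 1, 3, 5, 4, 6, 7], by decide, by decide⟩,
    ⟨![1, 0, 4, 5, 2, 3, 6, 7],
      ![1, 0, 4, 5, 2, 3, 6, 7], by decide, by decide⟩]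
  root := 0
  base := 0

theorem treeRankFour_isValid : treeRankFour.IsValid 0 where
  root := by decide +kernel
  tail := by decide +kernel
  edge := by decide +kernel
  normalForm := by decide +kernel
  even := by decide +kernel
  inv := by decide +kernel
  rel := by decide +kernel
  rel_two_three := by decide +kernel
  word_perm := by decide +kernel
  base_vertex := by decide +kernel
  base_stab := by decide +kernel
  stab := by decide +kernel

/-! ### Schottky groups from finite subtrees -/

/-- The two paths separate: neither is an initial segment of the other. -/
def Apart : List (Fin 3) → List (Fin 3) → Bool
  | a :: v, b :: w => if a = b then Apart v w else true
  | _, _ => false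

namespace TreeQuotient

variable {N g k : ℕ}

/-- All edges that leave the subtree. -/
def edges (T : TreeQuotient N g k) : Fin g ⊕ Fin g → List (Fin 3) :=
  Sum.elim (fun j => (T.leaf (T.src j)).reverse) fun j => (T.leaf (T.tgt j)).reverse

/-- The edges that leave the subtree point in different directions. -/
structure IsSeparated (T : TreeQuotient N g k) : Prop where
  ne_zero : ∀ x, ∀ a ∈ (T.edges x).tail, a ≠ 0
  apart : ∀ x y, x ≠ y → Apart (T.edges x) (T.edges y) = true

end TreeQuotient

section Paths

variable {r : Fin 4 → SpherePerm} {D Do : Set Sphere}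

/-- The product along a path in the tree. -/
def pathElt (r : Fin 4 → SpherePerm) (w : List (Fin 3)) : SpherePerm :=
  (w.map fun a : Fin 3 => (r 2 * r 0) ^ (a : ℕ) * r 3).prod

theorem pathElt_cons (a : Fin 3) (w : List (Fin 3)) :
    pathElt r (a :: w) = (r 2 * r 0) ^ (a : ℕ) * r 3 * pathElt r w := by
  simp [pathElt]

/-- The nested discs of a path lie in the disc of its first step. -/
theorem pathElt_image_subset (inv : r 3 * r 3 = 1) (hout : r 3 '' Dᶜ ⊆ D)
    (hdisj : ∀ a b : Fin 3, a ≠ b →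
      Disjoint (((r 2 * r 0) ^ (a : ℕ) : SpherePerm) '' D) (((r 2 * r 0) ^ (b : ℕ) : SpherePerm) '' D))
    (w : List (Fin 3)) (a : Fin 3) (hw : ∀ b ∈ w, b ≠ 0) :
    (pathElt r (a :: w) : SpherePerm) '' (r 3 '' D) ⊆ ((r 2 * r 0) ^ (a : ℕ) : SpherePerm) '' D := by
  induction w generalizing a with
  | nil =>
    rw [pathElt_cons, ← image_mul, mul_assoc, pathElt, List.map_nil, List.prod_nil, one_mul, mul_assoc,
      inv, mul_one]
  | cons b w ih =>
    rw [pathElt_cons, image_mul, image_mul]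
    refine Set.image_mono ((Set.image_mono ?_).trans hout)
    refine (ih b fun c hc => hw c (List.mem_cons_of_mem _ hc)).trans ?_
    have := hdisj b 0 (hw b List.mem_cons_self)
    rw [Fin.val_zero, pow_zero, Equiv.Perm.coe_one, Set.image_id] at this
    exact this.subset_compl_right

/-- Paths that separate lead to disjoint discs: where they part, the discs of the two directions are
disjoint. -/
theorem disjoint_pathElt_image (inv : r 3 * r 3 = 1) (hout : r 3 '' Dᶜ ⊆ D)
    (hdisj : ∀ a b : Fin 3, a ≠ b →
      Disjoint (((r 2 * r 0) ^ (a : ℕ) : SpherePerm) '' D) (((r 2 * r 0) ^ (b : ℕ) : SpherePerm) '' D))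
    (w w' : List (Fin 3)) (hw : ∀ b ∈ w.tail, b ≠ 0) (hw' : ∀ b ∈ w'.tail, b ≠ 0)
    (h : Apart w w' = true) : Disjoint (pathElt r w '' (r 3 '' D)) (pathElt r w' '' (r 3 '' D)) := by
  induction w generalizing w' with
  | nil => simp [Apart] at h
  | cons a v ih =>
    cases w' with
    | nil => simp [Apart] at h
    | cons b v' =>
      by_cases hab : a = b
      · subst hab
        rw [Apart, if_pos rfl] at h
        rw [pathElt_cons, pathElt_cons, image_mul, image_mul _ (pathElt r v')]
        exact (Set.disjoint_image_iff (Equiv.injective _)).2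
          (ih v' (fun b hb => hw b (List.mem_of_mem_tail hb))
            (fun b hb => hw' b (List.mem_of_mem_tail hb)) h)
      · exact (hdisj a b hab).mono (pathElt_image_subset inv hout hdisj v a hw)
          (pathElt_image_subset inv hout hdisj v' b hw')

/-- Words of even length are conformal, words of odd length anti-conformal. -/
theorem wordElt_conformal_or (hr : ∀ i, IsAntiConformal (r i)) (w : List (Fin 4)) :
    (w.length % 2 = 0 → wordElt r w ∈ mobiusGroup) ∧
      (w.length % 2 = 1 → IsAntiConformal (wordElt r w)) := by
  induction w with
  | nil => exact ⟨fun _ => one_mem _, fun h => by simp at h⟩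
  | cons i w ih =>
    rw [wordElt, List.map_cons, List.prod_cons, List.length_cons]
    constructor
    · intro h
      exact (hr i).mul (ih.2 (by omega))
    · intro h
      exact (hr i).mul_mobius (ih.1 (by omega))

end Paths

namespace TreeQuotient.IsValid

variable {N g k : ℕ} {T : TreeQuotient N g k} {m : ℕ} {r : Fin 4 → SpherePerm}

/-- The translates of the disc of `r₄` along the edges that leave the subtree are the discs of a
Schottky system. -/
theorem isSchottkySystem (V : T.IsValid m) (S : T.IsSeparated)
    (hl : (coxD4D6 0 (by decide)).IsLiftable r) (hr : ∀ i, IsAntiConformal (r i)) (A : GL (Fin 2) ℂ)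
    (h0 : r 0 '' openDisc A = openDisc A) (h1 : r 1 '' openDisc A = openDisc A)
    (h3 : r 3 '' openDisc A = (closedDisc A)ᶜ)
    (hdisj : ∀ a b : Fin 3, a ≠ b → Disjoint (((r 2 * r 0) ^ (a : ℕ) : SpherePerm) '' closedDisc A)
      (((r 2 * r 0) ^ (b : ℕ) : SpherePerm) '' closedDisc A)) :
    IsSchottkySystem (wordElt r ∘ T.word) := by
  have inv := mul_self_of_isLiftable hl
  have hvert : ∀ v, vertexElt r v ∈ mobiusGroup ∨ IsAntiConformal (vertexElt r v) := by
    intro v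
    rw [← wordElt_vertexWord]
    have := wordElt_conformal_or hr (vertexWord v)
    rcases Nat.mod_two_eq_zero_or_one (vertexWord v).length with h | h
    · exact Or.inl (this.1 h)
    · exact Or.inr (this.2 h)
  have hout : r 3 '' (closedDisc A)ᶜ ⊆ closedDisc A := by
    rw [← h3, ← image_mul, inv, Equiv.Perm.coe_one, Set.image_id]
    exact openDisc_subset_closedDisc A
  have hdisc : ∀ x : Fin 3 × Fin N, ∃ B : GL (Fin 2) ℂ,
      openDisc B = (vertexElt r (T.leaf x) : SpherePerm) '' (r 3 '' openDisc A) ∧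
      closedDisc B = (vertexElt r (T.leaf x) : SpherePerm) '' (r 3 '' closedDisc A) := by
    intro x
    obtain ⟨B, hB1, hB2⟩ := exists_disc_eq_image (Or.inr (hr 3)) A
    rw [← hB1, ← hB2]
    exact exists_disc_eq_image (hvert _) B
  choose B hB using hdisc
  have hopen : ∀ x, openDisc (B x) = _ := fun x => (hB x).1
  have hclosed : ∀ x, closedDisc (B x) = _ := fun x => (hB x).2
  refine ⟨fun j => B (T.src j), fun j => B (T.tgt j), ?_, fun j => ⟨?_, ?_⟩⟩
  · have hedge : Sum.elim (fun j => closedDisc (B (T.src j))) (fun j => closedDisc (B (T.tgt j))) =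
        fun x => pathElt r (T.edges x) '' (r 3 '' closedDisc A) := by
      funext x
      rcases x with j | j
      · exact hclosed _
      · exact hclosed _
    rw [hedge]
    exact fun x y hxy => disjoint_pathElt_image (inv 3) hout hdisj _ _ (S.ne_zero x) (S.ne_zero y)
      (S.apart x y hxy)
  · exact (wordElt_conformal_or hr _).1 (V.even j)
  · have hword := normalFormElt_normalForm hl (T.word j ++ vertexWord (T.leaf (T.src j)))
    rw [V.normalForm j, wordElt_append, wordElt_vertexWord] at hword
    have h3' : r 3 '' (r 3 '' closedDisc A)ᶜ = (closedDisc A)ᶜ := by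
      rw [Set.image_compl_eq (Equiv.bijective _), ← image_mul, inv, Equiv.Perm.coe_one, Set.image_id]
    rw [hopen, hclosed]
    change (wordElt r (T.word j) : SpherePerm) '' _ = _
    rw [← image_mul, ← hword, ← Set.image_compl_eq (Equiv.bijective _), leaf, vertexElt_cons, image_mul,
      image_mul _ (r 3), h3', normalFormElt, image_mul]
    congr 1
    -- the symmetries of the disc commute with `r₄`
    rw [stabElt, image_mul]
    congr 1
    rw [h3]
    have hk : ∀ i : Fin 4, r i '' openDisc A = openDisc A → Commute (r i) (r 3) → ∀ b : Bool,
        (r i ^ b.toNat : SpherePerm) '' (closedDisc A)ᶜ = (closedDisc A)ᶜ := by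
      intro i hi hc b
      cases b
      · simp
      · rw [← h3, Bool.toNat_true, pow_one, ← image_mul, hc.eq, image_mul, hi]
    rw [image_mul, hk 1 h1 (coxD4D6_commute_one_three hl), hk 0 h0 (coxD4D6_commute_zero_three hl)]

end TreeQuotient.IsValid

theorem treeTwo_isSeparated : treeTwo.IsSeparated :=
  ⟨by decide +kernel, by decide +kernel⟩

theorem treeThree_isSeparated : treeThree.IsSeparated :=
  ⟨by decide +kernel, by decide +kernel⟩

theorem treeFour_isSeparated : treeFour.IsSeparated :=
  ⟨by decide +kernel, by decide +kernel⟩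

theorem treeFive_isSeparated : treeFive.IsSeparated :=
  ⟨by decide +kernel, by decide +kernel⟩

theorem treeRankFour_isSeparated : treeRankFour.IsSeparated :=
  ⟨by decide +kernel, by decide +kernel⟩

/-! ### Discs bounded by circles of reflection -/

theorem mem_ball_sqrt_iff {c R : ℝ} {z : ℂ} :
    z ∈ Metric.ball (c : ℂ) √R ↔ (z.re - c) ^ 2 + z.im ^ 2 < R := by
  rw [Metric.mem_ball, Complex.dist_eq_re_im, Complex.ofReal_re, Complex.ofReal_im, sub_zero]
  exact Real.sqrt_lt_sqrt_iff (by positivity)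

theorem mem_closedBall_sqrt_iff {c R : ℝ} (hR : 0 ≤ R) {z : ℂ} :
    z ∈ Metric.closedBall (c : ℂ) √R ↔ (z.re - c) ^ 2 + z.im ^ 2 ≤ R := by
  rw [Metric.mem_closedBall, Complex.dist_eq_re_im, Complex.ofReal_re, Complex.ofReal_im, sub_zero]
  exact Real.sqrt_le_sqrt_iff hR

theorem coe_mem_image_iff {P : Set ℂ} {z : ℂ} : (z : Sphere) ∈ ((↑) : ℂ → Sphere) '' P ↔ z ∈ P := by
  constructor
  · rintro ⟨w, hw, e⟩
    rw [OnePoint.coe_eq_coe] at e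
    exact e ▸ hw
  · exact fun h => ⟨z, h, rfl⟩

theorem infty_notMem_image {P : Set ℂ} : OnePoint.infty ∉ ((↑) : ℂ → Sphere) '' P := by
  rintro ⟨w, -, e⟩
  exact OnePoint.coe_ne_infty _ e

theorem image_eq_of_involution {f : SpherePerm} (hf : f * f = 1) {P Q : Set Sphere}
    (hP : ∀ p ∈ P, f p ∈ Q) (hQ : ∀ p ∈ Q, f p ∈ P) : f '' P = Q := by
  apply Set.Subset.antisymm
  · rintro _ ⟨p, hp, rfl⟩
    exact hP p hp
  · intro p hp
    exact ⟨f p, hQ p hp, by rw [← Equiv.Perm.mul_apply, hf, Equiv.Perm.one_apply]⟩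

namespace IsCircleReflection

variable {f : SpherePerm} {c R : ℝ}

/-- The power of a point with respect to the circle changes sign under the reflection. -/
theorem exists_coe_power (h : IsCircleReflection f c R) {z : ℂ}
    (hz : 0 < (z.re - c) ^ 2 + z.im ^ 2) : ∃ w : ℂ, ∃ t : ℝ, f (z : Sphere) = (w : Sphere) ∧ 0 < t ∧
      (w.re - c) ^ 2 + w.im ^ 2 - R = - t * ((z.re - c) ^ 2 + z.im ^ 2 - R) ∧ w.im = t * z.im ∧
      w.re = c + t * (z.re - c) ∧ t * ((z.re - c) ^ 2 + z.im ^ 2) = R := by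
  obtain ⟨w, hw, e1, e2⟩ := h.exists_coe hz
  refine ⟨w, R / ((z.re - c) ^ 2 + z.im ^ 2), hw, div_pos h.pos hz, ?_, ?_, ?_, ?_⟩
  · rw [e1, e2]
    field_simp
    ring
  · rw [e2]; field_simp
  · rw [e1]; field_simp
  · field_simp

theorem apply_notMem_of_mem_ball (h : IsCircleReflection f c R) {x : Sphere}
    (hx : x ∈ ((↑) : ℂ → Sphere) '' Metric.ball (c : ℂ) √R) :
    f x ∈ (((↑) : ℂ → Sphere) '' Metric.closedBall (c : ℂ) √R)ᶜ := by
  obtain ⟨z, hz, rfl⟩ := hx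
  rw [mem_ball_sqrt_iff] at hz
  by_cases hc : z = c
  · rw [hc, h.center]; exact infty_notMem_image
  · obtain ⟨w, t, hw, ht, e, -⟩ := h.exists_coe_power (pos_of_ne hc)
    rw [Set.mem_compl_iff, hw, coe_mem_image_iff, mem_closedBall_sqrt_iff h.pos.le, not_le]
    nlinarith [mul_pos ht (sub_pos.2 hz)]

theorem apply_mem_ball_of_notMem (h : IsCircleReflection f c R) {x : Sphere}
    (hx : x ∈ (((↑) : ℂ → Sphere) '' Metric.closedBall (c : ℂ) √R)ᶜ) :
    f x ∈ ((↑) : ℂ → Sphere) '' Metric.ball (c : ℂ) √R := by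
  induction x using OnePoint.rec with
  | infty =>
    rw [h.infty, coe_mem_image_iff]
    exact Metric.mem_ball_self (Real.sqrt_pos.2 h.pos)
  | coe z =>
    rw [Set.mem_compl_iff, coe_mem_image_iff, mem_closedBall_sqrt_iff h.pos.le, not_le] at hx
    obtain ⟨w, t, hw, ht, e, -⟩ := h.exists_coe_power (h.pos.trans hx)
    rw [hw, coe_mem_image_iff, mem_ball_sqrt_iff]
    nlinarith [mul_pos ht (sub_pos.2 hx)]

/-- An inversion in a circle orthogonal to the circle preserves its two sides. -/
theorem power_inversion {g : SpherePerm} {s : ℝ} (hg : IsInversion g s) (hc : c ^ 2 = R + s)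
    {z : ℂ} (hz : z ≠ 0) : ∃ w : ℂ, ∃ t : ℝ, g (z : Sphere) = (w : Sphere) ∧ 0 < t ∧
      (w.re - c) ^ 2 + w.im ^ 2 - R = t * ((z.re - c) ^ 2 + z.im ^ 2 - R) ∧ w.im = t * z.im ∧
      w.re = t * z.re := by
  obtain ⟨w, t, hw, ht, -, e1, e2, e3⟩ := hg.isCircleReflection.exists_coe_power
    (pos_of_ne (c := 0) (by simpa using hz))
  rw [sub_zero, zero_add] at e2
  rw [sub_zero] at e3
  refine ⟨w, t, hw, ht, ?_, e1, e2⟩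
  have hR : R = c ^ 2 - s := by linarith
  rw [e1, e2, hR, ← e3]
  ring

end IsCircleReflection

theorem IsMirror.coe_conj {f : SpherePerm} (h : IsMirror f 1) (z : ℂ) :
    ∃ w : ℂ, f (z : Sphere) = (w : Sphere) ∧ w.re = z.re ∧ w.im = -z.im := by
  obtain ⟨w, hw, e1, e2⟩ := h.exists_coe z
  exact ⟨w, hw, by simpa using e1, by simpa using e2⟩

/-- The disc bounded by a circle with real centre orthogonal to the circle of an inversion is
invariant under conjugation and the inversion, and so is its exterior. -/
theorem disc_invariant {f g : SpherePerm} {c R s : ℝ} (hR : 0 < R) (hf : IsMirror f 1)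
    (hg : IsInversion g s) (hc : c ^ 2 = R + s) :
    (∀ x ∈ ((↑) : ℂ → Sphere) '' Metric.ball (c : ℂ) √R,
      f x ∈ ((↑) : ℂ → Sphere) '' Metric.ball (c : ℂ) √R ∧
      g x ∈ ((↑) : ℂ → Sphere) '' Metric.ball (c : ℂ) √R) ∧
    (∀ x ∈ (((↑) : ℂ → Sphere) '' Metric.closedBall (c : ℂ) √R)ᶜ,
      f x ∈ (((↑) : ℂ → Sphere) '' Metric.closedBall (c : ℂ) √R)ᶜ ∧
      g x ∈ (((↑) : ℂ → Sphere) '' Metric.closedBall (c : ℂ) √R)ᶜ) := by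
  have hs := hg.pos
  constructor
  · rintro _ ⟨z, hz, rfl⟩
    obtain ⟨w, hw, e1, e2⟩ := hf.coe_conj z
    rw [mem_ball_sqrt_iff] at hz
    have hz0 : z ≠ 0 := by
      rintro rfl
      simp at hz
      linarith
    obtain ⟨u, t, hu, ht, e3, -⟩ := IsCircleReflection.power_inversion hg hc hz0
    rw [hw, hu, coe_mem_image_iff, mem_ball_sqrt_iff, coe_mem_image_iff, mem_ball_sqrt_iff, e1, e2,
      neg_sq]
    refine ⟨hz, ?_⟩
    nlinarith [mul_pos ht (sub_pos.2 hz)]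
  · intro x hx
    induction x using OnePoint.rec with
    | infty =>
      refine ⟨by rwa [hf.infty], ?_⟩
      rw [hg.infty, Set.mem_compl_iff, coe_mem_image_iff, mem_closedBall_sqrt_iff hR.le]
      simp
      linarith
    | coe z =>
      rw [Set.mem_compl_iff, coe_mem_image_iff, mem_closedBall_sqrt_iff hR.le, not_le] at hx
      obtain ⟨w, hw, e1, e2⟩ := hf.coe_conj z
      constructor
      · rw [hw, Set.mem_compl_iff, coe_mem_image_iff, mem_closedBall_sqrt_iff hR.le, not_le, e1, e2,
          neg_sq]
        exact hx
      · by_cases hz0 : z = 0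
        · rw [hz0, hg.zero]; exact infty_notMem_image
        · obtain ⟨u, t, hu, ht, e3, -⟩ := IsCircleReflection.power_inversion hg hc hz0
          rw [hu, Set.mem_compl_iff, coe_mem_image_iff, mem_closedBall_sqrt_iff hR.le, not_le]
          nlinarith [mul_pos ht (sub_pos.2 hx)]

theorem mem_sector_three {z : ℂ} : z ∈ sector 3 ↔ 0 < z.im ∧ 0 < z.re ∧ z.im ^ 2 < 3 * z.re ^ 2 := by
  have hpi := Real.pi_pos
  have hre := Complex.norm_mul_cos_arg z
  have him := Complex.norm_mul_sin_arg z
  constructor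
  · intro hz
    have hz0 := norm_pos_iff.2 (ne_zero_of_mem_sector hz)
    obtain ⟨h1, h2⟩ := hz
    push_cast at h2
    have hs := Real.sin_pos_of_pos_of_lt_pi h1 (by linarith)
    have hc : 1 / 2 < Real.cos z.arg := by
      rw [← Real.cos_pi_div_three]
      exact Real.cos_lt_cos_of_nonneg_of_le_pi h1.le (by linarith) h2
    refine ⟨by rw [← him]; positivity, by rw [← hre]; positivity, ?_⟩
    rw [← him, ← hre, mul_pow, mul_pow]
    have := Real.sin_sq_add_cos_sq z.arg
    have h4 : Real.sin z.arg ^ 2 < 3 * Real.cos z.arg ^ 2 := by nlinarith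
    nlinarith [pow_pos hz0 2]
  · rintro ⟨h1, h2, h3⟩
    have hz0 : 0 < ‖z‖ := norm_pos_iff.2 (by rintro rfl; simp at h1)
    rw [← him] at h1
    rw [← hre] at h2
    have hs := pos_of_mul_pos_right h1 hz0.le
    have hc := pos_of_mul_pos_right h2 hz0.le
    have h0 : 0 < z.arg := by
      by_contra h
      have := Real.sin_nonpos_of_nonpos_of_neg_pi_le (not_lt.1 h) (Complex.neg_pi_lt_arg z).le
      linarith
    refine ⟨h0, ?_⟩
    push_cast
    by_contra h
    have h5 : Real.cos z.arg ≤ 1 / 2 := by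
      rw [← Real.cos_pi_div_three]
      exact Real.cos_le_cos_of_nonneg_of_le_pi (by positivity) (Complex.arg_le_pi z) (not_lt.1 h)
    rw [← him, ← hre, mul_pow, mul_pow] at h3
    have := Real.sin_sq_add_cos_sq z.arg
    have h6 : 3 * Real.cos z.arg ^ 2 ≤ Real.sin z.arg ^ 2 := by nlinarith
    nlinarith [pow_pos hz0 2]

/-! ### Schottky discs and fundamental regions for the dihedral groups of orders four and six -/

/-- A set that contains the end of a ray has the point at infinity in its closure. -/
theorem infty_mem_closure {P : Set ℂ} {u : ℂ} (hu : u ≠ 0)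
    (h : ∀ᶠ t : ℝ in Filter.atTop, (t : ℂ) * u ∈ P) :
    OnePoint.infty ∈ closure (((↑) : ℂ → Sphere) '' P) := by
  have h1 : Filter.Tendsto (fun t : ℝ => (t : ℂ) * u) Filter.atTop (Filter.cocompact ℂ) := by
    rw [← Metric.cobounded_eq_cocompact, ← tendsto_norm_atTop_iff_cobounded]
    have : (fun t : ℝ => ‖(t : ℂ) * u‖) = fun t => |t| * ‖u‖ := by
      funext t
      rw [norm_mul, Complex.norm_real, Real.norm_eq_abs]
    rw [this]
    exact Filter.tendsto_abs_atTop_atTop.atTop_mul_const (norm_pos_iff.2 hu)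
  have h2 : Filter.Tendsto (fun t : ℝ => (((t : ℂ) * u : ℂ) : Sphere)) Filter.atTop
      (nhds OnePoint.infty) := by
    rw [← Filter.coclosedCompact_eq_cocompact] at h1
    exact OnePoint.tendsto_coe_infty.comp h1
  exact mem_closure_of_tendsto h2 (h.mono fun t ht => ⟨_, ht, rfl⟩)

section D4D6

variable {p : ℝ} {hp : 1 < p}

/-- A disc orthogonal to the unit circle with centre less than `2` lies in the sector
`|arg z| < π / 3`. -/
theorem sector_of_mem_disc {c : ℝ} (h0c : 0 ≤ c) (hc : c < 2) {z : ℂ}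
    (hz : (z.re - c) ^ 2 + z.im ^ 2 ≤ c ^ 2 - 1) : 0 < z.re ∧ z.im ^ 2 < 3 * z.re ^ 2 := by
  have h0 : 0 < z.re := by
    by_contra h
    nlinarith [sq_nonneg z.re, sq_nonneg z.im, mul_nonneg h0c (neg_nonneg.2 (not_lt.1 h))]
  refine ⟨h0, ?_⟩
  nlinarith [sq_nonneg (2 * z.re - 1)]

theorem disjoint_pow_image {σ : SpherePerm} (h3 : σ ^ 3 = 1) {D : Set Sphere}
    (hD : Disjoint (σ '' D) D) (a b : Fin 3) (hab : a ≠ b) :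
    Disjoint ((σ ^ (a : ℕ) : SpherePerm) '' D) ((σ ^ (b : ℕ) : SpherePerm) '' D) := by
  have h01 : Disjoint ((σ ^ 1 : SpherePerm) '' D) ((σ ^ 0 : SpherePerm) '' D) := by simpa using hD
  have h12 : Disjoint ((σ ^ 2 : SpherePerm) '' D) ((σ ^ 1 : SpherePerm) '' D) := by
    have := (Set.disjoint_image_iff σ.injective).2 h01
    rwa [← image_mul, ← image_mul, ← pow_succ', ← pow_succ'] at this
  have h20 : Disjoint ((σ ^ 0 : SpherePerm) '' D) ((σ ^ 2 : SpherePerm) '' D) := by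
    have := (Set.disjoint_image_iff σ.injective).2 h12
    rwa [← image_mul, ← image_mul, ← pow_succ', ← pow_succ', h3] at this
  fin_cases a <;> fin_cases b <;> first | exact absurd rfl hab | skip
  exacts [h01.symm, h20, h01, h12.symm, h20.symm, h12]

/-- For `p < 2` the disc of `r₄` lies in the open sector `|arg z| < π / 3`, so its rotations of order
three are disjoint. -/
theorem reflD4D6_isSchottkySystem (hp2 : p < 2) {N g k m : ℕ} {T : TreeQuotient N g k}
    (V : T.IsValid m) (S : T.IsSeparated) : IsSchottkySystem (wordElt (reflD4D6 p hp) ∘ T.word) := by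
  have hl := reflD4D6_isLiftable (p := p) (hp := hp)
  have hanti := reflD4D6_anti (p := p) (hp := hp)
  have h0 := reflD4D6_zero (p := p) (hp := hp)
  have h1 := reflD4D6_one (p := p) (hp := hp)
  have h3 := reflD4D6_three (p := p) (hp := hp)
  have h2 := fun z => reflD4D6_two_maps (p := p) (hp := hp) (z := z)
  generalize reflD4D6 p hp = r at *
  have inv := mul_self_of_isLiftable hl
  obtain ⟨A, hA1, hA2⟩ := exists_disc_eq_ball (p : ℂ) (Real.sqrt_pos.2 h3.pos)
  have hinv := disc_invariant h3.pos h0 h1 (by ring : p ^ 2 = p ^ 2 - 1 + 1)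
  refine V.isSchottkySystem S hl hanti A ?_ ?_ ?_ ?_
  · rw [hA1]
    exact image_eq_of_involution (inv 0) (fun x hx => (hinv.1 x hx).1) fun x hx => (hinv.1 x hx).1
  · rw [hA1]
    exact image_eq_of_involution (inv 1) (fun x hx => (hinv.1 x hx).2) fun x hx => (hinv.1 x hx).2
  · rw [hA1, hA2]
    exact image_eq_of_involution (inv 3) (fun x => h3.apply_notMem_of_mem_ball)
      fun x => h3.apply_mem_ball_of_notMem
  · refine disjoint_pow_image (coxD4D6_rotation_pow hl) ?_
    rw [hA2, Set.disjoint_left]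
    rintro _ ⟨_, ⟨z, hz, rfl⟩, rfl⟩ hx
    rw [mem_closedBall_sqrt_iff h3.pos.le] at hz
    obtain ⟨w, hw, e1, e2⟩ := h0.coe_conj z
    have hs := sector_of_mem_disc (by linarith) hp2 (z := w) (by rw [e1, e2, neg_sq]; exact hz)
    obtain ⟨u, hu, h⟩ := h2 w hs.1 hs.2
    rw [Equiv.Perm.mul_apply, hw, hu, coe_mem_image_iff, mem_closedBall_sqrt_iff h3.pos.le] at hx
    have := sector_of_mem_disc (by linarith) hp2 hx
    rcases h with h | h <;> linarith

/-- The part of the upper half-plane outside the circle of `r₄` is a fundamental region of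
`⟨r₁, r₂, r₄⟩⁺`. -/
theorem isFundamentalRegion_halfPlane :
    IsFundamentalRegion (Subgroup.closure {reflD4D6 p hp 1 * reflD4D6 p hp 0,
      reflD4D6 p hp 3 * reflD4D6 p hp 0})
      (((↑) : ℂ → Sphere) '' {z | 0 < z.im ∧ p ^ 2 - 1 < (z.re - p) ^ 2 + z.im ^ 2}) := by
  have hl := reflD4D6_isLiftable (p := p) (hp := hp)
  have h0 := reflD4D6_zero (p := p) (hp := hp)
  have h1 := reflD4D6_one (p := p) (hp := hp)
  have h3 := reflD4D6_three (p := p) (hp := hp)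
  generalize reflD4D6 p hp = r at *
  have inv := mul_self_of_isLiftable hl
  have c01 : Commute (r 0) (r 1) := commute_of_isLiftable hl rfl
  have c03 : Commute (r 0) (r 3) := commute_of_isLiftable hl rfl
  have c13 : Commute (r 1) (r 3) := commute_of_isLiftable hl rfl
  set K := Subgroup.closure {r 1 * r 0, r 3 * r 0} with hK
  have ha : r 1 * r 0 ∈ K := Subgroup.subset_closure (by simp)
  have hb : r 3 * r 0 ∈ K := Subgroup.subset_closure (by simp)
  have hab : r 1 * r 0 * (r 3 * r 0) = r 3 * r 1 := by
    rw [mul_assoc, ← mul_assoc (r 0), c03.eq, mul_assoc (r 3), inv, mul_one, c13.eq]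
  have hmem : ∀ k ∈ K, k = 1 ∨ k = r 1 * r 0 ∨ k = r 3 * r 0 ∨ k = r 3 * r 1 := by
    intro k hk
    have haa : r 1 * r 0 * (r 1 * r 0) = 1 := by
      rw [mul_assoc, ← mul_assoc (r 0), c01.eq, mul_assoc (r 1), inv, mul_one, inv]
    have hbb : r 3 * r 0 * (r 3 * r 0) = 1 := by
      rw [mul_assoc, ← mul_assoc (r 0), c03.eq, mul_assoc (r 3), inv, mul_one, inv]
    have hbab : r 3 * r 0 * (r 1 * r 0) * (r 3 * r 0) = (r 1 * r 0)⁻¹ := by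
      rw [mul_assoc, hab, ← c13.eq, ← mul_assoc, mul_assoc (r 3), c01.eq, ← mul_assoc, ← c13.eq,
        mul_assoc (r 1), c03.symm.eq, mul_assoc, mul_assoc, inv, mul_one, _root_.mul_inv_rev,
        inv_eq_of_mul_eq_one_left (inv 0), inv_eq_of_mul_eq_one_left (inv 1), c01.eq]
    obtain ⟨j, hj⟩ := (mem_closure_pair_iff hbb hbab).1 hk
    have hz : (r 1 * r 0) ^ j = 1 ∨ (r 1 * r 0) ^ j = r 1 * r 0 := by
      have h2 : (r 1 * r 0) ^ (2 : ℤ) = 1 := by rw [zpow_two]; exact haa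
      rcases Int.even_or_odd' j with ⟨l, rfl | rfl⟩
      · left; rw [_root_.zpow_mul, h2, _root_.one_zpow]
      · right; rw [_root_.zpow_add, _root_.zpow_mul, h2, _root_.one_zpow, one_mul, zpow_one]
    rcases hj with rfl | rfl <;> rcases hz with e | e <;> rw [e]
    · exact Or.inl rfl
    · exact Or.inr (Or.inl rfl)
    · exact Or.inr (Or.inr (Or.inl (one_mul _)))
    · exact Or.inr (Or.inr (Or.inr hab))
  have hR : p ^ 2 = p ^ 2 - 1 + 1 := by ring
  refine ⟨OnePoint.isOpenEmbedding_coe.isOpenMap _ ?_, ?_, ?_⟩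
  · have hre := Complex.continuous_re
    have him := Complex.continuous_im
    exact (isOpen_lt continuous_const him).inter (isOpen_lt continuous_const
      (((hre.sub continuous_const).pow 2).add (him.pow 2)))
  · intro k hk hk1
    rw [Set.disjoint_left]
    rintro _ ⟨_, ⟨z, ⟨hz1, hz2⟩, rfl⟩, rfl⟩ hx
    obtain ⟨w, hw, e1, e2⟩ := h0.coe_conj z
    have hz0 : ∀ u : ℂ, u.im ≠ 0 → u ≠ 0 := by rintro u hu rfl; simp at hu
    rcases (hmem k hk).resolve_left hk1 with rfl | rfl | rfl
    · obtain ⟨u, t, hu, ht, -, e3, -⟩ := IsCircleReflection.power_inversion h1 hR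
        (hz0 w (by rw [e2]; linarith))
      rw [Equiv.Perm.mul_apply, hw, hu, coe_mem_image_iff] at hx
      have := hx.1
      rw [e3, e2] at this
      nlinarith [mul_pos ht hz1]
    · obtain ⟨u, t, hu, ht, -, e3, -⟩ := h3.exists_coe_power (z := w) (by
        rw [e2]; nlinarith [sq_nonneg (w.re - p)])
      rw [Equiv.Perm.mul_apply, hw, hu, coe_mem_image_iff] at hx
      have := hx.1
      rw [e3, e2] at this
      nlinarith [mul_pos ht hz1]
    · obtain ⟨v, s, hv, hs, e3, -⟩ := IsCircleReflection.power_inversion h1 hR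
        (hz0 z (by linarith))
      have hv1 : 0 < (v.re - p) ^ 2 + v.im ^ 2 - (p ^ 2 - 1) := by
        rw [e3]; exact mul_pos hs (sub_pos.2 hz2)
      obtain ⟨u, t, hu, ht, e4, -⟩ := h3.exists_coe_power (z := v) (by linarith [h3.pos])
      rw [Equiv.Perm.mul_apply, hv, hu, coe_mem_image_iff] at hx
      nlinarith [hx.2, mul_pos ht hv1]
  · have hcl : ∀ z : ℂ, 0 ≤ z.im → p ^ 2 - 1 ≤ (z.re - p) ^ 2 + z.im ^ 2 → (z : Sphere) ∈
        closure (((↑) : ℂ → Sphere) '' {z | 0 < z.im ∧ p ^ 2 - 1 < (z.re - p) ^ 2 + z.im ^ 2}) := by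
      intro z h1 h2
      have hc : Continuous fun ε : ℝ => ((z + ε * Complex.I : ℂ) : Sphere) :=
        OnePoint.continuous_coe.comp (by fun_prop)
      have h := map_mem_closure hc (s := Set.Ioi (0 : ℝ)) (x := 0)
        (t := ((↑) : ℂ → Sphere) '' {z | 0 < z.im ∧ p ^ 2 - 1 < (z.re - p) ^ 2 + z.im ^ 2})
        (by rw [closure_Ioi]; exact Set.self_mem_Ici) (by
          intro ε hε
          rw [Set.mem_Ioi] at hε
          refine ⟨_, ⟨?_, ?_⟩, rfl⟩
          · simp; linarith
          · simp; nlinarith)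
      simpa using h
    have hinf : OnePoint.infty ∈
        closure (((↑) : ℂ → Sphere) '' {z | 0 < z.im ∧ p ^ 2 - 1 < (z.re - p) ^ 2 + z.im ^ 2}) := by
      refine infty_mem_closure Complex.I_ne_zero ?_
      filter_upwards [Filter.eventually_gt_atTop (1 : ℝ)] with t ht
      simp
      constructor <;> nlinarith
    have hin : ∀ (k : SpherePerm), k ∈ K → ∀ x, k x ∈ closure (((↑) : ℂ → Sphere) ''
        {z | 0 < z.im ∧ p ^ 2 - 1 < (z.re - p) ^ 2 + z.im ^ 2}) → x ∈ ⋃ k ∈ K, k '' closure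
        (((↑) : ℂ → Sphere) '' {z | 0 < z.im ∧ p ^ 2 - 1 < (z.re - p) ^ 2 + z.im ^ 2}) := by
      intro k hk x hx
      refine Set.mem_biUnion (inv_mem hk) ⟨k x, hx, ?_⟩
      rw [← Equiv.Perm.mul_apply, inv_mul_cancel, Equiv.Perm.one_apply]
    rw [Set.eq_univ_iff_forall]
    intro x
    induction x using OnePoint.rec with
    | infty => exact hin 1 (one_mem _) _ hinf
    | coe z =>
      rcases le_total (p ^ 2 - 1) ((z.re - p) ^ 2 + z.im ^ 2) with h | h
      · rcases le_total 0 z.im with h' | h'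
        · exact hin 1 (one_mem _) _ (hcl z h' h)
        · obtain ⟨w, hw, e1, e2⟩ := h0.coe_conj z
          refine hin (r 1 * r 0) ha _ ?_
          rw [Equiv.Perm.mul_apply, hw]
          by_cases hz0 : w = 0
          · rw [hz0, h1.zero]; exact hinf
          · obtain ⟨u, t, hu, ht, e3, e4, -⟩ := IsCircleReflection.power_inversion h1 hR hz0
            rw [hu]
            refine hcl u (by rw [e4, e2]; exact mul_nonneg ht.le (by linarith)) ?_
            rw [e1, e2, neg_sq] at e3
            nlinarith [mul_nonneg ht.le (sub_nonneg.2 h)]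
      · by_cases hc : z = p
        · refine hin (r 3 * r 0) hb _ ?_
          rw [Equiv.Perm.mul_apply, hc, h0.coe, one_mul, Complex.conj_ofReal, h3.center]
          exact hinf
        · rcases le_total 0 z.im with h' | h'
          · have hz0 : z ≠ 0 := by
              rintro rfl
              simp at h
              linarith
            obtain ⟨v, s, hv, hs, e3, e5, -⟩ := IsCircleReflection.power_inversion h1 hR hz0
            refine hin (r 3 * r 1) (hab ▸ mul_mem ha hb) _ ?_
            rw [Equiv.Perm.mul_apply, hv]
            by_cases hvc : v = p
            · rw [hvc, h3.center]; exact hinf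
            · obtain ⟨u, t, hu, ht, e4, e6, -⟩ := h3.exists_coe_power (IsCircleReflection.pos_of_ne hvc)
              rw [hu]
              refine hcl u (by rw [e6, e5]; positivity) ?_
              rw [e3] at e4
              nlinarith [mul_nonneg (mul_nonneg ht.le hs.le) (sub_nonneg.2 h)]
          · obtain ⟨w, hw, e1, e2⟩ := h0.coe_conj z
            refine hin (r 3 * r 0) hb _ ?_
            rw [Equiv.Perm.mul_apply, hw]
            obtain ⟨u, t, hu, ht, e4, e6, -⟩ := h3.exists_coe_power (z := w) (by
              rw [e1, e2, neg_sq]; exact IsCircleReflection.pos_of_ne hc)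
            rw [hu]
            refine hcl u (by rw [e6, e2]; exact mul_nonneg ht.le (by linarith)) ?_
            rw [e1, e2, neg_sq] at e4
            nlinarith [mul_nonneg ht.le (sub_nonneg.2 h)]

end D4D6

/-! ### Maskit combination of the dihedral groups of orders four and six -/

section D4D6

variable {p : ℝ} {hp : 1 < p}

/-- The half-turn `r i * r 0` inverts the rotation `r 2 * r 0`, where `r 0` and `r 2` are reflections in
lines through the origin and `r i` is an inversion about the origin. -/
theorem dihedral_relations {r : Fin 4 → SpherePerm} {i : Fin 4} {n : ℕ} (hn : n ≠ 0) {s : ℝ}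
    (h0 : IsMirror (r 0) 1) (h1 : IsInversion (r i) s) (h2 : IsMirror (r 2) (zeta n))
    (hc : Commute (r i) (r 2)) :
    r i * r 0 * (r i * r 0) = 1 ∧
      r i * r 0 * (r 2 * r 0) * (r i * r 0) = (r 2 * r 0)⁻¹ ∧ (r 2 * r 0) ^ n = 1 := by
  have h0f : Commute (r i) (r 0) :=
    (commute_of_sq h0.mul_self h1.mul_self (h0.mul_inversion_sq h1)).symm
  refine ⟨?_, ?_, h2.rot_pow hn h0⟩
  · rw [← pow_two, h0f.eq]; exact h0.mul_inversion_sq h1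
  · rw [_root_.mul_inv_rev, inv_eq_of_mul_eq_one_left h0.mul_self,
      inv_eq_of_mul_eq_one_left h2.mul_self, h0f.eq]
    calc r 0 * r i * (r 2 * r 0) * (r 0 * r i)
        = r 0 * r i * r 2 * (r 0 * r 0) * r i := by group
      _ = r 0 * (r i * r 2) * r i := by rw [h0.mul_self, mul_one]; group
      _ = r 0 * r 2 * (r i * r i) := by rw [hc.eq]; group
      _ = _ := by rw [h1.mul_self, mul_one]

theorem isFundamentalRegion_sector_of_mirror {r : Fin 4 → SpherePerm} {i : Fin 4} {n : ℕ}
    (hn : 1 ≤ n) {s : ℝ} (h0 : IsMirror (r 0) 1) (h1 : IsInversion (r i) s)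
    (h2 : IsMirror (r 2) (zeta n)) (hc : Commute (r i) (r 2)) :
    IsFundamentalRegion (Subgroup.closure {r 2 * r 0, r i * r 0})
      (((↑) : ℂ → Sphere) '' sector n) := by
  obtain ⟨e1, e2, e3⟩ := dihedral_relations (by omega) h0 h1 h2 hc
  refine isFundamentalRegion_sector hn h1.pos (h2.rot h0) (fun z hz => h1.mul_conj_coe h0 hz) ?_
    e3 e1 e2
  rw [Equiv.Perm.mul_apply, h0.coe, map_zero, mul_zero, h1.zero]

theorem orderOf_rotation_three {a b : SpherePerm} (ha : IsMirror a (zeta 3)) (hb : IsMirror b 1) :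
    orderOf (a * b) = 3 := by
  have : Fact (Nat.Prime 3) := ⟨Nat.prime_three⟩
  refine orderOf_eq_prime (ha.rot_pow (n := 3) (by norm_num) hb) fun h => ?_
  have := ha.rot hb 1
  rw [h, Equiv.Perm.one_apply, OnePoint.coe_eq_coe, mul_one, zeta_three] at this
  have := congrArg Complex.re this
  simp at this
  norm_num at this

theorem dihedral_three {r : Fin 4 → SpherePerm} {i : Fin 4} {s : ℝ} (h0 : IsMirror (r 0) 1)
    (h1 : IsInversion (r i) s) (h2 : IsMirror (r 2) (zeta 3)) (hc : Commute (r i) (r 2)) :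
    Nonempty (Subgroup.closure {r 2 * r 0, r i * r 0} ≃* DihedralGroup 3) := by
  obtain ⟨e1, e2, -⟩ := dihedral_relations (n := 3) (by norm_num) h0 h1 h2 hc
  refine dihedral_mulEquiv e1 e2 (orderOf_rotation_three h2 h0) ?_
  rintro ⟨k, hk⟩
  have h4 := congrFun (congrArg DFunLike.coe hk) ((0 : ℂ) : Sphere)
  dsimp only at h4
  rw [rotation_zpow_coe (h2.rot h0), Equiv.Perm.mul_apply, h0.coe, map_zero, mul_zero, mul_zero,
    h1.zero] at h4
  exact OnePoint.coe_ne_infty _ h4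

theorem reflD4D6_dihedral_three {z₀ : ℂ} {U : Set ℂ} {Y X₁ X₂ : Set Sphere}
    (h : ReflectionAmalgam (coxD4D6 0 (by decide)) (reflD4D6 p hp) 1 3 2 2 z₀ U Y X₁ X₂) :
    Nonempty (sphericalGroup (reflD4D6 p hp) 0 1 2 ≃* DihedralGroup 3) := by
  rw [h.sphericalGroup_eq, Set.pair_comm]
  exact dihedral_three reflD4D6_zero reflD4D6_one reflD4D6_two
    (commute_of_isLiftable h.lift rfl)

/-- The separating circle is orthogonal to the unit circle, with centre between `p` and `2`: it
encloses the disc of `r₄` and still lies in the sector `|arg z| < π / 3`. -/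
theorem reflD4D6_isMaskitCombination (hp2 : p < 2) {z₀ : ℂ} {U : Set ℂ} {Y X₁ X₂ : Set Sphere}
    (h : ReflectionAmalgam (coxD4D6 0 (by decide)) (reflD4D6 p hp) 1 3 2 2 z₀ U Y X₁ X₂) :
    IsMaskitCombination (sphericalGroup (reflD4D6 p hp) 0 1 3) (sphericalGroup (reflD4D6 p hp) 0 1 2)
      (Subgroup.zpowers (reflD4D6 p hp 1 * reflD4D6 p hp 0)) := by
  have h0 := reflD4D6_zero (p := p) (hp := hp)
  have h1 := reflD4D6_one (p := p) (hp := hp)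
  have h2 := reflD4D6_two (p := p) (hp := hp)
  have h3 := reflD4D6_three (p := p) (hp := hp)
  have h2m := fun z => reflD4D6_two_maps (p := p) (hp := hp) (z := z)
  have hl := h.lift
  obtain ⟨e2⟩ := reflD4D6_dihedral_three h
  have f1 := isFundamentalRegion_halfPlane (p := p) (hp := hp)
  have f2 := isFundamentalRegion_sector_of_mirror (n := 3) (by norm_num) h0 h1 h2
    (commute_of_isLiftable h.lift rfl)
  generalize reflD4D6 p hp = r at *
  obtain ⟨e1⟩ := h.dihedral_of_commute h.s_notMem_zpowers (commute_of_isLiftable h.lift rfl)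
    (commute_of_isLiftable h.lift rfl)
  rw [← h.sphericalGroup_eq] at f1
  rw [Set.pair_comm, ← h.sphericalGroup_eq] at f2
  have : Finite (sphericalGroup r 0 1 3) := Finite.of_equiv _ e1.symm.toEquiv
  have : Finite (sphericalGroup r 0 1 2) := Finite.of_equiv _ e2.symm.toEquiv
  obtain ⟨c, hc1, hc2⟩ := exists_between hp2
  have hR : 0 < c ^ 2 - 1 := by nlinarith
  obtain ⟨A, hA1, hA2⟩ := exists_disc_eq_ball (c : ℂ) (Real.sqrt_pos.2 hR)
  have hinv := disc_invariant hR h0 h1 (by ring : c ^ 2 = c ^ 2 - 1 + 1)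
  have hin : ∀ i : Fin 4, i = 0 ∨ i = 1 → ∀ x ∈ ((↑) : ℂ → Sphere) '' Metric.ball (c : ℂ) √(c ^ 2 - 1),
      r i x ∈ ((↑) : ℂ → Sphere) '' Metric.ball (c : ℂ) √(c ^ 2 - 1) := by
    rintro i (rfl | rfl) x hx
    exacts [(hinv.1 x hx).1, (hinv.1 x hx).2]
  have hout : ∀ i : Fin 4, i = 0 ∨ i = 1 →
      ∀ x ∈ (((↑) : ℂ → Sphere) '' Metric.closedBall (c : ℂ) √(c ^ 2 - 1))ᶜ,
      r i x ∈ (((↑) : ℂ → Sphere) '' Metric.closedBall (c : ℂ) √(c ^ 2 - 1))ᶜ := by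
    rintro i (rfl | rfl) x hx
    exacts [(hinv.2 x hx).1, (hinv.2 x hx).2]
  -- the disc of the reflection `r₄` lies inside the separating circle
  have hsub : ∀ z : ℂ, (z.re - p) ^ 2 + z.im ^ 2 ≤ p ^ 2 - 1 →
      (z.re - c) ^ 2 + z.im ^ 2 < c ^ 2 - 1 := by
    intro z hz
    have := (sector_of_mem_disc (by linarith) hp2 hz).1
    nlinarith [mul_pos this (sub_pos.2 hc1)]
  refine ⟨h.isKleinian (ReflectionAmalgam.sphericalGroup_le _ _ _ _), inferInstance,
    h.isKleinian (ReflectionAmalgam.sphericalGroup_le _ _ _ _), inferInstance, inferInstance,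
    h.zpowers_lt_s, h.zpowers_lt_t, A, _, _, _, _, _, rfl, Or.inr ⟨rfl, rfl⟩, ?_, f1, f2, ?_, ?_, ?_⟩
  · intro j hj
    rw [hA1, hA2]
    exact ⟨h.zpowers_image_eq hout hj, h.zpowers_image_eq hin hj⟩
  · rw [hA1, hA2]
    ext x
    induction x using OnePoint.rec with
    | infty =>
      exact ⟨fun hx => absurd hx.2 infty_notMem_image, fun hx => absurd hx.2 infty_notMem_image⟩
    | coe z =>
      simp only [Set.mem_inter_iff, Set.mem_sdiff, coe_mem_image_iff, mem_sector_three,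
        mem_closedBall_sqrt_iff hR.le, mem_ball_sqrt_iff, Set.mem_ofPred_eq]
      refine and_congr_right fun hz => ?_
      have := sector_of_mem_disc (by linarith) hc2 hz.1
      refine ⟨fun hz' => ⟨hz'.1, this⟩, fun hz' => ⟨hz'.1, ?_⟩⟩
      by_contra h'
      exact hz.2 (hsub z (not_lt.1 h'))
  · rintro k hk hkJ _ ⟨x, hx, rfl⟩
    rw [hA1]
    rw [hA2] at hx
    refine h.maps_of_mem_s hout hin ?_ hk hkJ x hx
    intro x hx
    have : r 3 x ∈ ((↑) : ℂ → Sphere) '' Metric.ball (p : ℂ) √(p ^ 2 - 1) := by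
      refine h3.apply_mem_ball_of_notMem fun hx' => hx ?_
      obtain ⟨z, hz, rfl⟩ := hx'
      rw [mem_closedBall_sqrt_iff h3.pos.le] at hz
      rw [coe_mem_image_iff, mem_closedBall_sqrt_iff hR.le]
      exact (hsub z hz).le
    obtain ⟨z, hz, e⟩ := this
    rw [mem_ball_sqrt_iff] at hz
    rw [← e, coe_mem_image_iff, mem_ball_sqrt_iff]
    exact hsub z hz.le
  · rintro k hk hkJ _ ⟨x, hx, rfl⟩
    rw [hA2]
    rw [hA1] at hx
    refine h.maps_of_mem_t hin hout ?_ hk hkJ x hx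
    rintro _ ⟨z, hz, rfl⟩
    rw [mem_ball_sqrt_iff] at hz
    have hs := sector_of_mem_disc (by linarith) hc2 hz.le
    obtain ⟨w, hw, hw'⟩ := h2m z hs.1 hs.2
    rw [hw, Set.mem_compl_iff, coe_mem_image_iff, mem_closedBall_sqrt_iff hR.le]
    intro hw2
    have := sector_of_mem_disc (by linarith) hc2 hw2
    rcases hw' with h | h <;> linarith

end D4D6

/-! ### Free generators and finite quotients -/

section Transfer

variable {G G' : Type*} [Group G] [Group G'] {r : Fin 4 → G} {r' : Fin 4 → G'}

/-- Words that are free generators in some group with the relations of a Coxeter matrix are free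
generators in the Coxeter group. -/
theorem injective_lift_of_isLiftable {M : CoxeterMatrix (Fin 4)} (h : HasCoxeterPresentation M r)
    (h' : M.IsLiftable r') {g : ℕ} (w : Fin g → List (Fin 4))
    (hinj : Function.Injective (FreeGroup.lift (wordElt r' ∘ w))) :
    Function.Injective (FreeGroup.lift (wordElt r ∘ w)) := by
  obtain ⟨φ, hφ⟩ := h.exists_hom h'
  let R : Fin 4 → Subgroup.closure (Set.range r) := fun i => ⟨r i, Subgroup.subset_closure ⟨i, rfl⟩⟩
  have hφR : φ ∘ R = r' := funext hφ
  have h1 : φ.comp (FreeGroup.lift (wordElt R ∘ w)) = FreeGroup.lift (wordElt r' ∘ w) := by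
    ext j
    simp [map_wordElt, hφR]
  have h2 : (Subgroup.subtype _).comp (FreeGroup.lift (wordElt R ∘ w)) =
      FreeGroup.lift (wordElt r ∘ w) := by
    ext j
    simp only [MonoidHom.comp_apply, FreeGroup.lift_apply_of, Function.comp_apply]
    exact map_wordElt (Subgroup.subtype _) R _
  rw [← h1, MonoidHom.coe_comp] at hinj
  rw [← h2, MonoidHom.coe_comp]
  exact Subtype.val_injective.comp hinj.of_comp

theorem range_lift {g : ℕ} (L : Fin g → G) :
    (FreeGroup.lift L).range = Subgroup.closure (Set.range L) := by
  exact FreeGroup.range_lift_eq_closure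

theorem orderOf_eq_zero_of_injective {g : ℕ} {L : Fin g → G}
    (hinj : Function.Injective (FreeGroup.lift L)) (j : Fin g) : orderOf (L j) = 0 := by
  have h : L j = FreeGroup.lift L (FreeGroup.of j) := by simp
  rw [h, orderOf_injective _ hinj, orderOf_eq_zero_iff]
  intro hf
  exact FreeGroup.of_ne_one j ((isOfFinOrder_iff_eq_one _).1 hf)

end Transfer

section Quotient

variable {r : Fin 4 → SpherePerm} {M : CoxeterMatrix (Fin 4)} {Q : Type*} [Group Q]

/-- A homomorphism from the extended group onto a finite group `Q`, surjective already on words of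
even length, identifies the quotient of the orientation-preserving subgroup by a subgroup of its
kernel with `Q` as soon as the index is right. -/
theorem hasQuotient_closure_words (h : HasCoxeterPresentation M r)
    (anti : ∀ i, IsAntiConformal (r i)) {f : Fin 4 → Q} (hf : M.IsLiftable f) {g : ℕ}
    {w : Fin g → List (Fin 4)} (heven : ∀ j, (w j).length % 2 = 0) (hw : ∀ j, wordElt f (w j) = 1)
    (hsurj : ∀ x : Q, ∃ l : List (Fin 4), l.length % 2 = 0 ∧ wordElt f l = x) [Finite Q]
    (hidx : (Subgroup.closure (Set.range (wordElt r ∘ w))).relIndex (conformalGroup r) =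
      Nat.card Q) :
    HasQuotient (conformalGroup r) (Subgroup.closure (Set.range (wordElt r ∘ w))) Q := by
  obtain ⟨q, hq⟩ := h.exists_hom hf
  let R : Fin 4 → Subgroup.closure (Set.range r) := fun i => ⟨r i, Subgroup.subset_closure ⟨i, rfl⟩⟩
  have hqR : q ∘ R = f := funext hq
  have hmem : ∀ l : List (Fin 4), l.length % 2 = 0 → wordElt r l ∈ conformalGroup r :=
    fun l hl => ⟨wordElt_mem _, (wordElt_conformal_or anti _).1 hl⟩
  let φ : conformalGroup r →* Q := q.comp (Subgroup.inclusion inf_le_left)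
  have hφ : ∀ l (hl : l.length % 2 = 0), φ ⟨wordElt r l, hmem l hl⟩ = wordElt f l := by
    intro l hl
    rw [← hqR, ← map_wordElt]
    refine congrArg q (Subtype.ext ?_)
    exact (map_wordElt (Subgroup.subtype _) R l).symm
  have hle : Subgroup.closure (Set.range (wordElt r ∘ w)) ≤ conformalGroup r := by
    rw [Subgroup.closure_le]
    rintro _ ⟨j, rfl⟩
    exact hmem _ (heven j)
  have hs : Function.Surjective φ := fun x => by
    obtain ⟨l, hl, rfl⟩ := hsurj x
    exact ⟨_, hφ l hl⟩
  refine ⟨hle, φ, hs, ?_⟩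
  have hker : (Subgroup.closure (Set.range (wordElt r ∘ w))).subgroupOf (conformalGroup r) ≤
      φ.ker := by
    have : Subgroup.closure (Set.range (wordElt r ∘ w)) ≤ φ.ker.map (Subgroup.subtype _) := by
      rw [Subgroup.closure_le]
      rintro _ ⟨j, rfl⟩
      exact ⟨⟨_, hmem _ (heven j)⟩, (hφ _ (heven j)).trans (hw j), rfl⟩
    rintro ⟨x, hx⟩ hxS
    obtain ⟨y, hy, rfl⟩ := this hxS
    exact hy
  refine le_antisymm ?_ hker
  have e := Subgroup.relIndex_mul_index hker
  rw [Subgroup.index_ker, MonoidHom.range_eq_top.2 hs, Subgroup.card_top] at e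
  rw [Subgroup.relIndex] at hidx
  rw [hidx] at e
  exact Subgroup.relIndex_eq_one.1 (Nat.eq_of_mul_eq_mul_right Nat.card_pos (e.trans (one_mul _).symm))

end Quotient

section D4D6

variable {p : ℝ} {hp : 1 < p}

theorem reflD4D6_hasCoxeterPresentation (hp2 : p ≤ 2) :
    HasCoxeterPresentation (coxD4D6 0 (by decide)) (reflD4D6 p hp) := by
  obtain ⟨z₀, U, h⟩ := reflD4D6_amalgam (hp := hp) hp2
  exact h.hasCoxeterPresentation

/-- For `p = 2` the Schottky discs touch; the generators are free since they are free for smaller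
`p` and the group has the same presentation. -/
theorem reflD4D6_injective (hp2 : p ≤ 2) {N g k m : ℕ} {T : TreeQuotient N g k} (V : T.IsValid m)
    (S : T.IsSeparated) (hg : 2 ≤ g) :
    Function.Injective (FreeGroup.lift (wordElt (reflD4D6 p hp) ∘ T.word)) :=
  injective_lift_of_isLiftable (reflD4D6_hasCoxeterPresentation hp2)
    (reflD4D6_isLiftable (p := 3 / 2) (hp := by norm_num)) T.word
    ((reflD4D6_isSchottkySystem (by norm_num) V S).injective hg)

theorem coxD4D6_apply_eq_or {m : ℕ} (hm : m ≠ 1) (h0 : 0 ≠ 1) (i j : Fin 4) :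
    coxD4D6 m hm i j = coxD4D6 0 h0 i j ∨ (i = 2 ∧ j = 3) ∨ (i = 3 ∧ j = 2) := by
  change !![1, 2, 3, 2; 2, 1, 2, 2; 3, 2, 1, m; 2, 2, m, 1] i j =
    !![1, 2, 3, 2; 2, 1, 2, 2; 3, 2, 1, 0; 2, 2, 0, 1] i j ∨ _
  fin_cases i <;> fin_cases j <;> simp

variable {r : Fin 4 → SpherePerm} {z₀ : ℂ} {U : Set ℂ} {Y X₁ X₂ : Set Sphere}

/-- The subgroup generated by the words of a finite subtree, as a subgroup of the extended group. -/
theorem TreeQuotient.IsValid.conclusions {N g k m : ℕ} {T : TreeQuotient N g k} (V : T.IsValid m)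
    (h : ReflectionAmalgam (coxD4D6 0 (by decide)) r 1 3 2 2 z₀ U Y X₁ X₂)
    (hinj : Function.Injective (FreeGroup.lift (wordElt r ∘ T.word))) {S : Subgroup SpherePerm}
    (hS : S = Subgroup.closure (Set.range (wordElt r ∘ T.word))) :
    IsNormalIn S (extendedGroup r) ∧ S ≤ conformalGroup r ∧
      S.relIndex (conformalGroup r) = 6 * N ∧ IsFreeBasis (wordElt r ∘ T.word) S ∧
      S.relIndex (Subgroup.closure (Set.range r)) = 12 * N := by
  obtain ⟨q, -, -, hidx⟩ := V.ker_eq h.hasCoxeterPresentation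
  have hle : S ≤ conformalGroup r := by
    rw [hS, Subgroup.closure_le]
    rintro _ ⟨j, rfl⟩
    exact ⟨wordElt_mem _, (wordElt_conformal_or h.anti _).1 (V.even j)⟩
  rw [← hS] at hidx
  refine ⟨hS ▸ V.isNormalIn h.hasCoxeterPresentation, hle, h.relIndex_eq hle ?_,
    ⟨hinj, by rw [range_lift, hS]⟩, hidx⟩
  rw [extendedGroup, hidx]
  ring

/-- The reflections of the quotient of rank four inside `S₃ × S₃`. -/
def permThreePair : Fin 4 → Equiv.Perm (Fin 3) × Equiv.Perm (Fin 3) :=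
  ![(Equiv.swap 1 2, Equiv.swap 1 2), 1, (Equiv.swap 0 1, Equiv.swap 0 1), (1, Equiv.swap 1 2)]

theorem permThreePair_surjective (x : Equiv.Perm (Fin 3) × Equiv.Perm (Fin 3)) :
    ∃ l : List (Fin 4), l.length % 2 = 0 ∧ wordElt permThreePair l = x := by
  -- words of even length for the elements of the two factors
  have key : ∀ x : Equiv.Perm (Fin 3) × Equiv.Perm (Fin 3),
      ∃ l₁ ∈ ([[], [0, 3], [2, 0, 3, 2], [0, 2, 0, 3, 2, 0], [0, 2, 0, 3, 2, 3],
        [0, 2, 3, 2, 3, 2]] : List (List (Fin 4))),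
      ∃ l₂ ∈ ([[], [1, 3], [1, 2, 3, 2], [2, 3, 2, 3], [3, 2, 3, 2],
        [0, 1, 2, 3, 2, 0]] : List (List (Fin 4))),
      (l₁ ++ l₂).length % 2 = 0 ∧ wordElt permThreePair (l₁ ++ l₂) = x := by
    decide +kernel
  obtain ⟨l₁, -, l₂, -, h⟩ := key x
  exact ⟨_, h⟩

/-- The permutations of `permThreePair` kill the four words and have the order of the quotient. -/
theorem treeRankFour_hasQuotient
    (h : ReflectionAmalgam (coxD4D6 0 (by decide)) r 1 3 2 2 z₀ U Y X₁ X₂)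
    (hidx : (Subgroup.closure (Set.range (wordElt r ∘ treeRankFour.word))).relIndex
      (conformalGroup r) = 36) :
    HasQuotient (conformalGroup r) (Subgroup.closure (Set.range (wordElt r ∘ treeRankFour.word)))
      (Equiv.Perm (Fin 3) × Equiv.Perm (Fin 3)) := by
  refine hasQuotient_closure_words h.hasCoxeterPresentation h.anti (f := permThreePair) ?_
    treeRankFour_isValid.even ?_ permThreePair_surjective ?_
  · refine isLiftable_fin_four (by decide +kernel) ?_
    intro i j hij
    change (permThreePair i * permThreePair j) ^
      (!![1, 2, 3, 2; 2, 1, 2, 2; 3, 2, 1, 0; 2, 2, 0, 1] : Matrix (Fin 4) (Fin 4) ℕ) i j = 1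
    revert i j
    decide +kernel
  · decide +kernel
  · rw [hidx, Nat.card_prod, Nat.card_perm, Nat.card_fin]; rfl

theorem treeTwo_word {G : Type*} [Group G] (r : Fin 4 → G) :
    wordElt r ∘ treeTwo.word = ![(r 2 * r 3) ^ 2, r 0 * (r 2 * r 3) ^ 2 * r 0] := by
  funext j
  fin_cases j <;> simp [treeTwo, wordElt, pow_succ, mul_assoc]

theorem treeThree_word {G : Type*} [Group G] {r : Fin 4 → G} (inv : ∀ i, r i * r i = 1) :
    wordElt r ∘ treeThree.word = ![(r 2 * r 3) ^ 3, r 0 * (r 2 * r 3) ^ 3 * r 0,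
      (r 0 * r 2 * r 0) * (r 2 * r 3) ^ 3 * (r 0 * r 2 * r 0)⁻¹] := by
  have hri : ∀ i, (r i)⁻¹ = r i := fun i => inv_eq_of_mul_eq_one_left (inv i)
  funext j
  fin_cases j <;> simp [treeThree, wordElt, pow_succ, mul_assoc, hri]

theorem treeRankFour_word {G : Type*} [Group G] (r : Fin 4 → G) :
    wordElt r ∘ treeRankFour.word = ![((r 3 * r 2) ^ 2 * r 0) ^ 2, (r 0 * (r 3 * r 2) ^ 2) ^ 2,
      (r 0 * r 3 * r 2) ^ 3 * (r 0 * r 2 * r 3 * r 2 * r 0),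
      (r 3 * r 2 * r 0) ^ 3 * (r 2 * r 3 * r 2)] := by
  funext j
  fin_cases j <;> simp [treeRankFour, wordElt, pow_succ, mul_assoc]

/-- The amalgam `D₄ *_{ℤ₂} D₆` and its normal Schottky subgroups. -/
theorem amalgam_dihedral_four_six (p : ℝ) (hp : 1 < p) (hp2 : p ≤ 2) (r : Fin 4 → SpherePerm)
    (hr : r = reflD4D6 p hp) (K₁ K₂ J : Subgroup SpherePerm) (hK₁ : K₁ = sphericalGroup r 0 1 3)
    (hK₂ : K₂ = sphericalGroup r 0 1 2) (hJ : J = Subgroup.zpowers (r 1 * r 0)) :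
      IsExtendedKleinian (extendedGroup r) ∧
      HasCoxeterPresentation (coxD4D6 0 (by decide)) r ∧
      orderOf (r 2 * r 3) = 0 ∧
      Nonempty (K₁ ≃* DihedralGroup 2) ∧ Nonempty (K₂ ≃* DihedralGroup 3) ∧ Nat.card J = 2 ∧
      (p < 2 → IsMaskitCombination K₁ K₂ J) ∧ IsAmalgam ![K₁, K₂] J (conformalGroup r) ∧
      amalgamCharacteristic K₁ K₂ J = -1 / 12 ∧
      (∀ (m N g : ℕ) (hm : m ≠ 1),
        (m, N, g) ∈ [(2, 12, 2), (3, 24, 3), (4, 48, 5), (5, 120, 11)] →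
        ∀ S : Subgroup SpherePerm, S = normalClosureIn (extendedGroup r) ((r 2 * r 3) ^ m) →
        Finite (coxD4D6 m hm).Group ∧ HasCoxeterQuotient (coxD4D6 m hm) r S ∧
        IsNormalIn S (extendedGroup r) ∧ S ≤ conformalGroup r ∧
        S.relIndex (conformalGroup r) = N ∧
        ∃ L : Fin g → SpherePerm, IsFreeBasis L S ∧ (p < 2 → IsSchottkySystem L)) ∧
      (∀ L₁ : SpherePerm, L₁ = (r 2 * r 3) ^ 2 →
        ∀ L : Fin 2 → SpherePerm, L = ![L₁, r 0 * L₁ * r 0] →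
        IsFreeBasis L (normalClosureIn (extendedGroup r) ((r 2 * r 3) ^ 2)) ∧
        (p < 2 → IsSchottkySystem L)) ∧
      (∀ L₁ : SpherePerm, L₁ = (r 2 * r 3) ^ 3 →
        ∀ L : Fin 3 → SpherePerm,
        L = ![L₁, r 0 * L₁ * r 0, (r 0 * r 2 * r 0) * L₁ * (r 0 * r 2 * r 0)⁻¹] →
        IsFreeBasis L (normalClosureIn (extendedGroup r) ((r 2 * r 3) ^ 3)) ∧
        (p < 2 → IsSchottkySystem L)) ∧
      (∀ L : Fin 4 → SpherePerm,
        L = ![((r 3 * r 2) ^ 2 * r 0) ^ 2, (r 0 * (r 3 * r 2) ^ 2) ^ 2,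
          (r 0 * r 3 * r 2) ^ 3 * (r 0 * r 2 * r 3 * r 2 * r 0),
          (r 3 * r 2 * r 0) ^ 3 * (r 2 * r 3 * r 2)] →
        ∀ S : Subgroup SpherePerm, S = Subgroup.closure (Set.range L) →
        IsNormalIn S (extendedGroup r) ∧ IsFreeBasis L S ∧ (p < 2 → IsSchottkySystem L) ∧
        S.relIndex (conformalGroup r) = 36 ∧
        HasQuotient (conformalGroup r) S (Equiv.Perm (Fin 3) × Equiv.Perm (Fin 3))) := by
  obtain ⟨z₀, U, h⟩ := reflD4D6_amalgam (p := p) (hp := hp) hp2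
  have e2 := reflD4D6_dihedral_three h
  have hMask : p < 2 → IsMaskitCombination K₁ K₂ J := by
    intro hp2
    rw [hK₁, hK₂, hJ, hr]; exact reflD4D6_isMaskitCombination hp2 h
  have hSch : p < 2 → ∀ {N g k m : ℕ} {T : TreeQuotient N g k}, T.IsValid m → T.IsSeparated →
      IsSchottkySystem (wordElt r ∘ T.word) :=
    fun hp2 {_ _ _ _ _} V S => hr ▸ reflD4D6_isSchottkySystem hp2 V S
  have hinj : ∀ {N g k m : ℕ} {T : TreeQuotient N g k}, T.IsValid m → T.IsSeparated → 2 ≤ g →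
      Function.Injective (FreeGroup.lift (wordElt r ∘ T.word)) :=
    fun {_ _ _ _ _} V S hg => hr ▸ reflD4D6_injective hp2 V S hg
  rw [← hr] at h e2
  clear hr
  subst hK₁ hK₂ hJ
  have inv := h.inv
  have e1 := h.dihedral_of_commute h.s_notMem_zpowers (commute_of_isLiftable h.lift rfl)
    (commute_of_isLiftable h.lift rfl)
  have hcox := h.hasCoxeterPresentation
  have hmem : ∀ i, r i ∈ extendedGroup r := fun i => Subgroup.subset_closure ⟨i, rfl⟩
  have hord : orderOf (r 2 * r 3) = 0 := by
    have := orderOf_eq_zero_of_injective (hinj treeTwo_isValid treeTwo_isSeparated le_rfl) 0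
    rw [treeTwo_word] at this
    change orderOf ((r 2 * r 3) ^ 2) = 0 at this
    rw [orderOf_pow' _ two_ne_zero] at this
    by_contra h
    have h1 := Nat.div_mul_cancel (Nat.gcd_dvd_left (orderOf (r 2 * r 3)) 2)
    rw [this, zero_mul] at h1
    exact h h1.symm
  -- the normal closure of `(r₃ r₄) ^ m` as the group of a finite subtree
  have quot : ∀ {N g k m : ℕ} {T : TreeQuotient N g k} (hm : m ≠ 1) (V : T.IsValid m)
      (hs : T.IsSeparated) (hg : 2 ≤ g) (hN : 0 < N), normalClosureIn (extendedGroup r) ((r 2 * r 3) ^ m) =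
        Subgroup.closure (Set.range (wordElt r ∘ T.word)) →
      ∀ S : Subgroup SpherePerm, S = normalClosureIn (extendedGroup r) ((r 2 * r 3) ^ m) →
        Finite (coxD4D6 m hm).Group ∧ HasCoxeterQuotient (coxD4D6 m hm) r S ∧
        IsNormalIn S (extendedGroup r) ∧ S ≤ conformalGroup r ∧
        S.relIndex (conformalGroup r) = 6 * N ∧
        ∃ L : Fin g → SpherePerm, IsFreeBasis L S ∧ (p < 2 → IsSchottkySystem L) := by
    rintro N g k m T hm V hs hg hN hT S rfl
    obtain ⟨c1, c2, c3, c4, c5⟩ := V.conclusions h (hinj V hs hg) hT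
    have hq : HasCoxeterQuotient (coxD4D6 m hm) r
        (normalClosureIn (extendedGroup r) ((r 2 * r 3) ^ m)) :=
      hasCoxeterQuotient_normalClosureIn hcox rfl rfl (coxD4D6_apply_eq_or hm _)
    exact ⟨hq.finite (by rw [c5]; positivity), hq, c1, c2, c3, _, c4, fun hp2 => hSch hp2 V hs⟩
  have n2 : normalClosureIn (extendedGroup r) ((r 2 * r 3) ^ 2) = _ :=
    treeTwo_isValid.normalClosureIn_eq hcox treeTwoCert (by decide +kernel)
  have n3 : normalClosureIn (extendedGroup r) ((r 2 * r 3) ^ 3) = _ :=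
    treeThree_isValid.normalClosureIn_eq hcox treeThreeCert (by decide +kernel)
  have n4 : normalClosureIn (extendedGroup r) ((r 2 * r 3) ^ 4) = _ :=
    treeFour_isValid.normalClosureIn_eq hcox treeFourCert (by decide +kernel)
  have n5 : normalClosureIn (extendedGroup r) ((r 2 * r 3) ^ 5) = _ :=
    treeFive_isValid.normalClosureIn_eq hcox treeFiveCert (by decide +kernel)
  refine ⟨h.isExtendedKleinian, hcox, hord, e1, e2, h.card_zpowers, hMask, h.isAmalgam, ?_, ?_, ?_,
    ?_, ?_⟩
  · obtain ⟨e1⟩ := e1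
    obtain ⟨e2⟩ := e2
    rw [amalgamCharacteristic, (Nat.card_congr e1.toEquiv).trans DihedralGroup.nat_card,
      (Nat.card_congr e2.toEquiv).trans DihedralGroup.nat_card, h.card_zpowers]
    norm_num
  · intro m N g hm hmem
    simp only [List.mem_cons, Prod.mk.injEq, List.not_mem_nil, or_false] at hmem
    rcases hmem with ⟨rfl, rfl, rfl⟩ | ⟨rfl, rfl, rfl⟩ | ⟨rfl, rfl, rfl⟩ | ⟨rfl, rfl, rfl⟩
    · exact quot hm treeTwo_isValid treeTwo_isSeparated (by norm_num) (by norm_num) n2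
    · exact quot hm treeThree_isValid treeThree_isSeparated (by norm_num) (by norm_num) n3
    · exact quot hm treeFour_isValid treeFour_isSeparated (by norm_num) (by norm_num) n4
    · exact quot hm treeFive_isValid treeFive_isSeparated (by norm_num) (by norm_num) n5
  · rintro _ rfl L rfl
    rw [← treeTwo_word]
    exact ⟨(treeTwo_isValid.conclusions h (hinj treeTwo_isValid treeTwo_isSeparated le_rfl)
      n2).2.2.2.1, fun hp2 => hSch hp2 treeTwo_isValid treeTwo_isSeparated⟩
  · rintro _ rfl L rfl
    rw [← treeThree_word inv]
    exact ⟨(treeThree_isValid.conclusions h (hinj treeThree_isValid treeThree_isSeparated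
      (by norm_num)) n3).2.2.2.1, fun hp2 => hSch hp2 treeThree_isValid treeThree_isSeparated⟩
  · rintro L rfl S rfl
    rw [← treeRankFour_word]
    obtain ⟨c1, c2, c3, c4, -⟩ := treeRankFour_isValid.conclusions h
      (hinj treeRankFour_isValid treeRankFour_isSeparated (by norm_num)) rfl
    exact ⟨c1, c4, fun hp2 => hSch hp2 treeRankFour_isValid treeRankFour_isSeparated, c3,
      treeRankFour_hasQuotient h c3⟩

end D4D6

/-! ### Infinite Coxeter groups -/

section Infinite

open Module in
/-- The product of two reflections of a real vector space has order dividing `m` if it acts on the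
plane of the two roots with the trace of a rotation by `2π / m`. -/
theorem reflection_mul_reflection_pow_eq_one {V : Type*} [AddCommGroup V] [Module ℝ V] {x y : V}
    {f g : Dual ℝ V} (hf : f x = 2) (hg : g y = 2) {m : ℕ} (hm : 3 ≤ m)
    (h : f y * g x = 4 * Real.cos (π / m) ^ 2) :
    (reflection hf * reflection hg) ^ m = 1 := by
  have hm0 : (0 : ℝ) < m := by exact_mod_cast (by omega : 0 < m)
  set θ : ℝ := 2 * π / m with hθ
  have hmθ : m * θ = 2 * π := by rw [hθ]; field_simp
  have hsin : Real.sin θ ≠ 0 := by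
    refine (Real.sin_pos_of_pos_of_lt_pi (by positivity) ?_).ne'
    rw [hθ, div_lt_iff₀ hm0]
    have : (3 : ℝ) ≤ m := by exact_mod_cast hm
    nlinarith [Real.pi_pos]
  have ht : 2 * Real.cos θ = f y * g x - 2 := by
    have : θ = 2 * (π / m) := by rw [hθ]; ring
    rw [h, this, Real.cos_two_mul]
    ring
  have hS := fun k : ℤ => Polynomial.Chebyshev.S_two_mul_real_cos θ k
  ext z
  rw [reflection_mul_reflection_pow_apply hf hg m z _ ht, LinearEquiv.coe_one, id]
  clear_value θ
  obtain ⟨k, rfl | rfl⟩ := Nat.even_or_odd' m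
  · have e1 : ((2 * k : ℕ) - 2 : ℤ) / 2 = k - 1 := by omega
    have e2 : ((2 * k : ℕ) - 1 : ℤ) / 2 = k - 1 := by omega
    have h0 : (Polynomial.Chebyshev.S ℝ (k - 1 : ℤ)).eval (2 * Real.cos θ) = 0 := by
      refine (mul_eq_zero.1 ((hS _).trans ?_)).resolve_right hsin
      push_cast at hmθ ⊢
      rw [show ((k : ℝ) - 1 + 1) * θ = π by linarith, Real.sin_pi]
    rw [e1, e2, h0]
    simp
  · have e1 : ((2 * k + 1 : ℕ) - 1 : ℤ) / 2 = k := by omega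
    have e2 : ((2 * k + 1 : ℕ) - 3 : ℤ) / 2 = k - 1 := by omega
    have e3 : ((2 * k + 1 : ℕ) : ℤ) / 2 = k := by omega
    have e4 : ((2 * k + 1 : ℕ) - 2 : ℤ) / 2 = k - 1 := by omega
    have h0 : (Polynomial.Chebyshev.S ℝ k).eval (2 * Real.cos θ) +
        (Polynomial.Chebyshev.S ℝ (k - 1 : ℤ)).eval (2 * Real.cos θ) = 0 := by
      refine (mul_eq_zero.1 ?_).resolve_right hsin
      rw [add_mul, hS, hS]
      push_cast at hmθ ⊢
      rw [show ((k : ℝ) + 1) * θ = 2 * π - ((k : ℝ) - 1 + 1) * θ by linarith,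
        Real.sin_two_pi_sub]
      ring
    rw [e1, e2, e3, e4, h0]
    simp

/-- The coroots of the reflection representation of the Coxeter group with `m₁₂ = 3`, `m₁₃ = 2`,
`m₂₃ = m`, where `u = 4 cos² (π / m)`; the roots are the standard basis vectors. -/
def coroot (u : ℝ) : Fin 3 → Module.Dual ℝ (Fin 3 → ℝ) :=
  ![(2 : ℝ) • LinearMap.proj 0 - LinearMap.proj 1,
    (2 : ℝ) • LinearMap.proj 1 - LinearMap.proj 0 - u • LinearMap.proj 2,
    (2 : ℝ) • LinearMap.proj 2 - LinearMap.proj 1]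

theorem coroot_self (u : ℝ) (i : Fin 3) : coroot u i (Pi.single i 1) = 2 := by
  fin_cases i <;> simp [coroot]

/-- The reflections of the reflection representation. -/
def rootReflection (u : ℝ) (i : Fin 3) : (Fin 3 → ℝ) ≃ₗ[ℝ] (Fin 3 → ℝ) :=
  Module.reflection (coroot_self u i)

theorem rootReflection_apply (u : ℝ) (i : Fin 3) (v : Fin 3 → ℝ) :
    rootReflection u i v = v - coroot u i v • Pi.single i 1 :=
  Module.reflection_apply _ _

theorem rootReflection_mul_self (u : ℝ) (i : Fin 3) :
    rootReflection u i * rootReflection u i = 1 := by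
  ext1 v
  exact Module.involutive_reflection (coroot_self u i) v

theorem rootReflection_zero (u a b c : ℝ) : rootReflection u 0 ![a, b, c] = ![b - a, b, c] := by
  ext i; fin_cases i <;> simp [rootReflection_apply, coroot]
  ring

theorem rootReflection_one (u a b c : ℝ) :
    rootReflection u 1 ![a, b, c] = ![a, a + u * c - b, c] := by
  ext i; fin_cases i <;> simp [rootReflection_apply, coroot]
  ring

theorem rootReflection_two (u a b c : ℝ) : rootReflection u 2 ![a, b, c] = ![a, b, b - c] := by
  ext i; fin_cases i <;> simp [rootReflection_apply, coroot]
  ring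

theorem rootReflection_isLiftable {m : ℕ} (hm : 3 ≤ m) (hm1 : m ≠ 1) {u : ℝ}
    (hu : u = 4 * Real.cos (π / m) ^ 2) :
    (coxD4D6 m hm1).IsLiftable
      ![rootReflection u 0, 1, rootReflection u 1, rootReflection u 2] := by
  have sq : ∀ i, rootReflection u i ^ 2 = 1 := fun i => by rw [pow_two, rootReflection_mul_self]
  refine isLiftable_fin_four ?_ ?_
  · intro i; fin_cases i <;> simp [rootReflection_mul_self]
  · intro i j hij
    fin_cases i <;> fin_cases j <;> first | exact absurd hij (by decide) | skip
    · exact (congrArg (· ^ 2) (mul_one _)).trans (sq 0)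
    · refine reflection_mul_reflection_pow_eq_one (coroot_self u 0) (coroot_self u 1) le_rfl ?_
      change coroot u 0 (Pi.single 1 1) * coroot u 1 (Pi.single 0 1) =
        4 * Real.cos (π / (3 : ℕ)) ^ 2
      rw [Nat.cast_ofNat, Real.cos_pi_div_three]
      simp [coroot]
      norm_num
    · change (rootReflection u 0 * rootReflection u 2) ^ 2 = 1
      ext v i
      simp only [pow_two, LinearEquiv.mul_apply, rootReflection_apply, LinearEquiv.coe_one, id]
      fin_cases i <;> simp [coroot] <;> ring
    · exact (congrArg (· ^ 2) (one_mul _)).trans (sq 1)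
    · exact (congrArg (· ^ 2) (one_mul _)).trans (sq 2)
    · refine reflection_mul_reflection_pow_eq_one (coroot_self u 1) (coroot_self u 2) hm ?_
      change coroot u 1 (Pi.single 2 1) * coroot u 2 (Pi.single 1 1) = 4 * Real.cos (π / m) ^ 2
      simp [coroot, hu]

/-- The Coxeter element moves the second simple root to vectors with ever larger coordinates. -/
theorem coxeterElement_pow {u : ℝ} (hu : 3 ≤ u) (k : ℕ) :
    ∃ a b : ℝ, ((rootReflection u 0 * rootReflection u 2 * rootReflection u 1) ^ k)
      ![0, -1, 0] = ![b, a, b] ∧ (k : ℝ) ≤ b ∧ 1 ≤ (u - 1) * b - a := by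
  induction k with
  | zero => exact ⟨-1, 0, by simp, by simp, by simp⟩
  | succ k ih =>
    obtain ⟨a, b, h1, h2, h3⟩ := ih
    have hk : (0 : ℝ) ≤ k := k.cast_nonneg
    refine ⟨(1 + u) * b - a, u * b - a, ?_, ?_, ?_⟩
    · rw [pow_succ', LinearEquiv.mul_apply, h1, LinearEquiv.mul_apply, LinearEquiv.mul_apply,
        rootReflection_one, rootReflection_two, rootReflection_zero]
      ext i; fin_cases i <;> simp <;> ring
    · push_cast; nlinarith
    · nlinarith [mul_nonneg (sub_nonneg.2 hu) (hk.trans h2)]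

/-- If `m ≥ 6`, then `4 cos² (π / m) ≥ 3` and the Coxeter element of the three reflections `r₁`, `r₃`,
`r₄` has infinite order; `r₂` is sent to the identity. -/
theorem infinite_coxD4D6 (m : ℕ) (hm : 6 ≤ m) (hm1 : m ≠ 1) :
    Infinite (coxD4D6 m hm1).Group := by
  set u : ℝ := 4 * Real.cos (π / m) ^ 2 with hu
  have hu3 : 3 ≤ u := by
    have hm' : (6 : ℝ) ≤ m := by exact_mod_cast hm
    have h1 : √3 / 2 ≤ Real.cos (π / m) := by
      rw [← Real.cos_pi_div_six]
      refine Real.cos_le_cos_of_nonneg_of_le_pi (by positivity) ?_ ?_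
      · linarith [Real.pi_pos]
      · exact div_le_div_of_nonneg_left Real.pi_pos.le (by norm_num) hm'
    have h2 : (√3 / 2) ^ 2 ≤ Real.cos (π / m) ^ 2 := pow_le_pow_left₀ (by positivity) h1 2
    rw [div_pow, Real.sq_sqrt (by norm_num)] at h2
    rw [hu]; linarith
  have hl := rootReflection_isLiftable (by omega) hm1 hu
  by_contra hfin
  rw [not_infinite_iff_finite] at hfin
  let M := coxD4D6 m hm1
  let φ : M.Group →* ((Fin 3 → ℝ) ≃ₗ[ℝ] (Fin 3 → ℝ)) := M.toCoxeterSystem.lift ⟨_, hl⟩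
  have hφ : ∀ i, φ (M.simple i) = _ := M.toCoxeterSystem.lift_apply_simple hl
  set x : M.Group := M.simple 0 * M.simple 3 * M.simple 2 with hx
  have hφx : φ x = rootReflection u 0 * rootReflection u 2 * rootReflection u 1 := by
    rw [hx, map_mul, map_mul, hφ, hφ, hφ]; rfl
  obtain ⟨a, b, h1, h2, -⟩ := coxeterElement_pow hu3 (orderOf x)
  rw [← hφx, ← map_pow, pow_orderOf_eq_one, map_one] at h1
  have hb : (0 : ℝ) = b := congrFun h1 0
  have : (0 : ℝ) < orderOf x := by exact_mod_cast orderOf_pos x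
  linarith

end Infinite

/-! ### The amalgam of the dihedral group of order six and the alternating group -/

theorem alpha_eq : alpha = √3 - 2 := by
  have h3 : √3 ^ 2 = 3 := Real.sq_sqrt (by norm_num)
  have h : (0 : ℝ) < √3 := by positivity
  rw [alpha, div_eq_iff (by positivity)]
  linear_combination -h3

theorem alpha_sq : alpha ^ 2 + 4 * alpha + 1 = 0 := by
  have h3 : √3 ^ 2 = 3 := Real.sq_sqrt (by norm_num)
  rw [alpha_eq]
  linear_combination h3

theorem alpha_neg : alpha < 0 := by
  rw [alpha_eq, sub_neg, Real.sqrt_lt' (by norm_num)]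
  norm_num

theorem neg_one_lt_alpha : -1 < alpha := by
  have : 1 < √3 := by rw [Real.lt_sqrt (by norm_num)]; norm_num
  rw [alpha_eq]; linarith

theorem zeta_three_sq : zeta 3 ^ 2 + zeta 3 + 1 = 0 := by
  have h3 : √3 ^ 2 = 3 := Real.sq_sqrt (by norm_num)
  rw [zeta_three, pow_two]
  apply Complex.ext
  · simp
    linear_combination -(1 / 4) * h3
  · simp
    ring

theorem zeta_three_zpow (k : ℤ) : zeta 3 ^ k = 1 ∨ zeta 3 ^ k = zeta 3 ∨ zeta 3 ^ k = zeta 3 ^ 2 := by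
  have h : zeta 3 ^ k = zeta 3 ^ (k % 3) := by
    conv_lhs => rw [← Int.mul_ediv_add_emod k 3]
    rw [zpow_add₀ (zeta_ne_zero 3), _root_.zpow_mul]
    have : zeta 3 ^ (3 : ℤ) = 1 := by exact_mod_cast zeta_pow_self (n := 3) (by norm_num)
    rw [this, _root_.one_zpow, one_mul]
  have h0 := Int.emod_nonneg k (b := 3) (by norm_num)
  have h1 := Int.emod_lt_of_pos k (b := 3) (by norm_num)
  rw [h]
  interval_cases k % 3
  · exact Or.inl (zpow_zero _)
  · exact Or.inr (Or.inl (zpow_one _))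
  · exact Or.inr (Or.inr (by exact_mod_cast rfl))

/-- A matrix of size two whose squared trace is its determinant has order three up to scalars. -/
theorem pow_three_of_trace_sq {a b c d : ℂ} (h : (a + d) ^ 2 = a * d - b * c) :
    (!![a, b; c, d] : Matrix (Fin 2) (Fin 2) ℂ) ^ 3 = (-(a + d) ^ 3) • 1 := by
  rw [pow_succ, pow_two, Matrix.mul_fin_two, Matrix.mul_fin_two, Matrix.one_fin_two, Matrix.smul_of]
  ext i j
  fin_cases i <;> fin_cases j <;> simp
  · linear_combination (2 * a + d) * h
  · linear_combination b * h
  · linear_combination c * h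
  · linear_combination (a + 2 * d) * h

section D6A4

variable {p : ℝ} {hp : 0 < p}

theorem reflD6A4_zero : IsMirror (reflD6A4 p hp 0) 1 := isMirror_conjPerm

theorem reflD6A4_one : IsInversion (reflD6A4 p hp 1) (p ^ 2) :=
  isInversion_antiMobius _ (by positivity) (by simp)

theorem reflD6A4_two : IsMirror (reflD6A4 p hp 2) (zeta 3) :=
  isMirror_antiMobius _ (by simpa [zeta] using zeta_mul_conj 3)

theorem reflD6A4_three :
    IsCircleReflection (reflD6A4 p hp 3) ((1 + alpha) / 2) (((1 + alpha) / 2) ^ 2 - alpha) :=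
  isCircleReflection_antiMobius (by nlinarith [alpha_neg, sq_nonneg ((1 + alpha) / 2)]) _ two_ne_zero
    (by push_cast; ring) (by push_cast; ring)

theorem reflD6A4_anti (i : Fin 4) : IsAntiConformal (reflD6A4 p hp i) := by
  fin_cases i
  · exact isAntiConformal_conjPerm
  all_goals exact isAntiConformal_antiMobius _

theorem reflD6A4_isLiftable : (coxD6A4 0 (by decide)).IsLiftable (reflD6A4 p hp) := by
  have hα : (alpha : ℂ) ^ 2 + 4 * alpha + 1 = 0 := by exact_mod_cast alpha_sq
  have hdet : (!![1 + (alpha : ℂ), -2 * (alpha : ℂ); 2, -(1 + (alpha : ℂ))]).det ≠ 0 := by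
    rw [det_fin_two_of]
    have h : (1 + alpha) * -(1 + alpha) - -2 * alpha * 2 ≠ 0 := by
      have h1 : (1 - alpha) ^ 2 ≠ 0 := pow_ne_zero 2 (sub_ne_zero.mpr alpha_ne_one.symm)
      intro h2
      apply h1
      linarith
    exact_mod_cast h
  have e3 : reflD6A4 p hp 3 = antiMobius _ hdet := rfl
  have hmap : (!![1 + (alpha : ℂ), -2 * (alpha : ℂ); 2, -(1 + (alpha : ℂ))]).map (starRingEnd ℂ) =
      !![1 + (alpha : ℂ), -2 * (alpha : ℂ); 2, -(1 + (alpha : ℂ))] := by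
    simpa using map_conj_of_real (1 + alpha) (-2 * alpha) 2 (-(1 + alpha))
  have inv : ∀ i, reflD6A4 p hp i * reflD6A4 p hp i = 1 := by
    intro i
    fin_cases i
    · exact reflD6A4_zero.mul_self
    · exact reflD6A4_one.mul_self
    · exact reflD6A4_two.mul_self
    · change reflD6A4 p hp 3 * reflD6A4 p hp 3 = 1
      rw [← pow_one (reflD6A4 p hp 3 * reflD6A4 p hp 3), e3]
      refine antiMobius_mul_antiMobius_pow_eq_one (c := (1 - alpha) ^ 2) _ _ ?_
      rw [hmap, pow_one, Matrix.mul_fin_two, Matrix.one_fin_two, Matrix.smul_of]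
      ext i j
      fin_cases i <;> fin_cases j <;> simp <;> ring
  refine isLiftable_fin_four inv ?_
  intro i j hij
  fin_cases i <;> fin_cases j <;> first | exact absurd hij (by decide) | skip
  · exact reflD6A4_zero.mul_inversion_sq reflD6A4_one
  · exact mul_pow_eq_one_comm (inv 2) (inv 0)
      (reflD6A4_two.rot_pow (n := 3) (by norm_num) reflD6A4_zero)
  · change (conjPerm * reflD6A4 p hp 3) ^ 2 = 1
    rw [conjPerm_eq_antiMobius, e3]
    refine antiMobius_mul_antiMobius_pow_eq_one (c := (1 - alpha) ^ 2) _ _ ?_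
    rw [hmap, one_mul, pow_two, Matrix.mul_fin_two, Matrix.one_fin_two, Matrix.smul_of]
    ext i j
    fin_cases i <;> fin_cases j <;> simp <;> ring
  · exact mul_pow_eq_one_comm (inv 2) (inv 1) (reflD6A4_two.mul_inversion_sq reflD6A4_one)
  · exact pow_zero _
  · have hζ : Complex.exp (2 * π * Complex.I / 3) ^ 2 + Complex.exp (2 * π * Complex.I / 3) + 1 = 0 := by
      simpa [zeta] using zeta_three_sq
    change (antiMobius !![Complex.exp (2 * π * Complex.I / 3), 0; 0, 1] _ * reflD6A4 p hp 3) ^ 3 = 1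
    rw [e3]
    refine antiMobius_mul_antiMobius_pow_eq_one (c := ?_) _ _ ?_
    rotate_left
    · rw [hmap, Matrix.mul_fin_two]
      refine pow_three_of_trace_sq ?_
      generalize Complex.exp (2 * π * Complex.I / 3) = ζ at hζ
      linear_combination (1 + (alpha : ℂ)) ^ 2 * hζ - 2 * ζ * hα

/-- The set of points inside the circle of `r₄` and its images under rotation of order three. -/
def innerRegion : Set ℂ :=
  {z | ∀ k : ℤ, z.re ^ 2 + z.im ^ 2 + alpha < (1 + alpha) * (zeta 3 ^ k * z).re}

/-- The set of points outside the circle of `r₄` or one of its images under rotation of order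
three. -/
def outerRegion : Set ℂ :=
  {z | ∃ k : ℤ, (1 + alpha) * (zeta 3 ^ k * z).re < z.re ^ 2 + z.im ^ 2 + alpha}

theorem isOpen_innerRegion : IsOpen innerRegion := by
  have e : innerRegion = ⋂ k ∈ ({0, 1, 2} : Finset ℤ),
      {z | z.re ^ 2 + z.im ^ 2 + alpha < (1 + alpha) * (zeta 3 ^ k * z).re} := by
    ext z
    simp only [innerRegion, Set.mem_iInter, Set.mem_ofPred_eq]
    refine ⟨fun h k _ => h k, fun h k => ?_⟩
    rcases zeta_three_zpow k with e | e | e <;> rw [e]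
    · simpa using h 0 (by simp)
    · simpa using h 1 (by simp)
    · exact_mod_cast h 2 (by simp)
  rw [e]
  refine isOpen_biInter_finset fun k _ => ?_
  have hre := Complex.continuous_re
  exact isOpen_lt (((hre.pow 2).add (Complex.continuous_im.pow 2)).add continuous_const)
    (continuous_const.mul (hre.comp (continuous_const.mul continuous_id)))

/-- A reflection in a line through the origin permutes the rotations of order three of a point. -/
theorem mirror_rotations {f : SpherePerm} {j : ℤ} (hf : IsMirror f (zeta 3 ^ j)) (z : ℂ) :
    ∃ w : ℂ, f (z : Sphere) = (w : Sphere) ∧ w.re ^ 2 + w.im ^ 2 = z.re ^ 2 + z.im ^ 2 ∧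
      (∀ k : ℤ, (zeta 3 ^ k * w).re = (zeta 3 ^ (-k - j) * z).re) ∧
      (∀ k : ℤ, (zeta 3 ^ k * z).re = (zeta 3 ^ (-k - j) * w).re) := by
  have key : ∀ k : ℤ, (zeta 3 ^ k * (zeta 3 ^ j * starRingEnd ℂ z)).re =
      (zeta 3 ^ (-k - j) * z).re := by
    intro k
    rw [← Complex.conj_re, map_mul, map_mul, Complex.conj_conj, map_zpow₀, map_zpow₀, conj_zeta,
      _root_.inv_zpow', _root_.inv_zpow', ← mul_assoc, ← zpow_add₀ (zeta_ne_zero 3), sub_eq_add_neg]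
  refine ⟨_, hf.coe z, ?_, key, fun k => ?_⟩
  · have h1 : ∀ w : ℂ, w.re ^ 2 + w.im ^ 2 = ‖w‖ ^ 2 := fun w => by
      rw [← Complex.normSq_eq_norm_sq, Complex.normSq_apply]; ring
    rw [h1, h1, norm_mul, norm_zeta_zpow, one_mul, Complex.norm_conj]
  · rw [key, show -(-k - j) - j = k by ring]

theorem reflD6A4_mirror {i : Fin 4} (hi : i = 0 ∨ i = 2) :
    ∃ j : ℤ, IsMirror (reflD6A4 p hp i) (zeta 3 ^ j) := by
  rcases hi with rfl | rfl
  · exact ⟨0, by rw [zpow_zero]; exact reflD6A4_zero⟩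
  · exact ⟨1, by rw [zpow_one]; exact reflD6A4_two⟩

/-- The disc about the origin touching the circle of `r₄` lies inside that circle. -/
theorem power_of_mem_disc {z : ℂ} (hz : z.re ^ 2 + z.im ^ 2 ≤ alpha ^ 2) :
    z.re ^ 2 + z.im ^ 2 + alpha ≤ (1 + alpha) * z.re := by
  have h1 : alpha ≤ z.re := by
    by_contra h
    nlinarith [alpha_neg, sq_nonneg z.im]
  nlinarith [neg_one_lt_alpha]

theorem power_of_mem_disc' {z : ℂ} (hz : z.re ^ 2 + z.im ^ 2 < alpha ^ 2) :
    z.re ^ 2 + z.im ^ 2 + alpha < (1 + alpha) * z.re := by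
  have h1 : alpha ≤ z.re := by
    by_contra h
    nlinarith [alpha_neg, sq_nonneg z.im]
  nlinarith [neg_one_lt_alpha]

theorem norm_rotation (k : ℤ) (z : ℂ) :
    (zeta 3 ^ k * z).re ^ 2 + (zeta 3 ^ k * z).im ^ 2 = z.re ^ 2 + z.im ^ 2 := by
  have h1 : ∀ w : ℂ, w.re ^ 2 + w.im ^ 2 = ‖w‖ ^ 2 := fun w => by
    rw [← Complex.normSq_eq_norm_sq, Complex.normSq_apply]; ring
  rw [h1, h1, norm_mul, norm_zeta_zpow, one_mul]

/-- A point outside one of the three circles lies outside the disc about the origin touching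
them. -/
theorem lt_of_mem_outerRegion {z : ℂ} (hz : z ∈ outerRegion) :
    alpha ^ 2 < z.re ^ 2 + z.im ^ 2 := by
  obtain ⟨k, hk⟩ := hz
  by_contra h
  have := power_of_mem_disc (z := zeta 3 ^ k * z) (by rw [norm_rotation]; exact not_lt.1 h)
  rw [norm_rotation] at this
  linarith

/-- The reflection `r₄` takes the inside of its circle to the outside. -/
theorem reflD6A4_three_maps {z : ℂ} (hz : z.re ^ 2 + z.im ^ 2 + alpha < (1 + alpha) * z.re) :
    reflD6A4 p hp 3 (z : Sphere) ∈ ((↑) : ℂ → Sphere) '' outerRegion ∪ {OnePoint.infty} := by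
  have h3 := reflD6A4_three (p := p) (hp := hp)
  by_cases hc : z = ((1 + alpha) / 2 : ℝ)
  · rw [hc, h3.center]; exact Or.inr rfl
  · obtain ⟨w, t, hw, ht, e, -⟩ := h3.exists_coe_power (IsCircleReflection.pos_of_ne hc)
    rw [hw]
    refine Or.inl ⟨w, ⟨0, ?_⟩, rfl⟩
    rw [zpow_zero, one_mul]
    nlinarith [mul_pos ht (sub_pos.2 hz)]

/-- The sets of the ping-pong: the disc bounded by the circle of `r₂`, the outside of the circles
of the conjugates of `r₄`, and the region between them. -/
theorem reflD6A4_amalgam (hp2 : p ≤ -alpha) : ∃ z₀ : ℂ, ∃ U : Set ℂ,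
    ReflectionAmalgam (coxD6A4 0 (by decide)) (reflD6A4 p hp) 2 1 3 3 z₀ U
      (((↑) : ℂ → Sphere) '' {z | z ∈ innerRegion ∧ p ^ 2 < z.re ^ 2 + z.im ^ 2})
      (((↑) : ℂ → Sphere) '' outerRegion ∪ {OnePoint.infty})
      (((↑) : ℂ → Sphere) '' {z | z.re ^ 2 + z.im ^ 2 < p ^ 2}) := by
  have hlift := reflD6A4_isLiftable (p := p) (hp := hp)
  have h0 := reflD6A4_zero (p := p) (hp := hp)
  have h1 := (reflD6A4_one (p := p) (hp := hp)).isCircleReflection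
  have h2 := reflD6A4_two (p := p) (hp := hp)
  have h3 := fun z => reflD6A4_three_maps (p := p) (hp := hp) (z := z)
  have hm := fun i => reflD6A4_mirror (p := p) (hp := hp) (i := i)
  have hinf3 : reflD6A4 p hp 1 OnePoint.infty = ((0 : ℂ) : Sphere) := by
    simpa using h1.infty
  set r := reflD6A4 p hp with hr
  have hpα : p ^ 2 ≤ alpha ^ 2 := by nlinarith [alpha_neg]
  have hs3 : √3 ^ 2 = 3 := Real.sq_sqrt (by norm_num)
  have hs3a : √3 < 1.7321 := by rw [Real.sqrt_lt' (by norm_num)]; norm_num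
  have hs3b : 1.732 < √3 := by rw [Real.lt_sqrt (by norm_num)]; norm_num
  -- `z₀` has argument `π / 6` and norm `0.28 > -alpha`, on the axis of the sector, where the circles
  -- of the conjugates of `r₄` leave room
  set z₀ : ℂ := ⟨0.14 * √3, 0.14⟩ with hz₀def
  set U : Set ℂ := sector 3 ∩ (innerRegion ∩ {z | p ^ 2 < z.re ^ 2 + z.im ^ 2}) with hU
  have hz₀ : z₀ ∈ U := by
    refine ⟨?_, ?_, ?_⟩
    · rw [mem_sector_three, hz₀def]
      refine ⟨by norm_num, by positivity, ?_⟩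
      simp only
      rw [mul_pow, hs3]
      norm_num
    · intro k
      have key : z₀.re ^ 2 + z₀.im ^ 2 + alpha < (1 + alpha) * (-(0.14 * √3)) := by
        rw [hz₀def, alpha_eq]
        simp only
        nlinarith
      refine key.trans_le (mul_le_mul_of_nonneg_left ?_ (by linarith [neg_one_lt_alpha]))
      rcases zeta_three_zpow k with e | e | e <;> rw [e, hz₀def]
      · simp; positivity
      · rw [zeta_three]; simp; nlinarith
      · rw [zeta_three, pow_two]; simp; nlinarith
    · rw [Set.mem_ofPred_eq]
      refine hpα.trans_lt ?_
      rw [hz₀def, alpha_eq]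
      simp only
      nlinarith
  refine ⟨z₀, U, ?_⟩
  refine
  { univ := by decide
    anti := reflD6A4_anti
    lift := hlift
    order := rfl
    pos := by norm_num
    coset_s := fun G _ f hf C hC c hc => coset_of_commute (mul_self_of_isLiftable hf 1)
      (commute_of_isLiftable hf rfl) (commute_of_isLiftable hf rfl) hC hc
    coset_t := fun G _ f hf C hC c hc => by
      have inv := mul_self_of_isLiftable hf
      exact coset_of_braid (inv 0) (inv 2) (inv 3) (commute_of_isLiftable hf rfl)
        (eq_of_sq_eq_one_of_pow_three (inv 2) (inv 3) (hf 2 3))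
        (Or.inr (eq_of_sq_eq_one_of_pow_three (inv 0) (inv 2) (hf 0 2))) hC hc
    mapsY := ?_
    maps₁ := ?_
    maps₂ := ?_
    maps_s := ?_
    maps_t := ?_
    isOpen := (isOpen_sector (by norm_num)).inter (isOpen_innerRegion.inter
      (isOpen_lt continuous_const ((Complex.continuous_re.pow 2).add (Complex.continuous_im.pow 2))))
    mem := hz₀
    memY := ⟨_, hz₀.2, rfl⟩
    disjY := ?_
    disj := ?_
    rot := ?_
    refl := ?_ }
  · rintro i hi _ ⟨z, ⟨hz, hz'⟩, rfl⟩
    obtain ⟨j, hj⟩ := hm i hi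
    obtain ⟨w, hw, e, e1, -⟩ := mirror_rotations hj z
    exact ⟨w, ⟨fun k => by rw [e, e1]; exact hz _, by rw [e]; exact hz'⟩, hw.symm⟩
  · rintro i hi _ (⟨z, ⟨k, hk⟩, rfl⟩ | rfl)
    · obtain ⟨j, hj⟩ := hm i hi
      obtain ⟨w, hw, e, -, e1⟩ := mirror_rotations hj z
      exact Or.inl ⟨w, ⟨-k - j, by rw [e, ← e1]; exact hk⟩, hw.symm⟩
    · obtain ⟨j, hj⟩ := hm i hi
      exact Or.inr hj.infty
  · rintro i hi _ ⟨z, hz, rfl⟩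
    obtain ⟨j, hj⟩ := hm i hi
    obtain ⟨w, hw, e, -⟩ := mirror_rotations hj z
    exact ⟨w, by rw [Set.mem_ofPred_eq, e]; exact hz, hw.symm⟩
  · intro x hx
    have hx' : x = OnePoint.infty ∨ ∃ z : ℂ, p ^ 2 < z.re ^ 2 + z.im ^ 2 ∧ (z : Sphere) = x := by
      rcases hx with ⟨z, hz, rfl⟩ | ⟨z, hz, rfl⟩ | rfl
      · exact Or.inr ⟨z, hz.2, rfl⟩
      · exact Or.inr ⟨z, hpα.trans_lt (lt_of_mem_outerRegion hz), rfl⟩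
      · exact Or.inl rfl
    rcases hx' with rfl | ⟨z, hz, rfl⟩
    · exact ⟨0, by simp; positivity, hinf3.symm⟩
    · have hpos : 0 < (z.re - 0) ^ 2 + z.im ^ 2 := by
        rw [sub_zero]; exact lt_trans (by positivity) hz
      obtain ⟨w, t, hw, ht, e, -⟩ := h1.exists_coe_power hpos
      rw [sub_zero, sub_zero] at e
      refine ⟨w, ?_, hw.symm⟩
      rw [Set.mem_ofPred_eq]
      nlinarith [mul_pos ht (sub_pos.2 hz)]
  · rintro x (⟨z, hz, rfl⟩ | ⟨z, hz, rfl⟩)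
    · have := hz.1 0
      rw [zpow_zero, one_mul] at this
      exact h3 z this
    · exact h3 z (power_of_mem_disc' (lt_of_lt_of_le hz hpα))
  · rintro _ ⟨z, hz, rfl⟩ ((h | h) | h)
    · rw [coe_mem_image_iff] at h
      obtain ⟨k, hk⟩ := h
      exact lt_asymm hk (hz.1 k)
    · exact OnePoint.coe_ne_infty _ h
    · rw [coe_mem_image_iff] at h
      exact lt_asymm (h : z.re ^ 2 + z.im ^ 2 < p ^ 2) hz.2
  · rintro z ⟨-, hz⟩ ((h | h) | h)
    · rw [coe_mem_image_iff] at h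
      obtain ⟨k, hk⟩ := h
      exact lt_asymm hk (hz.1 k)
    · exact OnePoint.coe_ne_infty _ h
    · rw [coe_mem_image_iff] at h
      exact lt_asymm (h : z.re ^ 2 + z.im ^ 2 < p ^ 2) (show p ^ 2 < z.re ^ 2 + z.im ^ 2 from hz.2)
  · rintro k ⟨w, hw, e⟩
    rw [rotation_zpow_coe (h2.rot h0), OnePoint.coe_eq_coe] at e
    exact dvd_of_rotate_mem_sector (by norm_num) hz₀.1 (e ▸ hw.1)
  · rintro k ⟨w, hw, e⟩
    rw [Equiv.Perm.mul_apply, h0.coe, one_mul,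
      rotation_zpow_coe (h2.rot h0), OnePoint.coe_eq_coe] at e
    exact reflect_notMem_sector (by norm_num) hz₀.1
      ((map_ne_zero _).2 (ne_zero_of_mem_sector hz₀.1)) (Complex.arg_conj_coe_angle _) k (e ▸ hw.1)

end D6A4

/-! ### The reflection group of the tetrahedron -/

section Tetrahedron

variable {G : Type*} [Group G] {r : Fin 4 → G}

/-- Reduced words for the elements of the Coxeter group of type `A₃` with generators `r 0`, `r 2`,
`r 3`, as products of minimal coset representatives along the chain of parabolic subgroups. -/
def tetrahedralWord (x : Fin 2 × Fin 3 × Fin 4) : List (Fin 4) :=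
  ![[], [0]] x.1 ++ ![[], [2], [2, 0]] x.2.1 ++ ![[], [3], [3, 2], [3, 2, 0]] x.2.2

/-- Right multiplication by a generator permutes the values of the words; it is carried from the last
coset representative to the first. -/
theorem exists_tetrahedralWord_mul (hl : (coxD6A4 0 (by decide)).IsLiftable r)
    (x : Fin 2 × Fin 3 × Fin 4) {j : Fin 4} (hj : j ≠ 1) :
    ∃ y, wordElt r (tetrahedralWord x) * r j = wordElt r (tetrahedralWord y) := by
  have inv := mul_self_of_isLiftable hl
  have h03 : r 3 * r 0 = r 0 * r 3 := (commute_of_isLiftable hl rfl : Commute (r 3) (r 0)).eq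
  have h02 : r 2 * r 0 * r 2 = r 0 * r 2 * r 0 :=
    eq_of_sq_eq_one_of_pow_three (inv 0) (inv 2) (hl 0 2)
  have h23 : r 3 * r 2 * r 3 = r 2 * r 3 * r 2 :=
    eq_of_sq_eq_one_of_pow_three (inv 2) (inv 3) (hl 2 3)
  have hA : ∀ a a' : Fin 2, wordElt r (![[], [0]] a) * wordElt r (![[], [0]] a') =
      wordElt r (![[], [0]] (a + a')) := by
    intro a a'
    fin_cases a <;> fin_cases a' <;> simp [wordElt, inv]
  have hE : ∀ (e : Fin 3) (j : Fin 4), j = 0 ∨ j = 2 → ∃ a' e',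
      wordElt r (![[], [2], [2, 0]] e) * r j =
        wordElt r (![[], [0]] a') * wordElt r (![[], [2], [2, 0]] e') := by
    rintro e j (rfl | rfl) <;> fin_cases e
    · exact ⟨1, 0, by simp [wordElt]⟩
    · exact ⟨0, 2, by simp [wordElt]⟩
    · exact ⟨0, 1, by simp [wordElt, mul_assoc, inv]⟩
    · exact ⟨0, 1, by simp [wordElt]⟩
    · exact ⟨0, 0, by simp [wordElt, inv]⟩
    · exact ⟨1, 2, by simpa [wordElt, mul_assoc] using h02⟩
  have hD : ∀ (d : Fin 4) (j : Fin 4), j ≠ 1 → ∃ d',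
      wordElt r (![[], [3], [3, 2], [3, 2, 0]] d) * r j =
        wordElt r (![[], [3], [3, 2], [3, 2, 0]] d') ∨ ∃ i, (i = 0 ∨ i = 2) ∧
      wordElt r (![[], [3], [3, 2], [3, 2, 0]] d) * r j =
        r i * wordElt r (![[], [3], [3, 2], [3, 2, 0]] d') := by
    intro d j hj
    obtain rfl | rfl | rfl : j = 0 ∨ j = 2 ∨ j = 3 := by revert j; decide
    · fin_cases d
      · exact ⟨0, Or.inr ⟨0, by simp [wordElt]⟩⟩
      · exact ⟨1, Or.inr ⟨0, by simpa [wordElt] using h03⟩⟩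
      · exact ⟨3, Or.inl (by simp [wordElt, mul_assoc])⟩
      · exact ⟨2, Or.inl (by simp [wordElt, mul_assoc, inv])⟩
    · fin_cases d
      · exact ⟨0, Or.inr ⟨2, by simp [wordElt]⟩⟩
      · exact ⟨2, Or.inl (by simp [wordElt])⟩
      · exact ⟨1, Or.inl (by simp [wordElt, mul_assoc, inv])⟩
      · refine ⟨3, Or.inr ⟨0, Or.inl rfl, ?_⟩⟩
        calc _ = r 3 * (r 2 * r 0 * r 2) := by simp [wordElt, mul_assoc]
          _ = r 3 * r 0 * r 2 * r 0 := by rw [h02]; group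
          _ = _ := by rw [h03]; simp [wordElt, mul_assoc]
    · fin_cases d
      · exact ⟨1, Or.inl (by simp [wordElt])⟩
      · exact ⟨0, Or.inl (by simp [wordElt, inv])⟩
      · exact ⟨2, Or.inr ⟨2, Or.inr rfl, by simpa [wordElt, mul_assoc] using h23⟩⟩
      · refine ⟨3, Or.inr ⟨2, Or.inr rfl, ?_⟩⟩
        calc _ = r 3 * r 2 * (r 0 * r 3) := by simp [wordElt, mul_assoc]
          _ = r 3 * r 2 * r 3 * r 0 := by rw [← h03]; group
          _ = _ := by rw [h23]; simp [wordElt, mul_assoc]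
  obtain ⟨a, e, d⟩ := x
  simp only [tetrahedralWord, wordElt_append]
  obtain ⟨d', h | ⟨i, hi, h⟩⟩ := hD d j hj
  · exact ⟨(a, e, d'), by rw [mul_assoc, h]⟩
  · obtain ⟨a', e', h'⟩ := hE e i hi
    exact ⟨(a + a', e', d'), by rw [mul_assoc, h, ← hA]; simp only [← mul_assoc, mul_assoc _ _ (r i), h']⟩

/-- In every group that satisfies the Coxeter relations, `⟨r₁, r₃, r₄⟩` consists of the values of the
24 words. -/
theorem exists_tetrahedralWord (hl : (coxD6A4 0 (by decide)).IsLiftable r) {b : G}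
    (hb : b ∈ Subgroup.closure {r 0, r 2, r 3}) : ∃ x, b = wordElt r (tetrahedralWord x) := by
  have inv := mul_self_of_isLiftable hl
  have step : ∀ y j, j ≠ 1 → (∃ x, y = wordElt r (tetrahedralWord x)) →
      ∃ x, y * r j = wordElt r (tetrahedralWord x) := by
    rintro _ j hj ⟨x, rfl⟩
    exact exists_tetrahedralWord_mul hl x hj
  induction hb using Subgroup.closure_induction_right with
  | one => exact ⟨0, by simp [tetrahedralWord, wordElt]⟩
  | mul_right y _ x hx ih =>
    rcases hx with rfl | rfl | rfl <;> exact step _ _ (by decide) ih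
  | mul_inv_cancel y _ x hx ih =>
    rcases hx with rfl | rfl | rfl <;> rw [inv_eq_of_mul_eq_one_left (inv _)] <;>
      exact step _ _ (by decide) ih

/-- The action of the reflections of the tetrahedron on its vertices; `r 1` acts trivially. -/
def permFour : Fin 4 → Equiv.Perm (Fin 4) :=
  ![Equiv.swap 0 1, 1, Equiv.swap 1 2, Equiv.swap 2 3]

theorem permFour_injective : ∀ x, wordElt permFour (tetrahedralWord x) = 1 → x = 0 := by
  decide +kernel

theorem permFour_surjective : ∀ g : Equiv.Perm (Fin 4), ∃ x,
    wordElt permFour (tetrahedralWord x) = g ∧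
      (Equiv.Perm.sign g = 1 → (tetrahedralWord x).length % 2 = 0) := by
  decide +kernel

theorem permFour_isLiftable : (coxD6A4 0 (by decide)).IsLiftable permFour := by
  refine isLiftable_fin_four (by decide +kernel) ?_
  intro i j hij
  change (permFour i * permFour j) ^
    (!![1, 2, 3, 2; 2, 1, 2, 0; 3, 2, 1, 3; 2, 0, 3, 1] : Matrix (Fin 4) (Fin 4) ℕ) i j = 1
  revert i j
  decide +kernel

/-- The vertex permutations together with the parity of the number of letters `r 1`. -/
def permFourSign : Fin 4 → Equiv.Perm (Fin 4) × ℤˣ :=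
  ![(Equiv.swap 0 1, 1), (1, -1), (Equiv.swap 1 2, 1), (Equiv.swap 2 3, 1)]

theorem permFourSign_isLiftable : (coxD6A4 0 (by decide)).IsLiftable permFourSign := by
  refine isLiftable_fin_four (by decide +kernel) ?_
  intro i j hij
  change (permFourSign i * permFourSign j) ^
    (!![1, 2, 3, 2; 2, 1, 2, 0; 3, 2, 1, 3; 2, 0, 3, 1] : Matrix (Fin 4) (Fin 4) ℕ) i j = 1
  revert i j
  decide +kernel

theorem permFourSign_surjective (g : Equiv.Perm (Fin 4) × ℤˣ) :
    ∃ l, wordElt permFourSign l = g := by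
  have key : ∀ g : Equiv.Perm (Fin 4) × ℤˣ, ∃ x, wordElt permFourSign (tetrahedralWord x) = g ∨
      wordElt permFourSign (1 :: tetrahedralWord x) = g := by decide +kernel
  obtain ⟨x, h | h⟩ := key g
  exacts [⟨_, h⟩, ⟨_, h⟩]

theorem permFourSign_injective : ∀ x, wordElt permFourSign (tetrahedralWord x) = 1 → x = 0 := by
  decide +kernel

theorem permFourSign_ne : ∀ x, wordElt permFourSign (1 :: tetrahedralWord x) ≠ 1 := by
  decide +kernel

/-- The three generators of the kernel of rank three as words. -/
def wordsD6A4 : Fin 3 → List (Fin 4) :=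
  ![[1, 3, 1, 3], [0, 2, 1, 3, 1, 3, 2, 0], [0, 2, 0, 2, 1, 3, 1, 3, 2, 0, 2, 0]]

theorem wordsD6A4_eq (inv : ∀ i, r i * r i = 1) :
    wordElt r ∘ wordsD6A4 = ![(r 1 * r 3) ^ 2, (r 0 * r 2) * (r 1 * r 3) ^ 2 * (r 0 * r 2)⁻¹,
      (r 0 * r 2) ^ 2 * (r 1 * r 3) ^ 2 * ((r 0 * r 2) ^ 2)⁻¹] := by
  have hri : ∀ i, (r i)⁻¹ = r i := fun i => inv_eq_of_mul_eq_one_left (inv i)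
  funext j
  fin_cases j <;> simp [wordsD6A4, wordElt, pow_succ, mul_assoc, hri, _root_.mul_inv_rev]

/-- The group generated by the three words contains the conjugates of `(r₂ r₄) ^ 2` by the
dihedral group `⟨r₁, r₃⟩`. -/
theorem conj_mem_closure_wordsD6A4 (hl : (coxD6A4 0 (by decide)).IsLiftable r) {c : G}
    (hc : c ∈ Subgroup.closure {r 0, r 2}) :
    c * (r 1 * r 3) ^ 2 * c⁻¹ ∈ Subgroup.closure (Set.range (wordElt r ∘ wordsD6A4)) := by
  have inv := mul_self_of_isLiftable hl
  have hri : ∀ i, (r i)⁻¹ = r i := fun i => inv_eq_of_mul_eq_one_left (inv i)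
  have hrot : (r 0 * r 2) ^ (3 : ℤ) = 1 := by exact_mod_cast hl 0 2
  have h0 : Commute (r 0) ((r 1 * r 3) ^ 2) :=
    ((commute_of_isLiftable hl rfl : Commute (r 0) (r 1)).mul_right
      (commute_of_isLiftable hl rfl)).pow_right 2
  have hrotmem : ∀ k : ℤ, (r 0 * r 2) ^ k * (r 1 * r 3) ^ 2 * ((r 0 * r 2) ^ k)⁻¹ ∈
      Subgroup.closure (Set.range (wordElt r ∘ wordsD6A4)) := by
    intro k
    have e : (r 0 * r 2) ^ k = (r 0 * r 2) ^ (k % 3) := by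
      conv_lhs => rw [← Int.mul_ediv_add_emod k 3]
      rw [_root_.zpow_add, _root_.zpow_mul, hrot, _root_.one_zpow, one_mul]
    have h0 := Int.emod_nonneg k (b := 3) (by norm_num)
    have h1 := Int.emod_lt_of_pos k (b := 3) (by norm_num)
    rw [e, wordsD6A4_eq inv]
    interval_cases k % 3
    · exact Subgroup.subset_closure ⟨0, by simp⟩
    · exact Subgroup.subset_closure ⟨1, by simp⟩
    · exact Subgroup.subset_closure ⟨2, by norm_cast⟩
  obtain ⟨k, rfl | rfl⟩ := mem_closure_involutions (inv 0) (inv 2) hc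
  all_goals
    have e : (r 2 * r 0) ^ k = (r 0 * r 2) ^ (-k) := by
      rw [← _root_.inv_zpow', _root_.mul_inv_rev, hri, hri]
    rw [e]
  · exact hrotmem _
  · rw [mul_assoc (_ ^ (-k)), h0.eq, _root_.mul_inv_rev, hri, ← mul_assoc, ← mul_assoc,
      mul_assoc _ (r 0) (r 0), inv, mul_one]
    exact hrotmem _

/-- The subgroup is normalised by `r₂`. -/
theorem conj_one_mem_closure_wordsD6A4 (hl : (coxD6A4 0 (by decide)).IsLiftable r) {s : G}
    (hs : s ∈ Subgroup.closure (Set.range (wordElt r ∘ wordsD6A4))) :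
    r 1 * s * r 1 ∈ Subgroup.closure (Set.range (wordElt r ∘ wordsD6A4)) := by
  have inv := mul_self_of_isLiftable hl
  have hri : ∀ i, (r i)⁻¹ = r i := fun i => inv_eq_of_mul_eq_one_left (inv i)
  have c01 : Commute (r 1) (r 0) := commute_of_isLiftable hl rfl
  have c12 : Commute (r 1) (r 2) := commute_of_isLiftable hl rfl
  have hL : r 1 * (r 1 * r 3) ^ 2 * r 1 = ((r 1 * r 3) ^ 2)⁻¹ := by
    rw [pow_two, _root_.mul_inv_rev, _root_.mul_inv_rev, hri, hri]
    simp only [← mul_assoc, inv, one_mul]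
  have hconj : ∀ c, Commute (r 1) c →
      r 1 * (c * (r 1 * r 3) ^ 2 * c⁻¹) * r 1 = (c * (r 1 * r 3) ^ 2 * c⁻¹)⁻¹ := by
    intro c hc
    have hc' : c⁻¹ * r 1 = r 1 * c⁻¹ := (hc.inv_right).eq.symm
    calc r 1 * (c * (r 1 * r 3) ^ 2 * c⁻¹) * r 1
        = (r 1 * c) * (r 1 * r 3) ^ 2 * (c⁻¹ * r 1) := by group
      _ = c * (r 1 * (r 1 * r 3) ^ 2 * r 1) * c⁻¹ := by rw [hc.eq, hc']; group
      _ = _ := by rw [hL]; group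
  have hle : Subgroup.closure (Set.range (wordElt r ∘ wordsD6A4)) ≤
      (Subgroup.closure (Set.range (wordElt r ∘ wordsD6A4))).comap
        (MulAut.conj (r 1)).toMonoidHom := by
    rw [Subgroup.closure_le]
    rintro _ ⟨j, rfl⟩
    have key : ∀ y, y ∈ Set.range (wordElt r ∘ wordsD6A4) → r 1 * y * r 1 = y⁻¹ →
        r 1 * y * (r 1)⁻¹ ∈ Subgroup.closure (Set.range (wordElt r ∘ wordsD6A4)) := by
      intro y hy h
      rw [hri, h]
      exact inv_mem (Subgroup.subset_closure hy)
    refine key _ ⟨j, rfl⟩ ?_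
    rw [wordsD6A4_eq inv]
    fin_cases j
    · exact hL
    · exact hconj _ (c01.mul_right c12)
    · exact hconj _ ((c01.mul_right c12).pow_right 2)
  have : r 1 * s * (r 1)⁻¹ ∈ Subgroup.closure (Set.range (wordElt r ∘ wordsD6A4)) := hle hs
  rwa [hri] at this

/-- Every element is a product of an element of the subgroup, a power of `r₂` and an element of
`⟨r₁, r₃, r₄⟩`: modulo the subgroup, `r₂` commutes with `r₄`. -/
theorem exists_decomposition (hl : (coxD6A4 0 (by decide)).IsLiftable r)
    (hcoset : ∀ b ∈ Subgroup.closure {r 0, r 2, r 3}, b ∈ Subgroup.closure {r 0, r 2} ∨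
      ∃ c₁ ∈ Subgroup.closure {r 0, r 2}, ∃ c₂ ∈ Subgroup.closure {r 0, r 2}, b = c₁ * r 3 * c₂)
    {h : G} (hh : h ∈ Subgroup.closure (Set.range r)) :
    ∃ s ∈ Subgroup.closure (Set.range (wordElt r ∘ wordsD6A4)), ∃ u, (u = 1 ∨ u = r 1) ∧
      ∃ b ∈ Subgroup.closure {r 0, r 2, r 3}, h = s * u * b := by
  have inv := mul_self_of_isLiftable hl
  have hri : ∀ i, (r i)⁻¹ = r i := fun i => inv_eq_of_mul_eq_one_left (inv i)
  set S := Subgroup.closure (Set.range (wordElt r ∘ wordsD6A4)) with hS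
  set B := Subgroup.closure {r 0, r 2, r 3} with hB
  have hC : ∀ c ∈ Subgroup.closure {r 0, r 2}, Commute (r 1) c := by
    intro c hc
    have : Subgroup.closure {r 0, r 2} ≤ Subgroup.centralizer {r 1} := by
      rw [Subgroup.closure_le]
      rintro _ (rfl | rfl)
      · exact Subgroup.mem_centralizer_singleton_iff.2
          (commute_of_isLiftable hl rfl : Commute (r 0) (r 1)).eq
      · exact Subgroup.mem_centralizer_singleton_iff.2
          (commute_of_isLiftable hl rfl : Commute (r 2) (r 1)).eq
    exact (Subgroup.mem_centralizer_singleton_iff.1 (this hc)).symm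
  have hcomm : ∀ b ∈ B, ∃ t ∈ S, b * r 1 = t * r 1 * b := by
    intro b hb
    rcases hcoset b hb with hc | ⟨c₁, hc1, c₂, hc2, rfl⟩
    · exact ⟨1, one_mem _, by rw [one_mul, (hC b hc).eq]⟩
    · refine ⟨_, inv_mem (conj_mem_closure_wordsD6A4 hl hc1), ?_⟩
      have hL : ((r 1 * r 3) ^ 2)⁻¹ = r 3 * r 1 * (r 3 * r 1) := by
        rw [pow_two, _root_.mul_inv_rev, _root_.mul_inv_rev, hri, hri]
      have h1 : c₁⁻¹ * r 1 = r 1 * c₁⁻¹ := (hC c₁ hc1).inv_right.eq.symm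
      calc c₁ * r 3 * c₂ * r 1 = c₁ * r 3 * (r 1 * c₂) := by rw [(hC c₂ hc2).eq]; group
        _ = c₁ * (r 3 * r 1 * (r 3 * (r 1 * r 1) * r 3)) * c₂ := by rw [inv, mul_one, inv]; group
        _ = c₁ * ((r 3 * r 1 * (r 3 * r 1)) * (r 1 * c₁⁻¹)) * (c₁ * r 3 * c₂) := by group
        _ = _ := by rw [← hL, ← h1]; group
  have step : ∀ y j, (∃ s ∈ S, ∃ u, (u = 1 ∨ u = r 1) ∧ ∃ b ∈ B, y = s * u * b) →
      ∃ s ∈ S, ∃ u, (u = 1 ∨ u = r 1) ∧ ∃ b ∈ B, y * r j = s * u * b := by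
    rintro _ j ⟨s, hs, u, hu, b, hb, rfl⟩
    by_cases hj : j = 1
    · subst hj
      obtain ⟨t, ht, e⟩ := hcomm b hb
      rcases hu with rfl | rfl
      · exact ⟨s * t, mul_mem hs ht, r 1, Or.inr rfl, b, hb, by
          rw [mul_one, mul_assoc, e]; group⟩
      · refine ⟨s * (r 1 * t * r 1), mul_mem hs (conj_one_mem_closure_wordsD6A4 hl ht), 1,
          Or.inl rfl, b, hb, ?_⟩
        rw [mul_assoc _ b, e]; group
    · refine ⟨s, hs, u, hu, b * r j, mul_mem hb (Subgroup.subset_closure ?_), by group⟩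
      revert j
      intro j hj
      have : j = 0 ∨ j = 2 ∨ j = 3 := by revert j; decide
      rcases this with rfl | rfl | rfl <;> simp
  induction hh using Subgroup.closure_induction_right with
  | one => exact ⟨1, one_mem _, 1, Or.inl rfl, 1, one_mem _, by simp⟩
  | mul_right y _ x hx ih => obtain ⟨j, rfl⟩ := hx; exact step _ _ ih
  | mul_inv_cancel y _ x hx ih => obtain ⟨j, rfl⟩ := hx; rw [hri]; exact step _ _ ih

end Tetrahedron

/-! ### The kernel of rank three -/

section D6A4

variable {r : Fin 4 → SpherePerm} {z₀ : ℂ} {U : Set ℂ} {Y X₁ X₂ : Set Sphere}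

theorem ReflectionAmalgam.mem_or_doubleCoset_t
    (h : ReflectionAmalgam (coxD6A4 0 (by decide)) r 2 1 3 3 z₀ U Y X₁ X₂) {b : SpherePerm}
    (hb : b ∈ Subgroup.closure {r 0, r 2, r 3}) : b ∈ Subgroup.closure {r 0, r 2} ∨
      ∃ c₁ ∈ Subgroup.closure {r 0, r 2}, ∃ c₂ ∈ Subgroup.closure {r 0, r 2}, b = c₁ * r 3 * c₂ := by
  refine mem_or_doubleCoset (h.inv 3) (h.coset_t _ r h.lift _ rfl)
    (A := Subgroup.closure {r 0, r 2, r 3}) ?_ hb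
  rw [← Subgroup.closure_union]
  exact Subgroup.closure_mono (by rintro _ (rfl | rfl | rfl) <;> simp)

/-- The subgroup generated by the three words is the kernel of the homomorphism `permFourSign` from
the extended group, and of `permFour` on the orientation-preserving subgroup. -/
theorem wordsD6A4_conclusions
    (h : ReflectionAmalgam (coxD6A4 0 (by decide)) r 2 1 3 3 z₀ U Y X₁ X₂)
    {S : Subgroup SpherePerm} (hS : S = Subgroup.closure (Set.range (wordElt r ∘ wordsD6A4))) :
    IsNormalIn S (extendedGroup r) ∧ S ≤ conformalGroup r ∧ S.relIndex (conformalGroup r) = 24 ∧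
      HasQuotient (conformalGroup r) S (Equiv.Perm (Fin 4)) := by
  have hcox := h.hasCoxeterPresentation
  have hle : S ≤ conformalGroup r := by
    rw [hS, Subgroup.closure_le]
    rintro _ ⟨j, rfl⟩
    refine ⟨wordElt_mem _, (wordElt_conformal_or h.anti _).1 ?_⟩
    revert j; decide
  obtain ⟨q, hq⟩ := hcox.exists_hom permFourSign_isLiftable
  let R : Fin 4 → Subgroup.closure (Set.range r) := fun i => ⟨r i, Subgroup.subset_closure ⟨i, rfl⟩⟩
  have hqR : q ∘ R = permFourSign := funext hq
  have hR : ∀ l, ((wordElt R l : Subgroup.closure (Set.range r)) : SpherePerm) = wordElt r l :=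
    map_wordElt (Subgroup.subtype _) R
  have hql : ∀ l, q (wordElt R l) = wordElt permFourSign l := by
    intro l; rw [map_wordElt, hqR]
  have hsurj : Function.Surjective q := fun g => by
    obtain ⟨l, rfl⟩ := permFourSign_surjective g
    exact ⟨_, hql l⟩
  have hSle : S.subgroupOf (Subgroup.closure (Set.range r)) ≤ q.ker := by
    have : S ≤ q.ker.map (Subgroup.subtype _) := by
      rw [hS, Subgroup.closure_le]
      rintro _ ⟨j, rfl⟩
      refine ⟨wordElt R (wordsD6A4 j), ?_, hR _⟩
      change q _ = 1
      rw [hql]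
      revert j; decide +kernel
    rintro ⟨x, hx⟩ hxS
    obtain ⟨y, hy, rfl⟩ := this hxS
    exact hy
  have hker : q.ker = S.subgroupOf (Subgroup.closure (Set.range r)) := by
    refine le_antisymm ?_ hSle
    rintro ⟨x, hx⟩ hqx
    obtain ⟨s, hs, u, hu, b, hb, rfl⟩ := exists_decomposition h.lift
      (fun b hb => h.mem_or_doubleCoset_t hb) hx
    obtain ⟨y, rfl⟩ := exists_tetrahedralWord h.lift hb
    rw [← hS] at hs
    have hs' : s ∈ Subgroup.closure (Set.range r) := inf_le_left (a := Subgroup.closure _) (hle hs)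
    have hqs : q ⟨s, hs'⟩ = 1 := hSle (show s ∈ S from hs)
    have hqx' : ∀ l, s * u * wordElt r (tetrahedralWord y) = s * wordElt r l →
        wordElt permFourSign l = 1 := by
      intro l hl
      have e : (⟨_, hx⟩ : Subgroup.closure (Set.range r)) = ⟨s, hs'⟩ * wordElt R l :=
        Subtype.ext (by rw [Subgroup.coe_mul, hR]; exact hl)
      have h1 : q ⟨_, hx⟩ = 1 := hqx
      rw [e, map_mul, hqs, one_mul, hql] at h1
      exact h1
    rcases hu with rfl | rfl
    · have := permFourSign_injective y (hqx' _ (by rw [mul_one]))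
      subst this
      change s * 1 * _ ∈ S
      simpa [tetrahedralWord, wordElt] using hs
    · exact absurd (hqx' (1 :: tetrahedralWord y) (by simp [wordElt, mul_assoc]))
        (permFourSign_ne y)
  have hidx : S.relIndex (extendedGroup r) = 2 * 24 := by
    rw [extendedGroup, Subgroup.relIndex, ← hker, Subgroup.index_ker,
      MonoidHom.range_eq_top.2 hsurj, Subgroup.card_top, Nat.card_prod, Nat.card_perm, Nat.card_fin,
      Nat.card_eq_fintype_card (α := ℤˣ), Fintype.card_units_int]
    rfl
  have hidx' := h.relIndex_eq hle hidx
  refine ⟨⟨hle.trans inf_le_left, hker ▸ MonoidHom.normal_ker q⟩, hle, hidx', ?_⟩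
  rw [hS] at hidx' ⊢
  refine hasQuotient_closure_words hcox h.anti permFour_isLiftable (by decide) (by decide +kernel)
    ?_ ?_
  · intro g
    obtain ⟨x, hx, -⟩ := permFour_surjective g
    rcases Nat.mod_two_eq_zero_or_one (tetrahedralWord x).length with hl | hl
    · exact ⟨_, hl, hx⟩
    · refine ⟨1 :: tetrahedralWord x, by rw [List.length_cons]; omega, ?_⟩
      rw [wordElt, List.map_cons, List.prod_cons]
      exact (one_mul _).trans hx
  · rw [hidx', Nat.card_perm, Nat.card_fin]; rfl

/-- The reflections `r₁`, `r₃`, `r₄` permute the vertices of a tetrahedron like transpositions, so the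
orientation-preserving elements act as even permutations. -/
theorem sphericalGroup_mulEquiv_alternatingGroup
    (h : ReflectionAmalgam (coxD6A4 0 (by decide)) r 2 1 3 3 z₀ U Y X₁ X₂) :
    Nonempty (sphericalGroup r 0 2 3 ≃* alternatingGroup (Fin 4)) := by
  obtain ⟨q, hq⟩ := h.hasCoxeterPresentation.exists_hom permFour_isLiftable
  let R : Fin 4 → Subgroup.closure (Set.range r) := fun i => ⟨r i, Subgroup.subset_closure ⟨i, rfl⟩⟩
  have hqR : q ∘ R = permFour := funext hq
  have hR : ∀ l, ((wordElt R l : Subgroup.closure (Set.range r)) : SpherePerm) = wordElt r l :=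
    map_wordElt (Subgroup.subtype _) R
  have hsub : sphericalGroup r 0 2 3 ≤ Subgroup.closure (Set.range r) :=
    (ReflectionAmalgam.sphericalGroup_le r 0 2 3).trans inf_le_left
  let φ : sphericalGroup r 0 2 3 →* Equiv.Perm (Fin 4) := q.comp (Subgroup.inclusion hsub)
  have hφ : ∀ l (hl : wordElt r l ∈ sphericalGroup r 0 2 3), φ ⟨_, hl⟩ = wordElt permFour l := by
    intro l hl
    rw [← hqR, ← map_wordElt]
    exact congrArg q (Subtype.ext (hR l).symm)
  have hinj : Function.Injective φ := by
    rw [injective_iff_map_eq_one]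
    rintro ⟨x, hx⟩ hx1
    obtain ⟨y, rfl⟩ := exists_tetrahedralWord h.lift hx.1
    rw [hφ] at hx1
    have := permFour_injective y hx1
    subst this
    exact Subtype.ext (by simp [tetrahedralWord, wordElt])
  have hrange : φ.range = alternatingGroup (Fin 4) := by
    apply le_antisymm
    · rintro _ ⟨⟨x, hx⟩, rfl⟩
      obtain ⟨y, rfl⟩ := exists_tetrahedralWord h.lift hx.1
      have hlen : (tetrahedralWord y).length % 2 = 0 := by
        by_contra hl
        exact ((wordElt_conformal_or h.anti _).2 (Nat.mod_two_ne_zero.1 hl)).notMem_mobiusGroup hx.2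
      have key : ∀ y, (tetrahedralWord y).length % 2 = 0 →
          Equiv.Perm.sign (wordElt permFour (tetrahedralWord y)) = 1 := by decide +kernel
      exact (congrArg _ (hφ _ hx)).trans (key y hlen)
    · intro g hg
      obtain ⟨y, hy, hy2⟩ := permFour_surjective g
      have hmem : wordElt r (tetrahedralWord y) ∈ sphericalGroup r 0 2 3 := by
        refine ⟨?_, (wordElt_conformal_or h.anti _).1 (hy2 hg)⟩
        have key : ∀ y, ∀ i ∈ tetrahedralWord y, i = 0 ∨ i = 2 ∨ i = 3 := by decide +kernel
        refine Subgroup.list_prod_mem _ fun x hx => Subgroup.subset_closure ?_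
        obtain ⟨i, hi, rfl⟩ := List.mem_map.1 hx
        rcases key y i hi with rfl | rfl | rfl <;> simp
      exact ⟨⟨_, hmem⟩, (hφ _ hmem).trans hy⟩
  exact ⟨(MonoidHom.ofInjective hinj).trans (MulEquiv.subgroupCongr hrange)⟩

end D6A4

/-! ### Schottky circles in the amalgam with the alternating group -/

theorem IsAntiConformal.mobius_mul {f g : SpherePerm} (hf : f ∈ mobiusGroup)
    (hg : IsAntiConformal g) : IsAntiConformal (f * g) := by
  obtain ⟨A, rfl⟩ := hf
  obtain ⟨B, rfl⟩ := hg
  exact ⟨A * B, by rw [map_mul, mul_assoc]⟩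

section D6A4

variable {p : ℝ} {hp : 0 < p}

theorem mirror_closedBall {f : SpherePerm} {j : ℤ} (hf : IsMirror f (zeta 3 ^ j)) {R : ℝ}
    (hR : 0 ≤ R) {x : Sphere} (hx : x ∈ ((↑) : ℂ → Sphere) '' Metric.closedBall ((0 : ℝ) : ℂ) √R) :
    f x ∈ ((↑) : ℂ → Sphere) '' Metric.closedBall ((0 : ℝ) : ℂ) √R := by
  obtain ⟨z, hz, rfl⟩ := hx
  obtain ⟨w, hw, e, -⟩ := mirror_rotations hf z
  rw [mem_closedBall_sqrt_iff hR, sub_zero] at hz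
  rw [hw, coe_mem_image_iff, mem_closedBall_sqrt_iff hR, sub_zero, e]
  exact hz

/-- The reflection `r₄` takes a disc about the origin off itself. -/
theorem reflD6A4_three_notMem {R : ℝ} (hR : 0 ≤ R) (hR2 : R < alpha ^ 2) {x : Sphere}
    (hx : x ∈ ((↑) : ℂ → Sphere) '' Metric.closedBall ((0 : ℝ) : ℂ) √R) :
    reflD6A4 p hp 3 x ∉ ((↑) : ℂ → Sphere) '' Metric.closedBall ((0 : ℝ) : ℂ) √R := by
  obtain ⟨z, hz, rfl⟩ := hx
  rw [mem_closedBall_sqrt_iff hR, sub_zero] at hz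
  rcases reflD6A4_three_maps (p := p) (hp := hp) (power_of_mem_disc' (lt_of_le_of_lt hz hR2)) with
    ⟨w, hw, e⟩ | e
  · rw [← e, coe_mem_image_iff, mem_closedBall_sqrt_iff hR, sub_zero, not_le]
    exact hR2.trans (lt_of_mem_outerRegion hw)
  · rw [Set.mem_singleton_iff.1 e]
    exact infty_notMem_image

/-- The Schottky circles are the images of the circle of `r₂` under `r₄` and `r₂ r₄` and their
rotations. -/
theorem reflD6A4_isSchottkySystem (hp2 : p < -alpha) :
    IsSchottkySystem (wordElt (reflD6A4 p hp) ∘ wordsD6A4) := by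
  have hpα : p ^ 2 < alpha ^ 2 := by nlinarith [alpha_neg]
  have hl := reflD6A4_isLiftable (p := p) (hp := hp)
  have hanti := reflD6A4_anti (p := p) (hp := hp)
  have hm := fun i => reflD6A4_mirror (p := p) (hp := hp) (i := i)
  have h1 := (reflD6A4_one (p := p) (hp := hp)).isCircleReflection
  have h3 := fun x => reflD6A4_three_notMem (p := p) (hp := hp) (sq_nonneg p) hpα (x := x)
  generalize reflD6A4 p hp = r at *
  have inv := mul_self_of_isLiftable hl
  obtain ⟨A, hA1, hA2⟩ := exists_disc_eq_ball ((0 : ℝ) : ℂ) (Real.sqrt_pos.2 h1.pos)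
  set ρ := r 0 * r 2 with hρ
  have hρ3 : ρ ^ 3 = 1 := hl 0 2
  have c1ρ : Commute (r 1) ρ := (commute_of_isLiftable hl rfl).mul_right (commute_of_isLiftable hl rfl)
  have hD : ∀ i, i = 0 ∨ i = 2 → r i '' closedDisc A = closedDisc A := by
    intro i hi
    obtain ⟨j, hj⟩ := hm i hi
    rw [hA2]
    exact image_eq_of_involution (inv i) (fun x => mirror_closedBall hj h1.pos.le)
      fun x => mirror_closedBall hj h1.pos.le
  have hρD : ρ '' closedDisc A = closedDisc A := by
    rw [hρ, image_mul, hD 2 (Or.inr rfl), hD 0 (Or.inl rfl)]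
  have hρkD : ∀ k : ℕ, (ρ ^ k : SpherePerm) '' closedDisc A = closedDisc A := by
    intro k
    induction k with
    | zero => simp
    | succ k ih => rw [pow_succ, image_mul, hρD, ih]
  have h3D : Disjoint (r 3 '' closedDisc A) (closedDisc A) := by
    rw [hA2, Set.disjoint_left]
    rintro _ ⟨x, hx, rfl⟩
    exact h3 x hx
  have h1D : r 1 '' openDisc A = (closedDisc A)ᶜ := by
    rw [hA1, hA2]
    exact image_eq_of_involution (inv 1) (fun x => h1.apply_notMem_of_mem_ball)
      fun x => h1.apply_mem_ball_of_notMem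
  -- the braid relation turns the disjointness of `ρ r₄ D` and `r₄ D` into that of `r₄ D` and `D`
  have hE : Disjoint (ρ '' (r 3 '' closedDisc A)) (r 3 '' closedDisc A) := by
    have e : r 3 * (ρ * r 3) = ρ * (r 3 * r 2) := by
      have h03 : r 3 * r 0 = r 0 * r 3 := (commute_of_isLiftable hl rfl : Commute (r 3) (r 0)).eq
      have h23 : r 3 * r 2 * r 3 = r 2 * r 3 * r 2 :=
        eq_of_sq_eq_one_of_pow_three (inv 2) (inv 3) (hl 2 3)
      calc r 3 * (r 0 * r 2 * r 3) = r 3 * r 0 * r 2 * r 3 := by group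
        _ = r 0 * (r 3 * r 2 * r 3) := by rw [h03]; group
        _ = _ := by rw [h23, hρ]; group
    rw [← Set.disjoint_image_iff (r 3).injective, ← image_mul, ← image_mul, ← image_mul, inv, mul_assoc, e,
      image_mul ρ, image_mul (r 3), hD 2 (Or.inr rfl), Equiv.Perm.coe_one, Set.image_id]
    nth_rw 2 [← hρD]
    exact (Set.disjoint_image_iff ρ.injective).2 h3D
  have hsub : ∀ k : ℕ, (ρ ^ k * r 1 * r 3 : SpherePerm) '' closedDisc A ⊆ closedDisc A := by
    intro k
    rw [image_mul, image_mul]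
    nth_rw 2 [← hρkD k]
    refine Set.image_mono ?_
    have h4 : r 3 '' closedDisc A ⊆ r 1 '' openDisc A := by
      rw [h1D]; exact Set.disjoint_left.1 h3D
    refine (Set.image_mono h4).trans ?_
    rw [← image_mul, inv, Equiv.Perm.coe_one, Set.image_id]
    exact openDisc_subset_closedDisc A
  have hout : ∀ k : ℕ, Disjoint ((ρ ^ k * r 3 : SpherePerm) '' closedDisc A) (closedDisc A) := by
    intro k
    rw [image_mul]
    nth_rw 2 [← hρkD k]
    exact (Set.disjoint_image_iff (ρ ^ k).injective).2 h3D
  have hρM : ∀ k : ℕ, ρ ^ k ∈ mobiusGroup := fun k =>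
    mobiusGroup.pow_mem ((hanti 0).mul (hanti 2)) k
  have hc : ∀ k : Fin 3, ∃ A' : GL (Fin 2) ℂ,
      openDisc A' = (ρ ^ (k : ℕ) * r 3 : SpherePerm) '' openDisc A ∧
      closedDisc A' = (ρ ^ (k : ℕ) * r 3 : SpherePerm) '' closedDisc A := fun k =>
    exists_disc_eq_image (Or.inr (IsAntiConformal.mobius_mul (hρM k) (hanti 3))) A
  have hc' : ∀ k : Fin 3, ∃ A' : GL (Fin 2) ℂ,
      openDisc A' = (ρ ^ (k : ℕ) * r 1 * r 3 : SpherePerm) '' openDisc A ∧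
      closedDisc A' = (ρ ^ (k : ℕ) * r 1 * r 3 : SpherePerm) '' closedDisc A := fun k =>
    exists_disc_eq_image (Or.inl (by
      rw [mul_assoc]; exact mul_mem (hρM k) ((hanti 1).mul (hanti 3)))) A
  choose c hco hcc using hc
  choose c' hco' hcc' using hc'
  refine ⟨c, c', ?_, ?_⟩
  · have hcross : ∀ i j : Fin 3, Disjoint (closedDisc (c i)) (closedDisc (c' j)) := by
      intro i j
      rw [hcc, hcc']
      exact (hout i).mono_right (hsub j)
    rintro (i | i) (j | j) hij
    · change Disjoint (closedDisc (c i)) (closedDisc (c j))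
      rw [hcc, hcc, image_mul, image_mul]
      exact disjoint_pow_image hρ3 hE i j (by rintro rfl; exact hij rfl)
    · exact hcross i j
    · exact (hcross j i).symm
    · change Disjoint (closedDisc (c' i)) (closedDisc (c' j))
      rw [hcc', hcc', ← (c1ρ.pow_right _).eq, ← (c1ρ.pow_right _).eq, mul_assoc, mul_assoc,
        image_mul (r 1), image_mul (r 1), Set.disjoint_image_iff (r 1).injective, image_mul, image_mul]
      exact disjoint_pow_image hρ3 hE i j (by rintro rfl; exact hij rfl)
  · intro k
    have hL : (wordElt r ∘ wordsD6A4) k = ρ ^ (k : ℕ) * (r 1 * r 3) ^ 2 * (ρ ^ (k : ℕ))⁻¹ := by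
      rw [wordsD6A4_eq inv]
      fin_cases k <;> simp [hρ]
    refine ⟨?_, ?_⟩
    · rw [hL]
      exact mul_mem (mul_mem (hρM k) (mobiusGroup.pow_mem ((hanti 1).mul (hanti 3)) 2))
        (inv_mem (hρM k))
    · have e : ρ ^ (k : ℕ) * (r 1 * r 3) ^ 2 * (ρ ^ (k : ℕ))⁻¹ * (ρ ^ (k : ℕ) * r 3) =
          ρ ^ (k : ℕ) * r 1 * r 3 * r 1 := by
        calc _ = ρ ^ (k : ℕ) * r 1 * r 3 * r 1 * (r 3 * r 3) := by rw [pow_two]; group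
          _ = _ := by rw [inv, mul_one]
      rw [hL, hco, ← image_mul, e, image_mul _ (r 1), h1D, hcc',
        Set.image_compl_eq (Equiv.bijective _)]

end D6A4

/-! ### Fundamental regions inside a sector of angle `2π / 3` -/

theorem zeta_three_zpow_of_dvd {k : ℤ} (hk : 3 ∣ k) : zeta 3 ^ k = 1 := by
  obtain ⟨l, rfl⟩ := hk
  have : zeta 3 ^ (3 : ℤ) = 1 := by exact_mod_cast zeta_pow_self (n := 3) (by norm_num)
  rw [_root_.zpow_mul, this, _root_.one_zpow]

theorem zeta_three_zpow_re {k : ℤ} (hk : ¬ (3 : ℤ) ∣ k) : (zeta 3 ^ k).re = -1 / 2 := by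
  have hs3 : √3 ^ 2 = 3 := Real.sq_sqrt (by norm_num)
  have h : k = 3 * (k / 3) + 1 ∨ k = 3 * (k / 3) + 2 := by omega
  rcases h with h | h <;>
    rw [h, zpow_add₀ (zeta_ne_zero 3), zeta_three_zpow_of_dvd (dvd_mul_right _ _), one_mul]
  · rw [zpow_one, zeta_three]
  · rw [zpow_two, zeta_three, Complex.mul_re]
    linear_combination (-1 / 4) * hs3

/-- The open sector of angle `2π / 3` about the negative real axis: the points whose real part is
smaller than that of their rotations of order three. -/
def wideSector : Set ℂ := {z | ∀ k : ℤ, ¬ (3 : ℤ) ∣ k → z.re < (zeta 3 ^ k * z).re}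

/-- The closed sector of angle `2π / 3` about the negative real axis. -/
def closedWideSector : Set ℂ := {z | ∀ k : ℤ, z.re ≤ (zeta 3 ^ k * z).re}

theorem isOpen_wideSector : IsOpen wideSector := by
  have e : wideSector = ⋂ k ∈ ({1, 2} : Finset ℤ), {z | z.re < (zeta 3 ^ k * z).re} := by
    ext z
    simp only [wideSector, Set.mem_iInter, Set.mem_ofPred_eq]
    refine ⟨fun h k hk => h k ?_, fun h k hk => ?_⟩
    · rcases Finset.mem_insert.1 hk with rfl | hk
      · decide
      · rw [Finset.mem_singleton.1 hk]; decide
    · have hk' : k = 3 * (k / 3) + 1 ∨ k = 3 * (k / 3) + 2 := by omega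
      rcases hk' with h' | h' <;> rw [h', zpow_add₀ (zeta_ne_zero 3),
        zeta_three_zpow_of_dvd (dvd_mul_right _ _), one_mul]
      · exact h 1 (by simp)
      · exact h 2 (by simp)
  rw [e]
  exact isOpen_biInter_finset fun k _ => isOpen_lt Complex.continuous_re
    (Complex.continuous_re.comp (continuous_const.mul continuous_id))

theorem exists_rotate_mem_closedWideSector (z : ℂ) : ∃ k : ℤ, zeta 3 ^ k * z ∈ closedWideSector := by
  obtain ⟨k, -, hk⟩ := Finset.exists_min_image ({0, 1, 2} : Finset ℤ)
    (fun k => (zeta 3 ^ k * z).re) ⟨0, by simp⟩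
  refine ⟨k, fun j => ?_⟩
  rw [← mul_assoc, ← zpow_add₀ (zeta_ne_zero 3)]
  rcases zeta_three_zpow (j + k) with e | e | e
  · have := hk 0 (by simp)
    rw [e]; rwa [zpow_zero] at this
  · have := hk 1 (by simp)
    rw [e]; rwa [zpow_one] at this
  · have := hk 2 (by simp)
    have e2 : zeta 3 ^ (2 : ℤ) = zeta 3 ^ 2 := by norm_cast
    rw [e]; rwa [e2] at this

theorem re_nonpos_of_mem_closedWideSector {z : ℂ} (hz : z ∈ closedWideSector) : z.re ≤ 0 := by
  have h1 := hz 1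
  have h2 := hz (-1)
  have h : (zeta 3 ^ (1 : ℤ) * z).re + (zeta 3 ^ (-1 : ℤ) * z).re = -z.re := by
    rw [zpow_one, _root_.zpow_neg_one, ← conj_zeta, zeta_three, Complex.mul_re, Complex.mul_re]
    simp
    ring
  linarith

/-- Moving from the closed sector towards the negative real axis enters the open sector. -/
theorem add_mem_wideSector {z : ℂ} (hz : z ∈ closedWideSector) {a t : ℝ} (ha : 0 ≤ a) (ht : 0 < t) :
    (a : ℂ) * z - t ∈ wideSector := by
  intro k hk
  have h := mul_le_mul_of_nonneg_left (hz k) ha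
  have e : zeta 3 ^ k * ((a : ℂ) * z - t) = (a : ℂ) * (zeta 3 ^ k * z) - (t : ℂ) * zeta 3 ^ k := by
    ring
  rw [e, Complex.sub_re, Complex.sub_re, Complex.re_ofReal_mul, Complex.re_ofReal_mul,
    Complex.re_ofReal_mul, zeta_three_zpow_re hk, Complex.ofReal_re]
  linarith

/-- A region in the sector is a fundamental region of a group containing the rotation of order
three if the rest of the group moves it off itself and, up to the rotation, the translates of its
closure cover the sphere. -/
theorem isFundamentalRegion_wideSector {K : Subgroup SpherePerm} {ρ : SpherePerm} {V W : Set ℂ}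
    (hρ : ∀ z : ℂ, ρ (z : Sphere) = ((zeta 3 * z : ℂ) : Sphere))
    (hinf : ρ OnePoint.infty = OnePoint.infty) (hρK : ρ ∈ K) (hV : IsOpen V)
    (hK : ∀ k ∈ K, k ∉ Subgroup.zpowers ρ → ∀ x ∈ ((↑) : ℂ → Sphere) '' (wideSector ∩ V),
      k x ∉ ((↑) : ℂ → Sphere) '' (wideSector ∩ V))
    (hW : ∀ z ∈ W, ∀ k : ℤ, zeta 3 ^ k * z ∈ W)
    (hcl : ∀ z ∈ W, z ∈ closedWideSector →
      (z : Sphere) ∈ closure (((↑) : ℂ → Sphere) '' (wideSector ∩ V)))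
    (hcov : ∀ x : Sphere, ∃ k ∈ K, k x ∈ ((↑) : ℂ → Sphere) '' W ∨
      k x ∈ closure (((↑) : ℂ → Sphere) '' (wideSector ∩ V))) :
    IsFundamentalRegion K (((↑) : ℂ → Sphere) '' (wideSector ∩ V)) := by
  have hρ3 : ρ ^ (3 : ℤ) = 1 := by
    exact_mod_cast rotation_pow_eq_one (n := 3) (by norm_num) hρ hinf
  refine ⟨OnePoint.isOpenEmbedding_coe.isOpenMap _ (isOpen_wideSector.inter hV), ?_, ?_⟩
  · intro k hk hk1
    rw [Set.disjoint_left]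
    rintro _ ⟨x, hx, rfl⟩
    by_cases hkρ : k ∈ Subgroup.zpowers ρ
    · obtain ⟨j, rfl⟩ := hkρ
      have hj : ¬ (3 : ℤ) ∣ j := by
        rintro ⟨l, rfl⟩
        apply hk1
        change ρ ^ (3 * l) = 1
        rw [_root_.zpow_mul, hρ3, _root_.one_zpow]
      obtain ⟨z, hz, rfl⟩ := hx
      change (ρ ^ j) (z : Sphere) ∉ _
      rw [rotation_zpow_coe hρ, coe_mem_image_iff]
      intro hz'
      have h1 := hz.1 j hj
      have h2 := hz'.1 (-j) (by rwa [dvd_neg])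
      rw [← mul_assoc, ← zpow_add₀ (zeta_ne_zero 3), neg_add_cancel, zpow_zero, one_mul] at h2
      exact lt_asymm h1 h2
    · exact hK k hk hkρ x hx
  · rw [Set.eq_univ_iff_forall]
    intro x
    have hin : ∀ k ∈ K, k x ∈ closure (((↑) : ℂ → Sphere) '' (wideSector ∩ V)) →
        x ∈ ⋃ k ∈ K, k '' closure (((↑) : ℂ → Sphere) '' (wideSector ∩ V)) := by
      intro k hk hx
      refine Set.mem_biUnion (inv_mem hk) ⟨k x, hx, ?_⟩
      rw [← Equiv.Perm.mul_apply, inv_mul_cancel, Equiv.Perm.one_apply]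
    obtain ⟨k, hk, ⟨z, hz, e⟩ | h⟩ := hcov x
    · obtain ⟨j, hj⟩ := exists_rotate_mem_closedWideSector z
      refine hin (ρ ^ j * k) (mul_mem (zpow_mem hρK j) hk) ?_
      rw [Equiv.Perm.mul_apply, ← e, rotation_zpow_coe hρ]
      exact hcl _ (hW z hz j) hj
    · exact hin k hk h

section D6A4

variable {p : ℝ} {hp : 0 < p} {z₀ : ℂ} {U : Set ℂ} {Y X₁ X₂ : Set Sphere}

/-- The reflection `r₄` takes points outside its circle closer to the origin. -/
theorem reflD6A4_three_closer {z : ℂ} (hz : (1 + alpha) * z.re < z.re ^ 2 + z.im ^ 2 + alpha) :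
    ∃ w : ℂ, reflD6A4 p hp 3 (z : Sphere) = (w : Sphere) ∧
      w.re ^ 2 + w.im ^ 2 < z.re ^ 2 + z.im ^ 2 := by
  have h3 := reflD6A4_three (p := p) (hp := hp)
  set c : ℝ := (1 + alpha) / 2 with hc
  have hR := h3.pos
  set R : ℝ := c ^ 2 - alpha with hRdef
  have hg : 0 < (z.re - c) ^ 2 + z.im ^ 2 - R := by rw [hRdef, hc]; linarith
  obtain ⟨w, t, hw, ht, e1, e2, e3, e4⟩ := h3.exists_coe_power (z := z) (by linarith)
  refine ⟨w, hw, ?_⟩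
  set g : ℝ := (z.re - c) ^ 2 + z.im ^ 2 - R with hgdef
  have key : R * ((z.re ^ 2 + z.im ^ 2) - (w.re ^ 2 + w.im ^ 2)) =
      t * g * ((z.re ^ 2 + z.im ^ 2) - alpha) := by
    have e5 : w.re ^ 2 + w.im ^ 2 = R - t * g + 2 * c * t * (z.re - c) + c ^ 2 := by
      rw [e3] at e1 ⊢
      linear_combination e1
    have e6 : t * (g + R) = R := by rw [hgdef, ← e4]; ring
    have e7 : z.re ^ 2 + z.im ^ 2 = g + R + 2 * c * (z.re - c) + c ^ 2 := by rw [hgdef]; ring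
    rw [e5, e7, show alpha = c ^ 2 - R by rw [hRdef]; ring]
    linear_combination (-g - 2 * c * (z.re - c)) * e6
  have h1 : 0 < R * ((z.re ^ 2 + z.im ^ 2) - (w.re ^ 2 + w.im ^ 2)) := by
    rw [key]
    have : 0 < z.re ^ 2 + z.im ^ 2 - alpha := by nlinarith [alpha_neg, sq_nonneg z.re, sq_nonneg z.im]
    positivity
  have := pos_of_mul_pos_right h1 hR.le
  linarith

/-- The part of the sector outside the circle of `r₂` is a fundamental region of
`⟨r₁, r₂, r₃⟩⁺`. -/
theorem reflD6A4_isFundamentalRegion_one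
    (h : ReflectionAmalgam (coxD6A4 0 (by decide)) (reflD6A4 p hp) 2 1 3 3 z₀ U Y X₁ X₂) :
    IsFundamentalRegion (sphericalGroup (reflD6A4 p hp) 0 2 1)
      (((↑) : ℂ → Sphere) '' (wideSector ∩ {z | p ^ 2 < z.re ^ 2 + z.im ^ 2})) := by
  have h0 := reflD6A4_zero (p := p) (hp := hp)
  have h1 := (reflD6A4_one (p := p) (hp := hp)).isCircleReflection
  have h2 := reflD6A4_two (p := p) (hp := hp)
  have hm := fun i => reflD6A4_mirror (p := p) (hp := hp) (i := i)
  generalize reflD6A4 p hp = r at *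
  have hcl : ∀ z : ℂ, p ^ 2 ≤ z.re ^ 2 + z.im ^ 2 → z ∈ closedWideSector → (z : Sphere) ∈
      closure (((↑) : ℂ → Sphere) '' (wideSector ∩ {z | p ^ 2 < z.re ^ 2 + z.im ^ 2})) := by
    intro z hz hzs
    have hc : Continuous fun t : ℝ => ((((1 : ℝ) : ℂ) * z - t : ℂ) : Sphere) :=
      OnePoint.continuous_coe.comp (by fun_prop)
    have h := map_mem_closure hc (s := Set.Ioi (0 : ℝ)) (x := 0)
      (t := ((↑) : ℂ → Sphere) '' (wideSector ∩ {z | p ^ 2 < z.re ^ 2 + z.im ^ 2}))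
      (by rw [closure_Ioi]; exact Set.self_mem_Ici) (by
        intro t ht
        rw [Set.mem_Ioi] at ht
        refine ⟨_, ⟨add_mem_wideSector hzs zero_le_one ht, ?_⟩, rfl⟩
        have := re_nonpos_of_mem_closedWideSector hzs
        simp
        nlinarith)
    simpa using h
  have hinf : OnePoint.infty ∈
      closure (((↑) : ℂ → Sphere) '' (wideSector ∩ {z | p ^ 2 < z.re ^ 2 + z.im ^ 2})) := by
    refine infty_mem_closure (u := -1) (by simp) ?_
    filter_upwards [Filter.eventually_gt_atTop p] with t ht
    refine ⟨?_, ?_⟩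
    · have := add_mem_wideSector (z := 0) (fun k => by simp) (zero_le_one) (hp.trans ht)
      simpa using this
    · simp
      nlinarith
  have hin : ∀ i, r i * r 0 ∈ ({r 2 * r 0, r 1 * r 0} : Set SpherePerm) →
      r i * r 0 ∈ sphericalGroup r 0 2 1 := fun i hi => by
    rw [h.sphericalGroup_eq]; exact Subgroup.subset_closure hi
  refine isFundamentalRegion_wideSector (W := {z | p ^ 2 ≤ z.re ^ 2 + z.im ^ 2}) (h2.rot h0)
    (h2.rot_infty h0) (hin 2 (by simp)) (isOpen_lt continuous_const
      ((Complex.continuous_re.pow 2).add (Complex.continuous_im.pow 2))) ?_ ?_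
      (fun z (hz : p ^ 2 ≤ z.re ^ 2 + z.im ^ 2) => hcl z hz) ?_
  · rintro k hk hkJ _ ⟨z, hz, rfl⟩ hkz
    have := h.maps_of_mem_s (P := ((↑) : ℂ → Sphere) '' {z | p ^ 2 < z.re ^ 2 + z.im ^ 2})
      (Q := ((↑) : ℂ → Sphere) '' {z | z.re ^ 2 + z.im ^ 2 < p ^ 2}) ?_ ?_ ?_ hk hkJ _
      ⟨z, hz.2, rfl⟩
    · obtain ⟨w, hw, e⟩ := this
      rw [← e, coe_mem_image_iff] at hkz
      exact lt_asymm (show w.re ^ 2 + w.im ^ 2 < p ^ 2 from hw) hkz.2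
    · rintro i hi _ ⟨z, hz, rfl⟩
      obtain ⟨j, hj⟩ := hm i hi
      obtain ⟨w, hw, e, -⟩ := mirror_rotations hj z
      exact ⟨w, by rw [Set.mem_ofPred_eq, e]; exact hz, hw.symm⟩
    · rintro i hi _ ⟨z, hz, rfl⟩
      obtain ⟨j, hj⟩ := hm i hi
      obtain ⟨w, hw, e, -⟩ := mirror_rotations hj z
      exact ⟨w, by rw [Set.mem_ofPred_eq, e]; exact hz, hw.symm⟩
    · rintro _ ⟨z, hz, rfl⟩
      rw [Set.mem_ofPred_eq] at hz
      obtain ⟨w, t, hw, ht, e, -⟩ := h1.exists_coe_power (z := z) (by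
        rw [sub_zero]; exact lt_trans (by positivity) hz)
      rw [sub_zero, sub_zero] at e
      refine ⟨w, ?_, hw.symm⟩
      rw [Set.mem_ofPred_eq]
      nlinarith [mul_pos ht (sub_pos.2 hz)]
  · intro z hz k
    rw [Set.mem_ofPred_eq, norm_rotation]
    exact hz
  · intro x
    induction x using OnePoint.rec with
    | infty => exact ⟨1, one_mem _, Or.inr hinf⟩
    | coe z =>
      rcases le_total (p ^ 2) (z.re ^ 2 + z.im ^ 2) with hz | hz
      · exact ⟨1, one_mem _, Or.inl ⟨z, hz, rfl⟩⟩
      · refine ⟨r 1 * r 0, hin 1 (by simp), ?_⟩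
        obtain ⟨w, hw, e1, e2⟩ := h0.coe_conj z
        rw [Equiv.Perm.mul_apply, hw]
        by_cases hw0 : w = 0
        · right
          have := h1.center
          rw [Complex.ofReal_zero] at this
          rw [hw0, this]
          exact hinf
        · left
          obtain ⟨u, t, hu, ht, e, -⟩ := h1.exists_coe_power
            (IsCircleReflection.pos_of_ne (c := 0) (by simpa using hw0))
          rw [sub_zero, sub_zero, e1, e2, neg_sq] at e
          refine ⟨u, ?_, hu.symm⟩
          rw [Set.mem_ofPred_eq]
          nlinarith [mul_nonneg ht.le (sub_nonneg.2 hz)]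

/-- The part of the sector inside the circle of `r₄` is a fundamental region of
`⟨r₁, r₃, r₄⟩⁺`: in every orbit there is a point closest to the origin. -/
theorem reflD6A4_isFundamentalRegion_two
    (h : ReflectionAmalgam (coxD6A4 0 (by decide)) (reflD6A4 p hp) 2 1 3 3 z₀ U Y X₁ X₂)
    (hfin : Finite (sphericalGroup (reflD6A4 p hp) 0 2 3)) :
    IsFundamentalRegion (sphericalGroup (reflD6A4 p hp) 0 2 3)
      (((↑) : ℂ → Sphere) '' (wideSector ∩
        {z | z.re ^ 2 + z.im ^ 2 + alpha < (1 + alpha) * z.re})) := by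
  have hα := alpha_neg
  have hα1 := neg_one_lt_alpha
  have h0 := reflD6A4_zero (p := p) (hp := hp)
  have h2 := reflD6A4_two (p := p) (hp := hp)
  have h3 := reflD6A4_three (p := p) (hp := hp)
  have h3m := fun z => reflD6A4_three_maps (p := p) (hp := hp) (z := z)
  have h3c := fun z => reflD6A4_three_closer (p := p) (hp := hp) (z := z)
  have hm := fun i => reflD6A4_mirror (p := p) (hp := hp) (i := i)
  generalize reflD6A4 p hp = r at *
  have hre := Complex.continuous_re
  have hin : ∀ i, r i * r 0 ∈ ({r 2 * r 0, r 3 * r 0} : Set SpherePerm) →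
      r i * r 0 ∈ sphericalGroup r 0 2 3 := fun i hi => by
    rw [h.sphericalGroup_eq]; exact Subgroup.subset_closure hi
  have hinner : ∀ z ∈ wideSector ∩ {z : ℂ | z.re ^ 2 + z.im ^ 2 + alpha < (1 + alpha) * z.re},
      z ∈ innerRegion := by
    rintro z ⟨hz1, hz2⟩ k
    rw [Set.mem_ofPred_eq] at hz2
    by_cases hk : (3 : ℤ) ∣ k
    · rw [zeta_three_zpow_of_dvd hk, one_mul]; exact hz2
    · exact hz2.trans (mul_lt_mul_of_pos_left (hz1 k hk) (by linarith))
  refine isFundamentalRegion_wideSector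
    (W := {z | ∀ k : ℤ, z.re ^ 2 + z.im ^ 2 + alpha ≤ (1 + alpha) * (zeta 3 ^ k * z).re}) (h2.rot h0)
    (h2.rot_infty h0) (hin 2 (by simp)) (isOpen_lt
      (((hre.pow 2).add (Complex.continuous_im.pow 2)).add continuous_const)
      (continuous_const.mul hre)) ?_ ?_ ?_ ?_
  · rintro k hk hkJ _ ⟨z, hz, rfl⟩ hkz
    have := h.maps_of_mem_t (P := ((↑) : ℂ → Sphere) '' innerRegion)
      (Q := ((↑) : ℂ → Sphere) '' outerRegion ∪ {OnePoint.infty}) ?_ ?_ ?_ hk hkJ _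
      ⟨z, hinner z hz, rfl⟩
    · obtain ⟨w, hw, e⟩ := hkz
      rw [← e] at this
      rcases this with hw' | hw'
      · rw [coe_mem_image_iff] at hw'
        obtain ⟨j, hj⟩ := hw'
        exact lt_asymm hj (hinner w hw j)
      · exact OnePoint.coe_ne_infty _ hw'
    · rintro i hi _ ⟨z, hz, rfl⟩
      obtain ⟨j, hj⟩ := hm i hi
      obtain ⟨w, hw, e, e1, -⟩ := mirror_rotations hj z
      exact ⟨w, fun k => by rw [e, e1]; exact hz _, hw.symm⟩
    · rintro i hi _ (⟨z, ⟨k, hk⟩, rfl⟩ | rfl)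
      · obtain ⟨j, hj⟩ := hm i hi
        obtain ⟨w, hw, e, -, e1⟩ := mirror_rotations hj z
        exact Or.inl ⟨w, ⟨-k - j, by rw [e, ← e1]; exact hk⟩, hw.symm⟩
      · obtain ⟨j, hj⟩ := hm i hi
        exact Or.inr hj.infty
    · rintro _ ⟨z, hz, rfl⟩
      have := hz 0
      rw [zpow_zero, one_mul] at this
      exact h3m z this
  · intro z hz k j
    rw [norm_rotation, ← mul_assoc, ← zpow_add₀ (zeta_ne_zero 3)]
    exact hz _
  · intro z hz hzs
    have hz0 := hz 0
    rw [zpow_zero, one_mul] at hz0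
    -- move towards the interior point `α / 2`
    have hc : Continuous fun t : ℝ => ((((1 - t : ℝ) : ℂ) * z - ((t * (-alpha / 2) : ℝ) : ℂ) : ℂ) :
        Sphere) := OnePoint.continuous_coe.comp (by fun_prop)
    have h := map_mem_closure hc (s := Set.Ioo (0 : ℝ) 1) (x := 0)
      (t := ((↑) : ℂ → Sphere) '' (wideSector ∩
        {z | z.re ^ 2 + z.im ^ 2 + alpha < (1 + alpha) * z.re}))
      (by rw [closure_Ioo zero_ne_one]; exact ⟨le_rfl, zero_le_one⟩) (by
        rintro t ⟨ht0, ht1⟩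
        refine ⟨_, ⟨add_mem_wideSector hzs (sub_nonneg.2 ht1.le)
          (mul_pos ht0 (by linarith)), ?_⟩, rfl⟩
        rw [Set.mem_ofPred_eq, Complex.sub_re, Complex.sub_im, Complex.re_ofReal_mul,
          Complex.im_ofReal_mul, Complex.ofReal_re, Complex.ofReal_im, sub_zero]
        have e : ((1 - t) * z.re - t * (-alpha / 2)) ^ 2 + ((1 - t) * z.im) ^ 2 + alpha -
            (1 + alpha) * ((1 - t) * z.re - t * (-alpha / 2)) =
            (1 - t) * (z.re ^ 2 + z.im ^ 2 + alpha - (1 + alpha) * z.re) +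
            t * (alpha / 2 - alpha ^ 2 / 4) -
            t * (1 - t) * ((z.re - alpha / 2) ^ 2 + z.im ^ 2) := by ring
        have e1 : (1 - t) * (z.re ^ 2 + z.im ^ 2 + alpha - (1 + alpha) * z.re) ≤ 0 :=
          mul_nonpos_of_nonneg_of_nonpos (by linarith) (by linarith)
        have e2 : t * (alpha / 2 - alpha ^ 2 / 4) < 0 :=
          mul_neg_of_pos_of_neg ht0 (by nlinarith [sq_nonneg alpha])
        have e3 : 0 ≤ t * (1 - t) * ((z.re - alpha / 2) ^ 2 + z.im ^ 2) := by
          have : 0 ≤ 1 - t := by linarith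
          positivity
        linarith)
    simpa using h
  · intro x
    let N : Sphere → WithTop ℝ := fun y =>
      OnePoint.elim y (⊤ : WithTop ℝ) fun z => ((z.re ^ 2 + z.im ^ 2 : ℝ) : WithTop ℝ)
    obtain ⟨⟨k, hk⟩, hmin⟩ := Finite.exists_min fun k : sphericalGroup r 0 2 3 => N ((k : SpherePerm) x)
    refine ⟨k, hk, Or.inl ?_⟩
    have hmin' : ∀ f ∈ sphericalGroup r 0 2 3, N (k x) ≤ N (f (k x)) := fun f hf =>
      hmin ⟨f * k, mul_mem hf hk⟩
    generalize k x = y at *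
    induction y using OnePoint.rec with
    | infty =>
      have := hmin' _ (hin 3 (by simp))
      rw [Equiv.Perm.mul_apply, h0.infty, h3.infty] at this
      exact absurd this (not_le.2 (WithTop.coe_lt_top _))
    | coe z =>
      refine ⟨z, fun j => ?_, rfl⟩
      by_contra hj
      rw [not_le] at hj
      obtain ⟨u, hu, e1, e2⟩ := h0.coe_conj (zeta 3 ^ j * z)
      obtain ⟨w, hw, hlt⟩ := h3c u (by
        rw [e1, e2, neg_sq, norm_rotation]; exact hj)
      rw [e1, e2, neg_sq, norm_rotation] at hlt
      have := hmin' _ (mul_mem (hin 3 (by simp)) (zpow_mem (hin 2 (by simp)) j))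
      rw [Equiv.Perm.mul_apply, rotation_zpow_coe (h2.rot h0), Equiv.Perm.mul_apply, hu, hw] at this
      exact absurd (WithTop.coe_le_coe.1 this) (not_le.2 hlt)

end D6A4

/-! ### Maskit combination of the dihedral group of order six and the alternating group -/

section D6A4

variable {p : ℝ} {hp : 0 < p} {z₀ : ℂ} {U : Set ℂ} {Y X₁ X₂ : Set Sphere}

theorem reflD6A4_dihedral
    (h : ReflectionAmalgam (coxD6A4 0 (by decide)) (reflD6A4 p hp) 2 1 3 3 z₀ U Y X₁ X₂) :
    Nonempty (sphericalGroup (reflD6A4 p hp) 0 2 1 ≃* DihedralGroup 3) :=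
  h.dihedral_of_commute h.s_notMem_zpowers (commute_of_isLiftable h.lift rfl)
    (commute_of_isLiftable h.lift rfl)

/-- Every circle about the origin between the circle of `r₂` and the circles of the conjugates of
`r₄` separates the two finite groups. -/
theorem reflD6A4_isMaskitCombination (hp2 : p < -alpha)
    (h : ReflectionAmalgam (coxD6A4 0 (by decide)) (reflD6A4 p hp) 2 1 3 3 z₀ U Y X₁ X₂) :
    IsMaskitCombination (sphericalGroup (reflD6A4 p hp) 0 2 1) (sphericalGroup (reflD6A4 p hp) 0 2 3)
      (Subgroup.zpowers (reflD6A4 p hp 2 * reflD6A4 p hp 0)) := by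
  have h1 := (reflD6A4_one (p := p) (hp := hp)).isCircleReflection
  have h3m := fun z => reflD6A4_three_maps (p := p) (hp := hp) (z := z)
  have hm := fun i => reflD6A4_mirror (p := p) (hp := hp) (i := i)
  obtain ⟨e1⟩ := reflD6A4_dihedral h
  obtain ⟨e2⟩ := sphericalGroup_mulEquiv_alternatingGroup h
  have : Finite (sphericalGroup (reflD6A4 p hp) 0 2 1) := Finite.of_equiv _ e1.symm.toEquiv
  have : Finite (sphericalGroup (reflD6A4 p hp) 0 2 3) := Finite.of_equiv _ e2.symm.toEquiv
  have f1 := reflD6A4_isFundamentalRegion_one h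
  have f2 := reflD6A4_isFundamentalRegion_two h inferInstance
  generalize reflD6A4 p hp = r at *
  obtain ⟨s, hs1, hs2⟩ := exists_between hp2
  have hs0 : 0 < s := hp.trans hs1
  have hps : p ^ 2 < s ^ 2 := by nlinarith
  have hsα : s ^ 2 < alpha ^ 2 := by nlinarith
  have hR : 0 < s ^ 2 := by positivity
  obtain ⟨A, hA1, hA2⟩ := exists_disc_eq_ball ((0 : ℝ) : ℂ) (Real.sqrt_pos.2 hR)
  have hin : ∀ i : Fin 4, i = 0 ∨ i = 2 →
      ∀ x ∈ ((↑) : ℂ → Sphere) '' Metric.ball ((0 : ℝ) : ℂ) √(s ^ 2),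
      r i x ∈ ((↑) : ℂ → Sphere) '' Metric.ball ((0 : ℝ) : ℂ) √(s ^ 2) := by
    rintro i hi _ ⟨z, hz, rfl⟩
    obtain ⟨j, hj⟩ := hm i hi
    obtain ⟨w, hw, e, -⟩ := mirror_rotations hj z
    rw [mem_ball_sqrt_iff, sub_zero] at hz
    rw [hw, coe_mem_image_iff, mem_ball_sqrt_iff, sub_zero, e]
    exact hz
  have hout : ∀ i : Fin 4, i = 0 ∨ i = 2 →
      ∀ x ∈ (((↑) : ℂ → Sphere) '' Metric.closedBall ((0 : ℝ) : ℂ) √(s ^ 2))ᶜ,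
      r i x ∈ (((↑) : ℂ → Sphere) '' Metric.closedBall ((0 : ℝ) : ℂ) √(s ^ 2))ᶜ := by
    intro i hi x hx
    obtain ⟨j, hj⟩ := hm i hi
    induction x using OnePoint.rec with
    | infty => rw [hj.infty]; exact infty_notMem_image
    | coe z =>
      obtain ⟨w, hw, e, -⟩ := mirror_rotations hj z
      rw [Set.mem_compl_iff, coe_mem_image_iff, mem_closedBall_sqrt_iff hR.le, sub_zero] at hx
      rw [hw, Set.mem_compl_iff, coe_mem_image_iff, mem_closedBall_sqrt_iff hR.le, sub_zero, e]
      exact hx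
  refine ⟨h.isKleinian (ReflectionAmalgam.sphericalGroup_le _ _ _ _), inferInstance,
    h.isKleinian (ReflectionAmalgam.sphericalGroup_le _ _ _ _), inferInstance, inferInstance,
    h.zpowers_lt_s, h.zpowers_lt_t, A, _, _, _, _, _, rfl, Or.inr ⟨rfl, rfl⟩, ?_, f1, f2, ?_, ?_, ?_⟩
  · intro j hj
    rw [hA1, hA2]
    exact ⟨h.zpowers_image_eq hout hj, h.zpowers_image_eq hin hj⟩
  · rw [hA1, hA2]
    ext x
    induction x using OnePoint.rec with
    | infty =>
      exact ⟨fun hx => absurd hx.2 infty_notMem_image, fun hx => absurd hx.2 infty_notMem_image⟩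
    | coe z =>
      simp only [Set.mem_inter_iff, Set.mem_sdiff, coe_mem_image_iff, sub_zero,
        mem_closedBall_sqrt_iff hR.le, mem_ball_sqrt_iff, Set.mem_ofPred_eq, not_lt]
      refine and_congr_right fun hz => and_congr_right fun _ => ?_
      exact ⟨fun _ => power_of_mem_disc' (hz.1.trans_lt hsα), fun _ => hps.trans_le hz.2⟩
  · rintro k hk hkJ _ ⟨x, hx, rfl⟩
    rw [hA1]
    rw [hA2] at hx
    refine h.maps_of_mem_s hout hin ?_ hk hkJ x hx
    intro x hx
    have : r 1 x ∈ ((↑) : ℂ → Sphere) '' Metric.ball ((0 : ℝ) : ℂ) √(p ^ 2) := by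
      refine h1.apply_mem_ball_of_notMem fun hx' => hx ?_
      obtain ⟨z, hz, rfl⟩ := hx'
      rw [mem_closedBall_sqrt_iff (by positivity)] at hz
      rw [coe_mem_image_iff, mem_closedBall_sqrt_iff hR.le]
      exact hz.trans hps.le
    obtain ⟨z, hz, e⟩ := this
    rw [mem_ball_sqrt_iff] at hz
    rw [← e, coe_mem_image_iff, mem_ball_sqrt_iff]
    exact hz.trans hps
  · rintro k hk hkJ _ ⟨x, hx, rfl⟩
    rw [hA2]
    rw [hA1] at hx
    refine h.maps_of_mem_t hin hout ?_ hk hkJ x hx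
    rintro _ ⟨z, hz, rfl⟩
    rw [mem_ball_sqrt_iff, sub_zero] at hz
    rcases h3m z (power_of_mem_disc' (hz.trans hsα)) with ⟨w, hw, e⟩ | e
    · rw [← e, Set.mem_compl_iff, coe_mem_image_iff, mem_closedBall_sqrt_iff hR.le, sub_zero, not_le]
      exact hsα.trans (lt_of_mem_outerRegion hw)
    · rw [e]; exact infty_notMem_image

/-- The amalgam `D₆ *_{ℤ₃} A₄` and its normal Schottky subgroup of rank three. -/
theorem amalgam_dihedral_alternating (p : ℝ) (hp : 0 < p) (hp2 : p ≤ -alpha)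
    (r : Fin 4 → SpherePerm) (hr : r = reflD6A4 p hp) (K₁ K₂ J : Subgroup SpherePerm)
    (hK₁ : K₁ = sphericalGroup r 0 1 2) (hK₂ : K₂ = sphericalGroup r 0 2 3)
    (hJ : J = Subgroup.zpowers (r 2 * r 0)) :
      IsExtendedKleinian (extendedGroup r) ∧
      HasCoxeterPresentation (coxD6A4 0 (by decide)) r ∧
      Nonempty (K₁ ≃* DihedralGroup 3) ∧ Nonempty (K₂ ≃* alternatingGroup (Fin 4)) ∧
      Nat.card J = 3 ∧
      (p < -alpha → IsMaskitCombination K₁ K₂ J) ∧ IsAmalgam ![K₁, K₂] J (conformalGroup r) ∧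
      amalgamCharacteristic K₁ K₂ J = -1 / 12 ∧
      ∀ L₁ : SpherePerm, L₁ = (r 1 * r 3) ^ 2 →
        ∀ L : Fin 3 → SpherePerm,
        L = ![L₁, (r 0 * r 2) * L₁ * (r 0 * r 2)⁻¹, (r 0 * r 2) ^ 2 * L₁ * ((r 0 * r 2) ^ 2)⁻¹] →
        ∀ S : Subgroup SpherePerm, S = Subgroup.closure (Set.range L) →
        IsNormalIn S (extendedGroup r) ∧ IsFreeBasis L S ∧ (p < -alpha → IsSchottkySystem L) ∧
        S.relIndex (conformalGroup r) = 24 ∧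
        HasQuotient (conformalGroup r) S (Equiv.Perm (Fin 4)) := by
  obtain ⟨z₀, U, h⟩ := reflD6A4_amalgam (p := p) (hp := hp) hp2
  have e1 := reflD6A4_dihedral h
  have e2 := sphericalGroup_mulEquiv_alternatingGroup h
  have hconc := wordsD6A4_conclusions h rfl
  have hMask : p < -alpha → IsMaskitCombination K₁ K₂ J := by
    intro hp2
    rw [hK₁, hK₂, hJ, hr, sphericalGroup_comm _ 0 1 2]
    exact reflD6A4_isMaskitCombination hp2 h
  have hSch : p < -alpha → IsSchottkySystem (wordElt r ∘ wordsD6A4) :=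
    fun hp2 => hr ▸ reflD6A4_isSchottkySystem hp2
  -- freeness passes from a smaller parameter, where the generators are Schottky generators,
  -- to all parameters, since the group has the same presentation
  have hinj : Function.Injective (FreeGroup.lift (wordElt r ∘ wordsD6A4)) := by
    have hα : 0 < -alpha / 2 := by linarith [alpha_neg]
    have hα' : -alpha / 2 < -alpha := by linarith [alpha_neg]
    rw [hr]
    exact injective_lift_of_isLiftable h.hasCoxeterPresentation (reflD6A4_isLiftable (hp := hα))
      wordsD6A4 ((reflD6A4_isSchottkySystem (hp := hα) hα').injective (by norm_num))
  rw [← hr] at h e1 e2 hconc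
  clear hr
  rw [sphericalGroup_comm] at hK₁
  subst hK₁ hK₂ hJ
  refine ⟨h.isExtendedKleinian, h.hasCoxeterPresentation, e1, e2, h.card_zpowers, hMask,
    h.isAmalgam, ?_, ?_⟩
  · obtain ⟨e1⟩ := e1
    obtain ⟨e2⟩ := e2
    have h4 : Nat.card (alternatingGroup (Fin 4)) = 12 := by
      rw [Nat.card_eq_fintype_card]; decide +kernel
    rw [amalgamCharacteristic, (Nat.card_congr e1.toEquiv).trans DihedralGroup.nat_card,
      (Nat.card_congr e2.toEquiv).trans h4, h.card_zpowers]
    norm_num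
  · rintro _ rfl L rfl S rfl
    rw [← wordsD6A4_eq h.inv]
    obtain ⟨c1, -, c3, c4⟩ := hconc
    exact ⟨c1, ⟨hinj, range_lift _⟩, hSch, c3, c4⟩

end D6A4

end Kleinian

theorem mainTheorem2 :
    -- The amalgam of two dihedral groups of order `2n` along a cyclic group of order `n`.
    (∀ (n : ℕ) (hn : 2 ≤ n) (p : ℝ) (hp : 1 < p) (r : Fin 4 → SpherePerm),
      r = reflDD n p hp →
      ∀ K₁ K₂ J : Subgroup SpherePerm, K₁ = sphericalGroup r 0 1 2 → K₂ = sphericalGroup r 0 3 2 →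
      J = Subgroup.zpowers (r 2 * r 0) →
      IsExtendedKleinian (extendedGroup r) ∧
      HasCoxeterPresentation (coxDD n 0 (by omega) (by decide)) r ∧
      orderOf (r 1 * r 3) = 0 ∧
      Nonempty (K₁ ≃* DihedralGroup n) ∧ Nonempty (K₂ ≃* DihedralGroup n) ∧ Nat.card J = n ∧
      IsMaskitCombination K₁ K₂ J ∧ IsAmalgam ![K₁, K₂] J (conformalGroup r) ∧
      amalgamCharacteristic K₁ K₂ J = 0 ∧
      ∀ m : ℕ, 1 ≤ m → ∀ S : Subgroup SpherePerm,
        S = normalClosureIn (extendedGroup r) ((r 1 * r 3) ^ m) →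
        IsNormalIn S (extendedGroup r) ∧ S ≤ conformalGroup r ∧
        IsFreeBasis ![(r 1 * r 3) ^ m] S ∧ IsSchottkySystem ![(r 1 * r 3) ^ m] ∧
        S.relIndex (conformalGroup r) = 2 * n * m ∧
        ∀ hm : m ≠ 1, Finite (coxDD n m (by omega) hm).Group ∧
          HasCoxeterQuotient (coxDD n m (by omega) hm) r S) ∧
    -- The amalgam of the dihedral groups of orders `4` and `6` along a group of order `2`.
    (∀ (p : ℝ) (hp : 1 < p) (_ : p ≤ 2) (r : Fin 4 → SpherePerm), r = reflD4D6 p hp →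
      ∀ K₁ K₂ J : Subgroup SpherePerm, K₁ = sphericalGroup r 0 1 3 → K₂ = sphericalGroup r 0 1 2 →
      J = Subgroup.zpowers (r 1 * r 0) →
      IsExtendedKleinian (extendedGroup r) ∧
      HasCoxeterPresentation (coxD4D6 0 (by decide)) r ∧
      orderOf (r 2 * r 3) = 0 ∧
      Nonempty (K₁ ≃* DihedralGroup 2) ∧ Nonempty (K₂ ≃* DihedralGroup 3) ∧ Nat.card J = 2 ∧
      (p < 2 → IsMaskitCombination K₁ K₂ J) ∧ IsAmalgam ![K₁, K₂] J (conformalGroup r) ∧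
      amalgamCharacteristic K₁ K₂ J = -1 / 12 ∧
      -- the Coxeter quotients obtained by adding `(r₃ r₄) ^ m = 1`
      (∀ (m N g : ℕ) (hm : m ≠ 1),
        (m, N, g) ∈ [(2, 12, 2), (3, 24, 3), (4, 48, 5), (5, 120, 11)] →
        ∀ S : Subgroup SpherePerm, S = normalClosureIn (extendedGroup r) ((r 2 * r 3) ^ m) →
        Finite (coxD4D6 m hm).Group ∧ HasCoxeterQuotient (coxD4D6 m hm) r S ∧
        IsNormalIn S (extendedGroup r) ∧ S ≤ conformalGroup r ∧
        S.relIndex (conformalGroup r) = N ∧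
        ∃ L : Fin g → SpherePerm, IsFreeBasis L S ∧ (p < 2 → IsSchottkySystem L)) ∧
      -- explicit generators for `m = 2`
      (∀ L₁ : SpherePerm, L₁ = (r 2 * r 3) ^ 2 →
        ∀ L : Fin 2 → SpherePerm, L = ![L₁, r 0 * L₁ * r 0] →
        IsFreeBasis L (normalClosureIn (extendedGroup r) ((r 2 * r 3) ^ 2)) ∧
        (p < 2 → IsSchottkySystem L)) ∧
      -- explicit generators for `m = 3`
      (∀ L₁ : SpherePerm, L₁ = (r 2 * r 3) ^ 3 →
        ∀ L : Fin 3 → SpherePerm,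
        L = ![L₁, r 0 * L₁ * r 0, (r 0 * r 2 * r 0) * L₁ * (r 0 * r 2 * r 0)⁻¹] →
        IsFreeBasis L (normalClosureIn (extendedGroup r) ((r 2 * r 3) ^ 3)) ∧
        (p < 2 → IsSchottkySystem L)) ∧
      -- a free normal subgroup of rank `4` whose quotient is not a Coxeter quotient
      (∀ L : Fin 4 → SpherePerm,
        L = ![((r 3 * r 2) ^ 2 * r 0) ^ 2, (r 0 * (r 3 * r 2) ^ 2) ^ 2,
          (r 0 * r 3 * r 2) ^ 3 * (r 0 * r 2 * r 3 * r 2 * r 0),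
          (r 3 * r 2 * r 0) ^ 3 * (r 2 * r 3 * r 2)] →
        ∀ S : Subgroup SpherePerm, S = Subgroup.closure (Set.range L) →
        IsNormalIn S (extendedGroup r) ∧ IsFreeBasis L S ∧ (p < 2 → IsSchottkySystem L) ∧
        S.relIndex (conformalGroup r) = 36 ∧
        HasQuotient (conformalGroup r) S (Equiv.Perm (Fin 3) × Equiv.Perm (Fin 3)))) ∧
    -- for larger `m` the Coxeter group is infinite
    (∀ (m : ℕ) (hm : 6 ≤ m), Infinite (coxD4D6 m (by omega)).Group) ∧
    -- The amalgam of the dihedral group of order `6` and `A₄` along a group of order `3`.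
    (∀ (p : ℝ) (hp : 0 < p) (_ : p ≤ -alpha) (r : Fin 4 → SpherePerm), r = reflD6A4 p hp →
      ∀ K₁ K₂ J : Subgroup SpherePerm, K₁ = sphericalGroup r 0 1 2 → K₂ = sphericalGroup r 0 2 3 →
      J = Subgroup.zpowers (r 2 * r 0) →
      IsExtendedKleinian (extendedGroup r) ∧
      HasCoxeterPresentation (coxD6A4 0 (by decide)) r ∧
      Nonempty (K₁ ≃* DihedralGroup 3) ∧ Nonempty (K₂ ≃* alternatingGroup (Fin 4)) ∧
      Nat.card J = 3 ∧
      (p < -alpha → IsMaskitCombination K₁ K₂ J) ∧ IsAmalgam ![K₁, K₂] J (conformalGroup r) ∧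
      amalgamCharacteristic K₁ K₂ J = -1 / 12 ∧
      ∀ L₁ : SpherePerm, L₁ = (r 1 * r 3) ^ 2 →
        ∀ L : Fin 3 → SpherePerm,
        L = ![L₁, (r 0 * r 2) * L₁ * (r 0 * r 2)⁻¹, (r 0 * r 2) ^ 2 * L₁ * ((r 0 * r 2) ^ 2)⁻¹] →
        ∀ S : Subgroup SpherePerm, S = Subgroup.closure (Set.range L) →
        IsNormalIn S (extendedGroup r) ∧ IsFreeBasis L S ∧ (p < -alpha → IsSchottkySystem L) ∧
        S.relIndex (conformalGroup r) = 24 ∧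
        HasQuotient (conformalGroup r) S (Equiv.Perm (Fin 4))) :=
  ⟨fun n hn p hp r hr _ _ _ h1 h2 h3 => amalgam_dihedral_dihedral n hn p hp r hr _ _ _ h1 h2 h3,
    fun p hp hp2 r hr _ _ _ h1 h2 h3 => amalgam_dihedral_four_six p hp hp2 r hr _ _ _ h1 h2 h3,
    fun m hm => infinite_coxD4D6 m hm _,
    fun p hp hp2 r hr _ _ _ h1 h2 h3 => amalgam_dihedral_alternating p hp hp2 r hr _ _ _ h1 h2 h3⟩
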